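/- **Notation.** Write $\bar m=\{1,\dots,m\}$, $\|A\|=|A|-1$. A map $f:\bar m\to\bar k$ is *nondegenerate* if it is surjective and $f(j)\ne f(j+1)$ for all $j<m$. Let $\mathcal S(k)$ be the graded abelian group freely generated by the nondegenerate $f:\bar m\to\bar k$, with $\deg f=m-k$; a degenerate map represents $0$. A diagram $S\xleftarrow{\alpha}T\xrightarrow{\beta}U$ of finite totally ordered sets is *special* if $\alpha,\beta$ are order-preserving surjections and for each adjacent pair $q<q'$ of $T$ exactly one of $\alpha(q)<\alpha(q')$, $\beta(q)<\beta(q')$ holds; $\{pt\}\leftarrow\emptyset\to\emptyset$ is also counted as special. Put $\tau_f(j)=|\{j': f(j')<f(j)\text{, or }f(j')=f(j)\text{ and }j'\le j\}|$ and, for a family $\mathcal A=(A_1,\dots,A_m)$ of finite sets, $$\epsilon(f,\mathcal A)=\sum_{j<j',\,f(j)>f(j')}\|A_j\|\,\|A_{j'}\|+\sum_{j}\|A_j\|(\tau_f(j)-f(j)).$$ The structure maps of the chain operad $\mathcal S$ are: the unit $\mathrm{id}_{\bar 1}$; the differential $\partial f=\sum_{j=1}^m(-1)^{\tau_f(j)-f(j)}f_{\bar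 m-\{j\}}$, where $f_{\bar m-\{j\}}$ is $f$ with its $j$-th entry deleted; the right action $f\rho=(-1)^{\zeta}\rho^{-1}\circ f$ of $\rho\in\Sigma_k$, with $\zeta=\sum\|f^{-1}(i)\|\,\|f^{-1}(i')\|$ over all $i<i'$ with $\rho^{-1}(i)>\rho^{-1}(i')$; and, for $g_i:\bar m_i\to\bar j_i$, the composition $\gamma(f;g_1,\dots,g_k)=\sum_D(-1)^{\eta(D)}h_D$. Here $D$ runs over the pairs of maps $a:\overline{m-k+\sum m_i}\to\bar m$ (order-preserving) and $b:\overline{m-k+\sum m_i}\to\coprod_i\bar m_i$ such that $f(a(l))=i$ whenever $b(l)\in\bar m_i$ and such that $f^{-1}(i)\xleftarrow{a}b^{-1}(\bar m_i)\xrightarrow{b}\bar m_i$ is special for each $i$; $h_D$ is $b$ followed by $\coprod g_i:\coprod\bar m_i\to\coprod\bar j_i\cong\overline{\sum j_i}$; and $\eta(D)=\sum_{i<i'}(m_i-j_i)\|f^{-1}(i')\|+\sum_i\epsilon(g_i,\mathcal A^i)$ with $\mathcal A^i_r=a(b^{-1}(r))$ for $r\in\bar m_i$. The *complexity* of $f$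 is $0$ if $k\le1$, and otherwise the maximum over the two-element subsets $A\subset\bar k$ of (the number of maximal constant runs of the subsequence of $f$ with values in $A$) $-1$. $\mathcal S_2(k)\subset\mathcal S(k)$ is spanned by the nondegenerate $f$ of complexity $\le2$. For an associative unital ring $R$, $C^p(R)$ is the group of homomorphisms $x:R^{\otimes p}\to R$ that vanish whenever one of the arguments is $1$, with differential $$(\partial x)(r_1,\dots,r_{p+1})=r_1x(r_2,\dots,r_{p+1})+\sum_{0<i<p+1}(-1)^ix(r_1,\dots,r_ir_{i+1},\dots,r_{p+1})+(-1)^{p+1}x(r_1,\dots,r_p)r_{p+1}.$$ For $\mathbf x=(x_1,\dots,x_k)$ in $C^*(R)$ and a finite word $g$ with letters in $\bar k$, of complexity $\le 2$, in which each $i$ that occurs does so $|x_i|+1$ times, the cochain $g(\mathbf x)$ is defined inductively. The empty word gives $1\in C^0(R)$. If $g$ begins and ends with the same letter $i$, and $A_1,\dots,A_{|x_i|}$ are the (possibly empty) words between consecutive occurrences of $i$, then $g(\mathbf x)$ is the composite $x_i(A_1(\mathbf x),\dots,A_{|x_i|}(\mathbf x))$, in which an empty $A_t$ is replaced by the identity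 map of $R$. Otherwise $g$ is uniquely a concatenation of maximal subwords of consecutive letters each of which begins and ends with the same letter, and $g(\mathbf x)$ is the cup product of their values. For $f:\bar m\to\bar k$ nondegenerate of complexity $\le2$ put $$\theta_k(f,x_1,\dots,x_k)=\sum(-1)^{\epsilon(f,\mathcal A)+(m-k)\sum|x_i|+(m-k)(m-k+1)/2}\,(f\circ\beta)(\mathbf x),$$ the sum being over the special diagrams $\overline{\sum|x_i|+k-m+1}\xleftarrow{\alpha}\overline{k+\sum|x_i|}\xrightarrow{\beta}\bar m$ with $|\beta^{-1}f^{-1}(i)|=|x_i|+1$ for each $i$, where $\mathcal A_j=\alpha(\beta^{-1}(j))$. **Theorem.** $\mathcal S_2$ is closed under the structure maps of $\mathcal S$, and for every associative unital ring $R$ the maps $\theta_k$ give $C^*(R)$ a structure of algebra over $\mathcal S_2$: they are multilinear, $\theta_k(f,-)$ lowers the total degree by $\deg f$, and, with the usual (Koszul) signs, they are compatible with the differentials, the unit, the actions of the symmetric groups and the composition. This structure is natural: it is preserved by the isomorphism $C^*(R)\cong C^*(R')$ induced by any ring isomorphism $R\cong R'$. -/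

import Mathlib

open scoped DirectSum

noncomputable section

namespace SeqOperad

/-! ## The sequence operad -/

/-- A sequence of length `m` with entries in `{1, …, k}` is a map `Fin m → Fin k`; it is
nondegenerate if every entry occurs and adjacent entries are distinct. -/
def Nondegenerate {m k : ℕ} (f : Fin m → Fin k) : Prop :=
  Function.Surjective f ∧ ∀ j j' : Fin m, (j : ℕ) + 1 = j' → f j ≠ f j'

/-- The nondegenerate sequences with entries in `{1, …, k}`. -/
structure NSeq (k : ℕ) where
  len : ℕ
  fn : Fin len → Fin k
  nondeg : Nondegenerate fn

/-- The degree `m - k` of a sequence of length `m`. -/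
def NSeq.degree {k : ℕ} (f : NSeq k) : ℤ := (f.len : ℤ) - k

/-- The group `S(k)`, free on the nondegenerate sequences. -/
abbrev S (k : ℕ) : Type := NSeq k →₀ ℤ

open Classical in
/-- The class of an arbitrary sequence in `S(k)`; degenerate sequences represent `0`. -/
def cls {m k : ℕ} (f : Fin m → Fin k) : S k :=
  if h : Nondegenerate f then Finsupp.single ⟨m, f, h⟩ 1 else 0

/-- `τ_f(j)`, the position of `j` after stably sorting `f`, counted from `1`. -/
def tau {m k : ℕ} (f : Fin m → Fin k) (j : Fin m) : ℤ :=
  ((Finset.univ.filter fun j' : Fin m => f j' < f j ∨ (f j' = f j ∧ j' ≤ j)).card : ℤ)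

/-- The value `f(j)` as an element of `{1, …, k}`. -/
def entry {m k : ℕ} (f : Fin m → Fin k) (j : Fin m) : ℤ := ((f j : ℕ) : ℤ) + 1

/-- `‖A‖ = |A| - 1`. -/
def norm1 {T : Type*} (A : Set T) : ℤ := (A.ncard : ℤ) - 1

/-- `ε(f, 𝒜)` as a function of the numbers `a j = ‖A_j‖`. -/
def eps {m k : ℕ} (f : Fin m → Fin k) (a : Fin m → ℤ) : ℤ :=
  (∑ j : Fin m, ∑ j' : Fin m, if j < j' ∧ f j' < f j then a j * a j' else 0) +
    ∑ j : Fin m, a j * (tau f j - entry f j)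

/-- The sequence `f_A` obtained from `f` by keeping only the positions in `A`. -/
def restrictSeq {m k : ℕ} (f : Fin m → Fin k) (A : Finset (Fin m)) : Fin A.card → Fin k :=
  fun i => f (A.orderEmbOfFin rfl i)

/-- `∂f = ∑_j (-1)^{τ_f(j) - f(j)} f_{m̄ - {j}}` on generators. -/
def bdGen {k : ℕ} (f : NSeq k) : S k :=
  ∑ j : Fin f.len,
    (tau f.fn j - entry f.fn j).negOnePow • cls (restrictSeq f.fn (Finset.univ.erase j))

/-- The differential of `S(k)`. -/
def bd (k : ℕ) : S k →ₗ[ℤ] S k := Finsupp.linearCombination ℤ bdGen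

/-- The exponent `ζ(f, ρ)` of the sign in the action of `ρ` on `f`. -/
def zeta {m k : ℕ} (f : Fin m → Fin k) (ρ : Equiv.Perm (Fin k)) : ℤ :=
  ∑ i : Fin k, ∑ i' : Fin k,
    if i < i' ∧ ρ⁻¹ i' < ρ⁻¹ i then norm1 (f ⁻¹' {i}) * norm1 (f ⁻¹' {i'}) else 0

/-- The right action of the symmetric group: `f ρ = (-1)^{ζ(f, ρ)} ρ⁻¹ ∘ f`. -/
def perm {k : ℕ} (ρ : Equiv.Perm (Fin k)) : S k →ₗ[ℤ] S k :=
  Finsupp.linearCombination ℤ fun f : NSeq k => (zeta f.fn ρ).negOnePow • cls (⇑ρ⁻¹ ∘ f.fn)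

/-- The unit of the operad: the sequence of length one in `S(1)`. -/
def unitSeq : NSeq 1 := ⟨1, id, Function.surjective_id, fun j j' h => by omega⟩

/-- A diagram `S ← T → U` of finite totally ordered sets is special if both maps are
order-preserving surjections and every adjacent pair of `T` is strictly increased by exactly one of
the two maps.  (So `|T| = |S| + |U| - 1`.)  By convention `{pt} ← ∅ → ∅` is also special: it
is the partition of a one-point set into no pieces. -/
def IsSpecial {S T U : Type*} [PartialOrder S] [PartialOrder T] [PartialOrder U]
    (α : T → S) (β : T → U) : Prop :=
  Monotone α ∧ Monotone β ∧ Function.Surjective β ∧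
    (Function.Surjective α ∨ (IsEmpty U ∧ Nat.card S = 1)) ∧
    ∀ q q' : T, q ⋖ q' → Xor (α q < α q') (β q < β q')

/-- A diagram of type `(f, m_1, …, m_k)`: a commutative square consisting of an order-preserving map
`a` and a map `b` to the disjoint union of the `Fin (m_i)`, such that for each `i` the diagram
`f⁻¹(i) ← b⁻¹(Fin (m_i)) → Fin (m_i)` is special. The set `Fin (m_i)` appears as the `i`-th summand
of the disjoint union; the order on the disjoint union relates only elements of the same summand. -/
def IsDiagram {m k N : ℕ} (f : Fin m → Fin k) (ms : Fin k → ℕ)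
    (a : Fin N → Fin m) (b : Fin N → Σ i : Fin k, Fin (ms i)) : Prop :=
  Monotone a ∧
  ∃ comm : ∀ l, f (a l) = (b l).1,
    ∀ i : Fin k,
      IsSpecial (S := {j : Fin m // f j = i}) (T := {l : Fin N // (b l).1 = i})
        (U := {r : Σ i' : Fin k, Fin (ms i') // r.1 = i})
        (fun l => ⟨a l.1, (comm l.1).trans l.2⟩) (fun l => ⟨b l.1, l.2⟩)

/-- The sequence `h_D` of a diagram `D = (a, b)`; it depends on `b` only. -/
def hD {k N : ℕ} {j : Fin k → ℕ} (g : ∀ i, NSeq (j i))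
    (b : Fin N → Σ i : Fin k, Fin (g i).len) : Fin N → Fin (∑ i, j i) :=
  fun l => finSigmaFinEquiv ⟨(b l).1, (g (b l).1).fn (b l).2⟩

/-- The exponent `η(D)` of the sign of a diagram `D = (a, b)`. -/
def eta {k N : ℕ} (f : NSeq k) {j : Fin k → ℕ} (g : ∀ i, NSeq (j i))
    (a : Fin N → Fin f.len) (b : Fin N → Σ i : Fin k, Fin (g i).len) : ℤ :=
  (∑ i : Fin k, ∑ i' : Fin k,
      if i < i' then (g i).degree * norm1 (f.fn ⁻¹' {i'}) else 0) +
    ∑ i : Fin k, eps (g i).fn (fun r => norm1 (a '' (b ⁻¹' {⟨i, r⟩})))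

open Classical in
/-- The operad composition `γ(f; g_1, …, g_k) = ∑_D (-1)^{η(D)} h_D` of generators; the composition
of arbitrary elements is its multilinear extension. -/
def gamma {k : ℕ} (f : NSeq k) {j : Fin k → ℕ} (g : ∀ i, NSeq (j i)) : S (∑ i, j i) :=
  ∑ D ∈ Finset.univ.filter
      (fun D : (Fin (f.len + ∑ i, (g i).len - k) → Fin f.len) ×
          (Fin (f.len + ∑ i, (g i).len - k) → Σ i : Fin k, Fin (g i).len) =>
        IsDiagram f.fn (fun i => (g i).len) D.1 D.2),
    (eta f g D.1 D.2).negOnePow • cls (hD g D.2)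

/-- The complexity of a sequence: the maximum, over all two-element subsets `{i, i'}` of `{1, …, k}`,
of one less than the number of maximal constant runs of the subsequence with entries in `{i, i'}`;
it is `0` if `k ≤ 1`. -/
def complexity {m k : ℕ} (f : Fin m → Fin k) : ℕ :=
  (Finset.univ.filter fun p : Fin k × Fin k => p.1 < p.2).sup fun p =>
    (((List.ofFn f).filter fun t => t = p.1 ∨ t = p.2).destutter (· ≠ ·)).length - 1

/-- `S_n(k)`, the subgroup of `S(k)` generated by the nondegenerate sequences of complexity at most
`n`. -/
def Sub (n k : ℕ) : Submodule ℤ (S k) :=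
  Finsupp.supported ℤ ℤ {f : NSeq k | complexity f.fn ≤ n}

/-- `S_n` is closed under the structure maps of `S`. -/
structure IsSuboperad (n : ℕ) : Prop where
  unit_mem : Finsupp.single unitSeq 1 ∈ Sub n 1
  bd_mem : ∀ (k : ℕ), ∀ s ∈ Sub n k, bd k s ∈ Sub n k
  perm_mem : ∀ (k : ℕ) (ρ : Equiv.Perm (Fin k)), ∀ s ∈ Sub n k, perm ρ s ∈ Sub n k
  gamma_mem : ∀ (k : ℕ) (f : NSeq k) (j : Fin k → ℕ) (g : ∀ i, NSeq (j i)),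
    complexity f.fn ≤ n → (∀ i, complexity (g i).fn ≤ n) → gamma f g ∈ Sub n (∑ i, j i)

/-- Let `C = ⨁ C^p` be a cochain complex with differential `d` of degree `+1`.  The maps
`θ_k : S(k) × C^k → C` make `C` an algebra over the chain operad `S_n`: restricted to `S_n(k)` they
are multilinear, a generator `f` lowers the total degree by `deg f`, and they are compatible with the
differentials, the unit, the actions of the symmetric groups and the composition, with the usual
signs. The compatibilities are stated for generators and homogeneous cochains, to which they reduce
by multilinearity. -/
structure IsAlgebraOver (n : ℕ) {M : ℕ → Type*} [∀ p, AddCommGroup (M p)]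
    (d : (⨁ p, M p) →ₗ[ℤ] ⨁ p, M p)
    (θ : ∀ k : ℕ, S k →ₗ[ℤ] ((Fin k → ⨁ p, M p) → ⨁ p, M p)) : Prop where
  multilinear : ∀ (k : ℕ), ∀ s ∈ Sub n k,
    ∃ Φ : MultilinearMap ℤ (fun _ : Fin k => ⨁ p, M p) (⨁ p, M p), ∀ x, θ k s x = Φ x
  degree : ∀ (k : ℕ) (f : NSeq k), complexity f.fn ≤ n →
    ∀ (q : Fin k → ℕ) (x : ∀ i, M (q i)) (p : ℕ),
      θ k (Finsupp.single f 1) (fun i => DirectSum.of M (q i) (x i)) p ≠ 0 →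
        (p : ℤ) = (∑ i, (q i : ℤ)) - f.degree
  chain_map : ∀ (k : ℕ) (f : NSeq k), complexity f.fn ≤ n →
    ∀ (q : Fin k → ℕ) (x : ∀ i, M (q i)),
      θ k (bd k (Finsupp.single f 1)) (fun i => DirectSum.of M (q i) (x i)) =
        d (θ k (Finsupp.single f 1) (fun i => DirectSum.of M (q i) (x i))) -
          f.degree.negOnePow • ∑ i : Fin k,
            (∑ i' : Fin k, if i' < i then (q i' : ℤ) else 0).negOnePow •
              θ k (Finsupp.single f 1)
                (Function.update (fun i => DirectSum.of M (q i) (x i)) i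
                  (d (DirectSum.of M (q i) (x i))))
  unit : ∀ x : Fin 1 → ⨁ p, M p, θ 1 (Finsupp.single unitSeq 1) x = x 0
  equivariant : ∀ (k : ℕ) (ρ : Equiv.Perm (Fin k)) (f : NSeq k), complexity f.fn ≤ n →
    ∀ (q : Fin k → ℕ) (x : ∀ i, M (q i)),
      θ k (perm ρ (Finsupp.single f 1)) (fun i => DirectSum.of M (q i) (x i)) =
        (∑ i : Fin k, ∑ i' : Fin k,
            if i < i' ∧ ρ i' < ρ i then (q i : ℤ) * q i' else 0).negOnePow •
          θ k (Finsupp.single f 1)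
            (fun i => DirectSum.of M (q (ρ⁻¹ i)) (x (ρ⁻¹ i)))
  composition : ∀ (k : ℕ) (f : NSeq k) (j : Fin k → ℕ) (g : ∀ i, NSeq (j i)),
    complexity f.fn ≤ n → (∀ i, complexity (g i).fn ≤ n) →
    ∀ (q : Fin (∑ i, j i) → ℕ) (x : ∀ l, M (q l)),
      θ (∑ i, j i) (gamma f g) (fun l => DirectSum.of M (q l) (x l)) =
        (∑ i : Fin k, ∑ i' : Fin k,
            if i < i' then
              (g i').degree * ∑ t : Fin (j i), (q (finSigmaFinEquiv ⟨i, t⟩) : ℤ)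
            else 0).negOnePow •
          θ k (Finsupp.single f 1) fun i =>
            θ (j i) (Finsupp.single (g i) 1) fun t =>
              DirectSum.of M (q (finSigmaFinEquiv ⟨i, t⟩)) (x (finSigmaFinEquiv ⟨i, t⟩))

end SeqOperad

namespace Hochschild

open SeqOperad

variable (R : Type*) [Ring R]

/-! ## The normalized Hochschild cochain complex -/

/-- Hochschild cochains of degree `p`: additive maps `R^{⊗p} → R`. -/
abbrev Coch (p : ℕ) : Type _ := MultilinearMap ℤ (fun _ : Fin p => R) R

/-- Normalized cochains: those that vanish as soon as one of the arguments is `1`. -/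
def normalized (p : ℕ) : Submodule ℤ (Coch R p) where
  carrier := {x | ∀ (r : Fin p → R) (i : Fin p), r i = 1 → x r = 0}
  add_mem' hx hy r i h := by simp [hx r i h, hy r i h]
  zero_mem' r i _ := rfl
  smul_mem' c x hx r i h := by simp [hx r i h]

/-- The graded group `C^*(R)` of normalized Hochschild cochains. -/
abbrev C : Type _ := ⨁ p, normalized R p

variable {R}

lemma contractNth_update {p : ℕ} [DecidableEq (Fin (p + 1))] [DecidableEq (Fin p)] (j : Fin p)
    (r : Fin (p + 1) → R) (i : Fin (p + 1)) :
    ∃ (i' : Fin p) (φ : R →ₗ[ℤ] R), ∀ v, Fin.contractNth j.castSucc (· * ·) (Function.update r i v) =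
      Function.update (Fin.contractNth j.castSucc (· * ·) r) i' (φ v) := by
  rcases lt_trichotomy (i : ℕ) j with h | h | h
  · refine ⟨⟨i, by omega⟩, LinearMap.id, fun v => funext fun t => ?_⟩
    simp only [Fin.contractNth, Function.update_apply, Fin.ext_iff, Fin.val_castSucc, Fin.val_succ,
      LinearMap.id_apply]
    split_ifs <;> first | rfl | omega
  · refine ⟨j, LinearMap.mulRight ℤ (r j.succ), fun v => funext fun t => ?_⟩
    simp only [Fin.contractNth, Function.update_apply, Fin.ext_iff, Fin.val_castSucc, Fin.val_succ,
      LinearMap.mulRight_apply]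
    split_ifs with h1 h2 h3 h4 h5 h6 <;> first | rfl | omega | skip
    all_goals (have : t = j := Fin.ext (by omega)); subst this; rfl
  · by_cases h' : (i : ℕ) = j + 1
    · refine ⟨j, LinearMap.mulLeft ℤ (r j.castSucc), fun v => funext fun t => ?_⟩
      simp only [Fin.contractNth, Function.update_apply, Fin.ext_iff, Fin.val_castSucc,
        Fin.val_succ, LinearMap.mulLeft_apply]
      split_ifs <;> first | rfl | omega | skip
      all_goals (have : t = j := Fin.ext (by omega)); subst this; rfl
    · refine ⟨⟨i - 1, by omega⟩, LinearMap.id, fun v => funext fun t => ?_⟩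
      simp only [Fin.contractNth, Function.update_apply, Fin.ext_iff, Fin.val_castSucc,
        Fin.val_succ, LinearMap.id_apply]
      split_ifs <;> first | rfl | omega

/-- `r ↦ x(r_1, …, r_j r_{j+1}, …, r_{p+1})`. -/
def contract {p : ℕ} (j : Fin p) (x : Coch R p) : Coch R (p + 1) where
  toFun r := x (Fin.contractNth j.castSucc (· * ·) r)
  map_update_add' r i u v := by
    obtain ⟨i', φ, h⟩ := contractNth_update j r i
    simp only [h, map_add, MultilinearMap.map_update_add]
  map_update_smul' r i c v := by
    obtain ⟨i', φ, h⟩ := contractNth_update j r i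
    simp only [h, map_smul, MultilinearMap.map_update_smul]

/-- `r ↦ r_1 x(r_2, …, r_{p+1})`. -/
def mulFirst {p : ℕ} (x : Coch R p) : Coch R (p + 1) where
  toFun r := r 0 * x (Fin.tail r)
  map_update_add' {inst} r i u v := by
    have := Subsingleton.elim inst (instDecidableEqFin (p + 1)); subst this
    refine Fin.cases ?_ (fun i => ?_) i
    · simp [add_mul]
    · rw [Function.update_of_ne (Fin.succ_ne_zero i).symm,
        Function.update_of_ne (Fin.succ_ne_zero i).symm,
        Function.update_of_ne (Fin.succ_ne_zero i).symm]
      simp [mul_add]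
  map_update_smul' {inst} r i c v := by
    have := Subsingleton.elim inst (instDecidableEqFin (p + 1)); subst this
    refine Fin.cases ?_ (fun i => ?_) i
    · simp [-zsmul_eq_mul]
    · rw [Function.update_of_ne (Fin.succ_ne_zero i).symm,
        Function.update_of_ne (Fin.succ_ne_zero i).symm]
      simp [-zsmul_eq_mul]

/-- `r ↦ x(r_1, …, r_p) r_{p+1}`. -/
def mulLast {p : ℕ} (x : Coch R p) : Coch R (p + 1) where
  toFun r := x (Fin.init r) * r (Fin.last p)
  map_update_add' {inst} r i u v := by
    have := Subsingleton.elim inst (instDecidableEqFin (p + 1)); subst this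
    refine Fin.lastCases ?_ (fun i => ?_) i
    · simp [mul_add]
    · simp [add_mul, (Fin.castSucc_lt_last i).ne']
  map_update_smul' {inst} r i c v := by
    have := Subsingleton.elim inst (instDecidableEqFin (p + 1)); subst this
    refine Fin.lastCases ?_ (fun i => ?_) i
    · simp [-zsmul_eq_mul]
    · simp [-zsmul_eq_mul, (Fin.castSucc_lt_last i).ne']

/-- The Hochschild differential
`(∂x)(r_1, …, r_{p+1}) = r_1 x(r_2, …) + ∑_{0<i<p+1} (-1)^i x(…, r_i r_{i+1}, …)
  + (-1)^{p+1} x(r_1, …, r_p) r_{p+1}`. -/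
def diff {p : ℕ} (x : Coch R p) : Coch R (p + 1) :=
  mulFirst x + ∑ j : Fin p, (-1 : ℤ) ^ ((j : ℕ) + 1) • contract j x
    + (-1 : ℤ) ^ (p + 1) • mulLast x

lemma diff_apply {p : ℕ} (x : Coch R p) (r : Fin (p + 1) → R) :
    diff x r = r 0 * x (Fin.tail r) +
      ∑ j : Fin p, (-1 : ℤ) ^ ((j : ℕ) + 1) • x (Fin.contractNth j.castSucc (· * ·) r) +
      (-1 : ℤ) ^ (p + 1) • (x (Fin.init r) * r (Fin.last p)) := by
  rw [diff, add_apply, add_apply, sum_apply]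
  rfl

lemma diff_mem {p : ℕ} {x : Coch R p} (hx : x ∈ normalized R p) : diff x ∈ normalized R (p + 1) := by
  intro r i hi
  let c : Fin (p + 2) → R := Fin.cases (r 0 * x (Fin.tail r)) fun j : Fin (p + 1) =>
    Fin.lastCases (motive := fun _ => R) (x (Fin.init r) * r (Fin.last p))
      (fun j : Fin p => x (Fin.contractNth j.castSucc (· * ·) r)) j
  have hsum : diff x r = ∑ l : Fin (p + 2), (-1 : ℤ) ^ (l : ℕ) • c l := by
    rw [Fin.sum_univ_succ, Fin.sum_univ_castSucc]
    have h1 : c (Fin.last p).succ = x (Fin.init r) * r (Fin.last p) := by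
      simp only [c, Fin.cases_succ, Fin.lastCases_last]
    have h2 : ∀ j : Fin p, c j.castSucc.succ = x (Fin.contractNth j.castSucc (· * ·) r) := by
      intro j
      simp only [c, Fin.cases_succ, Fin.lastCases_castSucc]
    have h3 : diff x r = r 0 * x (Fin.tail r) +
        ∑ j : Fin p, (-1 : ℤ) ^ ((j : ℕ) + 1) • x (Fin.contractNth j.castSucc (· * ·) r) +
        (-1 : ℤ) ^ (p + 1) • (x (Fin.init r) * r (Fin.last p)) := diff_apply x r
    rw [h3, h1]
    simp only [h2, Fin.val_succ, Fin.val_castSucc, Fin.val_last, Fin.val_zero, pow_zero, one_smul]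
    rw [add_assoc]
    rfl
  have hz : ∀ l : Fin (p + 2), l ≠ i.castSucc → l ≠ i.succ → c l = 0 := by
    intro l
    refine Fin.cases ?_ (fun l => Fin.lastCases ?_ (fun l => ?_) l) l
    · intro h1 _
      have hi0 : i ≠ 0 := fun h => h1 (by simp [h])
      have := hx (Fin.tail r) (i.pred hi0) (by simpa [Fin.tail] using hi)
      simp [c, this]
    · intro _ h2
      have hil : i ≠ Fin.last p := fun h => h2 (by simp [h])
      have := hx (Fin.init r) (i.castPred hil) (by simpa [Fin.init] using hi)
      simp only [c, Fin.cases_succ, Fin.lastCases_last, this, zero_mul]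
    · intro h1 h2
      simp only [ne_eq, Fin.ext_iff, Fin.val_castSucc, Fin.val_succ] at h1 h2
      simp only [c, Fin.cases_succ, Fin.lastCases_castSucc]
      rcases lt_or_gt_of_ne h2 with h | h
      · refine hx _ ⟨i - 1, by omega⟩ ?_
        rw [Fin.contractNth_apply_of_gt _ _ _ _ (by simp; omega)]
        convert hi using 2
        ext; simp; omega
      · refine hx _ ⟨i, by omega⟩ ?_
        rw [Fin.contractNth_apply_of_lt _ _ _ _ (by simp; omega)]
        exact hi
  have heq : c i.castSucc = c i.succ := by
    have key : ∀ l : Fin (p + 2), (l = i.castSucc ∨ l = i.succ) →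
        c l = x (fun t => r (i.succAbove t)) := by
      intro l
      refine Fin.cases ?_ (fun l => Fin.lastCases ?_ (fun l => ?_) l) l
      · rintro (h | h)
        · have : i = 0 := Fin.ext (by simpa using (congrArg Fin.val h).symm)
          subst this
          simp only [c, Fin.cases_zero, hi, one_mul]
          rfl
        · exact absurd h.symm (Fin.succ_ne_zero _)
      · rintro (h | h)
        · have := congrArg Fin.val h
          simp at this; omega
        · have : i = Fin.last p := Fin.ext (by simpa using (congrArg Fin.val h).symm)
          subst this
          simp only [c, Fin.cases_succ, Fin.lastCases_last, hi, mul_one, Fin.succAbove_last]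
          rfl
      · intro h
        simp only [c, Fin.cases_succ, Fin.lastCases_castSucc]
        congr 1
        funext t
        simp only [Fin.ext_iff, Fin.val_castSucc, Fin.val_succ] at h
        rcases lt_trichotomy (t : ℕ) l with ht | ht | ht
        · rw [Fin.contractNth_apply_of_lt _ _ _ _ (by simpa using ht),
            Fin.succAbove_of_castSucc_lt _ _ (by rw [Fin.lt_def]; simp; omega)]
        · rw [Fin.contractNth_apply_of_eq _ _ _ _ (by simpa using ht)]
          rcases h with h | h
          · have : t.succ = i := by ext; simp; omega
            rw [this, hi, mul_one,
              Fin.succAbove_of_castSucc_lt _ _ (by rw [Fin.lt_def]; simp; omega)]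
          · have : t.castSucc = i := by ext; simp; omega
            rw [this, hi, one_mul,
              Fin.succAbove_of_le_castSucc _ _ (by rw [Fin.le_def]; simp; omega)]
        · rw [Fin.contractNth_apply_of_gt _ _ _ _ (by simpa using ht),
            Fin.succAbove_of_le_castSucc _ _ (by rw [Fin.le_def]; simp; omega)]
    rw [key _ (Or.inl rfl), key _ (Or.inr rfl)]
  rw [hsum, Finset.sum_eq_add i.castSucc i.succ (by simp [Fin.ext_iff])
    (fun l _ h => by rw [hz l h.1 h.2, smul_zero]) (by simp) (by simp), heq]
  simp [pow_succ]

lemma diff_add {p : ℕ} (x y : Coch R p) : diff (x + y) = diff x + diff y := by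
  ext r
  rw [add_apply, diff_apply, diff_apply, diff_apply]
  simp only [add_apply, mul_add, add_mul, smul_add, Finset.sum_add_distrib]
  abel

variable (R) in
/-- The differential of the normalized Hochschild cochain complex `C^*(R)`. -/
def d : C R →ₗ[ℤ] C R :=
  DirectSum.toModule ℤ ℕ (C R) fun p =>
    (DirectSum.lof ℤ ℕ (fun p => normalized R p) (p + 1)) ∘ₗ
      (AddMonoidHom.mk' (fun x : normalized R p =>
        (⟨diff x.1, diff_mem x.2⟩ : normalized R (p + 1)))
        (fun x y => Subtype.ext (diff_add x.1 y.1))).toIntLinearMap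

/-! ## Evaluation of sequences on Hochschild cochains -/

variable (R) in
/-- A Hochschild cochain together with its degree. -/
abbrev GCoch : Type _ := Σ p : ℕ, Coch R p

/-- The cup product `(x ⌣ y)(r_1, …, r_{p+q}) = x(r_1, …, r_p) y(r_{p+1}, …, r_{p+q})`. -/
def cup (x y : GCoch R) : GCoch R :=
  ⟨x.1 + y.1, MultilinearMap.domDomCongr finSumFinEquiv
    ((LinearMap.mul' ℤ R).compMultilinearMap (MultilinearMap.domCoprod x.2 y.2))⟩

lemma cup_apply (x y : GCoch R) (r : Fin (x.1 + y.1) → R) :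
    (cup x y).2 r =
      x.2 (fun i => r (Fin.castAdd y.1 i)) * y.2 (fun i => r (Fin.natAdd x.1 i)) := rfl

/-- The composite `x(x_1, …, x_p) : R^{⊗(j_1 + ⋯ + j_p)} → R^{⊗p} → R`. -/
def comp {p : ℕ} (x : Coch R p) (y : Fin p → GCoch R) : GCoch R :=
  ⟨∑ i, (y i).1, MultilinearMap.domDomCongr finSigmaFinEquiv
    (x.compMultilinearMap fun i => (y i).2)⟩

lemma comp_apply {p : ℕ} (x : Coch R p) (y : Fin p → GCoch R) (r : Fin (∑ i, (y i).1) → R) :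
    (comp x y).2 r = x fun i => (y i).2 fun t => r (finSigmaFinEquiv ⟨i, t⟩) := rfl

variable (R) in
/-- The cochain `1 ∈ C^0(R)`, the unit of the cup product. -/
def one : GCoch R := ⟨0, MultilinearMap.constOfIsEmpty ℤ (fun _ : Fin 0 => R) 1⟩

variable (R) in
/-- The identity map of `R`, a Hochschild cochain of degree `1`. -/
def ident : GCoch R := ⟨1, (LinearMap.id : R →ₗ[ℤ] R).compMultilinearMap
  (MultilinearMap.ofSubsingleton ℤ R R (0 : Fin 1) LinearMap.id)⟩

lemma ident_apply (r : Fin 1 → R) : (ident R).2 r = r 0 := rfl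

lemma splitOn_getD_length_le {A : Type*} [DecidableEq A] (i : A) (w : List A) :
    ∀ t : ℕ, ((w.splitOn i).getD t []).length ≤ w.length := by
  unfold List.splitOn
  induction w with
  | nil => intro t; rcases t with _ | t <;> simp
  | cons a w ih =>
    intro t
    rw [List.splitOnP_cons_eq_if_modifyHead]
    split_ifs
    · rcases t with _ | t
      · simp
      · simpa using (ih t).trans (Nat.le_succ _)
    · have hne := List.splitOnP_ne_nil (· == i) w
      rcases hl : List.splitOnP (· == i) w with _ | ⟨b, l⟩
      · exact absurd hl hne
      · rw [hl] at ih
        rcases t with _ | t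
        · simpa using ih 0
        · simpa using (ih (t + 1)).trans (Nat.le_succ _)

/-- The evaluation of a word `g` on cochains `x_1, …, x_k`.

The evaluation of the empty word is the empty cup product `1 ∈ C^0(R)`.  If the word is nonempty with
first letter `i`, cut what follows the first letter at all further occurrences of `i`; this gives
subwords `A_1, …, A_s`, followed by a last subword without the letter `i`.  The part of the word from
the first to the last occurrence of `i` is its first maximal segment; its value is
`x_i(A_1(x), …, A_s(x))`, where an empty `A_t` stands for the identity map of `R`.  The value of the
word is the cup product of the value of this segment and the value of the remaining word (that is,
the cup product of the values of all its maximal segments).  It is only used when the letter `i`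
occurs `|x_i| + 1` times, that is, when `s = |x_i|`. -/
def eval {k : ℕ} {q : Fin k → ℕ} (x : ∀ i, Coch R (q i)) : List (Fin k) → GCoch R
  | [] => one R
  | i :: w =>
    cup
      (comp (x i) fun t : Fin (q i) =>
        if (w.splitOn i).getD t [] = [] then ident R else eval x ((w.splitOn i).getD t []))
      (eval x ((w.splitOn i).getD (w.count i) []))
  termination_by w => w.length
  decreasing_by
    all_goals exact Nat.lt_succ_of_le (splitOn_getD_length_le _ _ _)

lemma cup_mem {a b : GCoch R} (ha : a.2 ∈ normalized R a.1) (hb : b.2 ∈ normalized R b.1) :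
    (cup a b).2 ∈ normalized R (cup a b).1 := by
  intro r t
  refine Fin.addCases (fun t ht => ?_) (fun t ht => ?_) t
  · refine (cup_apply a b r).trans ?_
    rw [ha _ t ht, zero_mul]
  · refine (cup_apply a b r).trans ?_
    rw [hb _ t ht, mul_zero]

lemma comp_mem {p : ℕ} {x : Coch R p} (hx : x ∈ normalized R p) {y : Fin p → GCoch R}
    (hy : ∀ (t : Fin p) (r : Fin (y t).1 → R) (b : Fin (y t).1), r b = 1 →
      (y t).2 r = 0 ∨ (y t).2 r = 1) :
    (comp x y).2 ∈ normalized R (comp x y).1 := by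
  intro r t ht
  refine (comp_apply x y r).trans ?_
  obtain ⟨⟨a, b⟩, rfl⟩ := finSigmaFinEquiv.surjective t
  rcases hy a (fun t => r (finSigmaFinEquiv ⟨a, t⟩)) b ht with h | h
  · exact x.map_coord_zero a h
  · exact hx _ a h

lemma eval_mem {k : ℕ} {q : Fin k → ℕ} (x : ∀ i, normalized R (q i)) (w : List (Fin k)) :
    (eval (fun i => (x i).1) w).2 ∈ normalized R (eval (fun i => (x i).1) w).1 := by
  induction hw : w.length using Nat.strong_induction_on generalizing w with
  | _ N ih =>
    subst hw
    rcases w with _ | ⟨i, w⟩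
    · rw [eval]
      intro r t
      exact Fin.elim0 t
    · have hlt : ∀ t : ℕ, ((w.splitOn i).getD t []).length < (i :: w).length := fun t =>
        Nat.lt_succ_of_le (splitOn_getD_length_le _ _ _)
      rw [eval]
      refine cup_mem (comp_mem (x i).2 fun t => ?_) (ih _ (hlt _) _ rfl)
      have hid : ∀ (r : Fin (ident R).1 → R) (b : Fin (ident R).1), r b = 1 →
          (ident R).2 r = 0 ∨ (ident R).2 r = 1 := by
        intro r b hb
        right
        have hb0 : b = (0 : Fin 1) := Subsingleton.elim (α := Fin 1) _ _
        subst hb0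
        exact hb
      generalize hl : (w.splitOn i).getD t [] = l
      have hl' : l.length < (i :: w).length := hl ▸ hlt t
      by_cases h : l = []
      · rw [if_pos h]
        exact hid
      · rw [if_neg h]
        exact fun r b hb => Or.inl (ih _ hl' _ rfl r b hb)

/-! ## The maps `θ_k` -/

/-- The value of a word on normalized cochains, as an element of `C^*(R)`. -/
def value {k : ℕ} {q : Fin k → ℕ} (x : ∀ i, normalized R (q i)) (w : List (Fin k)) : C R :=
  DirectSum.of (fun p => normalized R p) (eval (fun i => (x i).1) w).1
    ⟨(eval (fun i => (x i).1) w).2, eval_mem x w⟩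

/-- The exponent `ε'(f, 𝒜) = ε(f, 𝒜) + (m - k) ∑ |x_i| + (m - k)(m - k + 1) / 2` of the sign of
the special diagram `(α, β)`, where `𝒜_j = α(β⁻¹(j))`. -/
def eps' {k s t : ℕ} (f : NSeq k) (q : Fin k → ℕ) (α : Fin t → Fin s) (β : Fin t → Fin f.len) : ℤ :=
  eps f.fn (fun j => norm1 (α '' (β ⁻¹' {j}))) + f.degree * ∑ i, (q i : ℤ) +
    f.degree * (f.degree + 1) / 2

open Classical in
/-- `θ_k(f, x_1, …, x_k)` for a generator `f` and homogeneous cochains `x_i` of degree `q i`: the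
signed sum of the values of the words `f ∘ β`, over all special diagrams `(α, β)` for which each `i`
occurs exactly `|x_i| + 1` times in `f ∘ β`. -/
def thetaHom {k : ℕ} (f : NSeq k) (q : Fin k → ℕ) (x : ∀ i, normalized R (q i)) : C R :=
  ∑ E ∈ Finset.univ.filter
      (fun E : (Fin (k + ∑ i, q i) → Fin (∑ i, q i + k + 1 - f.len)) ×
          (Fin (k + ∑ i, q i) → Fin f.len) =>
        IsSpecial E.1 E.2 ∧ ∀ i, (List.ofFn (f.fn ∘ E.2)).count i = q i + 1),
    (eps' f q E.1 E.2).negOnePow • value x (List.ofFn (f.fn ∘ E.2))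

open Classical in
/-- `θ_k(f, x_1, …, x_k)` for arbitrary cochains: the sum over all choices of homogeneous
components. -/
def thetaGen {k : ℕ} (f : NSeq k) (x : Fin k → C R) : C R :=
  ∑ q ∈ Fintype.piFinset fun i => DFinsupp.support (x i), thetaHom f q fun i => x i (q i)

variable (R) in
/-- The map `θ_k`, extended linearly in the sequence. -/
def theta (k : ℕ) : S k →ₗ[ℤ] ((Fin k → C R) → C R) := Finsupp.linearCombination ℤ thetaGen

/-- The isomorphism `C^*(R) → C^*(R')` induced by an isomorphism `e : R → R'` of rings:
`x ↦ e ∘ x ∘ (e⁻¹ ⊗ ⋯ ⊗ e⁻¹)`. -/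
def transport {R' : Type*} [Ring R'] (e : R ≃+* R') : C R →+ C R' :=
  DirectSum.map fun p => AddMonoidHom.mk'
    (fun x : normalized R p =>
      (⟨e.toAddMonoidHom.toIntLinearMap.compMultilinearMap
          (x.1.compLinearMap fun _ => e.symm.toAddMonoidHom.toIntLinearMap), fun r i h => by
          change e (x.1 fun t => e.symm (r t)) = 0
          rw [x.2 _ i (by rw [h, map_one]), map_zero]⟩ : normalized R' p))
    fun x y => Subtype.ext <| MultilinearMap.ext fun r => map_add e _ _

end Hochschild

end

noncomputable section

set_option linter.unusedSectionVars false

namespace SeqOperad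

/-! ## Noncrossing words -/

/-! By `complexity_le_two_iff`, complexity at most 2 means that no subword `a c a c` occurs.
Deleting entries, relabelling and forming `hD` create no such subword, whence closure. For the
evaluation it means that words are nested: the segment from the first to the last `i` shares no
letter with the rest of the word, and the pieces between consecutive occurrences of `i` share no
letter with their surroundings. So a closed subword enters the value of the whole word only through
its own value, and additively (`exists_context`).

Identities between cochains are checked after evaluation on ring elements. For this, `val` evaluates
words that contain letters as well as ring elements, and `eval_eq_val` identifies `eval` with the
value of the word in which a bar is put between equal neighbours and the bars are filled with the
arguments. In a special diagram `α l + β l = l`, so the diagram amounts to the multiplicities `n` of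
`β` (`sum_special`). The corresponding word is `bexp f n`: the entry `f j` becomes a block `f j | ⋯
| f j` with `n j` bars. If `f` is degenerate, two equal letters are adjacent without a bar, some
cochain receives the argument 1, and the term is zero. Hence one formula, `ev_theta_cls`, computes θ
on all sequences.

Differential. By `val_diff`, the value of a word on `∂x_i` is the alternating sum over the deletions
of an occurrence of `i`; sort these by the block `j` in which the deletion takes place. If the block
has a bar, deleting a letter is the same as inserting a bar into a block with one bar fewer. The
slots between blocks telescope (`edge_append`), and what remains is the Hochschild differential of
the value of the word (`edge_eq`, `edge_bexp`). If the block is a single letter, the entry `j`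
disappears, which gives a term of θ(∂f, x). The signs are `sign_insert` and `sign_delete`.

Symmetric groups. Relabelling does not change the values, so only signs are at stake (`sign_perm`).
The letter `u` of `f` stands for a cochain of degree `N u + φ u`, where `N u` is the total
multiplicity of `u` and `φ u = ‖f⁻¹(u)‖`. Expanding the Koszul sign in these terms yields ζ together
with the changes of the quadratic and the linear part of ε.

Composition. Let `ν` be multiplicities for `f` and `c i` multiplicities for `g i`. The word of `g i`
is cut at its bars into pieces, which are substituted for the occurrences of `i` in the word of `f`
(`val_subst`). The letter `r` of `g i` inside the block `j` of `f` forms a run. The runs of a given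
`i` form a lattice path with rows `j` and columns `r`, and their lengths give multiplicities for
`hD`. Such a path with prescribed row and column weights exists and is unique (`Path.exists_of_sum`,
`Path.unique`). So the pairs `(ν, c)` correspond to diagrams with multiplicities (`sum_diagrams`),
the values agree by `val_isWeighted`, and the signs by `sign_composition`.

Naturality holds because values of words are built from the cochains, the product and the unit of
the ring only. -/

/-- A word is noncrossing if it has no subword `a c a c` with `a ≠ c`. -/
def Noncrossing {A : Type*} (l : List A) : Prop := ∀ a c, a ≠ c → ¬ [a, c, a, c].Sublist l

lemma Noncrossing.sublist {A : Type*} {l l' : List A} (h : Noncrossing l) (hl : l'.Sublist l) :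
    Noncrossing l' := fun a c hac hs => h a c hac (hs.trans hl)

lemma noncrossing_map_iff {A B : Type*} {φ : A → B} (hφ : Function.Injective φ) {l : List A} :
    Noncrossing (l.map φ) ↔ Noncrossing l := by
  refine ⟨fun h a c hac hs => h (φ a) (φ c) (hφ.ne hac) (by simpa using hs.map φ),
    fun h a c hac hs => ?_⟩
  obtain ⟨l', hl', he⟩ := List.sublist_map_iff.1 hs
  rcases l' with _ | ⟨x, _ | ⟨y, _ | ⟨z, _ | ⟨w, _ | ⟨v, l'⟩⟩⟩⟩⟩ <;> simp at he
  obtain ⟨rfl, rfl, h1, h2⟩ := he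
  obtain rfl := hφ h1
  obtain rfl := hφ h2
  exact h _ _ (fun h => hac (congrArg φ h)) hl'

/-- In terms of positions the condition passes along strictly increasing maps of the positions. -/
lemma noncrossing_ofFn_iff {A : Type*} {m : ℕ} {f : Fin m → A} :
    Noncrossing (List.ofFn f) ↔ ∀ j₁ j₂ j₃ j₄ : Fin m, j₁ < j₂ → j₂ < j₃ → j₃ < j₄ →
      f j₁ = f j₃ → f j₂ = f j₄ → f j₁ = f j₂ := by
  constructor
  · intro h j₁ j₂ j₃ j₄ h12 h23 h34 h13 h24
    by_contra hne
    refine h _ _ hne ?_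
    rw [List.ofFn_eq_map]
    have hs : [j₁, j₂, j₃, j₄].Sublist (List.finRange m) := by
      have : (List.finRange m).Pairwise (· < ·) := List.pairwise_lt_finRange m
      refine List.sublist_of_subperm_of_pairwise (r := (· < ·)) ?_ ?_ this
      · refine List.subperm_of_subset ?_ fun x _ => List.mem_finRange x
        simp [h12.ne, h23.ne, h34.ne, (h12.trans h23).ne, (h23.trans h34).ne,
          ((h12.trans h23).trans h34).ne]
      · simp [h12, h23, h34, h12.trans h23, h23.trans h34, (h12.trans h23).trans h34]
    have := hs.map f
    simpa [← h13, ← h24] using this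
  · intro h a c hac hs
    obtain ⟨φ, hφ⟩ := List.sublist_iff_exists_fin_orderEmbedding_get_eq.1 hs
    have e0 := hφ ⟨0, by simp⟩
    have e1 := hφ ⟨1, by simp⟩
    have e2 := hφ ⟨2, by simp⟩
    have e3 := hφ ⟨3, by simp⟩
    simp only [List.get_ofFn] at e0 e1 e2 e3
    have l01 : φ ⟨0, by simp⟩ < φ ⟨1, by simp⟩ := by simp
    have l12 : φ ⟨1, by simp⟩ < φ ⟨2, by simp⟩ := by simp
    have l23 : φ ⟨2, by simp⟩ < φ ⟨3, by simp⟩ := by simp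
    have := h (Fin.cast (by simp) (φ ⟨0, by simp⟩)) (Fin.cast (by simp) (φ ⟨1, by simp⟩))
      (Fin.cast (by simp) (φ ⟨2, by simp⟩)) (Fin.cast (by simp) (φ ⟨3, by simp⟩))
      l01 l12 l23 (by rw [← e0, ← e2]; rfl) (by rw [← e1, ← e3]; rfl)
    rw [← e0, ← e1] at this
    exact hac this

/-- Removing repetitions from the subsequence in two given letters leaves one letter for each run.
This is a longest alternating subword, so four runs are present exactly when a subword `a c a c` is.
-/
lemma complexity_le_two_iff {m k : ℕ} {f : Fin m → Fin k} :
    complexity f ≤ 2 ↔ Noncrossing (List.ofFn f) := by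
  unfold complexity
  rw [Finset.sup_le_iff]
  constructor
  · intro h a c hac hs
    have key : ∀ p : Fin k × Fin k, p.1 < p.2 → (a = p.1 ∨ a = p.2) → (c = p.1 ∨ c = p.2) →
        False := by
      intro p hp ha hc
      have h1 := h p (by simp [hp])
      have h2 := hs.filter (fun t => t = p.1 ∨ t = p.2)
      have h3 : [a, c, a, c].filter (fun t => t = p.1 ∨ t = p.2) = [a, c, a, c] := by
        simp [ha, hc]
      rw [h3] at h2
      have h4 := List.IsChain.length_le_length_destutter_ne h2 (by simp [hac, hac.symm])
      simp only [List.length_cons, List.length_nil] at h4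
      omega
    rcases lt_or_gt_of_ne hac with h' | h'
    · exact key (a, c) h' (Or.inl rfl) (Or.inr rfl)
    · exact key (c, a) h' (Or.inr rfl) (Or.inl rfl)
  · intro h p _
    by_contra hlt
    set D := ((List.ofFn f).filter fun t => t = p.1 ∨ t = p.2).destutter (· ≠ ·) with hD
    have hch : D.IsChain (· ≠ ·) := List.isChain_destutter _ _
    have hsub := List.destutter_sublist (· ≠ ·) ((List.ofFn f).filter fun t => t = p.1 ∨ t = p.2)
    rw [← hD] at hsub
    have hmem : ∀ t ∈ D, t = p.1 ∨ t = p.2 := fun t ht => by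
      simpa using (List.mem_filter.1 (hsub.subset ht)).2
    have hsub' : D.Sublist (List.ofFn f) := hsub.trans List.filter_sublist
    clear_value D
    rcases D with _ | ⟨x, _ | ⟨y, _ | ⟨z, _ | ⟨w, D⟩⟩⟩⟩ <;> try (simp at hlt; done)
    simp only [List.isChain_cons_cons] at hch
    obtain ⟨hxy, hyz, hzw, -⟩ := hch
    have hx := hmem x (by simp)
    have hy := hmem y (by simp)
    have hz := hmem z (by simp)
    have hw := hmem w (by simp)
    -- Neighbours in `D` differ and only two values are available, so the entries alternate.
    have hxz : x = z := by
      rcases hx with rfl | rfl <;> rcases hy with rfl | rfl <;> rcases hz with rfl | rfl <;>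
        simp_all
    have hyw : y = w := by
      rcases hw with rfl | rfl <;> rcases hy with rfl | rfl <;> rcases hz with rfl | rfl <;>
        simp_all
    subst hxz hyw
    refine h x y hxy (List.Sublist.trans ?_ hsub')
    exact (List.nil_sublist _).cons_cons _ |>.cons_cons _ |>.cons_cons _ |>.cons_cons _

/-! ## Closure of noncrossing sequences under the structure maps -/

lemma restrictSeq_noncrossing {m k : ℕ} {f : Fin m → Fin k} (h : Noncrossing (List.ofFn f))
    (A : Finset (Fin m)) : Noncrossing (List.ofFn (restrictSeq f A)) := by
  rw [noncrossing_ofFn_iff] at h ⊢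
  intro j₁ j₂ j₃ j₄ h12 h23 h34
  exact h _ _ _ _ ((A.orderEmbOfFin rfl).strictMono h12) ((A.orderEmbOfFin rfl).strictMono h23)
    ((A.orderEmbOfFin rfl).strictMono h34)

lemma cls_mem {m k : ℕ} {f : Fin m → Fin k} (h : Noncrossing (List.ofFn f)) : cls f ∈ Sub 2 k := by
  unfold cls
  split_ifs with hf
  · exact Finsupp.single_mem_supported ℤ 1
      (show complexity f ≤ 2 from complexity_le_two_iff.2 h)
  · exact zero_mem _

lemma linearCombination_mem {n k : ℕ} {G : NSeq k → S k}
    (h : ∀ f : NSeq k, complexity f.fn ≤ n → G f ∈ Sub n k) {s : S k} (hs : s ∈ Sub n k) :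
    Finsupp.linearCombination ℤ G s ∈ Sub n k := by
  rw [Finsupp.linearCombination_apply]
  exact Submodule.sum_mem _ fun f hf => Submodule.smul_mem _ _
    (h f ((Finsupp.mem_supported ℤ s).1 hs hf))

lemma negOnePow_smul_mem {n k : ℕ} {s : S k} (hs : s ∈ Sub n k) (e : ℤ) :
    e.negOnePow • s ∈ Sub n k := by
  rcases Int.even_or_odd e with h | h
  · rw [Int.negOnePow_even _ h, one_smul]; exact hs
  · rw [Int.negOnePow_odd _ h, Units.neg_smul, one_smul]; exact neg_mem hs

lemma IsDiagram.adjacent_ne {m k N : ℕ} {f : Fin m → Fin k} {ms : Fin k → ℕ}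
    {a : Fin N → Fin m} {b : Fin N → Σ i : Fin k, Fin (ms i)} (h : IsDiagram f ms a b)
    {l l' : Fin N} (hll : l ≤ l') {i : Fin k} (hl : (b l).1 = i) (hl' : (b l').1 = i) :
    b l ≤ b l' := by
  obtain ⟨comm, hsp⟩ := h.2
  exact (hsp i).2.1 (show (⟨l, hl⟩ : {l : Fin N // (b l).1 = i}) ≤ ⟨l', hl'⟩ from hll)

/-- If the four positions lie in one summand, `b` is order-preserving there and the pattern is found
in some `g i`. Otherwise they alternate between two summands; since `f ∘ a` records the summand, `a`
is strictly increasing along them and the pattern is found in `f`. -/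
lemma hD_noncrossing {k N : ℕ} {f : NSeq k} {j : Fin k → ℕ} {g : ∀ i, NSeq (j i)}
    {a : Fin N → Fin f.len} {b : Fin N → Σ i : Fin k, Fin (g i).len}
    (h : IsDiagram f.fn (fun i => (g i).len) a b) (hf : Noncrossing (List.ofFn f.fn))
    (hg : ∀ i, Noncrossing (List.ofFn (g i).fn)) : Noncrossing (List.ofFn (hD g b)) := by
  rw [noncrossing_ofFn_iff] at hf ⊢
  intro l₁ l₂ l₃ l₄ h12 h23 h34 e13 e24
  obtain ⟨comm, -⟩ := h.2
  have e13' := finSigmaFinEquiv.injective e13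
  have e24' := finSigmaFinEquiv.injective e24
  simp only [Sigma.mk.injEq] at e13' e24'
  by_cases hi : (b l₁).1 = (b l₂).1
  · have m12 := h.adjacent_ne h12.le rfl hi.symm
    have m23 := h.adjacent_ne h23.le hi.symm e13'.1.symm
    have m34 := h.adjacent_ne h34.le e13'.1.symm (by rw [← e24'.1, hi])
    unfold hD
    generalize b l₁ = b₁ at *
    generalize b l₂ = b₂ at *
    generalize b l₃ = b₃ at *
    generalize b l₄ = b₄ at *
    obtain ⟨i₁, r₁⟩ := b₁
    obtain ⟨i₂, r₂⟩ := b₂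
    obtain ⟨i₃, r₃⟩ := b₃
    obtain ⟨i₄, r₄⟩ := b₄
    dsimp only at *
    obtain ⟨rfl, e13''⟩ := e13'
    obtain ⟨rfl, e24''⟩ := e24'
    subst hi
    have e13' := eq_of_heq e13''
    have e24' := eq_of_heq e24''
    have n12 : r₁ ≤ r₂ := (Sigma.mk_le_mk_iff (α := fun i => Fin (g i).len)).1 m12
    have n23 : r₂ ≤ r₃ := (Sigma.mk_le_mk_iff (α := fun i => Fin (g i).len)).1 m23
    have n34 : r₃ ≤ r₄ := (Sigma.mk_le_mk_iff (α := fun i => Fin (g i).len)).1 m34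
    by_contra hne
    have hg' := hg i₁
    rw [noncrossing_ofFn_iff] at hg'
    have hne' : (g i₁).fn r₁ ≠ (g i₁).fn r₂ := fun h => hne (by rw [h])
    refine hne' (hg' r₁ r₂ r₃ r₄ (lt_of_le_of_ne n12 ?_) (lt_of_le_of_ne n23 ?_)
      (lt_of_le_of_ne n34 ?_) e13' e24')
    · rintro rfl; exact hne' rfl
    · rintro rfl; exact hne' e13'
    · rintro rfl; exact hne' (e13'.trans e24'.symm)
  · exfalso
    have hlt : ∀ {l l' : Fin N}, l < l' → (b l).1 ≠ (b l').1 → a l < a l' := by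
      intro l l' hl hne
      refine lt_of_le_of_ne (h.1 hl.le) fun he => hne ?_
      rw [← comm, ← comm, he]
    refine hi ?_
    rw [← comm, ← comm]
    refine hf (a l₁) (a l₂) (a l₃) (a l₄) (hlt h12 hi) (hlt h23 ?_) (hlt h34 ?_) ?_ ?_
    · rw [← e13'.1]; exact Ne.symm hi
    · rw [← e13'.1, ← e24'.1]; exact hi
    · rw [comm, comm, e13'.1]
    · rw [comm, comm, e24'.1]

lemma isSuboperad_two : IsSuboperad 2 where
  unit_mem := Finsupp.single_mem_supported ℤ 1 (by
    show complexity _ ≤ 2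
    rw [complexity_le_two_iff, noncrossing_ofFn_iff]
    intro j₁ j₂ _ _ _ _ _ _ _
    exact Subsingleton.elim (α := Fin 1) _ _)
  bd_mem k s hs := linearCombination_mem (fun f hf => Submodule.sum_mem _ fun j _ =>
    negOnePow_smul_mem (cls_mem (restrictSeq_noncrossing (complexity_le_two_iff.1 hf) _)) _) hs
  perm_mem k ρ s hs := linearCombination_mem (fun f hf => negOnePow_smul_mem (cls_mem (by
    rw [← List.map_ofFn, noncrossing_map_iff (ρ⁻¹).injective]
    exact complexity_le_two_iff.1 hf)) _) hs
  gamma_mem k f j g hf hg := by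
    classical
    refine Submodule.sum_mem _ fun D hD => negOnePow_smul_mem (cls_mem ?_) _
    exact hD_noncrossing (Finset.mem_filter.1 hD).2 (complexity_le_two_iff.1 hf)
      fun i => complexity_le_two_iff.1 (hg i)

end SeqOperad

namespace Hochschild

open SeqOperad

/-! ## Words in which every letter occurs a prescribed number of times -/

section Good

variable {ι : Type*} [DecidableEq ι]

/-- A noncrossing word in which each letter `i` that occurs does so `q i + 1` times. -/
structure Good (q : ι → ℕ) (w : List ι) : Prop where
  nc : Noncrossing w
  count_eq : ∀ i ∈ w, w.count i = q i + 1

lemma Good.nil (q : ι → ℕ) : Good q [] := ⟨fun _ _ _ h => by simp at h, by simp⟩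

/-- A factor that shares no letter with its surroundings contains all occurrences of its letters. -/
lemma Good.middle {q : ι → ℕ} {u A v : List ι} (h : Good q (u ++ A ++ v))
    (hc : ∀ c ∈ A, c ∉ u ∧ c ∉ v) : Good q A := by
  refine ⟨h.nc.sublist (by rw [List.append_assoc]; exact
    (List.sublist_append_left _ _).trans (List.sublist_append_right _ _)), fun c hA => ?_⟩
  have := h.count_eq c (by simp [hA])
  simpa [List.count_append, List.count_eq_zero.2 (hc c hA).1, List.count_eq_zero.2 (hc c hA).2]
    using this

lemma Good.outer {q : ι → ℕ} {u A v : List ι} (h : Good q (u ++ A ++ v))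
    (hc : ∀ c ∈ A, c ∉ u ∧ c ∉ v) : Good q (u ++ v) := by
  refine ⟨h.nc.sublist (by simp), fun c hA => ?_⟩
  have hcA : c ∉ A := fun h' => by
    rcases List.mem_append.1 hA with h1 | h1
    · exact (hc c h').1 h1
    · exact (hc c h').2 h1
  have := h.count_eq c (by rcases List.mem_append.1 hA with h1 | h1 <;> simp [h1])
  simpa [List.count_append, List.count_eq_zero.2 hcA] using this

lemma Good.congr {q q' : ι → ℕ} {w : List ι} (h : Good q w) (hq : ∀ i ∈ w, q' i = q i) :
    Good q' w := ⟨h.nc, fun i hi => by rw [h.count_eq i hi, hq i hi]⟩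

/-- A letter `c` of `A` that also occurs outside would be interleaved with the leading `i` and the
`i` at the end of `u` or at the beginning of `v`, giving `i c i c`. The empty cases are those where
`A` is the first or the last piece. -/
lemma Noncrossing.separated {i : ι} {u A v : List ι} (h : Noncrossing (i :: (u ++ A ++ v)))
    (hA : i ∉ A) (hu : u = [] ∨ ∃ u', u = u' ++ [i]) (hv : v = [] ∨ ∃ v', v = i :: v') :
    ∀ c ∈ A, c ∉ u ∧ c ∉ v := by
  intro c hc
  have hci : i ≠ c := fun h => hA (h ▸ hc)
  constructor
  · intro hcu
    rcases hu with rfl | ⟨u', rfl⟩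
    · simp at hcu
    · have hcu' : c ∈ u' := by simpa [hci.symm] using hcu
      refine h i c hci ?_
      have h1 : [c].Sublist u' := List.singleton_sublist.2 hcu'
      have h2 : [c].Sublist A := List.singleton_sublist.2 hc
      have := ((h1.append (List.Sublist.refl [i])).append h2).append (List.nil_sublist v)
      exact this.cons_cons i
  · intro hcv
    rcases hv with rfl | ⟨v', rfl⟩
    · simp at hcv
    · have hcv' : c ∈ v' := by simpa [hci.symm] using hcv
      refine h i c hci ?_
      have h1 : [c].Sublist v' := List.singleton_sublist.2 hcv'
      have h2 : [c].Sublist A := List.singleton_sublist.2 hc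
      have := ((List.nil_sublist u).append h2).append (h1.cons_cons i)
      exact this.cons_cons i

/-- The separator form: each word of the list is followed by the letter `i`. -/
def seg {α : Type*} (i : α) (L : List (List α)) : List α := L.flatMap (· ++ [i])

@[simp] lemma seg_nil {α : Type*} (i : α) : seg i [] = [] := rfl

@[simp] lemma seg_cons {α : Type*} (i : α) (A : List α) (L : List (List α)) :
    seg i (A :: L) = A ++ i :: seg i L := by simp [seg]

@[simp] lemma seg_append {α : Type*} (i : α) (L L' : List (List α)) :
    seg i (L ++ L') = seg i L ++ seg i L' := by simp [seg]

lemma seg_eq_nil_or {α : Type*} (i : α) (L : List (List α)) :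
    seg i L = [] ∨ ∃ u, seg i L = u ++ [i] := by
  rcases List.eq_nil_or_concat L with rfl | ⟨L, A, rfl⟩
  · exact Or.inl rfl
  · exact Or.inr ⟨seg i L ++ A, by simp⟩

end Good

/-! ## Words with letters in `ι` and entries in `R` -/

variable {R : Type*} [Ring R] {ι : Type*} [DecidableEq ι]

/-- The value of a cochain on the first entries of a sequence. -/
def app (x : GCoch R) (r : ℕ → R) : R := x.2 fun i => r i

/-- The letters of a word with letters in `ι` and entries in `R`. -/
def letters {α β : Type*} (b : List (α ⊕ β)) : List α := b.filterMap Sum.getLeft?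

@[simp] lemma letters_nil {α β : Type*} : letters ([] : List (α ⊕ β)) = [] := rfl
@[simp] lemma letters_inl {α β : Type*} (i : α) (b : List (α ⊕ β)) :
    letters (Sum.inl i :: b) = i :: letters b := by simp [letters]
@[simp] lemma letters_inr {α β : Type*} (r : β) (b : List (α ⊕ β)) :
    letters (Sum.inr r :: b) = letters b :=
  List.filterMap_cons_none rfl
@[simp] lemma letters_append {α β : Type*} (b b' : List (α ⊕ β)) :
    letters (b ++ b') = letters b ++ letters b' := by simp [letters]

lemma letters_seg (i : ι) (L : List (List (ι ⊕ R))) :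
    letters (seg (Sum.inl i) L) = seg i (L.map letters) := by
  induction L with
  | nil => rfl
  | cons A L ih => simp [ih]

/-- The predicate of being the letter `i`. -/
def isLetter (i : ι) : ι ⊕ R → Bool
  | Sum.inl j => decide (j = i)
  | Sum.inr _ => false

lemma splitOnP_getD_length_le {A : Type*} (p : A → Bool) (w : List A) :
    ∀ t : ℕ, ((w.splitOnP p).getD t []).length ≤ w.length := by
  induction w with
  | nil => intro t; rcases t with _ | t <;> simp
  | cons a w ih =>
    intro t
    rw [List.splitOnP_cons_eq_if_modifyHead]
    split_ifs
    · rcases t with _ | t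
      · simp
      · simpa using (ih t).trans (Nat.le_succ _)
    · have hne := List.splitOnP_ne_nil p w
      rcases hl : List.splitOnP p w with _ | ⟨b, l⟩
      · exact absurd hl hne
      · rw [hl] at ih
        rcases t with _ | t
        · simpa using ih 0
        · simpa using (ih (t + 1)).trans (Nat.le_succ _)

/-- The value of a word whose letters stand for the cochains `z i`. -/
def val (z : ι → GCoch R) : List (ι ⊕ R) → R
  | [] => 1
  | Sum.inr r :: b => r * val z b
  | Sum.inl i :: b =>
    app (z i) (fun t => val z ((b.splitOnP (isLetter i)).getD t [])) *
      val z ((b.splitOnP (isLetter i)).getD (z i).1 [])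
  termination_by b => b.length
  decreasing_by
    · simp
    all_goals exact Nat.lt_succ_of_le (splitOnP_getD_length_le _ _ _)

@[simp] lemma val_nil (z : ι → GCoch R) : val z [] = 1 := by rw [val]

@[simp] lemma val_inr (z : ι → GCoch R) (r : R) (b : List (ι ⊕ R)) :
    val z (Sum.inr r :: b) = r * val z b := by rw [val]

lemma not_isLetter {i : ι} {A : List (ι ⊕ R)} (hA : i ∉ letters A) :
    ∀ s ∈ A, isLetter i s = false := by
  rintro (j | r) hs
  · simp only [isLetter, decide_eq_false_iff_not]
    rintro rfl
    exact hA (by simpa [letters] using hs)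
  · rfl

lemma splitOnP_seg {i : ι} {L : List (List (ι ⊕ R))} {v : List (ι ⊕ R)}
    (hL : ∀ A ∈ L, i ∉ letters A) (hv : i ∉ letters v) :
    (seg (Sum.inl i) L ++ v).splitOnP (isLetter i) = L ++ [v] := by
  induction L with
  | nil => simpa using List.splitOnP_eq_singleton (not_isLetter hv)
  | cons A L ih =>
    rw [seg_cons, List.append_assoc, List.cons_append,
      List.splitOnP_append_cons_of_forall_mem (not_isLetter (hL A (by simp))) _ (by simp [isLetter]),
      ih fun A hA => hL A (by simp [hA])]
    rfl

lemma exists_seg (i : ι) (b : List (ι ⊕ R)) : ∃ L v, b = seg (Sum.inl i) L ++ v ∧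
    (∀ A ∈ L, i ∉ letters A) ∧ i ∉ letters v := by
  induction b with
  | nil => exact ⟨[], [], by simp⟩
  | cons s b ih =>
    obtain ⟨L, v, rfl, hL, hv⟩ := ih
    by_cases hs : s = Sum.inl i
    · subst hs
      exact ⟨[] :: L, v, by simp, by simpa using hL, hv⟩
    · have hs' : ∀ A, i ∉ letters A → i ∉ letters (s :: A) := by
        rcases s with j | r
        · simp only [letters_inl, List.mem_cons, not_or]
          exact fun A hA => ⟨fun h => hs (h ▸ rfl), hA⟩
        · simp
      rcases L with _ | ⟨A, L⟩
      · exact ⟨[], s :: v, by simp, by simp, hs' _ hv⟩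
      · exact ⟨(s :: A) :: L, v, by simp, by
          simp only [List.mem_cons, forall_eq_or_imp] at hL ⊢
          exact ⟨hs' _ hL.1, hL.2⟩, hv⟩

lemma count_seg {i : ι} {L : List (List (ι ⊕ R))} (hL : ∀ A ∈ L, i ∉ letters A) :
    (letters (seg (Sum.inl i) L)).count i = L.length := by
  induction L with
  | nil => rfl
  | cons A L ih =>
    have := ih fun A hA => hL A (by simp [hA])
    simp [List.count_append, List.count_eq_zero.2 (hL A (by simp)), this]

/-- `val` looks for the remaining word at the index `(z i).1` of the list of pieces; it is there
exactly because the number of inner pieces is the degree of the cochain. -/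
lemma val_seg (z : ι → GCoch R) {i : ι} {L : List (List (ι ⊕ R))} {v : List (ι ⊕ R)}
    (hL : ∀ A ∈ L, i ∉ letters A) (hv : i ∉ letters v) (hlen : L.length = (z i).1) :
    val z (Sum.inl i :: (seg (Sum.inl i) L ++ v)) =
      app (z i) (fun t => val z (L.getD t [])) * val z v := by
  rw [val, splitOnP_seg hL hv]
  congr 1
  · refine congrArg (z i).2 (funext fun t => ?_)
    dsimp only
    rw [List.getD_append _ _ _ _ (by have := t.2; omega)]
  · rw [← hlen, List.getD_append_right _ _ _ _ le_rfl]
    simp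

lemma val_congr {z z' : ι → GCoch R} {b : List (ι ⊕ R)} (h : ∀ c ∈ letters b, z c = z' c) :
    val z b = val z' b := by
  induction hb : b.length using Nat.strong_induction_on generalizing b with
  | _ N ih =>
    subst hb
    rcases b with _ | ⟨i | r, b⟩
    · simp
    · obtain ⟨L, v, rfl, hL, hv⟩ := exists_seg i b
      rw [val, val, splitOnP_seg hL hv, ← h i (by simp)]
      have key : ∀ t, val z ((L ++ [v]).getD t []) = val z' ((L ++ [v]).getD t []) := by
        intro t
        have hlt : ((L ++ [v]).getD t []).length <
            (Sum.inl i :: (seg (Sum.inl i) L ++ v)).length := by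
          rw [← splitOnP_seg hL hv]
          exact Nat.lt_succ_of_le (splitOnP_getD_length_le _ _ _)
        refine ih _ hlt (fun c hc => h c ?_) rfl
        by_cases ht : t < (L ++ [v]).length
        · rw [List.getD_eq_getElem _ _ ht] at hc
          have hm := List.getElem_mem ht
          generalize (L ++ [v])[t] = A at hc hm
          rw [List.mem_append, List.mem_singleton] at hm
          rw [letters_inl, letters_append, List.mem_cons, List.mem_append]
          right
          rcases hm with hm | rfl
          · left
            obtain ⟨L1, L2, rfl⟩ := List.append_of_mem hm
            simp [hc]
          · exact Or.inr hc
        · rw [List.getD_eq_default _ _ (by omega)] at hc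
          simp at hc
      rw [key]
      congr 2
      exact funext key
    · rw [val_inr, val_inr, ih b.length (by simp) (fun c hc => h c (by simpa using hc)) rfl]

/-- The degrees of a family of cochains. -/
def deg (z : ι → GCoch R) (i : ι) : ℕ := (z i).1

/-- The piece `A` lies between two consecutive occurrences of `i`, so `Noncrossing.separated`
applies. -/
lemma seg_piece {i : ι} {L₁ L₂ : List (List (ι ⊕ R))} {A v : List (ι ⊕ R)}
    (h : Noncrossing (letters (Sum.inl i :: (seg (Sum.inl i) (L₁ ++ A :: L₂) ++ v))))
    (hA : i ∉ letters A) :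
    ∀ c ∈ letters A, c ∉ letters (seg (Sum.inl i) L₁) ∧
      c ∉ letters (Sum.inl i :: (seg (Sum.inl i) L₂ ++ v)) := by
  refine Noncrossing.separated (i := i) (by simpa using h) hA ?_ (Or.inr ⟨_, letters_inl _ _⟩)
  rw [letters_seg]
  exact seg_eq_nil_or _ _

lemma seg_rest {i : ι} {L : List (List (ι ⊕ R))} {v : List (ι ⊕ R)}
    (h : Noncrossing (letters (Sum.inl i :: (seg (Sum.inl i) L ++ v)))) (hv : i ∉ letters v) :
    ∀ c ∈ letters v, c ∉ letters (seg (Sum.inl i) L) := by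
  intro c hc
  refine (Noncrossing.separated (i := i) (v := []) (A := letters v)
    (u := letters (seg (Sum.inl i) L)) (by simpa using h) hv ?_ (Or.inl rfl) c hc).1
  rw [letters_seg]
  exact seg_eq_nil_or _ _

lemma Good.seg_piece {q : ι → ℕ} {i : ι} {L₁ L₂ : List (List (ι ⊕ R))} {A v : List (ι ⊕ R)}
    (h : Good q (letters (Sum.inl i :: (seg (Sum.inl i) (L₁ ++ A :: L₂) ++ v))))
    (hA : i ∉ letters A) : Good q (letters A) := by
  have hp := Hochschild.seg_piece h.nc hA
  refine Good.middle (u := i :: letters (seg (Sum.inl i) L₁))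
    (v := letters (Sum.inl i :: (seg (Sum.inl i) L₂ ++ v))) (by simpa using h) fun c hc => ?_
  refine ⟨?_, (hp c hc).2⟩
  rw [List.mem_cons, not_or]
  exact ⟨fun h => hA (h ▸ hc), (hp c hc).1⟩

lemma Good.seg_rest {q : ι → ℕ} {i : ι} {L : List (List (ι ⊕ R))} {v : List (ι ⊕ R)}
    (h : Good q (letters (Sum.inl i :: (seg (Sum.inl i) L ++ v)))) (hv : i ∉ letters v) :
    Good q (letters v) := by
  have hp := Hochschild.seg_rest h.nc hv
  refine Good.middle (u := i :: letters (seg (Sum.inl i) L)) (v := []) (by simpa using h)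
    fun c hc => ⟨?_, by simp⟩
  rw [List.mem_cons, not_or]
  exact ⟨fun h => hv (h ▸ hc), hp c hc⟩

lemma Good.seg_length {q : ι → ℕ} {i : ι} {L : List (List (ι ⊕ R))} {v : List (ι ⊕ R)}
    (h : Good q (letters (Sum.inl i :: (seg (Sum.inl i) L ++ v))))
    (hL : ∀ A ∈ L, i ∉ letters A) (hv : i ∉ letters v) : L.length = q i := by
  have := h.count_eq i (by simp)
  simpa [List.count_append, count_seg hL, List.count_eq_zero.2 hv] using this

/-- A closed prefix consists of whole segments: its first letter does not occur in `v`, so cutting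
at that letter only affects the prefix, and the claim passes to what follows the first segment. -/
lemma val_append {z : ι → GCoch R} {B v : List (ι ⊕ R)} (hB : Good (deg z) (letters B))
    (hv : ∀ c ∈ letters B, c ∉ letters v) : val z (B ++ v) = val z B * val z v := by
  induction hn : B.length using Nat.strong_induction_on generalizing B with
  | _ N ih =>
    subst hn
    rcases B with _ | ⟨i | r, B⟩
    · simp
    · obtain ⟨L, w, rfl, hL, hw⟩ := exists_seg i B
      have hlen := hB.seg_length hL hw
      rw [List.cons_append, List.append_assoc, val_seg z hL _ hlen, val_seg z hL hw hlen,
        mul_assoc, ih w.length (by simp) (hB.seg_rest hw) (fun c hc => hv c (by simp [hc]))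
          rfl]
      rw [letters_append, List.mem_append, not_or]
      exact ⟨hw, hv i (by simp)⟩
    · rw [List.cons_append, val_inr, val_inr, mul_assoc, ih B.length (by simp) (by simpa using hB)
        (fun c hc => hv c (by simpa using hc)) rfl]

lemma app_update (x : GCoch R) (P : ℕ → R) (t : Fin x.1) (s : R) :
    app x (Function.update P t s) = x.2.toLinearMap (fun i => P i) t s := by
  simp only [app, MultilinearMap.toLinearMap_apply]
  congr 1
  funext i
  by_cases h : i = t
  · subst h; simp
  · rw [Function.update_of_ne h, Function.update_of_ne (fun h' => h (Fin.ext h'))]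

/-- This isolates the one argument of a cochain in which a word is going to vary. -/
lemma getD_middle {z : ι → GCoch R} (L₁ L₂ : List (List (ι ⊕ R))) (A : List (ι ⊕ R)) :
    (fun t => val z ((L₁ ++ A :: L₂).getD t [])) =
      Function.update (fun t => val z ((L₁ ++ [] :: L₂).getD t [])) L₁.length (val z A) := by
  funext t
  rcases lt_trichotomy t L₁.length with h | h | h
  · rw [Function.update_of_ne h.ne, List.getD_append _ _ _ _ h, List.getD_append _ _ _ _ h]
  · subst h
    simp
  · rw [Function.update_of_ne h.ne', List.getD_append_right _ _ _ _ h.le,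
      List.getD_append_right _ _ _ _ h.le]
    obtain ⟨s, hs⟩ : ∃ s, t - L₁.length = s + 1 := ⟨t - L₁.length - 1, by omega⟩
    rw [hs]
    simp

/-- The value of a word depends additively on the value of a closed subword. -/
theorem exists_context (z : ι → GCoch R) {u v : List (ι ⊕ R)}
    (h : Good (deg z) (letters (u ++ v))) :
    ∃ φ : R →+ R, ∀ z' : ι → GCoch R, (∀ c ∈ letters (u ++ v), z' c = z c) →
      ∀ B : List (ι ⊕ R), Good (deg z') (letters B) →
        (∀ c ∈ letters B, c ∉ letters (u ++ v)) → val z' (u ++ B ++ v) = φ (val z' B) := by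
  -- One `φ` has to serve all `z'` that agree with `z` on the context, because later the cochain of
  -- a letter inside `B` changes, sometimes together with its degree.
  induction hn : u.length using Nat.strong_induction_on generalizing u v with
  | _ N ih =>
    subst hn
    rcases u with _ | ⟨i | r, u⟩
    · refine ⟨AddMonoidHom.mulRight (val z v), fun z' hz B hB hd => ?_⟩
      rw [List.nil_append, val_append hB (by simpa using hd), AddMonoidHom.mulRight_apply,
        val_congr (z := z') (z' := z) (b := v) (by simpa using hz)]
    · obtain ⟨L₁, r₁, rfl, hL₁, hr₁⟩ := exists_seg i u
      obtain ⟨L₂, r₂, rfl, hL₂, hr₂⟩ := exists_seg i v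
      -- If `i` does not occur in `v`, then `B` stands behind the last `i` and the segment of `i` is
      -- a left factor. Otherwise `B` belongs to the single piece `r₁ B A` between two occurrences
      -- of `i`, and the additivity of `z i` in the corresponding argument is used.
      rcases L₂ with _ | ⟨A, L₂⟩
      · have h' : Good (deg z)
            (letters (Sum.inl i :: (seg (Sum.inl i) L₁ ++ (r₁ ++ r₂)))) := by simpa using h
        have hr : i ∉ letters (r₁ ++ r₂) := by simp [hr₁, hr₂]
        have hlen := h'.seg_length hL₁ hr
        obtain ⟨φ, hφ⟩ := ih r₁.length (by simp) (u := r₁) (v := r₂)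
          (h'.seg_rest hr) rfl
        refine ⟨(AddMonoidHom.mulLeft (app (z i) fun t => val z (L₁.getD t []))).comp φ,
          fun z' hz B hB hd => ?_⟩
        have hzi : z' i = z i := hz i (by simp)
        have h1 : Sum.inl i :: (seg (Sum.inl i) L₁ ++ r₁) ++ B ++ (seg (Sum.inl i) [] ++ r₂) =
          Sum.inl i :: (seg (Sum.inl i) L₁ ++ (r₁ ++ B ++ r₂)) := by simp
        have hiB : i ∉ letters B := fun h => hd i h (by simp)
        rw [h1, val_seg z' hL₁ (by simp [hr₁, hr₂, hiB]) (by rw [hlen, hzi]; rfl),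
          hφ z' (fun c hc => hz c (by
            simp only [letters_append, List.mem_append, letters_inl, List.mem_cons, seg_nil,
              letters_nil] at hc ⊢
            tauto)) B hB (fun c hc hc' => hd c hc (by
            simp only [letters_append, List.mem_append, letters_inl, List.mem_cons, seg_nil,
              letters_nil] at hc' ⊢
            tauto))]
        rw [AddMonoidHom.comp_apply, AddMonoidHom.coe_mulLeft, hzi]
        congr 2
        funext t
        refine val_congr fun c hc => hz c ?_
        have : c ∈ letters (seg (Sum.inl i : ι ⊕ R) L₁) := by
          by_cases ht : t < L₁.length
          · rw [List.getD_eq_getElem _ _ ht] at hc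
            have hm := List.getElem_mem ht
            generalize L₁[t] = A at hc hm
            obtain ⟨L, L', rfl⟩ := List.append_of_mem hm
            simp [hc]
          · rw [List.getD_eq_default _ _ (by omega)] at hc
            simp at hc
        simp [this]
      · have h' : Good (deg z) (letters (Sum.inl i ::
            (seg (Sum.inl i) (L₁ ++ (r₁ ++ A) :: L₂) ++ r₂))) := by simpa using h
        have hA : i ∉ letters A := hL₂ A (by simp)
        have hr : i ∉ letters (r₁ ++ A) := by simp [hr₁, hA]
        have hall : ∀ X : List (ι ⊕ R), i ∉ letters X → ∀ A ∈ L₁ ++ X :: L₂, i ∉ letters A := by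
          intro X hX A' hA'
          simp only [List.mem_append, List.mem_cons] at hA'
          rcases hA' with h1 | rfl | h1
          · exact hL₁ _ h1
          · exact hX
          · exact hL₂ _ (by simp [h1])
        have hlen := h'.seg_length (hall _ hr) hr₂
        obtain ⟨φ, hφ⟩ := ih r₁.length (by simp) (u := r₁) (v := A)
          (h'.seg_piece hr) rfl
        have hlt : L₁.length < (z i).1 := by
          have : (L₁ ++ (r₁ ++ A) :: L₂).length = (z i).1 := hlen
          simp only [List.length_append, List.length_cons] at this
          omega
        refine ⟨(AddMonoidHom.mulRight (val z r₂)).comp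
          (((z i).2.toLinearMap (fun t => val z ((L₁ ++ [] :: L₂).getD t [])) ⟨L₁.length, hlt⟩
            ).toAddMonoidHom.comp φ), fun z' hz B hB hd => ?_⟩
        have hzi : z' i = z i := hz i (by simp)
        have h1 : Sum.inl i :: (seg (Sum.inl i) L₁ ++ r₁) ++ B ++
            (seg (Sum.inl i) (A :: L₂) ++ r₂) = Sum.inl i ::
              (seg (Sum.inl i) (L₁ ++ (r₁ ++ B ++ A) :: L₂) ++ r₂) := by simp
        have hiB : i ∉ letters B := fun h => hd i h (by simp)
        have hlen' : (L₁ ++ (r₁ ++ B ++ A) :: L₂).length = (z' i).1 := by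
          rw [hzi]
          have : (L₁ ++ (r₁ ++ A) :: L₂).length = (z i).1 := hlen
          simpa using this
        rw [h1, val_seg z' (hall _ (by simp [hr₁, hA, hiB])) hr₂ hlen', getD_middle,
          hφ z' (fun c hc => hz c (by
            simp only [letters_append, List.mem_append, letters_inl, List.mem_cons, seg_cons]
              at hc ⊢
            tauto)) B hB (fun c hc hc' => hd c hc (by
            simp only [letters_append, List.mem_append, letters_inl, List.mem_cons, seg_cons]
              at hc' ⊢
            tauto)), hzi]
        have h2 := app_update (z i) (fun t => val z' ((L₁ ++ [] :: L₂).getD t []))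
          ⟨L₁.length, hlt⟩ (φ (val z' B))
        rw [h2]
        have h3 : val z' r₂ = val z r₂ := val_congr fun c hc => hz c (by simp [hc])
        have h4 : (fun t => val z' ((L₁ ++ [] :: L₂).getD t [])) =
            fun t => val z ((L₁ ++ [] :: L₂).getD t []) := by
          funext t
          refine val_congr fun c hc => hz c ?_
          have : c ∈ letters (seg (Sum.inl i : ι ⊕ R) (L₁ ++ [] :: L₂)) := by
            by_cases ht : t < (L₁ ++ [] :: L₂).length
            · rw [List.getD_eq_getElem _ _ ht] at hc
              have hm := List.getElem_mem ht
              generalize (L₁ ++ [] :: L₂)[t] = X at hc hm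
              obtain ⟨L, L', hLL⟩ := List.append_of_mem hm
              rw [hLL]
              simp [hc]
            · rw [List.getD_eq_default _ _ (by omega)] at hc
              simp at hc
          simp only [letters_append, List.mem_append, letters_inl, List.mem_cons, seg_cons,
            seg_append, letters_nil, List.not_mem_nil] at this ⊢
          tauto
        rw [h3]
        simp only [AddMonoidHom.comp_apply, AddMonoidHom.mulRight_apply,
          LinearMap.toAddMonoidHom_coe]
        congr 3
        funext t
        exact congrFun h4 t
    · obtain ⟨φ, hφ⟩ := ih u.length (by simp) (u := u) (v := v) (by simpa using h) rfl
      refine ⟨(AddMonoidHom.mulLeft r).comp φ, fun z' hz B hB hd => ?_⟩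
      rw [List.cons_append, List.cons_append, val_inr, hφ z' (by simpa using hz) B hB
        (by simpa using hd)]
      rfl

end Hochschild

namespace Hochschild

open SeqOperad

variable {R : Type*} [Ring R] {ι : Type*} [DecidableEq ι]

/-! ## The dependence of the value of a word on one of its letters -/

lemma exists_first (i : ι) (b : List (ι ⊕ R)) : ∃ u L,
    b ++ [Sum.inl i] = u ++ Sum.inl i :: seg (Sum.inl i) L ∧ i ∉ letters u ∧
      ∀ A ∈ L, i ∉ letters A := by
  obtain ⟨L, v, rfl, hL, hv⟩ := exists_seg i b
  rcases L with _ | ⟨A, L⟩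
  · exact ⟨v, [], by simp, hv, by simp⟩
  · refine ⟨A, L ++ [v], by simp, hL A (by simp), fun B hB => ?_⟩
    rw [List.mem_append, List.mem_singleton] at hB
    rcases hB with hB | rfl
    · exact hL B (by simp [hB])
    · exact hv

lemma exists_segment (i : ι) (b : List (ι ⊕ R)) (hi : i ∈ letters b) : ∃ u L v,
    b = u ++ Sum.inl i :: seg (Sum.inl i) L ++ v ∧ i ∉ letters u ∧ (∀ A ∈ L, i ∉ letters A) ∧
      i ∉ letters v := by
  obtain ⟨L, v, rfl, hL, hv⟩ := exists_seg i b
  rcases L with _ | ⟨A, L⟩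
  · simp [hv] at hi
  · exact ⟨A, L, v, by simp, hL A (by simp), fun B hB => hL B (by simp [hB]), hv⟩

lemma mem_letters_seg {i c : ι} {L : List (List (ι ⊕ R))} (hci : c ≠ i)
    (hc : c ∈ letters (seg (Sum.inl i) L)) : ∃ L₁ A L₂, L = L₁ ++ A :: L₂ ∧ c ∈ letters A := by
  induction L with
  | nil => simp at hc
  | cons A L ih =>
    simp only [seg_cons, letters_append, letters_inl, List.mem_append, List.mem_cons] at hc
    rcases hc with hc | hc | hc
    · exact ⟨[], A, L, rfl, hc⟩
    · exact absurd hc hci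
    · obtain ⟨L₁, B, L₂, rfl, hB⟩ := ih hc
      exact ⟨A :: L₁, B, L₂, rfl, hB⟩

/-- A letter `c ≠ i` of the segment has an `i` on both sides. A further `c` in front would give `c i
c i`, a further `c` behind would give `i c i c`. -/
lemma segment_closed {i : ι} {u v : List (ι ⊕ R)} {L : List (List (ι ⊕ R))}
    (h : Noncrossing (letters (u ++ Sum.inl i :: seg (Sum.inl i) L ++ v)))
    (hu : i ∉ letters u) (hv : i ∉ letters v) :
    ∀ c ∈ letters (Sum.inl i :: seg (Sum.inl i) L), c ∉ letters u ∧ c ∉ letters v := by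
  intro c hc
  rw [letters_inl, List.mem_cons] at hc
  by_cases hci : c = i
  · subst hci
    exact ⟨hu, hv⟩
  obtain ⟨L₁, A, L₂, rfl, hA⟩ := mem_letters_seg hci (hc.resolve_left hci)
  have hsub : [i, c, i].Sublist
      (letters (Sum.inl i :: seg (Sum.inl i : ι ⊕ R) (L₁ ++ A :: L₂))) := by
    simp only [letters_inl, seg_append, seg_cons, letters_append]
    refine List.Sublist.cons_cons i ?_
    have h1 : [c].Sublist (letters A) := List.singleton_sublist.2 hA
    have h2 : [i].Sublist (i :: letters (seg (Sum.inl i : ι ⊕ R) L₂)) :=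
      List.singleton_sublist.2 (by simp)
    exact (h1.append h2).trans (List.sublist_append_right _ _)
  constructor <;> intro hc'
  · refine h c i hci ?_
    have h1 : [c].Sublist (letters u) := List.singleton_sublist.2 hc'
    rw [letters_append, letters_append]
    exact (h1.append hsub).trans (List.sublist_append_left _ _)
  · refine h i c (Ne.symm hci) ?_
    have h1 : [c].Sublist (letters v) := List.singleton_sublist.2 hc'
    rw [letters_append, letters_append, List.append_assoc]
    exact (hsub.append h1).trans (List.sublist_append_right _ _)

lemma not_mem_letters_getD {i : ι} {L : List (List (ι ⊕ R))} (hL : ∀ A ∈ L, i ∉ letters A) (t : ℕ) :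
    i ∉ letters (L.getD t []) := by
  by_cases ht : t < L.length
  · rw [List.getD_eq_getElem _ _ ht]
    exact hL _ (List.getElem_mem ht)
  · rw [List.getD_eq_default _ _ (by omega)]
    simp

lemma val_segment {z z' : ι → GCoch R} {i : ι} {L : List (List (ι ⊕ R))}
    (hz : ∀ c, c ≠ i → z' c = z c) (hL : ∀ A ∈ L, i ∉ letters A) (hlen : L.length = (z' i).1) :
    val z' (Sum.inl i :: seg (Sum.inl i) L) = app (z' i) fun t => val z (L.getD t []) := by
  have := val_seg z' (v := []) hL (by simp) hlen
  rw [List.append_nil, val_nil, mul_one] at this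
  rw [this]
  congr 1
  funext t
  exact val_congr fun c hc => hz c fun h => not_mem_letters_getD hL t (h ▸ hc)

/-- The degrees `q` may differ from those of `z` at `i`, since `i` does not occur outside its
segment. One `φ` therefore treats both the word with the cochain at `i` replaced and the words in
which an occurrence of `i` is deleted. -/
theorem exists_local_context {z : ι → GCoch R} {i : ι} {u v : List (ι ⊕ R)}
    {L : List (List (ι ⊕ R))} {q : ι → ℕ} (hq : ∀ c, c ≠ i → q c = deg z c)
    (h : Good q (letters (u ++ Sum.inl i :: seg (Sum.inl i) L ++ v)))
    (hu : i ∉ letters u) (hv : i ∉ letters v) :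
    ∃ φ : R →+ R, ∀ z' : ι → GCoch R, (∀ c, c ≠ i → z' c = z c) → ∀ B : List (ι ⊕ R),
      Good (deg z') (letters B) → letters B ⊆ letters (Sum.inl i :: seg (Sum.inl i) L) →
        val z' (u ++ B ++ v) = φ (val z' B) := by
  have hcl := segment_closed h.nc hu hv
  have hg : Good q (letters (u ++ v)) := by
    rw [letters_append]
    exact Good.outer (A := letters (Sum.inl i :: seg (Sum.inl i) L))
      (by simpa only [letters_append] using h) hcl
  have hne : ∀ c ∈ letters (u ++ v), c ≠ i := by
    rintro c hc rfl
    simp [hu, hv] at hc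
  obtain ⟨φ, hφ⟩ := exists_context z (u := u) (v := v) (hg.congr fun c hc => (hq c (hne c hc)).symm)
  refine ⟨φ, fun z' hz B hB hBs => hφ z' (fun c hc => hz c (hne c hc)) B hB fun c hc hc' => ?_⟩
  have := hcl c (hBs hc)
  simp only [letters_append, List.mem_append] at hc'
  tauto

/-- The value of a word is a linear function of the cochain that any of its letters stands for. -/
theorem exists_linear {z : ι → GCoch R} {i : ι} {b : List (ι ⊕ R)}
    (h : Good (deg z) (letters b)) (hi : i ∈ letters b) :
    ∃ (φ : R →+ R) (P : ℕ → R), ∀ z' : ι → GCoch R, (∀ c, c ≠ i → z' c = z c) →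
      (z' i).1 = (z i).1 → val z' b = φ (app (z' i) P) := by
  obtain ⟨u, L, v, rfl, hu, hL, hv⟩ := exists_segment i b hi
  have hcl := segment_closed h.nc hu hv
  obtain ⟨φ, hφ⟩ := exists_local_context (fun _ _ => rfl) h hu hv
  have hg : Good (deg z) (letters (Sum.inl i :: seg (Sum.inl i) L)) :=
    Good.middle (by simpa only [letters_append] using h) hcl
  have hlen : L.length = (z i).1 :=
    Good.seg_length (v := []) (by rw [List.append_nil]; exact hg) hL (by simp)
  refine ⟨φ, fun t => val z (L.getD t []), fun z' hz hzi => ?_⟩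
  rw [hφ z' hz _ (hg.congr fun c _ => ?_) (List.Subset.refl _), val_segment hz hL (hlen.trans hzi.symm)]
  by_cases hc : c = i
  · subst hc; exact hzi
  · exact congrArg Sigma.fst (hz c hc)

/-- The empty piece between the two letters has value 1, and `z i` is normalized. -/
theorem val_eq_zero_of_adjacent {z : ι → GCoch R} {i : ι} (hz : (z i).2 ∈ normalized R (z i).1)
    {b b' : List (ι ⊕ R)} (h : Good (deg z) (letters (b ++ Sum.inl i :: Sum.inl i :: b'))) :
    val z (b ++ Sum.inl i :: Sum.inl i :: b') = 0 := by
  obtain ⟨u, L₁, hb, hu, hL₁⟩ := exists_first i b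
  obtain ⟨L₂, v, rfl, hL₂, hv⟩ := exists_seg i b'
  have he : b ++ Sum.inl i :: Sum.inl i :: (seg (Sum.inl i) L₂ ++ v) =
      u ++ Sum.inl i :: seg (Sum.inl i) (L₁ ++ [] :: L₂) ++ v := by
    rw [List.append_cons, hb]
    simp
  have hL : ∀ A ∈ L₁ ++ [] :: L₂, i ∉ letters A := by
    intro A hA
    simp only [List.mem_append, List.mem_cons] at hA
    rcases hA with hA | rfl | hA
    · exact hL₁ A hA
    · simp
    · exact hL₂ A hA
  rw [he] at h ⊢
  have hcl := segment_closed h.nc hu hv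
  obtain ⟨φ, hφ⟩ := exists_local_context (fun _ _ => rfl) h hu hv
  have hg : Good (deg z) (letters (Sum.inl i :: seg (Sum.inl i) (L₁ ++ [] :: L₂))) :=
    Good.middle (by simpa only [letters_append] using h) hcl
  have hlen : (L₁ ++ [] :: L₂).length = (z i).1 :=
    Good.seg_length (v := []) (by rw [List.append_nil]; exact hg) hL (by simp)
  rw [hφ z (fun _ _ => rfl) _ hg (List.Subset.refl _), val_segment (fun _ _ => rfl) hL hlen]
  have : app (z i) (fun t => val z ((L₁ ++ [] :: L₂).getD t [])) = 0 := by
    refine hz _ ⟨L₁.length, by rw [← hlen]; simp⟩ ?_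
    simp
  rw [this, map_zero]

/-! ## The value of a word on the differential of a cochain -/

/-- If `F s` is the value of the word with the `s`-th occurrence of `i` deleted, then the
alternating sum of the `F s` is the value on the differential of the cochain that `i` stands for. -/
theorem val_diff {z z' : ι → GCoch R} {i : ι} (hz : ∀ c, c ≠ i → z' c = z c)
    (hzi : z' i = ⟨(z i).1 + 1, diff (z i).2⟩) {b : List (ι ⊕ R)}
    (h : Good (deg z') (letters b)) (hi : i ∈ letters b) (F : ℕ → R)
    (hF : ∀ b₁ b₂, b = b₁ ++ Sum.inl i :: b₂ → F ((letters b₁).count i) = val z (b₁ ++ b₂)) :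
    val z' b = ∑ s ∈ Finset.range ((z i).1 + 2), (-1 : ℤ) ^ s • F s := by
  obtain ⟨u, L, v, rfl, hu, hL, hv⟩ := exists_segment i b hi
  have hcl := segment_closed h.nc hu hv
  obtain ⟨φ, hφ⟩ := exists_local_context (z := z)
    (fun c hc => congrArg Sigma.fst (hz c hc)) h hu hv
  have hg : Good (deg z') (letters (Sum.inl i :: seg (Sum.inl i) L)) :=
    Good.middle (by simpa only [letters_append] using h) hcl
  have hlen : L.length = (z' i).1 :=
    Good.seg_length (v := []) (by rw [List.append_nil]; exact hg) hL (by simp)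
  have hlen' : L.length = (z i).1 + 1 := by rw [hlen, hzi]
  -- Deleting one `i` lowers its multiplicity from `deg z' i + 1` to `deg z i + 1`, so the shorter
  -- word is good for `z`.
  have hgood : ∀ B : List (ι ⊕ R), (letters B).Sublist (letters (Sum.inl i :: seg (Sum.inl i) L)) →
      (letters (Sum.inl i :: seg (Sum.inl i) L)).Perm (i :: letters B) →
      Good (deg z) (letters B) := by
    intro B hs hp
    refine ⟨hg.nc.sublist hs, fun c hc => ?_⟩
    have h1 := hg.count_eq c (hs.subset hc)
    rw [hp.count_eq, List.count_cons] at h1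
    by_cases hci : c = i
    · subst hci
      simp only [beq_self_eq_true, if_true, deg, hzi] at h1
      simp only [deg]
      omega
    · rw [if_neg (by simpa using Ne.symm hci), add_zero] at h1
      rw [h1, deg, hz c hci, deg]
  set P : ℕ → R := fun t => val z (L.getD t []) with hP
  have hval : val z' (u ++ Sum.inl i :: seg (Sum.inl i) L ++ v) =
      φ (diff (z i).2 fun t => P t) := by
    rw [hφ z' hz _ hg (List.Subset.refl _), val_segment hz hL hlen, hzi]
    rfl
  -- The three kinds of deletions give the three kinds of terms of the Hochschild differential:
  -- without the first `i` the first piece becomes a left factor, without an inner `i` two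
  -- neighbouring pieces merge and their values multiply, without the last `i` the last piece
  -- becomes a right factor.
  have h0 : F 0 = φ (P 0 * (z i).2 fun t => P (t + 1)) := by
    obtain ⟨A, L', rfl⟩ : ∃ A L', L = A :: L' := by
      rcases L with _ | ⟨A, L'⟩
      · simp at hlen'
      · exact ⟨A, L', rfl⟩
    have h1 := hF u (seg (Sum.inl i) (A :: L') ++ v) (by simp)
    rw [List.count_eq_zero.2 hu] at h1
    have hB : Good (deg z) (letters (seg (Sum.inl i) (A :: L'))) :=
      hgood _ (by simp) (by simp)
    rw [h1, ← List.append_assoc, hφ z (fun _ _ => rfl) _ hB (by simp), seg_cons]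
    congr 1
    have hgA : Good (deg z) (letters A) := by
      have h2 : Good (deg z') (letters A) :=
        Good.seg_piece (i := i) (L₁ := []) (A := A) (L₂ := L') (v := [])
          (by rw [List.append_nil]; exact hg) (hL A (by simp))
      exact h2.congr fun c hc => congrArg Sigma.fst (hz c fun h => hL A (by simp) (h ▸ hc)).symm
    rw [val_append hgA, val_segment (fun _ _ => rfl) (fun B hB => hL B (by simp [hB]))
      (by simpa using hlen')]
    · rfl
    · intro c hc
      exact (seg_piece (L₁ := []) (A := A) (L₂ := L') (v := [])
        (by rw [List.append_nil]; exact hg.nc) (hL A (by simp)) c hc).2 ∘ by simp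
  have hmid : ∀ t (ht : t < (z i).1), F (t + 1) = φ ((z i).2
      (Fin.contractNth (Fin.castSucc ⟨t, ht⟩) (· * ·) fun s => P s)) := by
    intro t ht
    obtain ⟨L₁, A, A', L₂, rfl, hL₁⟩ : ∃ L₁ A A' L₂, L = L₁ ++ A :: A' :: L₂ ∧ L₁.length = t := by
      refine ⟨L.take t, L[t], L[t + 1], L.drop (t + 2), ?_, by simp; omega⟩
      rw [List.getElem_cons_drop, List.getElem_cons_drop, List.take_append_drop]
    have h1 := hF (u ++ Sum.inl i :: seg (Sum.inl i) L₁ ++ A)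
      (seg (Sum.inl i) (A' :: L₂) ++ v) (by simp)
    have hA : i ∉ letters A := hL A (by simp)
    have hA' : i ∉ letters A' := hL A' (by simp)
    have hcount : (letters (u ++ Sum.inl i :: seg (Sum.inl i) L₁ ++ A)).count i = t + 1 := by
      have := count_seg (R := R) (i := i) (L := L₁) fun B hB => hL B (by simp [hB])
      simp [List.count_append, List.count_eq_zero.2 hu, this, hL₁, List.count_eq_zero.2 hA]
    rw [hcount] at h1
    have hB : Good (deg z) (letters (Sum.inl i :: seg (Sum.inl i) (L₁ ++ (A ++ A') :: L₂))) := by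
      refine hgood _ ?_ ?_
      · simp
      · simp only [letters_inl, seg_append, seg_cons, letters_append, List.append_assoc]
        refine List.Perm.cons i ?_
        rw [← List.append_assoc, ← List.append_assoc]
        refine List.perm_middle.trans (List.Perm.cons i ?_)
        simp
    have h2 : u ++ Sum.inl i :: seg (Sum.inl i) L₁ ++ A ++ (seg (Sum.inl i) (A' :: L₂) ++ v) =
        u ++ Sum.inl i :: seg (Sum.inl i) (L₁ ++ (A ++ A') :: L₂) ++ v := by simp
    have hLm : ∀ B ∈ L₁ ++ (A ++ A') :: L₂, i ∉ letters B := by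
      intro B hB
      simp only [List.mem_append, List.mem_cons] at hB
      rcases hB with hB | rfl | hB
      · exact hL B (by simp [hB])
      · simp [hA, hA']
      · exact hL B (by simp [hB])
    have hlm : (L₁ ++ (A ++ A') :: L₂).length = (z i).1 := by
      simp only [List.length_append, List.length_cons] at hlen' ⊢
      omega
    rw [h1, h2, hφ z (fun _ _ => rfl) _ hB (by
      intro c
      simp only [letters_inl, seg_append, seg_cons, letters_append, List.mem_cons,
        List.mem_append]
      tauto), val_segment (fun _ _ => rfl) hLm hlm]
    refine congrArg φ (congrArg (z i).2 (funext fun s => ?_))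
    dsimp only
    have hgA : Good (deg z) (letters A) := by
      have h2 : Good (deg z') (letters A) :=
        Good.seg_piece (i := i) (L₁ := L₁) (A := A) (L₂ := A' :: L₂) (v := [])
          (by rw [List.append_nil]; exact hg) hA
      exact h2.congr fun c hc => congrArg Sigma.fst (hz c fun h => hA (h ▸ hc)).symm
    have hAA : val z (A ++ A') = val z A * val z A' := by
      refine val_append hgA fun c hc hc' => ?_
      refine (seg_piece (L₁ := L₁) (A := A) (L₂ := A' :: L₂) (v := [])
        (by rw [List.append_nil]; exact hg.nc) hA c hc).2 ?_
      simp [hc']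
    rcases lt_trichotomy (s : ℕ) t with h | h | h
    · rw [Fin.contractNth_apply_of_lt _ _ _ _ (by simpa using h)]
      simp only [hP, Fin.val_castSucc]
      rw [List.getD_append _ _ _ _ (by omega), List.getD_append _ _ _ _ (by omega)]
    · rw [Fin.contractNth_apply_of_eq _ _ _ _ (by simpa using h)]
      simp only [hP, Fin.val_castSucc, Fin.val_succ]
      rw [List.getD_append_right _ _ _ _ (by omega), List.getD_append_right _ _ _ _ (by omega),
        List.getD_append_right _ _ _ _ (by omega)]
      simp [h, hL₁, hAA]
    · rw [Fin.contractNth_apply_of_gt _ _ _ _ (by simpa using h)]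
      simp only [hP, Fin.val_succ]
      rw [List.getD_append_right _ _ _ _ (by omega), List.getD_append_right _ _ _ _ (by omega)]
      obtain ⟨s', hs'⟩ : ∃ s', (s : ℕ) - L₁.length = s' + 1 := ⟨s - L₁.length - 1, by omega⟩
      rw [hs', show (s : ℕ) + 1 - L₁.length = s' + 2 by omega]
      simp
  have hlast : F ((z i).1 + 1) = φ (((z i).2 fun t => P t) * P (z i).1) := by
    obtain ⟨L₁, A, rfl⟩ : ∃ L₁ A, L = L₁ ++ [A] := by
      rcases List.eq_nil_or_concat L with rfl | ⟨L₁, A, rfl⟩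
      · simp at hlen'
      · exact ⟨L₁, A, by simp⟩
    have hL₁ : L₁.length = (z i).1 := by simpa using hlen'
    have h1 := hF (u ++ Sum.inl i :: seg (Sum.inl i) L₁ ++ A) v (by simp)
    have hA : i ∉ letters A := hL A (by simp)
    have hcount : (letters (u ++ Sum.inl i :: seg (Sum.inl i) L₁ ++ A)).count i = (z i).1 + 1 := by
      have := count_seg (R := R) (i := i) (L := L₁) fun B hB => hL B (by simp [hB])
      simp [List.count_append, List.count_eq_zero.2 hu, this, hL₁, List.count_eq_zero.2 hA]
    rw [hcount] at h1
    have hB : Good (deg z) (letters (Sum.inl i :: (seg (Sum.inl i) L₁ ++ A))) := by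
      refine hgood _ (by simp) ?_
      simp only [letters_inl, seg_append, seg_cons, letters_append, seg_nil, letters_nil]
      refine List.Perm.cons i ?_
      rw [← List.append_assoc]
      exact List.perm_append_comm
    have h2 : u ++ Sum.inl i :: seg (Sum.inl i) L₁ ++ A ++ v =
        u ++ Sum.inl i :: (seg (Sum.inl i) L₁ ++ A) ++ v := by simp
    rw [h1, h2, hφ z (fun _ _ => rfl) _ hB (by
      intro c
      simp only [letters_inl, seg_append, seg_cons, letters_append, List.mem_cons,
        List.mem_append]
      tauto), val_seg z (fun B hB => hL B (by simp [hB])) hA hL₁]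
    congr 2
    · refine congrArg (z i).2 (funext fun t => ?_)
      simp only [hP]
      rw [List.getD_append _ _ _ _ (by have := t.2; omega)]
    · simp [hP, ← hL₁]
  rw [hval, diff_apply, Finset.sum_range_succ, Finset.sum_range_succ', Finset.sum_range, hlast, h0]
  simp only [map_add, map_zsmul, map_sum]
  rw [pow_zero, one_smul, add_comm (φ _) (∑ _, _)]
  congr 1
  congr 1
  exact Finset.sum_congr rfl fun t _ => by rw [hmid t t.2]

/-! ## Relabelling and substitution -/

lemma letters_map {κ : Type*} (lab : κ → ι) (b : List (κ ⊕ R)) :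
    letters (b.map (Sum.map lab id)) = (letters b).map lab := by
  induction b with
  | nil => rfl
  | cons s b ih => rcases s with k | r <;> simp [ih]

lemma map_seg {α β : Type*} (φ : α → β) (a : α) (L : List (List α)) :
    (seg a L).map φ = seg (φ a) (L.map (List.map φ)) := by
  induction L with
  | nil => rfl
  | cons A L ih => simp [ih]

lemma val_map {κ : Type*} [DecidableEq κ] {lab : κ → ι} (hlab : Function.Injective lab)
    (z : ι → GCoch R) (b : List (κ ⊕ R)) :
    val z (b.map (Sum.map lab id)) = val (fun c => z (lab c)) b := by
  induction hb : b.length using Nat.strong_induction_on generalizing b with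
  | _ N ih =>
    subst hb
    rcases b with _ | ⟨i | r, b⟩
    · simp
    · obtain ⟨L, v, rfl, hL, hv⟩ := exists_seg i b
      have hni : ∀ A : List (κ ⊕ R), i ∉ letters A → lab i ∉ letters (A.map (Sum.map lab id)) := by
        intro A hA
        rw [letters_map, List.mem_map_of_injective hlab]
        exact hA
      rw [List.map_cons, List.map_append, map_seg, Sum.map_inl, val, val, splitOnP_seg hL hv,
        splitOnP_seg (fun A hA => ?_) (hni v hv)]
      · have key : ∀ t, val z ((L.map (List.map (Sum.map lab id)) ++
            [v.map (Sum.map lab id)]).getD t []) =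
            val (fun c => z (lab c)) ((L ++ [v]).getD t []) := by
          intro t
          have hlt : ((L ++ [v]).getD t []).length <
              (Sum.inl i :: (seg (Sum.inl i) L ++ v)).length := by
            rw [← splitOnP_seg hL hv]
            exact Nat.lt_succ_of_le (splitOnP_getD_length_le _ _ _)
          rw [← ih _ hlt _ rfl]
          congr 1
          have : L.map (List.map (Sum.map lab id)) ++ [v.map (Sum.map lab id)] =
            (L ++ [v]).map (List.map (Sum.map lab id)) := by simp
          rw [this]
          exact List.getD_map (d := []) (f := List.map (Sum.map lab id)) (n := t) (l := L ++ [v])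
        rw [key]
        congr 2
        exact funext key
      · obtain ⟨B, hB, rfl⟩ := List.mem_map.1 hA
        exact hni B (hL B hB)
    · rw [List.map_cons, Sum.map_inr, val_inr, val_inr, ih b.length (by simp) b rfl]
      rfl

/-- The words `P_1, P_2, …`, each preceded by the next entry of the sequence `r`. -/
def weave {α : Type*} (r : ℕ → R) : ℕ → List (List (α ⊕ R)) → List (α ⊕ R)
  | _, [] => []
  | s, P :: Ps => Sum.inr (r s) :: P ++ weave r (s + 1) Ps

lemma letters_flatMap {α β : Type*} (F : β → List (α ⊕ R)) (l : List β) :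
    letters (l.flatMap F) = l.flatMap fun x => letters (F x) := by
  induction l with
  | nil => rfl
  | cons x l ih => simp [ih]

/-- The ring entries are exchanged for the closed words `p.1` one at a time, from the left. An entry
and the word that replaces it have the same value, and by `exists_context` only this value matters.
-/
lemma val_weave (z : ι → GCoch R) (qs : List (List (ι ⊕ R) × List (ι ⊕ R))) (u : List (ι ⊕ R))
    (h : Good (deg z) (letters (u ++ qs.flatMap fun p => p.1 ++ p.2)))
    (hcl : ∀ L₁ p L₂, qs = L₁ ++ p :: L₂ → ∀ c ∈ letters p.1,
      c ∉ letters (u ++ L₁.flatMap fun p => p.1 ++ p.2) ∧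
      c ∉ letters (p.2 ++ L₂.flatMap fun p => p.1 ++ p.2)) (r : ℕ → R) (s : ℕ)
    (hr : ∀ t, t < qs.length → r (s + t) = val z ((qs.map Prod.fst).getD t [])) :
    val z (u ++ weave r s (qs.map Prod.snd)) = val z (u ++ qs.flatMap fun p => p.1 ++ p.2) := by
  induction qs generalizing u s with
  | nil => rfl
  | cons p qs ih =>
    obtain ⟨A, P⟩ := p
    have hA := hcl [] (A, P) qs rfl
    simp only [List.flatMap_nil, List.append_nil] at hA
    have hgA : Good (deg z) (letters A) :=
      Good.middle (u := letters u) (v := letters (P ++ qs.flatMap fun p => p.1 ++ p.2))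
        (by simpa using h) hA
    have hout : Good (deg z) (letters (u ++ (P ++ qs.flatMap fun p => p.1 ++ p.2))) := by
      rw [letters_append]
      exact Good.outer (A := letters A) (by simpa using h) hA
    have hr0 : r s = val z A := by simpa using hr 0 (by simp)
    have h1 := ih (u ++ (Sum.inr (r s) :: P)) (by simpa using hout) (fun L₁ p L₂ hq c hc => by
      have := hcl ((A, P) :: L₁) p L₂ (by rw [hq]; rfl) c hc
      refine ⟨fun h' => this.1 ?_, this.2⟩
      simp only [letters_append, letters_inr, List.flatMap_cons, List.mem_append] at h' ⊢
      tauto) (s + 1) (fun t ht => by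
        have := hr (t + 1) (by simpa using ht)
        rw [add_assoc, add_comm 1 t, this]
        simp)
    obtain ⟨φ, hφ⟩ := exists_context z hout
    have h2 := hφ z (fun _ _ => rfl) [Sum.inr (r s)] (Good.nil _) (by simp)
    have h3 := hφ z (fun _ _ => rfl) A hgA (fun c hc hc' => by
      have := hA c hc
      simp only [letters_append, List.mem_append] at hc' this
      tauto)
    simp only [List.map_cons, weave, List.flatMap_cons]
    have e1 : u ++ (Sum.inr (r s) :: P ++ weave r (s + 1) (qs.map Prod.snd)) =
      u ++ Sum.inr (r s) :: P ++ weave r (s + 1) (qs.map Prod.snd) := by simp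
    have e2 : u ++ Sum.inr (r s) :: P ++ (qs.flatMap fun p => p.1 ++ p.2) =
      u ++ [Sum.inr (r s)] ++ (P ++ qs.flatMap fun p => p.1 ++ p.2) := by simp
    have e3 : u ++ (A ++ P ++ qs.flatMap fun p => p.1 ++ p.2) =
      u ++ A ++ (P ++ qs.flatMap fun p => p.1 ++ p.2) := by simp
    rw [e1, h1, e2, h2, e3, h3, val_inr, val_nil, mul_one, hr0]

/-- The substitution of words for the letters of a word. -/
def subst {κ α : Type*} (part : κ → List (α ⊕ R)) (b : List (κ ⊕ R)) : List (α ⊕ R) :=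
  b.flatMap (Sum.elim part fun r => [Sum.inr r])

@[simp] lemma subst_append {κ α : Type*} (part : κ → List (α ⊕ R)) (b b' : List (κ ⊕ R)) :
    subst part (b ++ b') = subst part b ++ subst part b' := by simp [subst]

@[simp] lemma subst_inl {κ α : Type*} (part : κ → List (α ⊕ R)) (k : κ) (b : List (κ ⊕ R)) :
    subst part (Sum.inl k :: b) = part k ++ subst part b := by simp [subst]

@[simp] lemma subst_inr {κ α : Type*} (part : κ → List (α ⊕ R)) (r : R) (b : List (κ ⊕ R)) :
    subst part (Sum.inr r :: b) = Sum.inr r :: subst part b := by simp [subst]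

/-- The analogue of `exists_seg` when the separators may be different letters with the same label.
-/
lemma exists_seg_label {κ : Type*} (lab : κ → ι) (i : ι) (b : List (κ ⊕ R)) :
    ∃ (ps : List (List (κ ⊕ R) × κ)) (v : List (κ ⊕ R)),
      b = (ps.flatMap fun p => p.1 ++ [Sum.inl p.2]) ++ v ∧
      (∀ p ∈ ps, lab p.2 = i ∧ ∀ k ∈ letters p.1, lab k ≠ i) ∧ ∀ k ∈ letters v, lab k ≠ i := by
  induction b with
  | nil => exact ⟨[], [], by simp⟩
  | cons s b ih =>
    obtain ⟨ps, v, rfl, hps, hv⟩ := ih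
    by_cases hs : ∃ k, s = Sum.inl k ∧ lab k = i
    · obtain ⟨k, rfl, hk⟩ := hs
      refine ⟨([], k) :: ps, v, by simp, ?_, hv⟩
      intro p hp
      rcases List.mem_cons.1 hp with rfl | hp
      · exact ⟨hk, by simp⟩
      · exact hps p hp
    · have hs' : ∀ A : List (κ ⊕ R), (∀ k ∈ letters A, lab k ≠ i) →
          ∀ k ∈ letters (s :: A), lab k ≠ i := by
        rcases s with j | r
        · simp only [letters_inl, List.mem_cons, forall_eq_or_imp]
          exact fun A hA => ⟨fun h => hs ⟨j, rfl, h⟩, hA⟩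
        · simp
      rcases ps with _ | ⟨⟨A, k⟩, ps⟩
      · exact ⟨[], s :: v, by simp, by simp, hs' _ hv⟩
      · refine ⟨(s :: A, k) :: ps, v, by simp, ?_, hv⟩
        simp only [List.mem_cons, forall_eq_or_imp] at hps ⊢
        exact ⟨⟨hps.1.1, hs' _ hps.1.2⟩, hps.2⟩

lemma mem_letters_subst {κ α : Type*} {part : κ → List (α ⊕ R)} {b : List (κ ⊕ R)} {c : α} :
    c ∈ letters (subst part b) ↔ ∃ k ∈ letters b, c ∈ letters (part k) := by
  induction b with
  | nil => simp [subst]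
  | cons s b ih => rcases s with k | r <;> simp [ih]

end Hochschild

namespace Hochschild

open SeqOperad

variable {R : Type*} [Ring R] {ι : Type*} [DecidableEq ι]

/-! ### The substitution theorem for values of words. -/

lemma subst_labelled {κ α : Type*} (part : κ → List (α ⊕ R)) (ps : List (List (κ ⊕ R) × κ)) :
    subst part (ps.flatMap fun p => p.1 ++ [Sum.inl p.2]) =
      (ps.map fun p => (subst part p.1, part p.2)).flatMap fun p => p.1 ++ p.2 := by
  induction ps with
  | nil => rfl
  | cons p ps ih =>
    rw [List.flatMap_cons, subst_append, ih, List.map_cons, List.flatMap_cons, subst_append]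
    simp [subst]

/-- The value of a word on cochains that are themselves values of words is the value of the word
obtained by substitution. -/
theorem val_subst {κ ι' : Type*} [DecidableEq ι'] (lab : κ → ι) (part : κ → List (ι' ⊕ R))
    (own : ι' → ι) (hown : ∀ k, ∀ c ∈ letters (part k), own c = lab k)
    (y : ι → GCoch R) (z : ι' → GCoch R) (b : List (κ ⊕ R))
    (hb : Good (deg y) (letters (b.map (Sum.map lab id))))
    (hs : Good (deg z) (letters (subst part b)))
    (hy : ∀ i k ks, (letters b).filter (fun k => lab k = i) = k :: ks → ∀ r : ℕ → R,
      app (y i) r = val z (part k ++ weave r 0 (ks.map part))) :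
    val y (b.map (Sum.map lab id)) = val z (subst part b) := by
  -- The word is cut at the letters with the label of its first letter. By `hy`, the cochain of this
  -- label unfolds into the parts of these letters, with ring entries in between. These entries are
  -- the values of the pieces, hence by induction the values of the substituted pieces, and
  -- `val_weave` puts the latter in place of the entries.
  induction hn : b.length using Nat.strong_induction_on generalizing b with
  | _ N ih =>
    subst hn
    rcases b with _ | ⟨k | r, b⟩
    · simp [subst]
    · obtain ⟨ps, v, rfl, hps, hv⟩ := exists_seg_label lab (lab k) b
      have hfil : ∀ A : List (κ ⊕ R), (∀ k' ∈ letters A, lab k' ≠ lab k) →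
          (letters A).filter (fun k' => lab k' = lab k) = [] := by
        intro A hA
        rw [List.filter_eq_nil_iff]
        simpa using hA
      have hnotin : ∀ A : List (κ ⊕ R), (∀ k' ∈ letters A, lab k' ≠ lab k) →
          lab k ∉ letters (A.map (Sum.map lab id)) := by
        intro A hA hk
        rw [letters_map, List.mem_map] at hk
        obtain ⟨k', hk', he⟩ := hk
        exact hA k' hk' he
      have hmap : ((ps.flatMap fun p : List (κ ⊕ R) × κ => p.1 ++ [Sum.inl p.2]) ++ v).map
          (Sum.map lab (id : R → R)) = seg (Sum.inl (lab k)) (ps.map fun p => p.1.map (Sum.map lab id)) ++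
            v.map (Sum.map lab id) := by
        rw [List.map_append]
        congr 1
        clear hb hs hy ih
        induction ps with
        | nil => rfl
        | cons p ps ih =>
          have := ih fun p hp => hps p (by simp [hp])
          have hp := (hps p (by simp)).1
          simp only [List.flatMap_cons, List.map_append, List.map_cons, List.map_nil, seg_cons,
            Sum.map_inl, hp, this]
          simp
      have hL : ∀ A ∈ ps.map fun p => p.1.map (Sum.map lab id),
          lab k ∉ letters (A : List (ι ⊕ R)) := by
        intro A hA
        obtain ⟨p, hp, rfl⟩ := List.mem_map.1 hA
        exact hnotin _ (hps p hp).2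
      rw [List.map_cons, Sum.map_inl, hmap] at hb ⊢
      have hlen := hb.seg_length hL (hnotin v hv)
      -- the closed pieces
      have hsep : ∀ L₁ p L₂, ps = L₁ ++ p :: L₂ → ∀ k' ∈ letters p.1, ∀ k'',
          (k'' ∈ letters (Sum.inl k :: L₁.flatMap fun p => p.1 ++ [Sum.inl p.2]) ∨
            k'' ∈ letters (Sum.inl p.2 :: ((L₂.flatMap fun p => p.1 ++ [Sum.inl p.2]) ++ v))) →
          lab k' ≠ lab k'' := by
        intro L₁ p L₂ hp k' hk' k'' hk'' he
        have hpi := hps p (by rw [hp]; simp)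
        have hb' := hb.nc
        have e1 : (ps.map fun p => p.1.map (Sum.map lab id)) =
          (L₁.map fun p => p.1.map (Sum.map lab id)) ++ p.1.map (Sum.map lab (id : R → R)) ::
            L₂.map fun p => p.1.map (Sum.map lab id) := by rw [hp]; simp
        rw [e1] at hb'
        have hlk : lab k' ∈ letters (p.1.map (Sum.map lab (id : R → R))) := by
          rw [letters_map]; exact List.mem_map_of_mem hk'
        have := seg_piece hb' (hnotin _ hpi.2) _ hlk
        have hne := hpi.2 k' hk'
        have hsegmap : ∀ L : List (List (κ ⊕ R) × κ), (∀ p ∈ L, lab p.2 = lab k) →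
            letters (seg (Sum.inl (lab k)) (L.map fun p => p.1.map (Sum.map lab (id : R → R)))) =
            (letters (L.flatMap fun p => p.1 ++ [Sum.inl p.2])).map lab := by
          intro L hL
          induction L with
          | nil => rfl
          | cons p L ih =>
            have h1 := ih fun p hp => hL p (by simp [hp])
            have h2 := hL p (by simp)
            simp only [List.map_cons, seg_cons, letters_append, letters_inl, h1,
              List.flatMap_cons, letters_map, List.map_append, h2, letters_nil, List.map_nil]
            simp
        rw [letters_inl, letters_append, hsegmap _ (fun p' hp' => (hps p' (by rw [hp]; simp [hp'])).1),
          hsegmap _ (fun p' hp' => (hps p' (by rw [hp]; simp [hp'])).1), letters_map] at this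
        rcases hk'' with h | h
        · rw [letters_inl, List.mem_cons] at h
          rcases h with rfl | h
          · exact hne he
          · exact this.1 (he ▸ List.mem_map_of_mem h)
        · rw [letters_inl, List.mem_cons, letters_append, List.mem_append] at h
          rcases h with rfl | h | h
          · exact hne (he.trans hpi.1)
          · refine this.2 ?_
            simp [he, List.mem_map_of_mem (f := lab) h]
          · refine this.2 ?_
            simp [he, List.mem_map_of_mem (f := lab) h]
      have hsepv : ∀ k' ∈ letters v, ∀ k'' ∈ letters (Sum.inl k ::
          ps.flatMap fun p => p.1 ++ [Sum.inl p.2]), lab k' ≠ lab k'' := by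
        intro k' hk' k'' hk'' he
        have hlk : lab k' ∈ letters (v.map (Sum.map lab (id : R → R))) := by
          rw [letters_map]; exact List.mem_map_of_mem hk'
        have h1 := seg_rest hb.nc (hnotin v hv) _ hlk
        rw [letters_inl, List.mem_cons] at hk''
        rcases hk'' with rfl | h
        · exact hv k' hk' he
        · refine h1 ?_
          rw [he]
          rw [letters_flatMap, List.mem_flatMap] at h
          obtain ⟨p, hp, hk''⟩ := h
          rw [letters_append, List.mem_append] at hk''
          rcases hk'' with h | h
          · rw [letters_seg, List.map_map]
            obtain ⟨l1, l2, rfl⟩ := List.append_of_mem hp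
            simp only [List.map_append, List.map_cons, seg_append, seg_cons, List.mem_append]
            right; left
            simp only [Function.comp, letters_map]
            exact List.mem_map_of_mem h
          · simp only [letters_inl, letters_nil, List.mem_singleton] at h
            exact absurd (he.trans (h ▸ (hps p hp).1)) (hv k' hk')
      -- `own` recovers the label from a letter of a part, so words with disjoint labels have
      -- disjoint letters after substitution.
      have hcl : ∀ A B : List (κ ⊕ R), (∀ k' ∈ letters A, ∀ k'' ∈ letters B, lab k' ≠ lab k'') →
          ∀ c ∈ letters (subst part A), c ∉ letters (subst part B) := by
        intro A B hAB c hc hc'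
        obtain ⟨k', hk', h1⟩ := mem_letters_subst.1 hc
        obtain ⟨k'', hk'', h2⟩ := mem_letters_subst.1 hc'
        exact hAB k' hk' k'' hk'' ((hown k' c h1).symm.trans (hown k'' c h2))
      -- the values of the pieces
      have hpiece : ∀ L₁ p L₂, ps = L₁ ++ p :: L₂ →
          val y (p.1.map (Sum.map lab id)) = val z (subst part p.1) := by
        intro L₁ p L₂ hp
        have hpi := hps p (by rw [hp]; simp)
        have hsp := hsep L₁ p L₂ hp
        have hdec : Sum.inl k :: ((ps.flatMap fun p => p.1 ++ [Sum.inl p.2]) ++ v) =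
            (Sum.inl k :: L₁.flatMap fun p => p.1 ++ [Sum.inl p.2]) ++ p.1 ++
              (Sum.inl p.2 :: ((L₂.flatMap fun p => p.1 ++ [Sum.inl p.2]) ++ v)) := by
          rw [hp]; simp
        refine ih p.1.length ?_ p.1 ?_ ?_ ?_ rfl
        · rw [hdec]
          simp only [List.length_append, List.length_cons]
          omega
        · have e1 : (ps.map fun p => p.1.map (Sum.map lab id)) =
            (L₁.map fun p => p.1.map (Sum.map lab id)) ++ p.1.map (Sum.map lab (id : R → R)) ::
              L₂.map fun p => p.1.map (Sum.map lab id) := by rw [hp]; simp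
          rw [e1] at hb
          exact hb.seg_piece (hnotin _ hpi.2)
        · rw [hdec] at hs
          rw [subst_append, subst_append, letters_append, letters_append] at hs
          refine hs.middle fun c hc => ⟨?_, ?_⟩
          · exact hcl _ _ (fun k' hk' k'' hk'' => hsp k' hk' k'' (Or.inl hk'')) c hc
          · exact hcl _ _ (fun k' hk' k'' hk'' => hsp k' hk' k'' (Or.inr hk'')) c hc
        · intro i k' ks hk'
          refine hy i k' ks ?_
          have hk'mem : k' ∈ letters p.1 ∧ lab k' = i := by
            have : k' ∈ (letters p.1).filter (fun k => lab k = i) := by rw [hk']; simp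
            simpa using this
          rw [hdec, letters_append, letters_append, List.filter_append, List.filter_append, hk',
            List.filter_eq_nil_iff.2, List.filter_eq_nil_iff.2]
          · simp
          · intro k'' hk''
            have := hsp k' hk'mem.1 k'' (Or.inr hk'')
            rw [hk'mem.2] at this
            simpa using this.symm
          · intro k'' hk''
            have := hsp k' hk'mem.1 k'' (Or.inl hk'')
            rw [hk'mem.2] at this
            simpa using this.symm
      have hrest : val y (v.map (Sum.map lab id)) = val z (subst part v) := by
        refine ih v.length ?_ v (hb.seg_rest (hnotin v hv)) ?_ ?_ rfl
        · simp only [List.length_append, List.length_cons]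
          omega
        · have hdec : Sum.inl k :: ((ps.flatMap fun p => p.1 ++ [Sum.inl p.2]) ++ v) =
              (Sum.inl k :: ps.flatMap fun p => p.1 ++ [Sum.inl p.2]) ++ v ++ [] := by simp
          rw [hdec, subst_append, subst_append, letters_append, letters_append] at hs
          exact hs.middle fun c hc => ⟨hcl _ _ hsepv c hc, by simp [subst]⟩
        · intro i k' ks hk'
          refine hy i k' ks ?_
          have hk'mem : k' ∈ letters v ∧ lab k' = i := by
            have : k' ∈ (letters v).filter (fun k => lab k = i) := by rw [hk']; simp
            simpa using this
          have hdec : Sum.inl k :: ((ps.flatMap fun p => p.1 ++ [Sum.inl p.2]) ++ v) =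
              (Sum.inl k :: ps.flatMap fun p => p.1 ++ [Sum.inl p.2]) ++ v := by simp
          rw [hdec, letters_append, List.filter_append, hk', List.filter_eq_nil_iff.2]
          · simp
          · intro k'' hk''
            have := hsepv k' hk'mem.1 k'' hk''
            rw [hk'mem.2] at this
            simpa using this.symm
      -- the letters with the first label
      have hfilk : (letters (Sum.inl k :: ((ps.flatMap fun p => p.1 ++ [Sum.inl p.2]) ++ v))).filter
          (fun k' => lab k' = lab k) = k :: ps.map Prod.snd := by
        rw [letters_inl, List.filter_cons_of_pos (by simp), letters_append, List.filter_append,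
          hfil v hv, List.append_nil]
        congr 1
        clear hb hs hy ih hmap hL hlen hsep hsepv hcl hpiece hrest
        induction ps with
        | nil => rfl
        | cons p ps ih =>
          have := ih fun p hp => hps p (by simp [hp])
          have hp := hps p (by simp)
          rw [List.flatMap_cons, letters_append, List.filter_append, this, letters_append,
            List.filter_append, hfil _ hp.2]
          simp [hp.1]
      have hyk := hy (lab k) k _ hfilk
      have hsubps := subst_labelled part ps
      rw [val_seg y hL (hnotin v hv) hlen, hyk, hrest, subst_inl, subst_append, hsubps,
        ← List.append_assoc]
      have hs' : Good (deg z) (letters (part k ++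
          ((ps.map fun p => (subst part p.1, part p.2)).flatMap fun p => p.1 ++ p.2))) := by
        rw [subst_inl, subst_append, hsubps, ← List.append_assoc, letters_append] at hs
        refine Good.middle (u := []) hs fun c hc => ⟨by simp, fun hc' => ?_⟩
        refine hcl _ _ hsepv c hc' ?_
        rw [subst_inl, hsubps]
        exact hc
      rw [val_append hs']
      · congr 1
        have := val_weave z (ps.map fun p => (subst part p.1, part p.2)) (part k) hs' ?_
          (fun t => val y ((ps.map fun p => p.1.map (Sum.map lab id)).getD t [])) 0 ?_
        · rw [← this]
          simp [List.map_map, Function.comp_def]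
        · intro L₁ q L₂ hq c hc
          obtain ⟨M₁, M₂', hM, h1, h2⟩ := List.map_eq_append_iff.1 hq
          obtain ⟨p, M₂, hM', h3, h4⟩ := List.map_eq_cons_iff.1 h2
          have hsp := hsep M₁ p M₂ (by rw [hM, hM'])
          subst h1 h3 h4
          rw [← subst_labelled part M₁, ← subst_labelled part M₂]
          constructor
          · have := hcl _ _ (fun k' hk' k'' hk'' => hsp k' hk' k'' (Or.inl hk'')) c hc
            rwa [subst_inl] at this
          · have := hcl _ _ (fun k' hk' k'' hk'' => hsp k' hk' k'' (Or.inr hk'')) c hc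
            rw [subst_inl, subst_append] at this
            intro h
            apply this
            simp only [letters_append, List.mem_append] at h ⊢
            tauto
        · intro t ht
          have ht' : t < ps.length := by simpa using ht
          rw [zero_add, List.getD_eq_getElem _ _ (by simpa using ht'),
            List.getD_eq_getElem _ _ (by simpa using ht')]
          simp only [List.getElem_map]
          exact hpiece (ps.take t) ps[t] (ps.drop (t + 1)) (by simp)
      · intro c hc hc'
        refine hcl _ _ hsepv c hc' ?_
        rw [subst_inl, hsubps]
        exact hc
    · rw [List.map_cons, Sum.map_inr, val_inr, subst_inr, val_inr, ih b.length (by simp) b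
        (by simpa using hb) (by simpa using hs) (by simpa using hy) rfl]
      rfl

end Hochschild

namespace Hochschild

open SeqOperad

variable {R : Type*} [Ring R] {ι : Type*} [DecidableEq ι]

/-! ## Words with bars -/

/-- Replace the bars `none` of a word by consecutive entries of the sequence `r`. -/
def fill (r : ℕ → R) : ℕ → List (Option ι) → List (ι ⊕ R)
  | _, [] => []
  | s, some i :: b => Sum.inl i :: fill r s b
  | s, none :: b => Sum.inr (r s) :: fill r (s + 1) b

@[simp] lemma fill_nil (r : ℕ → R) (s : ℕ) : fill r s ([] : List (Option ι)) = [] := rfl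
@[simp] lemma fill_some (r : ℕ → R) (s : ℕ) (i : ι) (b : List (Option ι)) :
    fill r s (some i :: b) = Sum.inl i :: fill r s b := rfl
@[simp] lemma fill_none (r : ℕ → R) (s : ℕ) (b : List (Option ι)) :
    fill r s (none :: b) = Sum.inr (r s) :: fill r (s + 1) b := rfl

/-- The number of bars of a word. -/
def bars (b : List (Option ι)) : ℕ := b.countP Option.isNone

@[simp] lemma bars_nil : bars ([] : List (Option ι)) = 0 := rfl
@[simp] lemma bars_some (i : ι) (b : List (Option ι)) : bars (some i :: b) = bars b := by
  simp [bars]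
@[simp] lemma bars_none (b : List (Option ι)) : bars (none :: b) = bars b + 1 := by
  simp [bars]
@[simp] lemma bars_append (b b' : List (Option ι)) : bars (b ++ b') = bars b + bars b' := by
  simp [bars]

@[simp] lemma fill_append (r : ℕ → R) (s : ℕ) (b b' : List (Option ι)) :
    fill r s (b ++ b') = fill r s b ++ fill r (s + bars b) b' := by
  induction b generalizing s with
  | nil => simp
  | cons c b ih =>
    rcases c with _ | i
    · simp [ih, add_assoc, add_comm 1]
    · simp [ih]

lemma fill_congr {r r' : ℕ → R} {s s' : ℕ} {b : List (Option ι)}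
    (h : ∀ t, t < bars b → r (s + t) = r' (s' + t)) : fill r s b = fill r' s' b := by
  induction b generalizing s s' with
  | nil => rfl
  | cons c b ih =>
    rcases c with _ | i
    · rw [fill_none, fill_none, ← add_zero s, h 0 (by simp), add_zero, add_zero,
        ih fun t ht => ?_]
      rw [add_assoc, add_assoc, add_comm 1, h (t + 1) (by simpa using ht)]
    · rw [fill_some, fill_some, ih (by simpa using h)]

lemma letters_fill (r : ℕ → R) (s : ℕ) (b : List (Option ι)) :
    letters (fill r s b) = b.reduceOption := by
  induction b generalizing s with
  | nil => rfl
  | cons c b ih =>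
    rcases c with _ | i <;> simp [ih]

/-- Insert a bar between equal adjacent letters. -/
def bar : List ι → List (Option ι)
  | [] => []
  | [i] => [some i]
  | i :: j :: w => if i = j then some i :: none :: bar (j :: w) else some i :: bar (j :: w)

@[simp] lemma bar_nil : bar ([] : List ι) = [] := by simp [bar]
@[simp] lemma bar_singleton (i : ι) : bar [i] = [some i] := by simp [bar]
lemma bar_self (i : ι) (w : List ι) : bar (i :: i :: w) = some i :: none :: bar (i :: w) := by
  simp [bar]
lemma bar_ne {i j : ι} (h : i ≠ j) (w : List ι) :
    bar (i :: j :: w) = some i :: bar (j :: w) := by simp [bar, h]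

lemma bar_cons_of_notMem {i : ι} {w : List ι} (h : i ∉ w) : bar (i :: w) = some i :: bar w := by
  rcases w with _ | ⟨j, w⟩
  · simp
  · exact bar_ne (fun hij => h (by simp [hij])) w

lemma bar_append_cons {i : ι} {A : List ι} (h : i ∉ A) (w : List ι) :
    bar (A ++ i :: w) = bar A ++ bar (i :: w) := by
  induction A with
  | nil => simp
  | cons a A ih =>
    have ih' := ih fun h' => h (by simp [h'])
    rcases A with _ | ⟨a', A⟩
    · exact bar_ne (fun hij => h (by simp [hij])) w
    · rw [List.cons_append, List.cons_append]
      rw [List.cons_append] at ih'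
      by_cases haa : a = a'
      · subst haa
        rw [bar_self, ih', bar_self]
        simp
      · rw [bar_ne haa, ih', bar_ne haa]
        simp

lemma reduceOption_bar (w : List ι) : (bar w).reduceOption = w := by
  induction w with
  | nil => simp
  | cons i w ih =>
    rcases w with _ | ⟨j, w⟩
    · simp
    · by_cases h : i = j
      · subst h
        rw [bar_self]
        simp [ih]
      · rw [bar_ne h]
        simp [ih]

/-- The word between two occurrences of a letter, an empty word being replaced by a bar. -/
def innerBar (A : List ι) : List (Option ι) := if A = [] then [none] else bar A

/-- No piece contains `i`, so the bars inside a piece depend on this piece alone. An empty piece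
means two adjacent `i`, which are separated by a bar. -/
lemma bar_seg {i : ι} {L : List (List ι)} {v : List ι} (hL : ∀ A ∈ L, i ∉ A) (hv : i ∉ v) :
    bar (i :: (seg i L ++ v)) = some i :: (seg (some i) (L.map innerBar) ++ bar v) := by
  induction L with
  | nil => simpa using bar_cons_of_notMem hv
  | cons A L ih =>
    have ih' := ih fun A hA => hL A (by simp [hA])
    have hA : i ∉ A := hL A (by simp)
    rw [seg_cons, List.append_assoc, List.cons_append, List.map_cons, seg_cons, List.append_assoc,
      List.cons_append, ← ih', innerBar]
    rcases A with _ | ⟨a, A⟩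
    · simp [bar_self]
    · rw [if_neg (by simp), List.cons_append, bar_ne (fun hij => hA (by simp [hij])),
        ← List.cons_append, bar_append_cons hA]

/-! ## The evaluation of words on cochains -/

lemma app_cup (x y : GCoch R) (r : ℕ → R) :
    app (cup x y) r = app x r * app y fun n => r (x.1 + n) := rfl

lemma app_comp {p : ℕ} (x : Coch R p) (y : Fin p → GCoch R) (r : ℕ → R) :
    app (comp x y) r = x fun i => app (y i) fun n =>
      r ((∑ i' : Fin i, (y (Fin.castLE i.2.le i')).1) + n) := by
  refine (comp_apply x y _).trans (congrArg x (funext fun i => ?_))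
  refine congrArg (y i).2 (funext fun t => ?_)
  rw [finSigmaFinEquiv_apply]

lemma exists_seg_list (i : ι) (b : List ι) : ∃ L v, b = seg i L ++ v ∧
    (∀ A ∈ L, i ∉ A) ∧ i ∉ v := by
  induction b with
  | nil => exact ⟨[], [], by simp⟩
  | cons s b ih =>
    obtain ⟨L, v, rfl, hL, hv⟩ := ih
    by_cases hs : s = i
    · subst hs
      exact ⟨[] :: L, v, by simp, by simpa using hL, hv⟩
    · have hs' : ∀ A : List ι, i ∉ A → i ∉ s :: A := fun A hA => by simp [hA, Ne.symm hs]
      rcases L with _ | ⟨A, L⟩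
      · exact ⟨[], s :: v, by simp, by simp, hs' _ hv⟩
      · exact ⟨(s :: A) :: L, v, by simp, by
          simp only [List.mem_cons, forall_eq_or_imp] at hL ⊢
          exact ⟨by simpa using hs' _ hL.1, hL.2⟩, hv⟩

lemma splitOn_seg {i : ι} {L : List (List ι)} {v : List ι} (hL : ∀ A ∈ L, i ∉ A) (hv : i ∉ v) :
    (seg i L ++ v).splitOn i = L ++ [v] := by
  have hni : ∀ A : List ι, i ∉ A → ∀ x ∈ A, (x == i) = false := by
    intro A hA x hx
    simp only [beq_eq_false_iff_ne]
    rintro rfl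
    exact hA hx
  rw [List.splitOn_eq_splitOnP]
  induction L with
  | nil => simpa using List.splitOnP_eq_singleton (hni v hv)
  | cons A L ih =>
    rw [seg_cons, List.append_assoc, List.cons_append,
      List.splitOnP_append_cons_of_forall_mem (hni A (hL A (by simp))) _ (by simp),
      ih fun A hA => hL A (by simp [hA])]
    rfl

lemma fill_seg (r : ℕ → R) (s : ℕ) (i : ι) (L : List (List (Option ι))) :
    ∃ L' : List (List (ι ⊕ R)), fill r s (seg (some i) L) = seg (Sum.inl i) L' ∧
      L'.length = L.length ∧ ∀ t, t < L.length → L'.getD t [] =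
        fill r (s + ∑ t' ∈ Finset.range t, bars (L.getD t' [])) (L.getD t []) := by
  induction L generalizing s with
  | nil => exact ⟨[], by simp⟩
  | cons A L ih =>
    obtain ⟨L', h1, h2, h3⟩ := ih (s + bars A)
    refine ⟨fill r s A :: L', by simp [h1], by simp [h2], fun t ht => ?_⟩
    rcases t with _ | t
    · simp
    · rw [List.getD_cons_succ, h3 t (by simpa using ht), Finset.sum_range_succ']
      simp only [List.getD_cons_succ, List.getD_cons_zero]
      congr 1
      ring

lemma letters_map_inl {α β : Type*} (w : List α) :
    letters (w.map Sum.inl : List (α ⊕ β)) = w := by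
  induction w with
  | nil => rfl
  | cons a w ih => simp [ih]

lemma Good.pieces {q : ι → ℕ} {i : ι} {L : List (List ι)} {v : List ι}
    (h : Good q (i :: (seg i L ++ v))) (hL : ∀ A ∈ L, i ∉ A) (hv : i ∉ v) :
    L.length = q i ∧ (∀ A ∈ L, Good q A) ∧ Good q v := by
  -- The lemmas on pieces are stated for words with ring entries; `ℤ` serves as a dummy ring.
  have e : ∀ L : List (List ι), letters (Sum.inl i :: (seg (Sum.inl i : ι ⊕ ℤ)
      (L.map (List.map Sum.inl)) ++ v.map Sum.inl)) = i :: (seg i L ++ v) := by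
    intro L
    rw [letters_inl, letters_append, letters_map_inl, letters_seg, List.map_map]
    congr 3
    conv_rhs => rw [← List.map_id L]
    exact List.map_congr_left fun A _ => letters_map_inl A
  have hL' : ∀ A ∈ L.map (List.map (Sum.inl : ι → ι ⊕ ℤ)), i ∉ letters A := by
    intro A hA
    obtain ⟨A, hA', rfl⟩ := List.mem_map.1 hA
    rw [letters_map_inl]
    exact hL A hA'
  have hv' : i ∉ letters (v.map Sum.inl : List (ι ⊕ ℤ)) := by rwa [letters_map_inl]
  refine ⟨?_, ?_, ?_⟩
  · have := Good.seg_length ((e L).symm ▸ h) hL' hv'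
    simpa using this
  · intro A hA
    obtain ⟨L₁, L₂, rfl⟩ := List.append_of_mem hA
    have h1 := (e _).symm ▸ h
    rw [List.map_append, List.map_cons] at h1
    have := h1.seg_piece (by rw [letters_map_inl]; exact hL A hA)
    rwa [letters_map_inl] at this
  · have := Good.seg_rest ((e L).symm ▸ h) hv'
    rwa [letters_map_inl] at this

lemma bars_seg (i : ι) (L : List (List (Option ι))) :
    bars (seg (some i) L) = ∑ t ∈ Finset.range L.length, bars (L.getD t []) := by
  induction L with
  | nil => rfl
  | cons A L ih =>
    rw [seg_cons, bars_append, bars_some, ih, List.length_cons, Finset.sum_range_succ']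
    simp [add_comm]

/-- In `eval` an empty inner word stands for the identity map, which takes one argument. In `val` an
empty piece would be 1, and it is the inserted bar that takes the argument. So the bars, in their
order, correspond to the arguments. -/
theorem eval_eq_val {k : ℕ} (z : Fin k → GCoch R) (w : List (Fin k)) (hw : Good (deg z) w) :
    (eval (fun i => (z i).2) w).1 = bars (bar w) ∧
      ∀ r, app (eval (fun i => (z i).2) w) r = val z (fill r 0 (bar w)) := by
  induction hn : w.length using Nat.strong_induction_on generalizing w with
  | _ N ih =>
    subst hn
    rcases w with _ | ⟨i, w⟩
    · rw [eval]
      exact ⟨rfl, fun r => by rw [bar_nil, fill_nil, val_nil]; rfl⟩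
    · obtain ⟨L, v, rfl, hL, hv⟩ := exists_seg_list i w
      obtain ⟨hlen, hgL, hgv⟩ := hw.pieces hL hv
      have hcount : (seg i L ++ v).count i = L.length := by
        have h1 := hw.count_eq i (by simp)
        rw [List.count_cons_self] at h1
        omega
      obtain ⟨hv1, hv2⟩ := ih v.length (by simp) v hgv rfl
      set y : ℕ → GCoch R := fun t => if L.getD t [] = [] then ident R
        else eval (fun i => (z i).2) (L.getD t []) with hy
      have hmem : ∀ t, t < L.length → L.getD t [] ∈ L := fun t ht => by
        rw [List.getD_eq_getElem _ _ ht]; exact List.getElem_mem ht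
      have hyt : ∀ t, t < L.length → (y t).1 = bars (innerBar (L.getD t [])) ∧
          ∀ r, app (y t) r = val z (fill r 0 (innerBar (L.getD t []))) := by
        intro t ht
        simp only [hy, innerBar]
        split_ifs with h
        · exact ⟨rfl, fun r => by
            rw [fill_none, fill_nil, val_inr, val_nil, mul_one]
            exact ident_apply _⟩
        · refine ih _ ?_ _ (hgL _ (hmem t ht)) rfl
          obtain ⟨L₁, L₂, hLL⟩ := List.append_of_mem (hmem t ht)
          generalize L.getD t [] = A at hLL
          subst hLL
          simp; omega
      have heval : eval (fun i => (z i).2) (i :: (seg i L ++ v)) =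
          cup (comp (z i).2 fun t : Fin (z i).1 => y t) (eval (fun i => (z i).2) v) := by
        rw [eval, splitOn_seg hL hv, hcount]
        congr 1
        · congr 1
          funext t
          have ht : (t : ℕ) < L.length := by rw [hlen]; exact t.2
          rw [List.getD_append _ _ _ _ ht]
        · rw [List.getD_append_right _ _ _ _ le_rfl]
          simp
      have hfst : (comp (z i).2 fun t : Fin (z i).1 => y t).1 =
          bars (seg (some i) (L.map innerBar)) := by
        rw [bars_seg, List.length_map, hlen, deg]
        refine Eq.trans (Finset.sum_range fun t => (y t).1).symm (Finset.sum_congr rfl fun t ht => ?_)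
        have ht' : t < L.length := by rw [hlen]; exact Finset.mem_range.1 ht
        rw [(hyt t ht').1, List.getD_eq_getElem _ _ ht',
          List.getD_eq_getElem _ _ (by simpa using ht'), List.getElem_map]
      rw [heval, bar_seg hL hv]
      constructor
      · rw [bars_some, bars_append, ← hv1, ← hfst]
        rfl
      · intro r
        rw [app_cup, hv2, fill_some, fill_append, hfst, zero_add]
        obtain ⟨L', h1, h2, h3⟩ := fill_seg r 0 i (L.map innerBar)
        rw [List.length_map] at h2 h3
        have hlet : ∀ A ∈ L', i ∉ letters A := by
          intro A hA
          obtain ⟨t, ht, rfl⟩ := List.getElem_of_mem hA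
          rw [h2] at ht
          rw [← List.getD_eq_getElem _ [] (by omega), h3 t ht, letters_fill,
            List.getD_eq_getElem _ _ (by simpa using ht), List.getElem_map, innerBar]
          split_ifs
          · simp
          · rw [reduceOption_bar]
            exact hL _ (List.getElem_mem ht)
        rw [h1, val_seg z hlet (by rw [letters_fill, reduceOption_bar]; exact hv) (h2.trans hlen)]
        congr 1
        · rw [app_comp]
          refine congrArg (z i).2 (funext fun t => ?_)
          have ht : (t : ℕ) < L.length := by rw [hlen]; exact t.2
          rw [(hyt t ht).2]
          dsimp only
          rw [h3 t ht, List.getD_eq_getElem _ _ ht,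
            List.getD_eq_getElem (L.map innerBar) _ (by simpa using ht), List.getElem_map]
          congr 1
          refine fill_congr fun s _ => ?_
          congr 2
          rw [zero_add]
          refine Eq.trans (Finset.sum_range fun t => (y t).1).symm ?_
          refine Finset.sum_congr rfl fun t' ht' => ?_
          have ht' : t' < L.length := (Finset.mem_range.1 ht').trans ht
          rw [(hyt t' ht').1, List.getD_eq_getElem _ _ ht',
            List.getD_eq_getElem _ _ (by simpa using ht'), List.getElem_map]
          exact zero_add s
        · congr 1
          exact fill_congr fun t _ => by simp

end Hochschild

namespace Hochschild

open SeqOperad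

/-! ## Special diagrams -/

lemma IsSpecial.comp_orderIso {S T U U' : Type*} [PartialOrder S] [PartialOrder T]
    [PartialOrder U] [PartialOrder U'] {α : T → S} {β : T → U} (h : IsSpecial α β) (e : U ≃o U') :
    IsSpecial α (e ∘ β) := by
  obtain ⟨h1, h2, h3, h4, h5⟩ := h
  refine ⟨h1, e.monotone.comp h2, e.surjective.comp h3, h4.imp id fun h => ⟨?_, h.2⟩, ?_⟩
  · exact (Equiv.isEmpty_congr e.toEquiv).1 h.1
  · intro q q' hq
    simpa using h5 q q' hq

lemma card_lt_of_covBy {V : Type*} [LinearOrder V] [Fintype V] {x y : V} (hxy : x ⋖ y) :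
    (Finset.univ.filter (· < y)).card = (Finset.univ.filter (· < x)).card + 1 := by
  rw [← Finset.card_insert_of_notMem (a := x) (by simp)]
  congr 1
  ext w
  simp only [Finset.mem_filter, Finset.mem_univ, true_and, Finset.mem_insert]
  constructor
  · intro hw
    exact eq_or_lt_of_le (hxy.le_of_lt hw)
  · rintro (rfl | hw)
    · exact hxy.lt
    · exact hw.trans hxy.lt

lemma covBy_map {T V : Type*} [LinearOrder T] [LinearOrder V] {γ : T → V} {p q : T} (hp : p ⋖ q)
    (hm : Monotone γ) (hs : Function.Surjective γ) (hlt : γ p < γ q) : γ p ⋖ γ q := by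
  refine ⟨hlt, fun x hx hx' => ?_⟩
  obtain ⟨y, rfl⟩ := hs x
  exact hp.2 (hm.reflect_lt hx) (hm.reflect_lt hx')

/-- In a special diagram the position of an element is the sum of the positions of its images. -/
theorem IsSpecial.card_lt {S T U : Type*} [LinearOrder S] [LinearOrder T] [LinearOrder U]
    [Fintype S] [Fintype T] [Fintype U] {α : T → S} {β : T → U} (h : IsSpecial α β) (q : T) :
    (Finset.univ.filter (· < q)).card =
      (Finset.univ.filter (· < α q)).card + (Finset.univ.filter (· < β q)).card := by
  obtain ⟨h1, h2, h3, h4, h5⟩ := h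
  have hα : Function.Surjective α := h4.resolve_right fun h => h.1.false (β q)
  induction q using WellFoundedLT.induction with
  | _ q ih =>
    by_cases hmin : IsMin q
    · have e1 : Finset.univ.filter (· < q) = ∅ := by
        rw [Finset.filter_eq_empty_iff]
        exact fun x _ hx => hmin.not_lt hx
      have e2 : Finset.univ.filter (· < α q) = ∅ := by
        rw [Finset.filter_eq_empty_iff]
        intro x _ hx
        obtain ⟨y, rfl⟩ := hα x
        exact hx.not_ge (h1 (hmin.isBot y))
      have e3 : Finset.univ.filter (· < β q) = ∅ := by
        rw [Finset.filter_eq_empty_iff]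
        intro x _ hx
        obtain ⟨y, rfl⟩ := h3 x
        exact hx.not_ge (h2 (hmin.isBot y))
      rw [e1, e2, e3]
      rfl
    · obtain ⟨p, hp⟩ := exists_covBy_of_wellFoundedGT hmin
      have hp' := ih p hp.lt
      rw [card_lt_of_covBy hp, hp']
      -- From `p` to its successor exactly one of the two images changes, and by surjectivity it
      -- moves to its own successor.
      rcases h5 p q hp with ⟨ha, hb⟩ | ⟨hb, ha⟩
      · have hb' : β p = β q := le_antisymm (h2 hp.le) (not_lt.1 hb)
        rw [card_lt_of_covBy (covBy_map hp h1 hα ha), hb']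
        omega
      · have ha' : α p = α q := le_antisymm (h1 hp.le) (not_lt.1 ha)
        rw [card_lt_of_covBy (covBy_map hp h2 h3 hb), ha']
        omega

lemma card_filter_lt_fin {n : ℕ} (x : Fin n) : (Finset.univ.filter (· < x)).card = (x : ℕ) := by
  have : Finset.univ.filter (· < x) = Finset.Iio x := by ext; simp
  rw [this, Fin.card_Iio]

/-- Consequently `α` is determined by `β`, and a special diagram is just a monotone surjection `β`.
-/
lemma IsSpecial.add_eq {s t m : ℕ} {α : Fin t → Fin s} {β : Fin t → Fin m} (h : IsSpecial α β)
    (l : Fin t) : (α l : ℕ) + β l = l := by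
  have := IsSpecial.card_lt h l
  rw [card_filter_lt_fin, card_filter_lt_fin, card_filter_lt_fin] at this
  exact this.symm

/-- The sequence of positions, the position `j` being repeated `n j + 1` times. -/
def repeats {m : ℕ} (n : Fin m → ℕ) : List (Fin m) :=
  (List.finRange m).flatMap fun j => List.replicate (n j + 1) j

lemma count_flatMap_replicate {A B : Type*} [DecidableEq B] (l : List A) (φ : A → B) (n : A → ℕ)
    (b : B) : (l.flatMap fun a => List.replicate (n a) (φ a)).count b =
      (l.map fun a => if φ a = b then n a else 0).sum := by
  induction l with
  | nil => rfl
  | cons a l ih => simp [List.count_append, ih, List.count_replicate]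

lemma sum_map_finRange {m : ℕ} {M : Type*} [AddCommMonoid M] (F : Fin m → M) :
    ((List.finRange m).map F).sum = ∑ j, F j := by
  rw [Fin.univ_def, Finset.sum]
  simp

lemma count_repeats {m : ℕ} (n : Fin m → ℕ) (j : Fin m) : (repeats n).count j = n j + 1 := by
  rw [repeats, count_flatMap_replicate, sum_map_finRange]
  simp

lemma pairwise_repeats {m : ℕ} (n : Fin m → ℕ) : (repeats n).Pairwise (· ≤ ·) := by
  rw [repeats, List.pairwise_flatMap]
  refine ⟨fun j _ => ?_, ?_⟩
  · rw [List.pairwise_replicate]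
    exact Or.inr le_rfl
  · refine (List.pairwise_lt_finRange m).imp fun {j j'} hj x hx y hy => ?_
    rw [List.eq_of_mem_replicate hx, List.eq_of_mem_replicate hy]
    exact hj.le

lemma length_repeats {m : ℕ} (n : Fin m → ℕ) : (repeats n).length = ∑ j, (n j + 1) := by
  rw [repeats, List.length_flatMap]
  simp only [List.length_replicate]
  exact sum_map_finRange _

/-- The multiplicities of a map onto `{1, …, m}`, diminished by one. -/
def mult {t m : ℕ} (β : Fin t → Fin m) (j : Fin m) : ℕ :=
  (Finset.univ.filter fun l => β l = j).card - 1

lemma count_ofFn {t : ℕ} {A : Type*} [DecidableEq A] (β : Fin t → A) (j : A) :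
    (List.ofFn β).count j = (Finset.univ.filter fun l => β l = j).card := by
  rw [List.ofFn_eq_map, List.count_eq_countP, List.countP_map, List.countP_eq_length_filter,
    Fin.univ_def]
  simp only [Finset.card, Finset.filter, Multiset.filter_coe, Multiset.coe_card]
  congr 1

/-- Two nondecreasing words with the same letter counts are equal. -/
lemma ofFn_eq_repeats {t m : ℕ} {β : Fin t → Fin m} (hm : Monotone β)
    (hs : Function.Surjective β) : List.ofFn β = repeats (mult β) := by
  refine List.Perm.eq_of_pairwise (le := (· ≤ ·)) (fun a b _ _ => le_antisymm) ?_
    (pairwise_repeats _) ?_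
  · rw [List.pairwise_ofFn]
    exact fun i j hij => hm hij.le
  · rw [List.perm_iff_count]
    intro j
    rw [count_repeats, count_ofFn, mult]
    have : 0 < (Finset.univ.filter fun l => β l = j).card := by
      obtain ⟨l, hl⟩ := hs j
      exact Finset.card_pos.2 ⟨l, by simp [hl]⟩
    omega

lemma monotone_succ_le {t m : ℕ} {β : Fin t → Fin m} (hm : Monotone β)
    (hs : Function.Surjective β) {l l' : Fin t} (h : (l : ℕ) + 1 = l') :
    (β l' : ℕ) ≤ β l + 1 := by
  by_contra hlt
  obtain ⟨x, hx⟩ := hs ⟨β l + 1, by have := (β l').2; omega⟩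
  have hx' : (β x : ℕ) = β l + 1 := by rw [hx]
  rcases le_or_gt x l with h1 | h1
  · have : (β x : ℕ) ≤ β l := hm h1
    omega
  · have : β l' ≤ β x := hm (show (l' : ℕ) ≤ x by have : (l : ℕ) < x := h1; omega)
    have : (β l' : ℕ) ≤ β x := this
    omega

lemma monotone_le_self {t m : ℕ} {β : Fin t → Fin m} (hm : Monotone β)
    (hs : Function.Surjective β) (l : Fin t) : (β l : ℕ) ≤ l := by
  obtain ⟨l, hl⟩ := l
  induction l with
  | zero =>
    obtain ⟨x, hx⟩ := hs ⟨0, Nat.pos_of_ne_zero fun h => by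
      subst h; exact (β ⟨0, hl⟩).elim0⟩
    have : β ⟨0, hl⟩ ≤ β x := hm (show 0 ≤ (x : ℕ) by omega)
    rw [hx] at this
    exact this
  | succ l ih =>
    have h1 := ih (by omega)
    have h2 := monotone_succ_le hm hs (l := ⟨l, by omega⟩) (l' := ⟨l + 1, hl⟩) rfl
    dsimp only at h1 ⊢
    omega

/-- By `IsSpecial.add_eq` only `α l = l - β l` is possible. It is monotone since `β` grows by at
most one at each step, and its last value is `t - m = s - 1`. The case `t = 0` is the convention
`{pt} ← ∅ → ∅`. -/
lemma exists_isSpecial {t m s : ℕ} {β : Fin t → Fin m} (hm : Monotone β)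
    (hs : Function.Surjective β) (hst : s + m = t + 1) :
    ∃ α : Fin t → Fin s, IsSpecial α β := by
  have hmono : ∀ l l' : Fin t, l ≤ l' → (l : ℕ) - β l ≤ l' - β l' := by
    intro l l' hl
    obtain ⟨d, hd⟩ : ∃ d, (l' : ℕ) = l + d := ⟨l' - l, by have : (l : ℕ) ≤ l' := hl; omega⟩
    induction d generalizing l' with
    | zero =>
      have : l = l' := Fin.ext (by omega)
      subst this
      exact le_rfl
    | succ d ih =>
      have hlt : (l : ℕ) + d < t := by have := l'.2; omega
      have h1 := ih ⟨l + d, hlt⟩ (show (l : ℕ) ≤ l + d by omega) rfl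
      have h2 := monotone_succ_le hm hs (l := ⟨l + d, hlt⟩) (l' := l') (by simp; omega)
      have h3 := monotone_le_self hm hs ⟨l + d, hlt⟩
      dsimp only at h1 h2 h3
      omega
  have hlast : ∀ h : 0 < t, (β ⟨t - 1, by omega⟩ : ℕ) = m - 1 := by
    intro h
    obtain ⟨x, hx⟩ := hs ⟨m - 1, by have := (β ⟨0, h⟩).2; omega⟩
    have h1 : β x ≤ β ⟨t - 1, by omega⟩ := hm (show (x : ℕ) ≤ t - 1 by have := x.2; omega)
    rw [hx] at h1
    have h2 : m - 1 ≤ (β ⟨t - 1, by omega⟩ : ℕ) := h1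
    have := (β ⟨t - 1, by omega⟩).2
    omega
  have hbound : ∀ l : Fin t, (l : ℕ) - β l < s := by
    intro l
    have ht : 0 < t := by have := l.2; omega
    have h1 := hmono l ⟨t - 1, by omega⟩ (show (l : ℕ) ≤ t - 1 by have := l.2; omega)
    have h2 := hlast ht
    have := (β l).2
    have h3 := monotone_le_self hm hs ⟨t - 1, by omega⟩
    dsimp only at h1 h3
    omega
  refine ⟨fun l => ⟨l - β l, hbound l⟩, fun l l' hl => hmono l l' hl, hm, hs, ?_, ?_⟩
  · rcases Nat.eq_zero_or_pos t with ht | ht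
    · right
      subst ht
      have hm0 : m = 0 := by
        by_contra h
        obtain ⟨x, -⟩ := hs ⟨0, by omega⟩
        exact x.elim0
      subst hm0
      exact ⟨inferInstance, by simp; omega⟩
    · left
      intro x
      -- The least `l` at which `l - β l` reaches `x` has exactly the value `x`, because the values
      -- grow by at most one.
      have hex : ∃ l, ∃ h : l < t, (x : ℕ) ≤ l - β ⟨l, h⟩ := by
        refine ⟨t - 1, by omega, ?_⟩
        have := hlast ht
        have h1 := x.2
        have h3 := (β ⟨t - 1, by omega⟩).2
        omega
      classical
      obtain ⟨hl, hle⟩ := Nat.find_spec hex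
      refine ⟨⟨Nat.find hex, hl⟩, Fin.ext ?_⟩
      show Nat.find hex - β ⟨Nat.find hex, hl⟩ = (x : ℕ)
      rcases Nat.eq_zero_or_pos (Nat.find hex) with h0 | h0
      · omega
      · have h1 := Nat.find_min hex (m := Nat.find hex - 1) (by omega)
        push Not at h1
        have h2 := h1 (by omega)
        have h3 : (β ⟨Nat.find hex - 1, by omega⟩ : ℕ) ≤ β ⟨Nat.find hex, hl⟩ :=
          hm (show Nat.find hex - 1 ≤ Nat.find hex by omega)
        omega
  · intro q q' hq
    have hqq : (q : ℕ) + 1 = q' := by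
      have h1 : (q : ℕ) < q' := hq.lt
      by_contra hne
      exact hq.2 (c := ⟨q + 1, by have := q'.2; omega⟩) (show (q : ℕ) < q + 1 by omega)
        (show (q : ℕ) + 1 < q' by omega)
    have h1 := monotone_succ_le hm hs hqq
    have h2 : (β q : ℕ) ≤ β q' := hm hq.le
    have h3 := monotone_le_self hm hs q
    have h4 := monotone_le_self hm hs q'
    have ha : ((⟨q - β q, hbound q⟩ : Fin s) < ⟨q' - β q', hbound q'⟩) ↔ (β q' : ℕ) = β q := by
      rw [Fin.lt_def]
      dsimp only
      omega
    have hb : β q < β q' ↔ (β q' : ℕ) = β q + 1 := by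
      rw [Fin.lt_def]
      omega
    rw [ha, hb, xor_iff_or_and_not_and]
    omega

/-- On a fibre of `β` the value of `α` determines the position, by `IsSpecial.add_eq`. So the image
has as many elements as the fibre, and the exponents in `eps'` are the multiplicities. -/
lemma norm1_image_preimage {s t m : ℕ} {α : Fin t → Fin s} {β : Fin t → Fin m}
    (h : IsSpecial α β) (j : Fin m) : norm1 (α '' (β ⁻¹' {j})) = (mult β j : ℤ) := by
  have hinj : Set.InjOn α (β ⁻¹' {j}) := by
    intro l hl l' hl' he
    have h1 := IsSpecial.add_eq h l
    have h2 := IsSpecial.add_eq h l'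
    rw [he, show β l = j from hl] at h1
    rw [show β l' = j from hl'] at h2
    exact Fin.ext (by omega)
  have hpos : 0 < (Finset.univ.filter fun l => β l = j).card := by
    obtain ⟨l, hl⟩ := h.2.2.1 j
    exact Finset.card_pos.2 ⟨l, by simp [hl]⟩
  have hset : β ⁻¹' {j} = ((Finset.univ.filter fun l => β l = j : Finset (Fin t)) : Set (Fin t)) := by
    ext; simp
  rw [norm1, hinj.ncard_image, hset, Set.ncard_coe_finset, mult]
  omega

/-! ## Multiplicities -/

/-- The multiplicities for which the letter `i` occurs `q i + 1` times. -/
def Mult {m k : ℕ} (h : Fin m → Fin k) (q : Fin k → ℕ) : Finset (Fin m → ℕ) :=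
  (Fintype.piFinset fun j => Finset.range (q (h j) + 1)).filter fun n =>
    ∀ i, ∑ j, (if h j = i then n j + 1 else 0) = q i + 1

/-- The bound on the single multiplicities, which makes `Mult` a finite set, follows from the
condition on the sums. -/
lemma mem_Mult {m k : ℕ} {h : Fin m → Fin k} {q : Fin k → ℕ} {n : Fin m → ℕ} :
    n ∈ Mult h q ↔ ∀ i, ∑ j, (if h j = i then n j + 1 else 0) = q i + 1 := by
  rw [Mult, Finset.mem_filter, Fintype.mem_piFinset, and_iff_right_iff_imp]
  intro hn j
  have h1 := Finset.single_le_sum (f := fun j' => if h j' = h j then n j' + 1 else 0)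
    (fun _ _ => Nat.zero_le _) (Finset.mem_univ j)
  rw [hn (h j)] at h1
  simp only [if_true] at h1
  exact Finset.mem_range.2 h1

lemma sum_of_mem_Mult {m k : ℕ} {h : Fin m → Fin k} {q : Fin k → ℕ} {n : Fin m → ℕ}
    (hn : n ∈ Mult h q) : (∑ j, n j) + m = (∑ i, q i) + k := by
  have h1 : ∑ i, ∑ j, (if h j = i then n j + 1 else 0) = ∑ i, (q i + 1) :=
    Finset.sum_congr rfl fun i _ => mem_Mult.1 hn i
  rw [Finset.sum_comm] at h1
  simpa [Finset.sum_add_distrib] using h1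

lemma surjective_of_mem_Mult {m k : ℕ} {h : Fin m → Fin k} {q : Fin k → ℕ} {n : Fin m → ℕ}
    (hn : n ∈ Mult h q) : Function.Surjective h := by
  intro i
  by_contra hi
  push Not at hi
  have := mem_Mult.1 hn i
  rw [Finset.sum_eq_zero fun j _ => if_neg (hi j)] at this
  omega

/-- The word in which the letter `h j` is repeated `n j + 1` times. -/
def expand {m : ℕ} {ι : Type*} (h : Fin m → ι) (n : Fin m → ℕ) : List ι := (repeats n).map h

lemma count_expand {m : ℕ} {ι : Type*} [DecidableEq ι] (h : Fin m → ι) (n : Fin m → ℕ) (i : ι) :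
    (expand h n).count i = ∑ j, (if h j = i then n j + 1 else 0) := by
  rw [expand, repeats, List.map_flatMap]
  simp only [List.map_replicate]
  rw [count_flatMap_replicate, sum_map_finRange]

/-- A sum over special diagrams as a sum over multiplicities. -/
theorem sum_special {m k : ℕ} (f : Fin m → Fin k) (q : Fin k → ℕ) {M : Type*} [AddCommMonoid M]
    {s t : ℕ} (ht : t = k + ∑ i, q i) (hs : s = ∑ i, q i + k + 1 - m)
    (G : (Fin t → Fin s) × (Fin t → Fin m) → M) (F : (Fin m → ℕ) → M)
    (P : (Fin t → Fin s) × (Fin t → Fin m) → Prop) [DecidablePred P]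
    (hP : ∀ E, P E ↔ IsSpecial E.1 E.2 ∧ ∀ i, (List.ofFn (f ∘ E.2)).count i = q i + 1)
    (hGF : ∀ E, IsSpecial E.1 E.2 → G E = F (mult E.2)) :
    ∑ E ∈ Finset.univ.filter P, G E = ∑ n ∈ Mult f q, F n := by
  have hof : ∀ E : (Fin t → Fin s) × (Fin t → Fin m), IsSpecial E.1 E.2 →
      List.ofFn (f ∘ E.2) = expand f (mult E.2) := by
    intro E hE
    rw [← List.map_ofFn, ofFn_eq_repeats hE.2.1 hE.2.2.1]
    rfl
  refine Finset.sum_bij (fun E _ => mult E.2) ?_ ?_ ?_ ?_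
  · intro E hE
    rw [Finset.mem_filter, hP] at hE
    rw [mem_Mult]
    intro i
    rw [← count_expand, ← hof E hE.2.1]
    exact hE.2.2 i
  · rintro ⟨α, β⟩ hE ⟨α', β'⟩ hE' he
    rw [Finset.mem_filter, hP] at hE hE'
    have hE := hE.2.1
    have hE' := hE'.2.1
    dsimp only at hE hE' he
    have hβ : β = β' := by
      apply List.ofFn_injective
      rw [ofFn_eq_repeats hE.2.1 hE.2.2.1, ofFn_eq_repeats hE'.2.1 hE'.2.2.1, he]
    subst hβ
    have hα : α = α' := by
      funext l
      have h1 := IsSpecial.add_eq hE l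
      have h2 := IsSpecial.add_eq hE' l
      exact Fin.ext (by omega)
    rw [hα]
  · intro n hn
    have hsum := sum_of_mem_Mult hn
    have hlen : (repeats n).length = t := by
      rw [length_repeats, Finset.sum_add_distrib]
      simp
      omega
    subst hlen
    have hmono : Monotone (repeats n).get := by
      intro l l' hl
      rcases eq_or_lt_of_le hl with rfl | hl
      · exact le_rfl
      · exact List.pairwise_iff_get.1 (pairwise_repeats n) l l' hl
    have hsurj : Function.Surjective (repeats n).get := by
      intro j
      have : j ∈ repeats n := List.count_pos_iff.1 (by rw [count_repeats]; omega)
      obtain ⟨l, hl⟩ := List.mem_iff_get.1 this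
      exact ⟨l, hl⟩
    obtain ⟨α, hα⟩ := exists_isSpecial (s := s) hmono hsurj (by omega)
    have hmult : mult (repeats n).get = n := by
      funext j
      rw [mult, ← count_ofFn, List.ofFn_get, count_repeats, Nat.add_sub_cancel]
    refine ⟨(α, (repeats n).get), ?_, hmult⟩
    rw [Finset.mem_filter, hP]
    refine ⟨Finset.mem_univ _, hα, fun i => ?_⟩
    rw [hof _ hα, count_expand]
    dsimp only
    rw [hmult]
    exact mem_Mult.1 hn i
  · intro E hE
    rw [Finset.mem_filter, hP] at hE
    exact hGF E hE.2.1

end Hochschild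

namespace Hochschild

open SeqOperad

/-! ## Expansions of sequences -/

section Expand

variable {ι : Type*} [DecidableEq ι]

/-- The word `c | c | ⋯ | c` with `n` bars. -/
def blk (c : ι) : ℕ → List (Option ι)
  | 0 => [some c]
  | n + 1 => some c :: none :: blk c n

/-- The word with bars in which the letter `h j` is replaced by `h j | ⋯ | h j` with `n j` bars. -/
def bexp {m : ℕ} (h : Fin m → ι) (n : Fin m → ℕ) : List (Option ι) :=
  (List.finRange m).flatMap fun j => blk (h j) (n j)

@[simp] lemma bars_blk (c : ι) (n : ℕ) : bars (blk c n) = n := by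
  induction n with
  | zero => rfl
  | succ n ih => simp [blk, ih]

@[simp] lemma reduceOption_blk (c : ι) (n : ℕ) :
    (blk c n).reduceOption = List.replicate (n + 1) c := by
  induction n with
  | zero => rfl
  | succ n ih => simp [blk, ih, List.replicate_succ]

lemma bars_flatMap {A : Type*} (l : List A) (F : A → List (Option ι)) :
    bars (l.flatMap F) = (l.map fun a => bars (F a)).sum := by
  induction l with
  | nil => rfl
  | cons a l ih => simp [ih]

lemma reduceOption_flatMap {A : Type*} (l : List A) (F : A → List (Option ι)) :
    (l.flatMap F).reduceOption = l.flatMap fun a => (F a).reduceOption := by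
  induction l with
  | nil => rfl
  | cons a l ih => simp [ih, List.reduceOption_append]

lemma bars_bexp {m : ℕ} (h : Fin m → ι) (n : Fin m → ℕ) : bars (bexp h n) = ∑ j, n j := by
  rw [bexp, bars_flatMap]
  simp only [bars_blk]
  exact sum_map_finRange n

lemma expand_eq {m : ℕ} (h : Fin m → ι) (n : Fin m → ℕ) :
    expand h n = (List.finRange m).flatMap fun j => List.replicate (n j + 1) (h j) := by
  rw [expand, repeats, List.map_flatMap]
  simp only [List.map_replicate]

lemma reduceOption_bexp {m : ℕ} (h : Fin m → ι) (n : Fin m → ℕ) :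
    (bexp h n).reduceOption = expand h n := by
  rw [bexp, reduceOption_flatMap, expand_eq]
  simp only [reduceOption_blk]

lemma bar_replicate_append (c : ι) (n : ℕ) {w : List ι} (hw : ∀ w', w ≠ c :: w') :
    bar (List.replicate (n + 1) c ++ w) = blk c n ++ bar w := by
  induction n with
  | zero =>
    rcases w with _ | ⟨d, w⟩
    · simp [blk]
    · have hcd : c ≠ d := fun h => hw w (by rw [h])
      simp [blk, bar_ne hcd]
  | succ n ih =>
    rw [List.replicate_succ, List.cons_append] at ih ⊢
    rw [List.replicate_succ, List.cons_append, bar_self, ih, blk]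
    rfl

/-- Neighbouring blocks have different letters, so bars are inserted inside the blocks only. For
degenerate sequences the two words differ: `bexp` leaves equal letters of neighbouring blocks
adjacent, and this is what makes its value vanish. -/
lemma bar_expand {m : ℕ} {h : Fin m → ι} (n : Fin m → ℕ)
    (hh : ∀ j j' : Fin m, (j : ℕ) + 1 = j' → h j ≠ h j') : bar (expand h n) = bexp h n := by
  have key : ∀ l : List (Fin m), l.IsChain (fun j j' => h j ≠ h j') →
      bar (l.flatMap fun j => List.replicate (n j + 1) (h j)) =
        l.flatMap fun j => blk (h j) (n j) := by
    intro l hl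
    induction l with
    | nil => simp
    | cons j l ih =>
      rw [List.flatMap_cons, List.flatMap_cons, bar_replicate_append, ih hl.tail]
      intro w'
      rcases l with _ | ⟨j', l⟩
      · simp
      · rw [List.flatMap_cons, List.replicate_succ, List.cons_append]
        intro he
        rw [List.isChain_cons_cons] at hl
        exact hl.1 (List.cons.inj he).1.symm
  rw [expand_eq, bexp]
  refine key _ ?_
  rw [List.isChain_iff_getElem]
  intro i hi
  refine hh _ _ ?_
  simp

/-- Neighbours in `s` are different, so `s` takes at most one letter from each run. -/
lemma sublist_of_isChain {A : Type*} (l : List A) (φ : A → ι) (n : A → ℕ) {s : List ι}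
    (hs : s.IsChain (· ≠ ·)) (h : s.Sublist (l.flatMap fun a => List.replicate (n a + 1) (φ a))) :
    s.Sublist (l.map φ) := by
  induction l generalizing s with
  | nil => simpa using h
  | cons a l ih =>
    rw [List.flatMap_cons, List.sublist_append_iff] at h
    obtain ⟨s₁, s₂, rfl, h1, h2⟩ := h
    have h3 := ih (List.IsChain.right_of_append hs) h2
    obtain ⟨t, -, rfl⟩ := List.sublist_replicate_iff.1 h1
    have h4 : (List.replicate t (φ a)).Sublist [φ a] := by
      rcases t with _ | _ | t
      · simp
      · simp
      · have := List.IsChain.left_of_append hs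
        simp [List.replicate_succ] at this
    exact h4.append h3

lemma noncrossing_expand {m : ℕ} {h : Fin m → ι} (n : Fin m → ℕ)
    (hh : Noncrossing (List.ofFn h)) : Noncrossing (expand h n) := by
  intro a c hac hs
  rw [expand_eq] at hs
  refine hh a c hac ?_
  rw [List.ofFn_eq_map]
  exact sublist_of_isChain _ _ _ (by simp [hac, hac.symm]) hs

lemma fill_blk {R : Type*} [Ring R] (r : ℕ → R) (s : ℕ) (c : ι) (n : ℕ) :
    fill r s (blk c n) = Sum.inl c ::
      seg (Sum.inl c) ((List.range n).map fun t => [Sum.inr (r (s + t))]) := by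
  induction n generalizing s with
  | zero => rfl
  | succ n ih =>
    rw [blk, fill_some, fill_none, ih, List.range_succ_eq_map]
    simp only [List.map_cons, seg_cons, List.map_map, add_zero]
    simp only [Function.comp_def, Nat.succ_eq_add_one, add_assoc, add_comm 1]
    rfl

lemma blk_eq_append (c : ι) (n : ℕ) : ∃ b, blk c n = b ++ [some c] := by
  induction n with
  | zero => exact ⟨[], rfl⟩
  | succ n ih =>
    obtain ⟨b, hb⟩ := ih
    exact ⟨some c :: none :: b, by rw [blk, hb]; rfl⟩

lemma blk_eq_cons (c : ι) (n : ℕ) : ∃ b, blk c n = some c :: b := by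
  cases n <;> exact ⟨_, rfl⟩

end Expand

lemma good_expand {m k : ℕ} {h : Fin m → Fin k} (hh : Noncrossing (List.ofFn h)) {q : Fin k → ℕ}
    {n : Fin m → ℕ} (hn : n ∈ Mult h q) : Good q (expand h n) :=
  ⟨noncrossing_expand n hh, fun i _ => by rw [count_expand]; exact mem_Mult.1 hn i⟩

variable {R : Type*} [Ring R]

lemma good_fill_bexp {m k : ℕ} {h : Fin m → Fin k} (hh : Noncrossing (List.ofFn h))
    {q : Fin k → ℕ} {n : Fin m → ℕ} (hn : n ∈ Mult h q) (r : ℕ → R) (s : ℕ) :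
    Good q (letters (fill r s (bexp h n))) := by
  rw [letters_fill, reduceOption_bexp]
  exact good_expand hh hn

/-! ## Homogeneous cochains -/

variable (R) in
/-- A homogeneous normalized cochain. -/
abbrev HC : Type _ := Σ p : ℕ, normalized R p

/-- The underlying cochains of a family of homogeneous normalized cochains. -/
def toG {ι : Type*} (z : ι → HC R) (i : ι) : GCoch R := ⟨(z i).1, (z i).2.1⟩

/-- A homogeneous cochain as an element of `C^*(R)`. -/
def hom (x : HC R) : C R := DirectSum.of (fun p => normalized R p) x.1 x.2

/-- The value of the component of degree `p` on the first entries of the sequence `r`. -/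
def ev (p : ℕ) (r : ℕ → R) : C R →+ R where
  toFun c := (c p).1 fun i => r i
  map_zero' := rfl
  map_add' _ _ := rfl

/-- Evaluating on infinite sequences avoids transporting cochains along equalities of degrees; a
family of `p` arguments is continued by zeros. -/
lemma ev_ext {c c' : C R} (h : ∀ p r, ev p r c = ev p r c') : c = c' := by
  refine DFinsupp.ext fun p => Subtype.ext (MultilinearMap.ext fun r => ?_)
  have := h p fun n => if hn : n < p then r ⟨n, hn⟩ else 0
  simpa [ev] using this

lemma ev_hom (p : ℕ) (r : ℕ → R) (x : HC R) :
    ev p r (hom x) = if x.1 = p then app ⟨x.1, x.2.1⟩ r else 0 := by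
  obtain ⟨q, x⟩ := x
  split_ifs with h
  · dsimp only at h
    subst h
    have := DirectSum.of_eq_same (β := fun p => normalized R p) q x
    exact congrArg (fun y : normalized R q => y.1 fun i => r i) this
  · have := DirectSum.of_eq_of_ne (β := fun p => normalized R p) q p x (Ne.symm h)
    exact congrArg (fun y : normalized R p => y.1 fun i => r i) this

lemma ev_zsmul (p : ℕ) (r : ℕ → R) (n : ℤ) (c : C R) : ev p r (n • c) = n • ev p r c := rfl

lemma ev_units_smul (p : ℕ) (r : ℕ → R) (u : ℤˣ) (c : C R) : ev p r (u • c) = u • ev p r c :=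
  ev_zsmul p r u c

lemma ev_value (p : ℕ) (r : ℕ → R) {k : ℕ} (z : Fin k → HC R) {w : List (Fin k)}
    (hw : Good (deg (toG z)) w) :
    ev p r (value (fun i => (z i).2) w) =
      if bars (bar w) = p then val (toG z) (fill r 0 (bar w)) else 0 := by
  obtain ⟨h1, h2⟩ := eval_eq_val (toG z) w hw
  have := ev_hom p r ⟨_, ⟨_, eval_mem (fun i => (z i).2) w⟩⟩
  refine this.trans ?_
  rw [← h1, ← h2]
  rfl

/-- The exponent of the sign of the term of `θ(h, x)` with multiplicities `n`. -/
def thetaExp {m k : ℕ} (h : Fin m → Fin k) (q : Fin k → ℕ) (n : Fin m → ℕ) : ℤ :=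
  eps h (fun j => (n j : ℤ)) + ((m : ℤ) - k) * ∑ i, (q i : ℤ) + ((m : ℤ) - k) * ((m : ℤ) - k + 1) / 2

theorem thetaHom_eq {k : ℕ} (f : NSeq k) (z : Fin k → HC R) :
    thetaHom f (fun i => (z i).1) (fun i => (z i).2) = ∑ n ∈ Mult f.fn (deg (toG z)),
      (thetaExp f.fn (deg (toG z)) n).negOnePow • value (fun i => (z i).2) (expand f.fn n) := by
  classical
  rw [thetaHom]
  refine sum_special f.fn (deg (toG z)) rfl rfl _ _ _ (fun E => Iff.rfl) ?_
  intro E hE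
  have h1 : List.ofFn (f.fn ∘ E.2) = expand f.fn (mult E.2) := by
    rw [← List.map_ofFn, ofFn_eq_repeats hE.2.1 hE.2.2.1]
    rfl
  have h2 : eps' f (fun i => (z i).1) E.1 E.2 = thetaExp f.fn (deg (toG z)) (mult E.2) := by
    rw [eps']
    simp only [norm1_image_preimage hE]
    rfl
  exact congrArg₂ (fun (a : ℤ) w => a.negOnePow • value (fun i => (z i).2) w) h2 h1

/-- All words in the sum have the same number of bars, by `sum_of_mem_Mult`, so only one degree
contributes. -/
theorem ev_thetaHom {k : ℕ} (f : NSeq k) (hf : Noncrossing (List.ofFn f.fn)) (z : Fin k → HC R)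
    (p : ℕ) (r : ℕ → R) :
    ev p r (thetaHom f (fun i => (z i).1) (fun i => (z i).2)) =
      if p + f.len = ∑ i, deg (toG z) i + k then ∑ n ∈ Mult f.fn (deg (toG z)),
        (thetaExp f.fn (deg (toG z)) n).negOnePow • val (toG z) (fill r 0 (bexp f.fn n))
      else 0 := by
  rw [thetaHom_eq, map_sum]
  have key : ∀ n ∈ Mult f.fn (deg (toG z)),
      ev p r ((thetaExp f.fn (deg (toG z)) n).negOnePow • value (fun i => (z i).2)
        (expand f.fn n)) = if ∑ j, n j = p then
        (thetaExp f.fn (deg (toG z)) n).negOnePow • val (toG z) (fill r 0 (bexp f.fn n))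
      else 0 := by
    intro n hn
    rw [ev_units_smul, ev_value p r z (good_expand hf hn), bar_expand n f.nondeg.2, bars_bexp]
    split_ifs
    · rfl
    · rw [smul_zero]
  rw [Finset.sum_congr rfl key]
  split_ifs with hp
  · refine Finset.sum_congr rfl fun n hn => if_pos ?_
    have := sum_of_mem_Mult hn
    omega
  · refine Finset.sum_eq_zero fun n hn => if_neg ?_
    have := sum_of_mem_Mult hn
    omega

/-- `θ_k(f, -)` on cochains of fixed degrees, as a multilinear map. -/
def thetaLin {k : ℕ} (f : NSeq k) (hf : Noncrossing (List.ofFn f.fn)) (q : Fin k → ℕ) :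
    MultilinearMap ℤ (fun i => normalized R (q i)) (C R) where
  toFun x := thetaHom f q x
  map_update_add' {inst} x i u v := by
    have := Subsingleton.elim inst (instDecidableEqFin k); subst this
    refine ev_ext fun p r => ?_
    rw [map_add]
    have key := fun w : normalized R (q i) =>
      ev_thetaHom f hf (fun i' => ⟨q i', Function.update x i w i'⟩) p r
    dsimp only at key
    rw [key u, key v, key (u + v)]
    -- The index set and the signs depend on the degrees only and are untouched by the update; each
    -- single term is additive in the cochain of `i` by `exists_linear`.
    change (if p + f.len = ∑ i, q i + k then ∑ n ∈ Mult f.fn q, _ else 0) =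
      (if p + f.len = ∑ i, q i + k then ∑ n ∈ Mult f.fn q, _ else 0) +
      if p + f.len = ∑ i, q i + k then ∑ n ∈ Mult f.fn q, _ else 0
    split_ifs
    · rw [← Finset.sum_add_distrib]
      refine Finset.sum_congr rfl fun n hn => ?_
      have hg : Good (deg (toG fun i' => (⟨q i', x i'⟩ : HC R)))
        (letters (fill r 0 (bexp f.fn n))) := good_fill_bexp hf hn r 0
      obtain ⟨φ, P, hφ⟩ := exists_linear (i := i) hg (by
        rw [letters_fill, reduceOption_bexp]
        refine List.count_pos_iff.1 ?_
        rw [count_expand, mem_Mult.1 hn i]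
        omega)
      have h1 := fun w : normalized R (q i) =>
        hφ (toG fun i' => (⟨q i', Function.update x i w i'⟩ : HC R))
          (fun c hc => by simp [toG, Function.update_of_ne hc]) rfl
      simp only [toG, Function.update_self] at h1
      refine Eq.trans (congrArg _ ?_) (smul_add _ _ _)
      refine (h1 (u + v)).trans ?_
      refine Eq.trans ?_ (congrArg₂ (· + ·) (h1 u) (h1 v)).symm
      rw [← map_add]
      rfl
    · simp
  map_update_smul' {inst} x i c v := by
    have := Subsingleton.elim inst (instDecidableEqFin k); subst this
    refine ev_ext fun p r => ?_
    refine Eq.trans ?_ (ev_zsmul p r c _).symm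
    have key := fun w : normalized R (q i) =>
      ev_thetaHom f hf (fun i' => ⟨q i', Function.update x i w i'⟩) p r
    dsimp only at key
    rw [key v, key (c • v)]
    change (if p + f.len = ∑ i, q i + k then ∑ n ∈ Mult f.fn q, _ else 0) =
      c • if p + f.len = ∑ i, q i + k then ∑ n ∈ Mult f.fn q, _ else 0
    split_ifs
    · rw [Finset.smul_sum]
      refine Finset.sum_congr rfl fun n hn => ?_
      have hg : Good (deg (toG fun i' => (⟨q i', x i'⟩ : HC R)))
        (letters (fill r 0 (bexp f.fn n))) := good_fill_bexp hf hn r 0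
      obtain ⟨φ, P, hφ⟩ := exists_linear (i := i) hg (by
        rw [letters_fill, reduceOption_bexp]
        refine List.count_pos_iff.1 ?_
        rw [count_expand, mem_Mult.1 hn i]
        omega)
      have h1 := fun w : normalized R (q i) =>
        hφ (toG fun i' => (⟨q i', Function.update x i w i'⟩ : HC R))
          (fun c hc => by simp [toG, Function.update_of_ne hc]) rfl
      simp only [toG, Function.update_self] at h1
      refine Eq.trans (congrArg _ ?_) (smul_comm _ c _)
      refine (h1 (c • v)).trans ?_
      refine Eq.trans ?_ (congrArg (c • ·) (h1 v)).symm
      rw [← map_zsmul]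
      rfl
    · simp

/-- `θ_k(f, -)` as a multilinear map. -/
def thetaMulti {k : ℕ} (f : NSeq k) (hf : Noncrossing (List.ofFn f.fn)) :
    MultilinearMap ℤ (fun _ : Fin k => C R) (C R) :=
  MultilinearMap.fromDFinsuppEquiv (fun _ : Fin k => ℕ) ℤ (fun q => thetaLin f hf q)

lemma thetaGen_eq {k : ℕ} (f : NSeq k) (hf : Noncrossing (List.ofFn f.fn)) (x : Fin k → C R) :
    thetaGen f x = thetaMulti f hf x := by
  classical
  refine Eq.trans ?_ (MultilinearMap.fromDFinsuppEquiv_apply (κ := fun _ : Fin k => ℕ) (R := ℤ)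
    (M := fun _ p => normalized R p) (N := C R) (fun q => thetaLin f hf q) x).symm
  rw [thetaGen]
  rfl

lemma thetaMulti_hom {k : ℕ} (f : NSeq k) (hf : Noncrossing (List.ofFn f.fn)) (z : Fin k → HC R) :
    thetaMulti f hf (fun i => hom (z i)) = thetaHom f (fun i => (z i).1) (fun i => (z i).2) := by
  have := MultilinearMap.fromDFinsuppEquiv_single (κ := fun _ : Fin k => ℕ) (R := ℤ)
    (M := fun _ p => normalized R p) (N := C R) (fun q : Fin k → ℕ => thetaLin (R := R) f hf q)
    (fun i => (z i).1) (fun i => (z i).2)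
  exact this

lemma theta_single {k : ℕ} (f : NSeq k) (x : Fin k → C R) :
    theta R k (Finsupp.single f 1) x = thetaGen f x := by
  rw [theta, Finsupp.linearCombination_single, one_smul]

/-- The value of `θ_k(h, x)` for an arbitrary, possibly degenerate, sequence. -/
theorem ev_theta_cls {m k : ℕ} {h : Fin m → Fin k} (hh : Noncrossing (List.ofFn h))
    (z : Fin k → HC R) (p : ℕ) (r : ℕ → R) :
    ev p r (theta R k (cls h) fun i => hom (z i)) =
      if p + m = ∑ i, deg (toG z) i + k then ∑ n ∈ Mult h (deg (toG z)),
        (thetaExp h (deg (toG z)) n).negOnePow • val (toG z) (fill r 0 (bexp h n))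
      else 0 := by
  unfold cls
  split_ifs with hn hp hp
  · rw [theta_single, thetaGen_eq _ hh, thetaMulti_hom, ev_thetaHom _ hh, if_pos hp]
  · rw [theta_single, thetaGen_eq _ hh, thetaMulti_hom, ev_thetaHom _ hh, if_neg hp]
  · rw [map_zero, Pi.zero_apply, map_zero]
    -- A sequence for which `Mult` is nonempty is surjective, so its degeneracy comes from two equal
    -- neighbouring entries. Their blocks put equal letters side by side without a bar, and every
    -- term vanishes by `val_eq_zero_of_adjacent`.
    refine (Finset.sum_eq_zero fun n hn' => ?_).symm
    have hs := surjective_of_mem_Mult hn'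
    have : ∃ j j' : Fin m, (j : ℕ) + 1 = j' ∧ h j = h j' := by
      by_contra hne
      push Not at hne
      exact hn ⟨hs, hne⟩
    obtain ⟨j, j', hj, he⟩ := this
    have hg := good_fill_bexp (R := R) hh hn' r 0
    have hsplit : List.finRange m = (List.finRange m).take j ++ j :: j' ::
        (List.finRange m).drop (j' + 1) := by
      conv_lhs => rw [← List.take_append_drop j (List.finRange m)]
      congr 1
      rw [List.drop_eq_getElem_cons (by simp), hj, List.drop_eq_getElem_cons (by simp)]
      simp
    obtain ⟨b₁, hb₁⟩ := blk_eq_append (h j) (n j)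
    obtain ⟨b₂, hb₂⟩ := blk_eq_cons (h j) (n j')
    have hword : bexp h n = ((List.finRange m).take j).flatMap (fun j => blk (h j) (n j)) ++ b₁ ++
        some (h j) :: some (h j) ::
          (b₂ ++ ((List.finRange m).drop (j' + 1)).flatMap fun j => blk (h j) (n j)) := by
      rw [bexp]
      conv_lhs => rw [hsplit]
      rw [List.flatMap_append, List.flatMap_cons, List.flatMap_cons, hb₁, ← he, hb₂]
      simp
    rw [hword] at hg ⊢
    rw [fill_append, fill_some, fill_some] at hg ⊢
    rw [val_eq_zero_of_adjacent (by exact (z (h j)).2.2) hg, smul_zero]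
  · rw [map_zero, Pi.zero_apply, map_zero]

lemma cls_fn {k : ℕ} (f : NSeq k) : cls f.fn = Finsupp.single f 1 := by
  rw [cls, dif_pos f.nondeg]

theorem theta_multilinear {k : ℕ} {s : S k} (hs : s ∈ Sub 2 k) :
    ∃ Φ : MultilinearMap ℤ (fun _ : Fin k => C R) (C R), ∀ x, theta R k s x = Φ x := by
  classical
  have key : ∀ f : NSeq k, ∃ Φ : MultilinearMap ℤ (fun _ : Fin k => C R) (C R),
      complexity f.fn ≤ 2 → ∀ x, thetaGen f x = Φ x := by
    intro f
    by_cases hf : complexity f.fn ≤ 2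
    · exact ⟨thetaMulti f (complexity_le_two_iff.1 hf), fun _ => thetaGen_eq f _⟩
    · exact ⟨0, fun h => absurd h hf⟩
  choose Φ hΦ using key
  refine ⟨∑ f ∈ s.support, s f • Φ f, fun x => ?_⟩
  rw [theta, Finsupp.linearCombination_apply, Finsupp.sum, Finset.sum_apply,
    sum_apply]
  refine Finset.sum_congr rfl fun f hf => ?_
  rw [Pi.smul_apply, smul_apply,
    hΦ f ((Finsupp.mem_supported ℤ s).1 hs hf)]

end Hochschild

namespace Hochschild

open SeqOperad

variable {R : Type*} [Ring R]

/-! ## Degree, unit and naturality -/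

theorem ev_theta_single {k : ℕ} {f : NSeq k} (hf : complexity f.fn ≤ 2)
    (z : Fin k → HC R) (p : ℕ) (r : ℕ → R) :
    ev p r (theta R k (Finsupp.single f 1) fun i => hom (z i)) =
      if p + f.len = ∑ i, deg (toG z) i + k then ∑ n ∈ Mult f.fn (deg (toG z)),
        (thetaExp f.fn (deg (toG z)) n).negOnePow • val (toG z) (fill r 0 (bexp f.fn n))
      else 0 := by
  rw [← cls_fn, ev_theta_cls (complexity_le_two_iff.1 hf)]

lemma eq_zero_of_ev {c : C R} {p : ℕ} (h : ∀ r, ev p r c = 0) : c p = 0 := by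
  refine Subtype.ext (MultilinearMap.ext fun r => ?_)
  have := h fun n => if hn : n < p then r ⟨n, hn⟩ else 0
  simpa [ev] using this

theorem theta_degree {k : ℕ} {f : NSeq k} (hf : complexity f.fn ≤ 2) (z : Fin k → HC R) {p : ℕ}
    (hp : theta R k (Finsupp.single f 1) (fun i => hom (z i)) p ≠ 0) :
    (p : ℤ) = (∑ i, ((z i).1 : ℤ)) - f.degree := by
  by_contra hne
  refine hp (eq_zero_of_ev fun r => ?_)
  rw [ev_theta_single hf, if_neg]
  intro h
  refine hne ?_
  have h' := congrArg (Nat.cast : ℕ → ℤ) h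
  push_cast at h'
  rw [NSeq.degree]
  change (p : ℤ) + f.len = ∑ i, ((z i).1 : ℤ) + k at h'
  linarith

lemma complexity_unitSeq : complexity unitSeq.fn ≤ 2 := by
  rw [complexity_le_two_iff]
  intro a c hac _
  exact hac (Subsingleton.elim a c)

lemma mult_id (q : Fin 1 → ℕ) : Mult (id : Fin 1 → Fin 1) q = {q} := by
  ext n
  rw [mem_Mult, Finset.mem_singleton]
  refine ⟨fun h => funext fun i => ?_, fun h i => ?_⟩
  · have := h i
    simpa [Subsingleton.elim i 0] using this
  · simp [h, Subsingleton.elim i 0]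

lemma thetaExp_id (q n : Fin 1 → ℕ) : thetaExp (id : Fin 1 → Fin 1) q n = 0 := by
  have h1 : tau (id : Fin 1 → Fin 1) 0 = 1 := by simp [tau, Finset.filter_singleton]
  simp [thetaExp, eps, h1, entry]

/-- For a single letter the only possible multiplicity is `|x|`; the word is one block with `|x|`
bars, and filling the bars with the arguments returns `x`. -/
lemma theta_unit_hom (x : HC R) :
    theta R 1 (Finsupp.single unitSeq 1) (fun _ => hom x) = hom x := by
  refine ev_ext fun p r => ?_
  have hc : cls (id : Fin 1 → Fin 1) = Finsupp.single unitSeq 1 := cls_fn unitSeq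
  rw [← hc]
  refine (ev_theta_cls (h := (id : Fin 1 → Fin 1))
    (complexity_le_two_iff.1 complexity_unitSeq) (fun _ => x) p r).trans ?_
  rw [mult_id, Finset.sum_singleton, thetaExp_id, ev_hom]
  have hdeg : deg (toG fun _ : Fin 1 => x) = fun _ => x.1 := rfl
  have hword : bexp (id : Fin 1 → Fin 1) (deg (toG fun _ : Fin 1 => x)) = blk 0 x.1 := by
    rw [hdeg]
    simp [bexp, List.finRange_succ]
  rw [hword, fill_blk, hdeg, Int.negOnePow_zero, one_smul]
  have hsum : ∑ _i : Fin 1, x.1 + 1 = x.1 + 1 := by simp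
  rw [hsum]
  by_cases hp : x.1 = p
  · rw [if_pos (by omega), if_pos hp]
    have := val_seg (toG fun _ : Fin 1 => x) (i := 0) (v := [])
      (L := (List.range x.1).map fun t => [Sum.inr (r (0 + t))]) (by simp) (by simp)
      (by simp [toG])
    rw [List.append_nil, val_nil, mul_one] at this
    rw [this]
    refine congrArg x.2.1 (funext fun t => ?_)
    dsimp only
    rw [List.getD_eq_getElem _ _ (by
      rw [List.length_map, List.length_range]; exact t.2)]
    simp
  · rw [if_neg (by omega), if_neg hp]

theorem theta_unit (x : Fin 1 → C R) : theta R 1 (Finsupp.single unitSeq 1) x = x 0 := by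
  obtain ⟨Φ, hΦ⟩ := theta_multilinear (R := R) (s := Finsupp.single unitSeq 1)
    (isSuboperad_two.unit_mem)
  rw [hΦ]
  have hx : x = fun _ => x 0 := funext fun i => by rw [Subsingleton.elim i 0]
  -- Both sides are additive in `x 0`, so homogeneous cochains suffice.
  let φ : C R →ₗ[ℤ] C R := (MultilinearMap.ofSubsingleton ℤ (C R) (C R) (0 : Fin 1)).symm Φ
  have hφ : ∀ c, φ c = Φ fun _ => c := fun c => rfl
  rw [hx, ← hφ]
  have : φ.toAddMonoidHom = AddMonoidHom.id (C R) := by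
    refine DirectSum.addHom_ext fun q y => ?_
    refine (hφ _).trans ((hΦ _).symm.trans ?_)
    exact theta_unit_hom ⟨q, y⟩
  exact DFunLike.congr_fun this (x 0)

/-! ### Naturality under isomorphisms of rings. -/

section Transport

variable {R' : Type*} [Ring R']

lemma val_transport {ι : Type*} [DecidableEq ι] (e : R →+* R') {z : ι → GCoch R}
    {z' : ι → GCoch R'} (hdeg : ∀ i, (z' i).1 = (z i).1)
    (hz : ∀ i r, app (z' i) (fun t => e (r t)) = e (app (z i) r)) (b : List (ι ⊕ R)) :
    val z' (b.map (Sum.map id e)) = e (val z b) := by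
  have hletters : ∀ b : List (ι ⊕ R), letters (b.map (Sum.map id e)) = letters b := by
    intro b
    induction b with
    | nil => rfl
    | cons s b ih => rcases s with k | r <;> simp [ih]
  induction hb : b.length using Nat.strong_induction_on generalizing b with
  | _ N ih =>
    subst hb
    rcases b with _ | ⟨i | r, b⟩
    · simp
    · obtain ⟨L, v, rfl, hL, hv⟩ := exists_seg i b
      rw [List.map_cons, List.map_append, map_seg, Sum.map_inl, id, val, val, splitOnP_seg hL hv,
        splitOnP_seg (fun A hA => ?_) ((hletters v).symm ▸ hv)]
      · have key : ∀ t, val z' ((L.map (List.map (Sum.map id e)) ++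
            [v.map (Sum.map id e)]).getD t []) = e (val z ((L ++ [v]).getD t [])) := by
          intro t
          have hlt : ((L ++ [v]).getD t []).length <
              (Sum.inl i :: (seg (Sum.inl i) L ++ v)).length := by
            rw [← splitOnP_seg hL hv]
            exact Nat.lt_succ_of_le (splitOnP_getD_length_le _ _ _)
          rw [← ih _ hlt _ rfl]
          congr 1
          have : L.map (List.map (Sum.map id e)) ++ [v.map (Sum.map id e)] =
            (L ++ [v]).map (List.map (Sum.map id e)) := by simp
          rw [this]
          exact List.getD_map (d := []) (f := List.map (Sum.map id e)) (n := t) (l := L ++ [v])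
        rw [key, map_mul, hdeg, ← hz]
        congr 2
        exact funext key
      · obtain ⟨B, hB, rfl⟩ := List.mem_map.1 hA
        rw [hletters]
        exact hL B hB
    · rw [List.map_cons, Sum.map_inr, val_inr, val_inr, ih b.length (by simp) b rfl, map_mul]

lemma fill_map {ι : Type*} (e : R →+* R') (r : ℕ → R) (s : ℕ) (b : List (Option ι)) :
    fill (fun t => e (r t)) s b = (fill r s b).map (Sum.map id e) := by
  induction b generalizing s with
  | nil => rfl
  | cons c b ih => cases c <;> simp [ih]

lemma ev_transport (e : R ≃+* R') (p : ℕ) (r : ℕ → R) (c : C R) :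
    ev p (fun t => e (r t)) (transport e c) = e (ev p r c) := by
  change e ((c p).1 fun i => e.symm (e (r i))) = e ((c p).1 fun i => r i)
  simp

/-- The image of a homogeneous cochain under an isomorphism of rings. -/
def homTransport (e : R ≃+* R') (x : HC R) : HC R' := ⟨x.1, transport e (hom x) x.1⟩

lemma transport_hom (e : R ≃+* R') (x : HC R) : transport e (hom x) = hom (homTransport e x) := by
  rw [hom, hom, homTransport, transport, hom, DirectSum.map_of, DirectSum.of_eq_same]

lemma app_homTransport (e : R ≃+* R') {ι : Type*} (z : ι → HC R) (i : ι) (r : ℕ → R) :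
    app (toG (fun i => homTransport e (z i)) i) (fun t => e (r t)) = e (app (toG z i) r) := by
  have h1 := ev_hom (z i).1 (fun t => e (r t)) (homTransport e (z i))
  have h2 := ev_hom (z i).1 r (z i)
  rw [if_pos (show (homTransport e (z i)).1 = (z i).1 from rfl)] at h1
  rw [if_pos rfl] at h2
  rw [← transport_hom, ev_transport, h2] at h1
  exact h1.symm

lemma transport_thetaMulti_hom (e : R ≃+* R') {k : ℕ} {f : NSeq k} (hf : complexity f.fn ≤ 2)
    (z : Fin k → HC R) :
    transport e (theta R k (Finsupp.single f 1) fun i => hom (z i)) =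
      theta R' k (Finsupp.single f 1) fun i => transport e (hom (z i)) := by
  refine ev_ext fun p r => ?_
  obtain ⟨r, rfl⟩ : ∃ r₀ : ℕ → R, r = fun t => e (r₀ t) :=
    ⟨fun t => e.symm (r t), by simp⟩
  rw [ev_transport]
  simp only [transport_hom]
  rw [ev_theta_single hf, ev_theta_single hf]
  have hdeg : deg (toG fun i => homTransport e (z i)) = deg (toG z) := rfl
  rw [hdeg]
  split_ifs
  · rw [map_sum]
    refine Finset.sum_congr rfl fun n _ => ?_
    rw [Units.smul_def, Units.smul_def, map_zsmul]
    congr 1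
    refine (val_transport (e : R →+* R') (fun _ => rfl) (app_homTransport e z) _).symm.trans ?_
    rw [← fill_map]
    rfl
  · exact map_zero e

lemma transport_of_apply (e : R ≃+* R') (c : C R) (p : ℕ) :
    transport e (hom ⟨p, c p⟩) p = transport e c p := by
  refine Subtype.ext (MultilinearMap.ext fun r => ?_)
  change e (((DirectSum.of (fun p => normalized R p) p (c p)) p).1 fun i => e.symm (r i)) =
    e ((c p).1 fun i => e.symm (r i))
  have := DirectSum.of_eq_same (β := fun p => normalized R p) p (c p)
  exact congrArg (fun y : normalized R p => e (y.1 fun i => e.symm (r i))) this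

lemma transport_apply_eq_zero (e : R ≃+* R') (c : C R) (p : ℕ) :
    transport e c p = 0 ↔ c p = 0 := by
  refine ⟨fun h => eq_zero_of_ev fun r => ?_, fun h => eq_zero_of_ev fun r => ?_⟩
  · have h1 := ev_transport e p r c
    have h2 : ev p (fun t => e (r t)) (transport e c) = 0 :=
      congrArg (fun y : normalized R' p => y.1 fun i => e (r i)) h
    rw [h2] at h1
    exact (map_eq_zero_iff e e.injective).1 h1.symm
  · have h1 := ev_transport e p (fun t => e.symm (r t)) c
    have h2 : ev p (fun t => e.symm (r t)) c = 0 :=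
      congrArg (fun y : normalized R p => y.1 fun i => e.symm (r i)) h
    rw [h2, map_zero] at h1
    simpa using h1

theorem transport_theta (e : R ≃+* R') {k : ℕ} {s : S k} (hs : s ∈ Sub 2 k) (x : Fin k → C R) :
    transport e (theta R k s x) = theta R' k s fun i => transport e (x i) := by
  classical
  have key : ∀ f : NSeq k, complexity f.fn ≤ 2 → transport e (thetaGen f x) =
      thetaGen f fun i => transport e (x i) := by
    intro f hf
    have hf' := complexity_le_two_iff.1 hf
    have h1 : ∀ q : Fin k → ℕ, transport e (thetaHom f q fun i => x i (q i)) =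
        thetaHom f q fun i => transport e (x i) (q i) := by
      intro q
      have := transport_thetaMulti_hom e hf fun i => ⟨q i, x i (q i)⟩
      simp only [transport_hom] at this
      rw [theta_single, theta_single, thetaGen_eq f hf', thetaGen_eq f hf', thetaMulti_hom,
        thetaMulti_hom] at this
      refine this.trans (congrArg (thetaHom f q) (funext fun i => ?_))
      exact transport_of_apply e (x i) (q i)
    -- `thetaGen` sums over the supports of its arguments, so these have to be compared as well.
    have h2 : ∀ i, DFinsupp.support (transport e (x i)) = DFinsupp.support (x i) := by
      intro i
      ext p
      rw [DFinsupp.mem_support_iff, DFinsupp.mem_support_iff, not_iff_not]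
      exact transport_apply_eq_zero e (x i) p
    rw [thetaGen, thetaGen, map_sum]
    simp only [h2]
    exact Finset.sum_congr rfl fun q _ => h1 q
  rw [theta, theta, Finsupp.linearCombination_apply, Finsupp.linearCombination_apply, Finsupp.sum,
    Finsupp.sum, Finset.sum_apply, Finset.sum_apply, map_sum]
  refine Finset.sum_congr rfl fun f hf => ?_
  rw [Pi.smul_apply, Pi.smul_apply, ← key f ((Finsupp.mem_supported ℤ s).1 hs hf)]
  refine ev_ext fun p r => ?_
  obtain ⟨r, rfl⟩ : ∃ r₀ : ℕ → R, r = fun t => e (r₀ t) := ⟨fun t => e.symm (r t), by simp⟩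
  rw [ev_transport, ev_zsmul, ev_zsmul, ev_transport, map_zsmul]

end Transport

end Hochschild

namespace Hochschild

open SeqOperad

variable {R : Type*} [Ring R]

/-! ## The differential of the value of a word -/

section Slots

variable {ι : Type*} [DecidableEq ι]

/-- The sequence `r_0, …, r_j r_{j+1}, …`. -/
def mulAt (r : ℕ → R) (j t : ℕ) : R :=
  if t < j then r t else if t = j then r j * r (j + 1) else r (t + 1)

lemma d_hom (x : HC R) : d R (hom x) = hom ⟨x.1 + 1, ⟨diff x.2.1, diff_mem x.2.2⟩⟩ := by
  have h := DirectSum.toModule_lof (R := ℤ) (ι := ℕ) (M := fun p => normalized R p) (N := C R)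
    (φ := fun p => (DirectSum.lof ℤ ℕ (fun p => normalized R p) (p + 1)) ∘ₗ
      (AddMonoidHom.mk' (fun x : normalized R p =>
        (⟨diff x.1, diff_mem x.2⟩ : normalized R (p + 1)))
        (fun x y => Subtype.ext (diff_add x.1 y.1))).toIntLinearMap) x.1 x.2
  exact h

lemma ev_d_zero (r : ℕ → R) (c : C R) : ev 0 r (d R c) = 0 := by
  let A : C R →+ R := (ev 0 r).comp (d R).toAddMonoidHom
  suffices h : A = 0 from DFunLike.congr_fun h c
  refine DirectSum.addHom_ext fun q y => ?_
  refine (congrArg (ev 0 r) (d_hom ⟨q, y⟩)).trans ?_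
  rw [ev_hom, if_neg (Nat.succ_ne_zero q)]
  rfl

/-- Both sides are additive in `c`; on a homogeneous cochain this is `diff_apply`, with the
arguments indexed by `ℕ`. -/
lemma ev_d (p : ℕ) (r : ℕ → R) (c : C R) : ev (p + 1) r (d R c) =
    r 0 * ev p (fun t => r (t + 1)) c +
      ∑ j ∈ Finset.range p, ((j : ℤ) + 1).negOnePow • ev p (mulAt r j) c +
      ((p : ℤ) + 1).negOnePow • (ev p r c * r p) := by
  let A : C R →+ R := (ev (p + 1) r).comp (d R).toAddMonoidHom
  let B : C R →+ R := (AddMonoidHom.mulLeft (r 0)).comp (ev p fun t => r (t + 1)) +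
    ∑ j ∈ Finset.range p, (((j : ℤ) + 1).negOnePow : ℤ) • ev p (mulAt r j) +
    (((p : ℤ) + 1).negOnePow : ℤ) • (AddMonoidHom.mulRight (r p)).comp (ev p r)
  have hB : ∀ c, B c = r 0 * ev p (fun t => r (t + 1)) c +
      ∑ j ∈ Finset.range p, ((j : ℤ) + 1).negOnePow • ev p (mulAt r j) c +
      ((p : ℤ) + 1).negOnePow • (ev p r c * r p) := by
    intro c
    simp only [B, AddMonoidHom.add_apply, AddMonoidHom.finsetSum_apply, AddMonoidHom.smul_apply,
      AddMonoidHom.comp_apply, AddMonoidHom.coe_mulLeft, AddMonoidHom.mulRight_apply,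
      Units.smul_def]
  rw [← hB c]
  suffices h : A = B from DFunLike.congr_fun h c
  refine DirectSum.addHom_ext fun q y => ?_
  refine (congrArg (ev (p + 1) r) (d_hom ⟨q, y⟩)).trans ?_
  rw [hB, ev_hom]
  change _ = r 0 * ev p _ (hom ⟨q, y⟩) + ∑ j ∈ Finset.range p, _ • ev p _ (hom ⟨q, y⟩) +
    _ • (ev p r (hom ⟨q, y⟩) * r p)
  simp only [ev_hom]
  by_cases hq : q = p
  · subst hq
    simp only [if_true]
    refine (diff_apply y.1 _).trans ?_
    have hpow : ∀ n : ℕ, ∀ x : R, ((-1 : ℤ) ^ n) • x = ((n : ℤ).negOnePow) • x := by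
      intro n x
      rw [Units.smul_def, Int.negOnePow_def]
      simp
    rw [Finset.sum_range]
    congr 1
    · congr 1
      refine Finset.sum_congr rfl fun j _ => ?_
      rw [hpow]
      push_cast
      congr 1
      refine congrArg y.1 (funext fun t => ?_)
      simp only [Fin.contractNth, mulAt, Fin.val_castSucc, Fin.val_succ]
      split_ifs with h1 h2
      · rfl
      · rw [h2]
      · rfl
  · rw [if_neg (by simpa using hq)]
    simp [hq]

/-- The word with bars obtained from `c | c | ⋯ | c` (`n` bars) by deleting the letter number `s`. -/
def delblk (c : ι) : ℕ → ℕ → List (Option ι)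
  | 0, _ => []
  | n + 1, 0 => none :: blk c n
  | n + 1, s + 1 => some c :: none :: delblk c n s

/-- The signed value of the word obtained by inserting a bar between `u` and `v`. -/
def slot (z : ι → GCoch R) (r : ℕ → R) (u v : List (Option ι)) : R :=
  (bars u : ℤ).negOnePow • val z (fill r 0 (u ++ none :: v))

/-- The sum of the values of the slots in front of the bars of `w`. -/
def slotSum (z : ι → GCoch R) (r : ℕ → R) :
    List (Option ι) → List (Option ι) → List (Option ι) → R
  | _, [], _ => 0
  | u, none :: w, v => slot z r u (none :: (w ++ v)) + slotSum z r (u ++ [none]) w v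
  | u, some c :: w, v => slotSum z r (u ++ [some c]) w v

lemma slotSum_append (z : ι → GCoch R) (r : ℕ → R) (u w w' v : List (Option ι)) :
    slotSum z r u (w ++ w') v = slotSum z r u w (w' ++ v) + slotSum z r (u ++ w) w' v := by
  induction w generalizing u with
  | nil => simp [slotSum]
  | cons c w ih =>
    rcases c with _ | c
    · simp only [List.cons_append, slotSum, ih, List.append_assoc, List.nil_append, add_assoc]
    · simp only [List.cons_append, slotSum, ih, List.append_assoc, List.nil_append]

/-- The part of the differential of the word `u ++ w ++ v` that comes from `w`. -/
def edge (z : ι → GCoch R) (r : ℕ → R) (u w v : List (Option ι)) : R :=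
  slot z r u (w ++ v) - slot z r (u ++ w) v - slotSum z r u w v

/-- The slot between `w` and `w'` enters once with each sign and cancels. -/
lemma edge_append (z : ι → GCoch R) (r : ℕ → R) (u w w' v : List (Option ι)) :
    edge z r u (w ++ w') v = edge z r u w (w' ++ v) + edge z r (u ++ w) w' v := by
  simp only [edge, slotSum_append, List.append_assoc]
  abel

/-- A bar can be put into a block with `n` bars in front of it, before one of its bars, or behind
it. These `n + 2` insertions are the deletions of the first, an inner or the last letter from the
block with `n + 1` bars; an inner deletion leaves two adjacent bars. -/
lemma edge_blk (z : ι → GCoch R) (r : ℕ → R) (c : ι) (n : ℕ) (u v : List (Option ι)) :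
    edge z r u (blk c n) v = ∑ s ∈ Finset.range (n + 2),
      ((bars u : ℤ) + s).negOnePow • val z (fill r 0 (u ++ delblk c (n + 1) s ++ v)) := by
  induction n generalizing u with
  | zero =>
    simp [edge, slot, slotSum, blk, delblk, Finset.sum_range_succ, Int.negOnePow_succ, ← sub_eq_add_neg]
  | succ n ih =>
    have h : blk c (n + 1) = [some c, none] ++ blk c n := rfl
    rw [h, edge_append, ih, Finset.sum_range_succ' _ (n + 2), add_comm]
    congr 1
    · refine Finset.sum_congr rfl fun s _ => ?_
      simp only [delblk, bars_append, bars_some, bars_none, bars_nil, List.append_assoc, List.cons_append,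
        List.nil_append]
      congr 2
      push_cast
      ring
    · simp [edge, slot, slotSum, delblk, blk, Int.negOnePow_succ]

lemma edge_flatMap (z : ι → GCoch R) (r : ℕ → R) {A : Type*} (F : A → List (Option ι)) (l : List A)
    (u v : List (Option ι)) :
    edge z r u (l.flatMap F) v = ∑ j : Fin l.length,
      edge z r (u ++ (l.take j).flatMap F) (F (l.get j)) ((l.drop (j + 1)).flatMap F ++ v) := by
  induction l generalizing u with
  | nil => simp [edge, slotSum]
  | cons a l ih =>
    rw [List.flatMap_cons, edge_append, ih]
    refine Eq.trans ?_ (Fin.sum_univ_succ (n := l.length) (fun j => edge z r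
      (u ++ ((a :: l).take j).flatMap F) (F ((a :: l).get j))
        (((a :: l).drop (j + 1)).flatMap F ++ v))).symm
    simp

/-- Two adjacent ring entries form a closed word, whose value is their product. -/
lemma val_mul_inr {z : ι → GCoch R} {x y : List (ι ⊕ R)} (h : Good (deg z) (letters (x ++ y)))
    (a b : R) : val z (x ++ Sum.inr a :: Sum.inr b :: y) = val z (x ++ Sum.inr (a * b) :: y) := by
  obtain ⟨φ, hφ⟩ := exists_context z h
  have h1 := hφ z (fun _ _ => rfl) [Sum.inr a, Sum.inr b] (by simpa using Good.nil _) (by simp)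
  have h2 := hφ z (fun _ _ => rfl) [Sum.inr (a * b)] (by simpa using Good.nil _) (by simp)
  simp only [List.append_assoc, List.cons_append, List.nil_append, val_inr, val_nil, mul_one]
    at h1 h2
  rw [h1, h2]

lemma fill_mulAt (r : ℕ → R) (u v : List (Option ι)) : ∃ x y : List (ι ⊕ R),
    fill r 0 (u ++ none :: none :: v) =
      x ++ Sum.inr (r (bars u)) :: Sum.inr (r (bars u + 1)) :: y ∧
    fill (mulAt r (bars u)) 0 (u ++ none :: v) =
      x ++ Sum.inr (r (bars u) * r (bars u + 1)) :: y := by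
  refine ⟨fill r 0 u, fill r (bars u + 2) v, by simp, ?_⟩
  rw [fill_append, fill_none, zero_add, fill_congr (r' := r) (s' := 0) fun t ht => ?_,
    fill_congr (b := v) (r' := r) (s' := bars u + 2) fun t ht => ?_]
  · simp [mulAt]
  · rw [mulAt, if_neg (by omega), if_neg (by omega)]
    congr 1
    omega
  · rw [mulAt, if_pos (by omega)]

/-- Inserting a bar in front of a bar makes two consecutive arguments adjacent, and they are
multiplied. -/
lemma slotSum_eq {z : ι → GCoch R} (r : ℕ → R) (u w v : List (Option ι))
    (h : Good (deg z) (u ++ w ++ v).reduceOption) :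
    slotSum z r u w v = ∑ t ∈ Finset.range (bars w),
      ((bars u : ℤ) + t).negOnePow • val z (fill (mulAt r (bars u + t)) 0 (u ++ w ++ v)) := by
  induction w generalizing u with
  | nil => simp [slotSum]
  | cons c w ih =>
    rcases c with _ | c
    · rw [slotSum, ih _ (by simpa using h), bars_none, Finset.sum_range_succ', add_comm]
      congr 1
      · refine Finset.sum_congr rfl fun s _ => ?_
        simp only [bars_append, bars_none, bars_nil, List.append_assoc, List.cons_append,
          List.nil_append]
        congr 2
        · push_cast; ring
        · congr 2; ring
      · obtain ⟨x, y, hx, hy⟩ := fill_mulAt r u (w ++ v)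
        have hg : Good (deg z) (letters (x ++ y)) := by
          have : letters (fill (mulAt r (bars u)) 0 (u ++ none :: (w ++ v))) =
            (u ++ none :: (w ++ v)).reduceOption := letters_fill _ _ _
          rw [hy] at this
          simp only [letters_append, letters_inr] at this ⊢
          rw [this]
          simpa using h
        simp only [slot, hx, Nat.cast_zero, add_zero, List.append_assoc, List.cons_append]
        rw [val_mul_inr hg, ← hy]
    · rw [slotSum, ih _ (by simpa using h)]
      simp

/-- The first slot gives the term with `r 0` as left factor, the last slot the term with a right
factor, and the slots at the bars give the products of consecutive arguments. Together they are the
Hochschild differential of the value of `w`. -/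
theorem edge_eq {z : ι → GCoch R} (r : ℕ → R) (w : List (Option ι))
    (h : Good (deg z) w.reduceOption) :
    edge z r [] w [] = r 0 * val z (fill (fun t => r (t + 1)) 0 w) +
      ∑ j ∈ Finset.range (bars w), ((j : ℤ) + 1).negOnePow • val z (fill (mulAt r j) 0 w) +
      ((bars w : ℤ) + 1).negOnePow • (val z (fill r 0 w) * r (bars w)) := by
  have h1 : fill r 1 w = fill (fun t => r (t + 1)) 0 w :=
    fill_congr fun t _ => by rw [zero_add, add_comm]
  have h2 : val z (fill r 0 w ++ [Sum.inr (r (bars w))]) = val z (fill r 0 w) * r (bars w) := by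
    rw [val_append (by rw [letters_fill]; exact h) (by simp)]
    simp
  rw [edge, slotSum_eq r [] w [] (by simpa using h)]
  simp [slot, h1, h2, Int.negOnePow_succ, sub_eq_add_neg]
  abel

end Slots

end Hochschild

namespace Hochschild

open SeqOperad

variable {R : Type*} [Ring R]

/-! ## Deleting a letter of an expansion -/

section Blocks

variable {ι : Type*} [DecidableEq ι]

/-- The word obtained by deleting the occurrence number `s` of the letter `i`. -/
def eraseLetter (i : ι) : ℕ → List (ι ⊕ R) → List (ι ⊕ R)
  | _, [] => []
  | s, Sum.inr r :: b => Sum.inr r :: eraseLetter i s b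
  | 0, Sum.inl c :: b => if c = i then b else Sum.inl c :: eraseLetter i 0 b
  | s + 1, Sum.inl c :: b =>
    if c = i then Sum.inl c :: eraseLetter i s b else Sum.inl c :: eraseLetter i (s + 1) b

lemma eraseLetter_append (i : ι) (s : ℕ) (u w : List (ι ⊕ R)) :
    eraseLetter i ((letters u).count i + s) (u ++ w) = u ++ eraseLetter i s w := by
  induction u with
  | nil => simp
  | cons c u ih =>
    rcases c with c | r
    · by_cases hc : c = i
      · subst hc
        rw [letters_inl, List.count_cons_self, add_right_comm, List.cons_append, eraseLetter,
          if_pos rfl, ih, List.cons_append]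
      · rw [letters_inl, List.count_cons_of_ne hc, List.cons_append, List.cons_append, ← ih]
        generalize (letters u).count i + s = t
        cases t <;> rw [eraseLetter, if_neg hc]
    · rw [letters_inr, List.cons_append, eraseLetter, ih, List.cons_append]

lemma eraseLetter_blk (c : ι) (r : ℕ → R) (t : ℕ) {n s : ℕ} (hs : s ≤ n) (w : List (ι ⊕ R)) :
    eraseLetter c s (fill r t (blk c n) ++ w) = fill r t (delblk c n s) ++ w := by
  induction n generalizing s t with
  | zero =>
    obtain rfl : s = 0 := by omega
    simp [blk, delblk, eraseLetter]
  | succ n ih =>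
    rcases s with _ | s
    · simp [blk, delblk, eraseLetter]
    · simp [blk, delblk, eraseLetter, ih (t + 1) (show s ≤ n by omega)]

lemma bars_delblk (c : ι) {n s : ℕ} (hs : s ≤ n) : bars (delblk c n s) = n := by
  induction n generalizing s with
  | zero => rfl
  | succ n ih =>
    rcases s with _ | s
    · simp [delblk]
    · simp [delblk, ih (show s ≤ n by omega)]

variable {m : ℕ}

/-- The part of an expansion in front of the block number `j`. -/
def before (h : Fin m → ι) (n : Fin m → ℕ) (j : Fin m) : List (Option ι) :=
  ((List.finRange m).take j).flatMap fun j' => blk (h j') (n j')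

/-- The part of an expansion behind the block number `j`. -/
def after (h : Fin m → ι) (n : Fin m → ℕ) (j : Fin m) : List (Option ι) :=
  ((List.finRange m).drop (j + 1)).flatMap fun j' => blk (h j') (n j')

lemma finRange_split (j : Fin m) : List.finRange m =
    (List.finRange m).take j ++ j :: (List.finRange m).drop (j + 1) := by
  conv_lhs => rw [← List.take_append_drop j (List.finRange m)]
  congr 1
  rw [List.drop_eq_getElem_cons (by simp)]
  simp

lemma bexp_split (h : Fin m → ι) (n : Fin m → ℕ) (j : Fin m) :
    bexp h n = before h n j ++ (blk (h j) (n j) ++ after h n j) := by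
  rw [bexp]
  conv_lhs => rw [finRange_split j]
  rw [List.flatMap_append, List.flatMap_cons]
  rfl

lemma mem_take_finRange {j j' : Fin m} (h : j' ∈ (List.finRange m).take j) : j' < j := by
  obtain ⟨i, hi, rfl⟩ := List.getElem_of_mem h
  rw [List.length_take] at hi
  rw [List.getElem_take, List.getElem_finRange, Fin.lt_def]
  simp
  omega

lemma mem_drop_finRange {j j' : Fin m} (h : j' ∈ (List.finRange m).drop (j + 1)) : j < j' := by
  obtain ⟨i, hi, rfl⟩ := List.getElem_of_mem h
  rw [List.getElem_drop, List.getElem_finRange, Fin.lt_def]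
  simp
  omega

lemma before_congr (h : Fin m → ι) {n n' : Fin m → ℕ} {j : Fin m} (hn : ∀ j' ≠ j, n j' = n' j') :
    before h n j = before h n' j :=
  List.flatMap_congr fun j' hj => by rw [hn j' (mem_take_finRange hj).ne]

lemma after_congr (h : Fin m → ι) {n n' : Fin m → ℕ} {j : Fin m} (hn : ∀ j' ≠ j, n j' = n' j') :
    after h n j = after h n' j :=
  List.flatMap_congr fun j' hj => by rw [hn j' (mem_drop_finRange hj).ne']

lemma sum_take_finRange {M : Type*} [AddCommMonoid M] (G : Fin m → M) (j : Fin m) :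
    (((List.finRange m).take j).map G).sum = ∑ j', if j' < j then G j' else 0 := by
  rw [List.map_take, ← List.ofFn_eq_map, List.sum_take_ofFn, Finset.sum_filter]
  rfl

lemma bars_before (h : Fin m → ι) (n : Fin m → ℕ) (j : Fin m) :
    bars (before h n j) = ∑ j', if j' < j then n j' else 0 := by
  rw [before, bars_flatMap]
  simp only [bars_blk]
  exact sum_take_finRange n j

lemma count_before (h : Fin m → ι) (n : Fin m → ℕ) (j : Fin m) (i : ι) :
    (before h n j).reduceOption.count i =
      ∑ j', if j' < j then if h j' = i then n j' + 1 else 0 else 0 := by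
  rw [before, reduceOption_flatMap]
  simp only [reduceOption_blk]
  rw [count_flatMap_replicate, sum_take_finRange]

/-- The alternating sum of the values of the words obtained by deleting a letter of the block
number `j` of an expansion. -/
def blockDel (z : ι → GCoch R) (r : ℕ → R) (h : Fin m → ι) (n : Fin m → ℕ) (j : Fin m) : R :=
  ∑ s ∈ Finset.range (n j + 1), (s : ℤ).negOnePow •
    val z (fill r 0 (before h n j ++ delblk (h j) (n j) s ++ after h n j))

/-- `edge` is additive along the blocks, and by `edge_blk` each block contributes the deletions from
the block enlarged by one bar. The outer sign counts the bars in front of the block. -/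
lemma edge_bexp (z : ι → GCoch R) (r : ℕ → R) (h : Fin m → ι) (n : Fin m → ℕ) :
    edge z r [] (bexp h n) [] = ∑ j, (∑ j', if j' < j then (n j' : ℤ) else 0).negOnePow •
      blockDel z r h (Function.update n j (n j + 1)) j := by
  rw [bexp, edge_flatMap]
  refine Fintype.sum_equiv (finCongr (List.length_finRange)) _ _ fun j => ?_
  set j₀ : Fin m := finCongr List.length_finRange j with hj₀
  have hj : (List.finRange m).get j = j₀ := by simp [hj₀]
  have hjv : (j : ℕ) = j₀ := rfl
  rw [hj, hjv, edge_blk, blockDel, Finset.smul_sum, Function.update_self]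
  have h1 : before h (Function.update n j₀ (n j₀ + 1)) j₀ = before h n j₀ :=
    before_congr h fun j' hj' => Function.update_of_ne hj' _ _
  have h2 : after h (Function.update n j₀ (n j₀ + 1)) j₀ = after h n j₀ :=
    after_congr h fun j' hj' => Function.update_of_ne hj' _ _
  have h3 := bars_before h n j₀
  rw [h1, h2]
  refine Finset.sum_congr rfl fun s _ => ?_
  rw [smul_smul, ← Int.negOnePow_add]
  change ((bars (before h n j₀) : ℤ) + s).negOnePow • val z (fill r 0 (before h n j₀ ++ _ ++
    (after h n j₀ ++ []))) = _
  rw [h3, List.append_nil]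
  push_cast
  rfl

lemma sum_range_sum {M : Type*} [AddCommMonoid M] {m : ℕ} (N : Fin m → ℕ) (G : ℕ → M) :
    ∑ s ∈ Finset.range (∑ j, N j), G s =
      ∑ j, ∑ s ∈ Finset.range (N j), G ((∑ j', if j' < j then N j' else 0) + s) := by
  induction m with
  | zero => simp
  | succ m ih =>
    rw [Fin.sum_univ_castSucc, Finset.sum_range_add, ih, Fin.sum_univ_castSucc]
    congr 1
    · refine Finset.sum_congr rfl fun j _ => Finset.sum_congr rfl fun s _ => ?_
      rw [Fin.sum_univ_castSucc, if_neg (not_lt.2 (Fin.le_last _)), add_zero]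
      rfl
    · refine Finset.sum_congr rfl fun s _ => ?_
      rw [Fin.sum_univ_castSucc, if_neg (lt_irrefl _), add_zero]
      simp only [Fin.castSucc_lt_last, if_true]

lemma neg_one_pow_smul (s : ℕ) (x : R) : (-1 : ℤ) ^ s • x = (s : ℤ).negOnePow • x := by
  rw [Units.smul_def, Int.coe_negOnePow_natCast]

/-- The occurrences of `i` are numbered through the successive blocks with this letter. So the sign
of a deletion is its place within the block plus the number of occurrences in earlier blocks. -/
theorem val_diff_bexp {h : Fin m → ι} {z z' : ι → GCoch R} {i : ι} (hz : ∀ c, c ≠ i → z' c = z c)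
    (hzi : z' i = ⟨(z i).1 + 1, diff (z i).2⟩) {n : Fin m → ℕ}
    (hg : Good (deg z') (expand h n)) (hi : i ∈ expand h n) (r : ℕ → R) :
    val z' (fill r 0 (bexp h n)) = ∑ j, if h j = i then
      (∑ j', if j' < j then if h j' = i then (n j' : ℤ) + 1 else 0 else 0).negOnePow •
        blockDel z r h n j else 0 := by
  have hl : letters (fill r 0 (bexp h n)) = expand h n := by rw [letters_fill, reduceOption_bexp]
  rw [val_diff hz hzi (by rw [hl]; exact hg) (by rw [hl]; exact hi)
    (fun s => val z (eraseLetter i s (fill r 0 (bexp h n)))) ?_]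
  · have hc : (z i).1 + 2 = ∑ j, if h j = i then n j + 1 else 0 := by
      have := hg.count_eq i hi
      rw [count_expand, deg, hzi] at this
      exact this.symm
    rw [hc, sum_range_sum]
    refine Finset.sum_congr rfl fun j _ => ?_
    split_ifs with hj
    · subst hj
      rw [blockDel, Finset.smul_sum]
      refine Finset.sum_congr rfl fun s hs => ?_
      have hs : s ≤ n j := by rw [Finset.mem_range] at hs; omega
      rw [neg_one_pow_smul, smul_smul, ← Int.negOnePow_add, bexp_split h n j, fill_append,
        fill_append, ← count_before h n j (h j), ← letters_fill r 0, eraseLetter_append,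
        eraseLetter_blk _ _ _ hs, letters_fill, count_before, fill_append, fill_append, bars_append,
        bars_delblk _ hs, bars_blk, zero_add, zero_add, List.append_assoc]
      push_cast
      rfl
    · simp
  · intro b₁ b₂ hb
    have := eraseLetter_append i 0 b₁ (Sum.inl i :: b₂)
    rw [add_zero] at this
    rw [hb, this, eraseLetter, if_pos rfl]

/-- A block without bars is a single letter; deleting it deletes the position `j` of the sequence,
and `σ` enumerates the others. -/
lemma blockDel_zero (z : ι → GCoch R) (r : ℕ → R) (h : Fin m → ι) {n : Fin m → ℕ} {j : Fin m}
    (hn : n j = 0) {m' : ℕ} {σ : Fin m' → Fin m} (hσ : StrictMono σ)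
    (hj : ∀ j', (∃ x, σ x = j') ↔ j' ≠ j) :
    blockDel z r h n j = val z (fill r 0 (bexp (h ∘ σ) (n ∘ σ))) := by
  have hlist : (List.finRange m').map σ =
      (List.finRange m).take j ++ (List.finRange m).drop (j + 1) := by
    have hp : (List.finRange m).Pairwise (· < ·) := List.pairwise_lt_finRange m
    have h1 : ((List.finRange m').map σ).Pairwise (· < ·) :=
      List.pairwise_map.2 ((List.pairwise_lt_finRange m').imp fun h => hσ h)
    have h2 : ((List.finRange m).take j ++ (List.finRange m).drop (j + 1)).Pairwise (· < ·) := by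
      refine hp.sublist ?_
      conv_rhs => rw [finRange_split j]
      simp
    refine List.Perm.eq_of_pairwise (fun a b _ _ hab hba => absurd hab hba.asymm) h1 h2 ?_
    refine (List.perm_ext_iff_of_nodup (h1.imp fun h => h.ne) (h2.imp fun h => h.ne)).2 fun j' => ?_
    have h3 : j' ∈ List.finRange m := List.mem_finRange j'
    rw [finRange_split j, List.mem_append, List.mem_cons] at h3
    simp only [List.mem_map, List.mem_finRange, true_and, List.mem_append, hj]
    refine ⟨fun h4 => by tauto, fun h4 h5 => ?_⟩
    subst h5
    rcases h4 with h4 | h4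
    · exact lt_irrefl _ (mem_take_finRange h4)
    · exact lt_irrefl _ (mem_drop_finRange h4)
  have hword : bexp (h ∘ σ) (n ∘ σ) = before h n j ++ after h n j := by
    rw [before, after, ← List.flatMap_append, ← hlist, List.flatMap_map]
    rfl
  rw [blockDel, hn, hword]
  simp [delblk]

end Blocks

end Hochschild

namespace Hochschild

open SeqOperad

/-! ## The signs of the differential -/

section Signs

variable {m k : ℕ}

lemma tau_eq (f : Fin m → Fin k) (j : Fin m) :
    tau f j = ∑ j', if f j' < f j ∨ (f j' = f j ∧ j' ≤ j) then 1 else 0 := by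
  rw [tau, Finset.card_filter]
  push_cast
  rfl

lemma tau_sub_entry (f : Fin m → Fin k) (j : Fin m) :
    tau f j - entry f j = (∑ j', if f j' < f j ∨ (f j' = f j ∧ j' < j) then 1 else 0) - (f j : ℕ) := by
  have : tau f j = (∑ j', if f j' < f j ∨ (f j' = f j ∧ j' < j) then 1 else 0) + 1 := by
    have h1 : ∑ j', (if j' = j then 1 else 0) = (1 : ℤ) := by simp
    rw [tau_eq]
    refine Eq.trans ?_ (congrArg (_ + ·) h1)
    rw [← Finset.sum_add_distrib]
    refine Finset.sum_congr rfl fun j' _ => ?_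
    by_cases h : j' = j
    · subst h; simp
    · rw [if_neg h, add_zero]
      refine if_congr ?_ rfl rfl
      rw [le_iff_lt_or_eq]
      tauto
  rw [this, entry]
  ring

lemma sum_lt_val (i : Fin k) : (∑ i', if i' < i then (1 : ℤ) else 0) = (i : ℕ) := by
  have h : Finset.univ.filter (· < i) = Finset.Iio i := by ext; simp
  rw [← Finset.sum_filter, Finset.sum_const, h, Fin.card_Iio]
  simp

/-- Count the letters of the expanded word that are smaller than `f j`, together with the letters `f
j` in earlier blocks. By values, a letter `i` occurs `q i + 1` times; by blocks, block `j'` has `n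
j' + 1` letters. Both sides are this count minus the number of letters below `f j`. -/
lemma lower_sum (f : Fin m → Fin k) (n : Fin m → ℕ) (q : Fin k → ℕ) (j : Fin m)
    (hn : ∀ i < f j, ∑ j', (if f j' = i then n j' + 1 else 0) = q i + 1) :
    (∑ i, if i < f j then (q i : ℤ) else 0) +
        (∑ j', if j' < j then if f j' = f j then (n j' : ℤ) + 1 else 0 else 0) =
      (tau f j - entry f j) +
        ∑ j', if f j' < f j ∨ (f j' = f j ∧ j' < j) then (n j' : ℤ) else 0 := by
  have h1 : (∑ i, if i < f j then (q i : ℤ) else 0) + (f j : ℕ) =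
      ∑ j', if f j' < f j then (n j' : ℤ) + 1 else 0 := by
    rw [← sum_lt_val (f j), ← Finset.sum_add_distrib]
    have h2 : ∀ i, ((if i < f j then (q i : ℤ) else 0) + if i < f j then 1 else 0) =
        ∑ j', if i < f j then (if f j' = i then (n j' : ℤ) + 1 else 0) else 0 := by
      intro i
      split_ifs with hi
      · have := congrArg (Nat.cast : ℕ → ℤ) (hn i hi)
        push_cast at this
        rw [← this]
      · simp
    rw [Finset.sum_congr rfl fun i _ => h2 i, Finset.sum_comm]
    refine Finset.sum_congr rfl fun j' _ => ?_
    rw [Finset.sum_eq_single (f j')]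
    · simp
    · intro i _ hi
      rw [if_neg (Ne.symm hi)]
      simp
    · simp
  have h3 : (∑ j', if f j' < f j then (n j' : ℤ) + 1 else 0) +
      (∑ j', if j' < j then if f j' = f j then (n j' : ℤ) + 1 else 0 else 0) =
      (∑ j', if f j' < f j ∨ (f j' = f j ∧ j' < j) then 1 else 0) +
        ∑ j', if f j' < f j ∨ (f j' = f j ∧ j' < j) then (n j' : ℤ) else 0 := by
    rw [← Finset.sum_add_distrib, ← Finset.sum_add_distrib]
    refine Finset.sum_congr rfl fun j' _ => ?_
    rcases lt_trichotomy (f j') (f j) with h | h | h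
    · simp [h, h.ne]; ring
    · by_cases hj : j' < j
      · simp [h, hj]; ring
      · simp [h, hj]
    · simp [h.not_gt, h.ne']
  rw [tau_sub_entry]
  linarith

/-- ε is a quadratic polynomial without squares of a single variable, so raising `n j` by one adds
its partial derivative at `n`. -/
lemma eps_add_single (f : Fin m → Fin k) (n : Fin m → ℕ) (j : Fin m) :
    eps f (fun j' => (Function.update n j (n j + 1) j' : ℕ)) = eps f (fun j' => (n j' : ℤ)) +
      (∑ j', if j < j' ∧ f j' < f j then (n j' : ℤ) else 0) +
      (∑ j', if j' < j ∧ f j < f j' then (n j' : ℤ) else 0) + (tau f j - entry f j) := by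
  have h0 : ∀ u, ((Function.update n j (n j + 1) u : ℕ) : ℤ) = n u + if u = j then 1 else 0 := by
    intro u
    by_cases hu : u = j
    · subst hu; simp
    · simp [hu]
  have h1 : ∀ u v, (if u < v ∧ f v < f u then ((Function.update n j (n j + 1) u : ℕ) : ℤ) *
      (Function.update n j (n j + 1) v : ℕ) else 0) =
      (if u < v ∧ f v < f u then (n u : ℤ) * n v else 0) +
      (if u = j then if u < v ∧ f v < f u then (n v : ℤ) else 0 else 0) +
      (if v = j then if u < v ∧ f v < f u then (n u : ℤ) else 0 else 0) := by
    intro u v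
    rw [h0, h0]
    by_cases hu : u = j <;> by_cases hv : v = j
    · subst hu; subst hv; simp
    · simp only [hu, hv, if_true, if_false]; split_ifs <;> ring
    · simp only [hu, hv, if_true, if_false]; split_ifs <;> ring
    · simp [hu, hv]
  have h2 : ∀ u, ((Function.update n j (n j + 1) u : ℕ) : ℤ) * (tau f u - entry f u) =
      n u * (tau f u - entry f u) + if u = j then (tau f u - entry f u) else 0 := by
    intro u
    rw [h0]
    split_ifs <;> ring
  rw [eps, eps]
  simp only [h1, h2, Finset.sum_add_distrib]
  have h3 : ∑ u, ∑ v, (if u = j then if u < v ∧ f v < f u then (n v : ℤ) else 0 else 0) =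
      ∑ v, if j < v ∧ f v < f j then (n v : ℤ) else 0 := by
    rw [Finset.sum_eq_single j (fun u _ hu => by simp [hu]) (by simp)]
    simp
  have h4 : ∑ u, ∑ v, (if v = j then if u < v ∧ f v < f u then (n u : ℤ) else 0 else 0) =
      ∑ u, if u < j ∧ f j < f u then (n u : ℤ) else 0 := by
    refine Finset.sum_congr rfl fun u _ => ?_
    rw [Finset.sum_ite_eq' Finset.univ j, if_pos (Finset.mem_univ j)]
  rw [h3, h4, Finset.sum_ite_eq' Finset.univ j, if_pos (Finset.mem_univ j)]
  ring

lemma sum_update_succ (q : Fin k → ℕ) (i : Fin k) :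
    ∑ i', (Function.update q i (q i + 1) i' : ℤ) = (∑ i', (q i' : ℤ)) + 1 := by
  rw [← Finset.add_sum_erase _ _ (Finset.mem_univ i), ← Finset.add_sum_erase _ _ (Finset.mem_univ i),
    Function.update_self, Finset.sum_congr rfl fun i' hi' => by
      rw [Function.update_of_ne (Finset.ne_of_mem_erase hi')]]
  push_cast
  ring

/-- The sign of a term of `θ(f, …, ∂x_i, …)` that contributes to `∂θ(f, x)`. -/
theorem sign_insert {f : Fin m → Fin k} {q : Fin k → ℕ} {n : Fin m → ℕ} (hn : n ∈ Mult f q)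
    (j : Fin m) :
    (((m : ℤ) - k) + (∑ i, if i < f j then (q i : ℤ) else 0) +
      thetaExp f (Function.update q (f j) (q (f j) + 1)) (Function.update n j (n j + 1)) +
      ∑ j', if j' < j then if f j' = f j then
        ((Function.update n j (n j + 1) j' : ℕ) : ℤ) + 1 else 0 else 0).negOnePow =
    (thetaExp f q n + ∑ j', if j' < j then (n j' : ℤ) else 0).negOnePow := by
  have h1 := lower_sum f n q j fun i _ => mem_Mult.1 hn i
  have h2 : (∑ j', if j' < j then if f j' = f j then
        ((Function.update n j (n j + 1) j' : ℕ) : ℤ) + 1 else 0 else 0) =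
      ∑ j', if j' < j then if f j' = f j then (n j' : ℤ) + 1 else 0 else 0 := by
    refine Finset.sum_congr rfl fun j' _ => ?_
    by_cases h : j' < j
    · rw [Function.update_of_ne h.ne]
    · simp [h]
  have h3 := eps_add_single f n j
  -- Up to a doubled term, the inversions that involve `j` and the positions that sort before `j`
  -- together give the positions in front of `j`.
  have h4 : (∑ j', if j < j' ∧ f j' < f j then (n j' : ℤ) else 0) +
      (∑ j', if j' < j ∧ f j < f j' then (n j' : ℤ) else 0) +
      (∑ j', if f j' < f j ∨ (f j' = f j ∧ j' < j) then (n j' : ℤ) else 0) =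
      (∑ j', if j' < j then (n j' : ℤ) else 0) +
        2 * ∑ j', if j < j' ∧ f j' < f j then (n j' : ℤ) else 0 := by
    rw [Finset.mul_sum, ← Finset.sum_add_distrib, ← Finset.sum_add_distrib,
      ← Finset.sum_add_distrib]
    refine Finset.sum_congr rfl fun j' _ => ?_
    rcases lt_trichotomy j' j with h | h | h
    · rcases lt_trichotomy (f j') (f j) with h' | h' | h'
      · simp [h, h', h.not_gt, h'.not_gt]
      · simp [h, h', h.not_gt]
      · simp [h, h', h.not_gt, h'.not_gt, h'.ne']
    · subst h; simp
    · rcases lt_trichotomy (f j') (f j) with h' | h' | h'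
      · simp [h, h', h.not_gt]; ring
      · simp [h', h.not_gt]
      · simp [h.not_gt, h'.not_gt, h'.ne']
  rw [Int.negOnePow_eq_iff, h2, thetaExp, thetaExp, h3, sum_update_succ]
  refine ⟨((m : ℤ) - k) + (tau f j - entry f j) +
    ∑ j', if j < j' ∧ f j' < f j then (n j' : ℤ) else 0, ?_⟩
  linear_combination h1 + h4

variable {m' : ℕ} {σ : Fin m' → Fin m} {j : Fin m}

lemma sum_delete {M : Type*} [AddCommMonoid M] (hσ : StrictMono σ)
    (hj : ∀ j', (∃ x, σ x = j') ↔ j' ≠ j) (G : Fin m → M) : ∑ j', G j' = G j + ∑ x, G (σ x) := by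
  rw [← Finset.add_sum_erase _ _ (Finset.mem_univ j)]
  congr 1
  symm
  refine Finset.sum_bij (fun x _ => σ x) (fun x _ => ?_) (fun x _ y _ h => hσ.injective h)
    (fun j' hj' => ?_) fun _ _ => rfl
  · exact Finset.mem_erase.2 ⟨(hj _).1 ⟨x, rfl⟩, Finset.mem_univ _⟩
  · obtain ⟨x, hx⟩ := (hj j').2 (Finset.ne_of_mem_erase hj')
    exact ⟨x, Finset.mem_univ x, hx⟩

/-- As `n j = 0`, the position `j` contributes nothing itself. Its removal lowers `τ` by one at all
positions that sort after `j`. -/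
lemma eps_delete (hσ : StrictMono σ) (hj : ∀ j', (∃ x, σ x = j') ↔ j' ≠ j) (f : Fin m → Fin k)
    (n : Fin m → ℤ) (hn : n j = 0) : eps f n = eps (f ∘ σ) (n ∘ σ) +
      ∑ j', if f j < f j' ∨ (f j = f j' ∧ j < j') then n j' else 0 := by
  have h1 : ∑ u, ∑ v, (if u < v ∧ f v < f u then n u * n v else 0) =
      ∑ x, ∑ y, if x < y ∧ (f ∘ σ) y < (f ∘ σ) x then (n ∘ σ) x * (n ∘ σ) y else 0 := by
    rw [sum_delete hσ hj]
    simp only [hn, zero_mul, ite_self, Finset.sum_const_zero, zero_add]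
    refine Finset.sum_congr rfl fun x _ => ?_
    rw [sum_delete hσ hj]
    simp [hn, hσ.lt_iff_lt]
  have h2 : ∀ x, tau f (σ x) = tau (f ∘ σ) x +
      if f j < f (σ x) ∨ (f j = f (σ x) ∧ j < σ x) then 1 else 0 := by
    intro x
    rw [tau_eq, tau_eq, sum_delete hσ hj, add_comm]
    have hne : j ≠ σ x := fun h => (hj _).1 ⟨x, rfl⟩ h.symm
    simp [hσ.le_iff_le, le_iff_lt_or_eq, hne]
  rw [eps, eps, h1, sum_delete (M := ℤ) hσ hj fun u => n u * (tau f u - entry f u),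
    sum_delete (M := ℤ) hσ hj fun j' => if f j < f j' ∨ (f j = f j' ∧ j < j') then n j' else 0]
  simp only [hn, zero_mul, ite_self, zero_add]
  rw [add_assoc]
  refine congrArg (HAdd.hAdd _) ?_
  rw [← Finset.sum_add_distrib]
  refine Finset.sum_congr rfl fun x _ => ?_
  rw [h2]
  simp only [entry, Function.comp_apply]
  split_ifs <;> ring

/-- The sign of a term of `θ(f, …, ∂x_i, …)` that contributes to `θ(∂f, x)`. -/
theorem sign_delete (hσ : StrictMono σ) (hj : ∀ j', (∃ x, σ x = j') ↔ j' ≠ j) {f : Fin m → Fin k}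
    {q : Fin k → ℕ} {n : Fin m → ℕ} (hn : n ∈ Mult f (Function.update q (f j) (q (f j) + 1)))
    (hn0 : n j = 0) (hm : m = m' + 1) :
    (((m : ℤ) - k) + (∑ i, if i < f j then (q i : ℤ) else 0) +
      thetaExp f (Function.update q (f j) (q (f j) + 1)) n +
      ∑ j', if j' < j then if f j' = f j then (n j' : ℤ) + 1 else 0 else 0).negOnePow =
    -((tau f j - entry f j) + thetaExp (f ∘ σ) q (n ∘ σ)).negOnePow := by
  have h1 := lower_sum f n q j fun i hi => by
    rw [mem_Mult.1 hn i, Function.update_of_ne hi.ne]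
  have h2 := eps_delete hσ hj f (fun j' => (n j' : ℤ)) (by simp [hn0])
  have h3 := congrArg (Nat.cast : ℕ → ℤ) (sum_of_mem_Mult hn)
  push_cast at h3
  rw [sum_update_succ] at h3
  -- Every position other than `j` sorts either before or after `j`, and `n j = 0`.
  have h4 : (∑ j', if f j' < f j ∨ (f j' = f j ∧ j' < j) then (n j' : ℤ) else 0) +
      (∑ j', if f j < f j' ∨ (f j = f j' ∧ j < j') then (n j' : ℤ) else 0) = ∑ j', (n j' : ℤ) := by
    rw [← Finset.sum_add_distrib]
    refine Finset.sum_congr rfl fun j' _ => ?_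
    rcases lt_trichotomy (f j') (f j) with h' | h' | h'
    · simp [h', h'.not_gt, h'.ne']
    · rcases lt_trichotomy j' j with h | h | h
      · simp [h', h, h.not_gt]
      · subst h; simp [hn0]
      · simp [h', h, h.not_gt]
    · simp [h', h'.not_gt, h'.ne']
  -- Deleting an entry lowers the degree of the sequence by one, so the triangular number in the
  -- sign drops by `m - k`.
  have hδ : ((m : ℤ) - k) * ((m : ℤ) - k + 1) / 2 =
      ((m' : ℤ) - k) * ((m' : ℤ) - k + 1) / 2 + ((m : ℤ) - k) := by
    have : ((m : ℤ) - k) * ((m : ℤ) - k + 1) =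
        ((m' : ℤ) - k) * ((m' : ℤ) - k + 1) + ((m : ℤ) - k) * 2 := by
      rw [hm]; push_cast; ring
    rw [this, Int.add_mul_ediv_right _ _ two_ne_zero]
  rw [← Int.negOnePow_succ, Int.negOnePow_eq_iff, thetaExp, thetaExp, h2, sum_update_succ, hδ]
  have h5 : (fun j' => (n j' : ℤ)) ∘ σ = fun x => ((n ∘ σ) x : ℤ) := rfl
  rw [h5]
  have hm' : (m' : ℤ) = m - 1 := by rw [hm]; push_cast; ring
  rw [hm']
  refine ⟨(m : ℤ) - k + ∑ i, (q i : ℤ), ?_⟩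
  linear_combination h1 + h4 + h3

end Signs

end Hochschild

namespace Hochschild

open SeqOperad

/-! ## Compatibility with the differentials -/

section Mult

variable {m k m' : ℕ} {σ : Fin m' → Fin m} {j : Fin m}

lemma mem_Mult_delete (hσ : StrictMono σ) (hj : ∀ j', (∃ x, σ x = j') ↔ j' ≠ j) {f : Fin m → Fin k}
    {q : Fin k → ℕ} {n : Fin m → ℕ} (hn0 : n j = 0) :
    n ∈ Mult f (Function.update q (f j) (q (f j) + 1)) ↔ n ∘ σ ∈ Mult (f ∘ σ) q := by
  rw [mem_Mult, mem_Mult]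
  refine forall_congr' fun i => ?_
  rw [sum_delete hσ hj, hn0]
  by_cases hi : f j = i
  · subst hi
    rw [if_pos rfl, Function.update_self]
    simp only [Function.comp_apply]
    omega
  · rw [if_neg hi, Function.update_of_ne (Ne.symm hi), zero_add]
    rfl

lemma mem_Mult_insert {f : Fin m → Fin k} {q : Fin k → ℕ} {n : Fin m → ℕ} :
    Function.update n j (n j + 1) ∈ Mult f (Function.update q (f j) (q (f j) + 1)) ↔
      n ∈ Mult f q := by
  rw [mem_Mult, mem_Mult]
  refine forall_congr' fun i => ?_
  have h : ∑ j', (if f j' = i then Function.update n j (n j + 1) j' + 1 else 0) =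
      (∑ j', if f j' = i then n j' + 1 else 0) + if f j = i then 1 else 0 := by
    rw [← Finset.add_sum_erase _ _ (Finset.mem_univ j),
      ← Finset.add_sum_erase (a := j) _ (fun j' => if f j' = i then n j' + 1 else 0)
        (Finset.mem_univ j), Function.update_self,
      Finset.sum_congr rfl fun j' hj' => by
        rw [Function.update_of_ne (Finset.ne_of_mem_erase hj')]]
    split_ifs <;> omega
  rw [h]
  by_cases hi : f j = i
  · subst hi
    rw [if_pos rfl, Function.update_self]
    omega
  · rw [if_neg hi, Function.update_of_ne (Ne.symm hi), add_zero]

/-- With the degree at `f j` raised by one, the multiplicities with `n j ≠ 0` arise from those for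
the old degrees by raising `n j`, and the ones with `n j = 0` belong to the sequence without `j`.
The first kind will give ∂θ(f, x), the second θ(∂f, x). -/
lemma sum_Mult_split {M : Type*} [AddCommMonoid M] (hσ : StrictMono σ)
    (hj : ∀ j', (∃ x, σ x = j') ↔ j' ≠ j) {f : Fin m → Fin k} {q : Fin k → ℕ}
    (G : (Fin m → ℕ) → M) (H : (Fin m' → ℕ) → M)
    (hGH : ∀ n ∈ Mult f (Function.update q (f j) (q (f j) + 1)), n j = 0 → G n = H (n ∘ σ)) :
    ∑ n ∈ Mult f (Function.update q (f j) (q (f j) + 1)), G n =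
      ∑ n ∈ Mult f q, G (Function.update n j (n j + 1)) + ∑ n ∈ Mult (f ∘ σ) q, H n := by
  rw [← Finset.sum_filter_add_sum_filter_not _ (fun n => n j ≠ 0)]
  congr 1
  · symm
    refine Finset.sum_bij (fun n _ => Function.update n j (n j + 1)) ?_ ?_ ?_ fun _ _ => rfl
    · intro n hn
      rw [Finset.mem_filter, mem_Mult_insert, Function.update_self]
      exact ⟨hn, Nat.succ_ne_zero _⟩
    · intro n _ n' _ h
      funext j'
      have := congrFun h j'
      by_cases hj' : j' = j
      · subst hj'
        simpa using this
      · simpa [hj'] using this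
    · intro n hn
      rw [Finset.mem_filter] at hn
      have h : Function.update (Function.update n j (n j - 1)) j
          (Function.update n j (n j - 1) j + 1) = n := by
        rw [Function.update_self, Function.update_idem, Nat.sub_add_cancel (by omega),
          Function.update_eq_self]
      refine ⟨Function.update n j (n j - 1), ?_, h⟩
      rw [← mem_Mult_insert (j := j), h]
      exact hn.1
  · refine Finset.sum_bij (fun n _ => n ∘ σ) ?_ ?_ ?_ ?_
    · intro n hn
      rw [Finset.mem_filter, not_not] at hn
      exact (mem_Mult_delete hσ hj hn.2).1 hn.1
    · intro n hn n' hn' h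
      rw [Finset.mem_filter, not_not] at hn hn'
      funext j'
      by_cases hj' : j' = j
      · rw [hj', hn.2, hn'.2]
      · obtain ⟨x, rfl⟩ := (hj j').2 hj'
        exact congrFun h x
    · intro ν hν
      have h0 : Function.extend σ ν 0 j = 0 :=
        Function.extend_apply' _ _ _ fun h => (hj j).1 h rfl
      have h1 : Function.extend σ ν 0 ∘ σ = ν := funext fun x => hσ.injective.extend_apply _ _ _
      refine ⟨Function.extend σ ν 0, ?_, h1⟩
      rw [Finset.mem_filter, not_not, mem_Mult_delete hσ hj h0, h1]
      exact ⟨hν, h0⟩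
    · intro n hn
      rw [Finset.mem_filter, not_not] at hn
      exact hGH n hn.1 hn.2

end Mult

variable {R : Type*} [Ring R]

lemma ev_theta_units_smul (p : ℕ) (r : ℕ → R) {k : ℕ} (u : ℤˣ) (s : S k) (x : Fin k → C R) :
    ev p r (theta R k (u • s) x) = u • ev p r (theta R k s x) := by
  rw [Units.smul_def, (theta R k).map_smul]
  rfl

lemma ev_theta_sum (p : ℕ) (r : ℕ → R) {k : ℕ} {A : Type*} (B : Finset A) (s : A → S k)
    (x : Fin k → C R) :
    ev p r (theta R k (∑ a ∈ B, s a) x) = ∑ a ∈ B, ev p r (theta R k (s a) x) := by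
  rw [map_sum, Finset.sum_apply, map_sum]

lemma ev_d_theta {k : ℕ} {f : NSeq k} (hf : complexity f.fn ≤ 2) (z : Fin k → HC R) (p : ℕ)
    (r : ℕ → R) :
    ev p r (d R (theta R k (Finsupp.single f 1) fun i => hom (z i))) =
      if p + f.len = ∑ i, deg (toG z) i + k + 1 then ∑ n ∈ Mult f.fn (deg (toG z)),
        (thetaExp f.fn (deg (toG z)) n).negOnePow • edge (toG z) r [] (bexp f.fn n) []
      else 0 := by
  rcases p with _ | p
  · rw [ev_d_zero]
    split_ifs with hp
    · refine (Finset.sum_eq_zero fun n hn => ?_).symm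
      have := sum_of_mem_Mult hn
      omega
    · rfl
  · rw [ev_d]
    simp only [ev_theta_single hf]
    by_cases hp : p + f.len = ∑ i, deg (toG z) i + k
    · simp only [if_pos hp]
      rw [if_pos (by omega), Finset.mul_sum, Finset.sum_mul, Finset.smul_sum]
      simp only [Finset.smul_sum]
      rw [Finset.sum_comm, ← Finset.sum_add_distrib, ← Finset.sum_add_distrib]
      refine Finset.sum_congr rfl fun n hn => ?_
      have hb : bars (bexp f.fn n) = p := by
        have := sum_of_mem_Mult hn
        rw [bars_bexp]
        omega
      rw [edge_eq r _ (by
        rw [reduceOption_bexp]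
        exact good_expand (complexity_le_two_iff.1 hf) hn), hb, smul_add, smul_add,
        Finset.smul_sum]
      congr 1
      · congr 1
        · rw [mul_smul_comm]
        · exact Finset.sum_congr rfl fun j _ => smul_comm _ _ _
      · rw [smul_mul_assoc, smul_comm]
    · simp only [if_neg hp]
      rw [if_neg (by omega)]
      simp

/-- The family obtained by replacing `x_i` by its differential. -/
def diffAt {k : ℕ} (z : Fin k → HC R) (i : Fin k) : Fin k → HC R :=
  Function.update z i ⟨(z i).1 + 1, ⟨diff (z i).2.1, diff_mem (z i).2.2⟩⟩

lemma update_d_hom {k : ℕ} (z : Fin k → HC R) (i : Fin k) :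
    Function.update (fun i => hom (z i)) i (d R (hom (z i))) = fun i' => hom (diffAt z i i') := by
  funext i'
  by_cases h : i' = i
  · subst h
    rw [Function.update_self, diffAt, Function.update_self, d_hom]
  · rw [Function.update_of_ne h, diffAt, Function.update_of_ne h]

lemma deg_diffAt {k : ℕ} (z : Fin k → HC R) (i : Fin k) : deg (toG (diffAt z i)) =
    Function.update (deg (toG z)) i (deg (toG z) i + 1) := by
  funext i'
  by_cases h : i' = i
  · subst h
    simp [deg, toG, diffAt]
  · simp [deg, toG, diffAt, h]

lemma ev_theta_diffAt {k : ℕ} {f : NSeq k} (hf : complexity f.fn ≤ 2) (z : Fin k → HC R) (p : ℕ)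
    (r : ℕ → R) (i : Fin k) :
    ev p r (theta R k (Finsupp.single f 1) fun i' => hom (diffAt z i i')) =
      if p + f.len = ∑ i, deg (toG z) i + k + 1 then
        ∑ n ∈ Mult f.fn (Function.update (deg (toG z)) i (deg (toG z) i + 1)),
          (thetaExp f.fn (Function.update (deg (toG z)) i (deg (toG z) i + 1)) n).negOnePow •
            ∑ j, if f.fn j = i then
              (∑ j', if j' < j then if f.fn j' = i then (n j' : ℤ) + 1 else 0 else 0).negOnePow •
                blockDel (toG z) r f.fn n j else 0
      else 0 := by
  rw [ev_theta_single hf, deg_diffAt]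
  have hs : ∑ i', Function.update (deg (toG z)) i (deg (toG z) i + 1) i' =
      ∑ i', deg (toG z) i' + 1 := by
    have := sum_update_succ (deg (toG z)) i
    exact_mod_cast this
  rw [hs]
  refine if_congr (by omega) (Finset.sum_congr rfl fun n hn => ?_) rfl
  rw [← deg_diffAt] at hn
  have hg := good_expand (complexity_le_two_iff.1 hf) hn
  rw [val_diff_bexp (z := toG z) (z' := toG (diffAt z i)) (i := i) ?_ ?_ hg]
  · refine List.count_pos_iff.1 ?_
    rw [count_expand, mem_Mult.1 hn i]
    omega
  · exact fun c hc => congrArg (fun y : HC R => (⟨y.1, y.2.1⟩ : GCoch R))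
      (Function.update_of_ne hc _ _)
  · exact congrArg (fun y : HC R => (⟨y.1, y.2.1⟩ : GCoch R))
      (Function.update_self i (⟨(z i).1 + 1, ⟨diff (z i).2.1, diff_mem (z i).2.2⟩⟩ : HC R) z)

/-- The terms with a differentiated argument form a sum over positions `j` and multiplicities of the
deletions from block `j`. After `sum_Mult_split`, the part with `n j ≠ 0` is ∂θ(f, x) by `edge_bexp`
and `sign_insert`. The part with `n j = 0` is the negative of θ(∂f, x), by `blockDel_zero` and
`sign_delete`. -/
theorem theta_chain_map {k : ℕ} {f : NSeq k} (hf : complexity f.fn ≤ 2) (z : Fin k → HC R)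
    (p : ℕ) (r : ℕ → R) :
    ev p r (theta R k (bd k (Finsupp.single f 1)) fun i => hom (z i)) =
      ev p r (d R (theta R k (Finsupp.single f 1) fun i => hom (z i))) -
        f.degree.negOnePow • ∑ i : Fin k,
          (∑ i' : Fin k, if i' < i then ((z i').1 : ℤ) else 0).negOnePow •
            ev p r (theta R k (Finsupp.single f 1)
              (Function.update (fun i => hom (z i)) i (d R (hom (z i))))) := by
  rw [bd, Finsupp.linearCombination_single, one_smul, bdGen, ev_theta_sum, ev_d_theta hf]
  simp only [update_d_hom, ev_theta_diffAt hf, ev_theta_units_smul]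
  have hcard : ∀ j : Fin f.len, (Finset.univ.erase j).card + 1 = f.len := fun j => by
    rw [Finset.card_erase_add_one (Finset.mem_univ j), Finset.card_univ, Fintype.card_fin]
  have hterm : ∀ j : Fin f.len,
      ev p r (theta R k (cls (restrictSeq f.fn (Finset.univ.erase j))) fun i => hom (z i)) =
      if p + f.len = ∑ i, deg (toG z) i + k + 1 then
        ∑ n ∈ Mult (restrictSeq f.fn (Finset.univ.erase j)) (deg (toG z)),
          (thetaExp (restrictSeq f.fn (Finset.univ.erase j)) (deg (toG z)) n).negOnePow •
            val (toG z) (fill r 0 (bexp (restrictSeq f.fn (Finset.univ.erase j)) n))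
      else 0 := by
    intro j
    rw [ev_theta_cls (restrictSeq_noncrossing (complexity_le_two_iff.1 hf) _)]
    have := hcard j
    exact if_congr (by omega) rfl rfl
  simp only [hterm]
  split_ifs with hp
  · set q := deg (toG z) with hq
    have hT : f.degree.negOnePow • ∑ i : Fin k,
        (∑ i' : Fin k, if i' < i then ((z i').1 : ℤ) else 0).negOnePow •
          ∑ n ∈ Mult f.fn (Function.update q i (q i + 1)),
          (thetaExp f.fn (Function.update q i (q i + 1)) n).negOnePow •
            ∑ j, (if f.fn j = i then
              (∑ j', if j' < j then if f.fn j' = i then (n j' : ℤ) + 1 else 0 else 0).negOnePow •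
                blockDel (toG z) r f.fn n j else 0) =
        ∑ j, ∑ n ∈ Mult f.fn (Function.update q (f.fn j) (q (f.fn j) + 1)),
          (((f.len : ℤ) - k) + (∑ i, if i < f.fn j then (q i : ℤ) else 0) +
            thetaExp f.fn (Function.update q (f.fn j) (q (f.fn j) + 1)) n +
            ∑ j', if j' < j then if f.fn j' = f.fn j then (n j' : ℤ) + 1 else 0
              else 0).negOnePow • blockDel (toG z) r f.fn n j := by
      -- The sum over `i` is absorbed into the sum over `j`, since a position `j` belongs to the
      -- letter `f j` only.
      have h1 : ∀ j, ∑ n ∈ Mult f.fn (Function.update q (f.fn j) (q (f.fn j) + 1)),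
          (((f.len : ℤ) - k) + (∑ i, if i < f.fn j then (q i : ℤ) else 0) +
            thetaExp f.fn (Function.update q (f.fn j) (q (f.fn j) + 1)) n +
            ∑ j', if j' < j then if f.fn j' = f.fn j then (n j' : ℤ) + 1 else 0
              else 0).negOnePow • blockDel (toG z) r f.fn n j =
          ∑ i, if f.fn j = i then ∑ n ∈ Mult f.fn (Function.update q i (q i + 1)),
          (((f.len : ℤ) - k) + (∑ i', if i' < i then (q i' : ℤ) else 0) +
            thetaExp f.fn (Function.update q i (q i + 1)) n +
            ∑ j', if j' < j then if f.fn j' = i then (n j' : ℤ) + 1 else 0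
              else 0).negOnePow • blockDel (toG z) r f.fn n j else 0 := by
        intro j
        rw [Finset.sum_ite_eq, if_pos (Finset.mem_univ _)]
      rw [Finset.sum_congr rfl fun j _ => h1 j, Finset.sum_comm, Finset.smul_sum]
      refine Finset.sum_congr rfl fun i _ => ?_
      simp only [Finset.smul_sum]
      rw [Finset.sum_comm]
      refine Finset.sum_congr rfl fun j _ => ?_
      split_ifs
      · refine Finset.sum_congr rfl fun n _ => ?_
        rw [smul_smul, smul_smul, smul_smul, ← Int.negOnePow_add, ← Int.negOnePow_add,
          ← Int.negOnePow_add]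
        rfl
      · simp
    rw [hT]
    have hsplit : ∀ j : Fin f.len,
        ∑ n ∈ Mult f.fn (Function.update q (f.fn j) (q (f.fn j) + 1)),
          (((f.len : ℤ) - k) + (∑ i, if i < f.fn j then (q i : ℤ) else 0) +
            thetaExp f.fn (Function.update q (f.fn j) (q (f.fn j) + 1)) n +
            ∑ j', if j' < j then if f.fn j' = f.fn j then (n j' : ℤ) + 1 else 0
              else 0).negOnePow • blockDel (toG z) r f.fn n j =
        ∑ n ∈ Mult f.fn q, (thetaExp f.fn q n + ∑ j', if j' < j then (n j' : ℤ) else 0).negOnePow •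
          blockDel (toG z) r f.fn (Function.update n j (n j + 1)) j +
        ∑ n ∈ Mult (restrictSeq f.fn (Finset.univ.erase j)) q,
          (-((tau f.fn j - entry f.fn j) +
            thetaExp (restrictSeq f.fn (Finset.univ.erase j)) q n).negOnePow) •
            val (toG z) (fill r 0 (bexp (restrictSeq f.fn (Finset.univ.erase j)) n)) := by
      intro j
      have hσ : StrictMono ((Finset.univ.erase j).orderEmbOfFin rfl) :=
        ((Finset.univ.erase j).orderEmbOfFin rfl).strictMono
      have hj : ∀ j', (∃ x, (Finset.univ.erase j).orderEmbOfFin rfl x = j') ↔ j' ≠ j := by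
        intro j'
        have : j' ∈ Set.range ((Finset.univ.erase j).orderEmbOfFin rfl) ↔ j' ≠ j := by
          rw [Finset.range_orderEmbOfFin]
          simp
        exact this
      refine (sum_Mult_split hσ hj (f := f.fn) (q := q) _ _ fun n hn hn0 => ?_).trans
        (congrArg₂ (· + ·) (Finset.sum_congr rfl fun n hn => ?_) rfl)
      · rw [sign_delete hσ hj hn hn0 (hcard j).symm, blockDel_zero _ _ _ hn0 hσ hj]
        rfl
      · rw [sign_insert hn]
    rw [Finset.sum_congr rfl fun j _ => hsplit j, Finset.sum_add_distrib, sub_add_eq_sub_sub]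
    have hedge : ∑ n ∈ Mult f.fn q, (thetaExp f.fn q n).negOnePow •
        edge (toG z) r [] (bexp f.fn n) [] = ∑ j, ∑ n ∈ Mult f.fn q,
          (thetaExp f.fn q n + ∑ j', if j' < j then (n j' : ℤ) else 0).negOnePow •
          blockDel (toG z) r f.fn (Function.update n j (n j + 1)) j := by
      rw [Finset.sum_comm]
      refine Finset.sum_congr rfl fun n _ => ?_
      rw [edge_bexp, Finset.smul_sum]
      refine Finset.sum_congr rfl fun j _ => ?_
      rw [smul_smul, ← Int.negOnePow_add]
    rw [hedge, sub_self, zero_sub, ← Finset.sum_neg_distrib]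
    refine Finset.sum_congr rfl fun j _ => ?_
    rw [Finset.smul_sum, ← Finset.sum_neg_distrib]
    refine Finset.sum_congr rfl fun n _ => ?_
    rw [smul_smul, ← Int.negOnePow_add, Units.neg_smul, neg_neg]
  · simp

end Hochschild

namespace Hochschild

open SeqOperad

/-! ## Compatibility with the actions of the symmetric groups -/

section Signs

variable {m k : ℕ}

lemma sum_fiber (f : Fin m → Fin k) (a : Fin m → ℤ) (G : Fin k → ℤ) :
    ∑ u, (∑ j, if f j = u then a j else 0) * G u = ∑ j, a j * G (f j) := by
  simp only [Finset.sum_mul]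
  rw [Finset.sum_comm]
  refine Finset.sum_congr rfl fun j _ => ?_
  rw [Finset.sum_eq_single (f j)]
  · rw [if_pos rfl]
  · intro u _ hu
    rw [if_neg (Ne.symm hu), zero_mul]
  · simp

lemma sum_sum_lt (G : Fin m → Fin m → ℤ) (hG : ∀ j, G j j = 0) :
    ∑ j, ∑ j', G j j' = ∑ j, ∑ j', if j < j' then G j j' + G j' j else 0 := by
  have h : ∀ j j', G j j' = (if j < j' then G j j' else 0) + if j' < j then G j j' else 0 := by
    intro j j'
    rcases lt_trichotomy j j' with h | h | h
    · simp [h, h.not_gt]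
    · subst h; simp [hG]
    · simp [h, h.not_gt]
  rw [Finset.sum_congr rfl fun j _ => Finset.sum_congr rfl fun j' _ => h j j']
  simp only [Finset.sum_add_distrib]
  rw [Finset.sum_comm (f := fun j j' => if j' < j then G j j' else 0),
    ← Finset.sum_add_distrib]
  refine Finset.sum_congr rfl fun j _ => ?_
  rw [← Finset.sum_add_distrib]
  refine Finset.sum_congr rfl fun j' _ => ?_
  split_ifs <;> simp

lemma norm1_fiber (f : Fin m → Fin k) (u : Fin k) :
    norm1 (f ⁻¹' {u}) = (∑ j, if f j = u then 1 else 0) - 1 := by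
  have hset : f ⁻¹' {u} = ((Finset.univ.filter fun j => f j = u : Finset (Fin m)) : Set (Fin m)) := by
    ext; simp
  rw [norm1, hset, Set.ncard_coe_finset, Finset.card_filter]
  push_cast
  rfl

/-- Each letter `u < f j` contributes its number of occurrences to `τ` and one to the entry. In this
form the dependence on the order of the letters is confined to the first sum. -/
lemma tau_sub_entry_eq (f : Fin m → Fin k) (j : Fin m) : tau f j - entry f j =
    (∑ u, if u < f j then norm1 (f ⁻¹' {u}) else 0) +
      ∑ j', if f j' = f j ∧ j' < j then 1 else 0 := by
  have h1 : (∑ u, if u < f j then norm1 (f ⁻¹' {u}) else 0) + (f j : ℕ) =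
      ∑ j', if f j' < f j then 1 else 0 := by
    rw [← sum_lt_val (f j), ← Finset.sum_add_distrib]
    have h2 : ∀ u, ((if u < f j then norm1 (f ⁻¹' {u}) else 0) + if u < f j then 1 else 0) =
        (∑ j', if f j' = u then 1 else 0) * if u < f j then 1 else 0 := by
      intro u
      rw [norm1_fiber]
      split_ifs <;> ring
    rw [Finset.sum_congr rfl fun u _ => h2 u, sum_fiber]
    simp
  rw [tau_sub_entry]
  have h3 : (∑ j', if f j' < f j ∨ (f j' = f j ∧ j' < j) then (1 : ℤ) else 0) =
      (∑ j', if f j' < f j then 1 else 0) + ∑ j', if f j' = f j ∧ j' < j then 1 else 0 := by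
    rw [← Finset.sum_add_distrib]
    refine Finset.sum_congr rfl fun j' _ => ?_
    by_cases h : f j' < f j
    · simp [h, h.ne]
    · simp [h]
  linarith

lemma even_sum_int {A : Type*} (s : Finset A) (G : A → ℤ) (h : ∀ a ∈ s, Even (G a)) :
    Even (∑ a ∈ s, G a) := Finset.sum_induction _ Even (fun _ _ => Even.add) Even.zero h

/-- The last two terms record whether the two pairs are ordered differently, which is the parity of
the first two. -/
lemma even_inversion {u v a b : Fin k} (h : u = v ↔ a = b) (x : ℤ) :
    Even ((if u < v then x else 0) + (if a < b then x else 0) +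
      ((if v < u ∧ a < b then x else 0) + if u < v ∧ b < a then x else 0)) := by
  rcases lt_trichotomy u v with h1 | h1 | h1
  · rcases lt_trichotomy a b with h2 | h2 | h2
    · simp [h1, h1.not_gt, h2, h2.not_gt]
    · exact absurd (h.2 h2) h1.ne
    · simp [h1, h1.not_gt, h2, h2.not_gt]
  · simp [h1, h.1 h1]
  · rcases lt_trichotomy a b with h2 | h2 | h2
    · simp [h1, h1.not_gt, h2]
    · exact absurd (h.2 h2) h1.ne'
    · simp [h1.not_gt, h2.not_gt]

/-- The signs in `θ(f ρ, x)`. -/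
theorem sign_perm (f : Fin m → Fin k) (ρ : Equiv.Perm (Fin k)) {q : Fin k → ℕ} {n : Fin m → ℕ}
    (hn : n ∈ Mult (⇑ρ⁻¹ ∘ f) q) :
    (zeta f ρ + thetaExp (⇑ρ⁻¹ ∘ f) q n).negOnePow =
      ((∑ i : Fin k, ∑ i' : Fin k, if i < i' ∧ ρ i' < ρ i then (q i : ℤ) * q i' else 0) +
        thetaExp f (q ∘ ⇑ρ⁻¹) n).negOnePow := by
  set N : Fin k → ℤ := fun u => ∑ j, if f j = u then (n j : ℤ) else 0 with hN
  set φ : Fin k → ℤ := fun u => norm1 (f ⁻¹' {u}) with hφ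
  -- The letter `u` of `f` occurs `q (ρ⁻¹ u) + 1` times in the expanded word. In the Koszul sign the
  -- products of these degrees split up: the terms `φ φ` form ζ, the terms `N N` the change of the
  -- quadratic part of ε, the mixed terms the change of its linear part.
  have hQ : ∀ u, (q (ρ⁻¹ u) : ℤ) = N u + φ u := by
    intro u
    have := congrArg (Nat.cast : ℕ → ℤ) (mem_Mult.1 hn (ρ⁻¹ u))
    simp only [Function.comp_apply, EmbeddingLike.apply_eq_iff_eq] at this
    push_cast at this
    rw [hφ, hN]
    simp only
    rw [norm1_fiber, ← add_sub_assoc, ← Finset.sum_add_distrib, eq_sub_iff_add_eq, ← this]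
    refine Finset.sum_congr rfl fun j _ => ?_
    split_ifs <;> ring
  have hK : (∑ i : Fin k, ∑ i' : Fin k, if i < i' ∧ ρ i' < ρ i then (q i : ℤ) * q i' else 0) =
      ∑ u, ∑ u', if u < u' ∧ ρ⁻¹ u' < ρ⁻¹ u then (N u + φ u) * (N u' + φ u') else 0 := by
    rw [Finset.sum_comm, ← Equiv.sum_comp ρ⁻¹]
    refine Finset.sum_congr rfl fun u _ => ?_
    rw [← Equiv.sum_comp ρ⁻¹]
    refine Finset.sum_congr rfl fun u' _ => ?_
    rw [← hQ, ← hQ]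
    refine if_congr ?_ (mul_comm _ _) rfl
    simp [and_comm]
  have hK2 : (∑ u, ∑ u', if u < u' ∧ ρ⁻¹ u' < ρ⁻¹ u then (N u + φ u) * (N u' + φ u') else 0) =
      zeta f ρ + (∑ j, ∑ j', if f j < f j' ∧ ρ⁻¹ (f j') < ρ⁻¹ (f j) then (n j : ℤ) * n j' else 0) +
      (∑ j, (n j : ℤ) * ∑ u, ((if f j < u ∧ ρ⁻¹ u < ρ⁻¹ (f j) then φ u else 0) +
        if u < f j ∧ ρ⁻¹ (f j) < ρ⁻¹ u then φ u else 0)) := by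
    have h1 : (∑ j, ∑ j', if f j < f j' ∧ ρ⁻¹ (f j') < ρ⁻¹ (f j) then (n j : ℤ) * n j' else 0) =
        ∑ u, ∑ u', if u < u' ∧ ρ⁻¹ u' < ρ⁻¹ u then N u * N u' else 0 := by
      have h2 : ∀ u, (∑ u', if u < u' ∧ ρ⁻¹ u' < ρ⁻¹ u then N u * N u' else 0) =
          N u * ∑ j', (n j' : ℤ) * if u < f j' ∧ ρ⁻¹ (f j') < ρ⁻¹ u then 1 else 0 := by
        intro u
        rw [← sum_fiber f (fun j => (n j : ℤ)) fun u' => if u < u' ∧ ρ⁻¹ u' < ρ⁻¹ u then 1 else 0,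
          Finset.mul_sum]
        refine Finset.sum_congr rfl fun u' _ => ?_
        rw [hN]
        simp only
        split_ifs <;> ring
      rw [Finset.sum_congr rfl fun u _ => h2 u, sum_fiber f (fun j => (n j : ℤ)) fun u =>
        ∑ j', (n j' : ℤ) * if u < f j' ∧ ρ⁻¹ (f j') < ρ⁻¹ u then 1 else 0]
      refine Finset.sum_congr rfl fun j _ => ?_
      rw [Finset.mul_sum]
      refine Finset.sum_congr rfl fun j' _ => ?_
      split_ifs <;> ring
    rw [h1, ← sum_fiber f (fun j => (n j : ℤ)) fun v =>
      ∑ u, ((if v < u ∧ ρ⁻¹ u < ρ⁻¹ v then φ u else 0) +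
        if u < v ∧ ρ⁻¹ v < ρ⁻¹ u then φ u else 0)]
    have h3 : (∑ v, (∑ j, if f j = v then (n j : ℤ) else 0) *
        ∑ u, ((if v < u ∧ ρ⁻¹ u < ρ⁻¹ v then φ u else 0) +
        if u < v ∧ ρ⁻¹ v < ρ⁻¹ u then φ u else 0)) =
        ∑ u, ∑ u', if u < u' ∧ ρ⁻¹ u' < ρ⁻¹ u then N u * φ u' + φ u * N u' else 0 := by
      have h4 : ∀ u u', (if u < u' ∧ ρ⁻¹ u' < ρ⁻¹ u then N u * φ u' + φ u * N u' else 0) =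
          (if u < u' ∧ ρ⁻¹ u' < ρ⁻¹ u then N u * φ u' else 0) +
          if u < u' ∧ ρ⁻¹ u' < ρ⁻¹ u then φ u * N u' else 0 := by
        intro u u'
        split_ifs <;> ring
      simp only [h4, Finset.sum_add_distrib, mul_add]
      congr 1
      · refine Finset.sum_congr rfl fun u _ => ?_
        rw [Finset.mul_sum]
        refine Finset.sum_congr rfl fun u' _ => ?_
        rw [hN]
        split_ifs <;> ring
      · rw [Finset.sum_comm]
        refine Finset.sum_congr rfl fun u _ => ?_
        rw [Finset.mul_sum]
        refine Finset.sum_congr rfl fun u' _ => ?_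
        rw [hN]
        split_ifs <;> ring
    rw [h3, zeta, ← Finset.sum_add_distrib, ← Finset.sum_add_distrib]
    refine Finset.sum_congr rfl fun u _ => ?_
    rw [← Finset.sum_add_distrib, ← Finset.sum_add_distrib]
    refine Finset.sum_congr rfl fun u' _ => ?_
    split_ifs <;> ring
  have hquad : Even ((∑ j, ∑ j', if j < j' ∧ f j' < f j then (n j : ℤ) * n j' else 0) +
      (∑ j, ∑ j', if j < j' ∧ (⇑ρ⁻¹ ∘ f) j' < (⇑ρ⁻¹ ∘ f) j then (n j : ℤ) * n j' else 0) +
      ∑ j, ∑ j', if f j < f j' ∧ ρ⁻¹ (f j') < ρ⁻¹ (f j) then (n j : ℤ) * n j' else 0) := by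
    rw [sum_sum_lt (fun j j' => if f j < f j' ∧ ρ⁻¹ (f j') < ρ⁻¹ (f j) then (n j : ℤ) * n j' else 0)
      (by simp), ← Finset.sum_add_distrib, ← Finset.sum_add_distrib]
    refine even_sum_int _ _ fun j _ => ?_
    rw [← Finset.sum_add_distrib, ← Finset.sum_add_distrib]
    refine even_sum_int _ _ fun j' _ => ?_
    by_cases h : j < j'
    · simp only [h, true_and, if_true, mul_comm (n j' : ℤ)]
      exact even_inversion (by simp) _
    · simp [h]
  have hlin : Even ((∑ j, (n j : ℤ) * (tau f j - entry f j)) +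
      (∑ j, (n j : ℤ) * (tau (⇑ρ⁻¹ ∘ f) j - entry (⇑ρ⁻¹ ∘ f) j)) +
      (∑ j, (n j : ℤ) * ∑ u, ((if f j < u ∧ ρ⁻¹ u < ρ⁻¹ (f j) then φ u else 0) +
        if u < f j ∧ ρ⁻¹ (f j) < ρ⁻¹ u then φ u else 0))) := by
    rw [← Finset.sum_add_distrib, ← Finset.sum_add_distrib]
    refine even_sum_int _ _ fun j _ => ?_
    rw [← mul_add, ← mul_add]
    refine Even.mul_left ?_ _
    have h1 : (∑ u, if u < (⇑ρ⁻¹ ∘ f) j then norm1 ((⇑ρ⁻¹ ∘ f) ⁻¹' {u}) else 0) =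
        ∑ u, if ρ⁻¹ u < ρ⁻¹ (f j) then φ u else 0 := by
      rw [← Equiv.sum_comp ρ⁻¹]
      refine Finset.sum_congr rfl fun u _ => ?_
      refine if_congr Iff.rfl ?_ rfl
      rw [hφ]
      simp only
      congr 1
      ext j'
      simp
    have h2 : (∑ j', if (⇑ρ⁻¹ ∘ f) j' = (⇑ρ⁻¹ ∘ f) j ∧ j' < j then (1 : ℤ) else 0) =
        ∑ j', if f j' = f j ∧ j' < j then 1 else 0 := by
      simp
    rw [tau_sub_entry_eq, tau_sub_entry_eq, h1, h2]
    have h3 : Even ((∑ u, if u < f j then φ u else 0) +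
        (∑ u, if ρ⁻¹ u < ρ⁻¹ (f j) then φ u else 0) +
        ∑ u, ((if f j < u ∧ ρ⁻¹ u < ρ⁻¹ (f j) then φ u else 0) +
        if u < f j ∧ ρ⁻¹ (f j) < ρ⁻¹ u then φ u else 0)) := by
      rw [← Finset.sum_add_distrib, ← Finset.sum_add_distrib]
      refine even_sum_int _ _ fun u _ => ?_
      exact even_inversion (by simp) _
    obtain ⟨a, ha⟩ := h3
    refine ⟨a + ∑ j', (if f j' = f j ∧ j' < j then (1 : ℤ) else 0), ?_⟩
    linear_combination ha
  have hsum : ∑ i, ((q ∘ ⇑ρ⁻¹) i : ℤ) = ∑ i, (q i : ℤ) := Equiv.sum_comp ρ⁻¹ fun i => (q i : ℤ)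
  rw [Int.negOnePow_eq_iff, thetaExp, thetaExp, hsum, hK, hK2, eps, eps]
  obtain ⟨a, ha⟩ := hquad
  obtain ⟨b, hb⟩ := hlin
  refine ⟨a + b - (∑ j, ∑ j', if j < j' ∧ f j' < f j then (n j : ℤ) * n j' else 0) -
    (∑ j, ∑ j', if f j < f j' ∧ ρ⁻¹ (f j') < ρ⁻¹ (f j) then (n j : ℤ) * n j' else 0) -
    (∑ j, (n j : ℤ) * (tau f j - entry f j)) -
      (∑ j, (n j : ℤ) * ∑ u, ((if f j < u ∧ ρ⁻¹ u < ρ⁻¹ (f j) then φ u else 0) +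
        if u < f j ∧ ρ⁻¹ (f j) < ρ⁻¹ u then φ u else 0)), ?_⟩
  linear_combination ha + hb

end Signs

variable {R : Type*} [Ring R]

lemma bexp_map {ι κ : Type*} {m : ℕ} (lab : ι → κ) (h : Fin m → ι) (n : Fin m → ℕ) :
    bexp (lab ∘ h) n = (bexp h n).map (Option.map lab) := by
  have hblk : ∀ c t, blk (lab c) t = (blk c t).map (Option.map lab) := by
    intro c t
    induction t with
    | zero => rfl
    | succ t ih => simp [blk, ih]
  simp only [bexp, List.map_flatMap, Function.comp_apply, hblk]

lemma fill_map_letters {ι κ : Type*} (lab : ι → κ) (r : ℕ → R) (s : ℕ) (b : List (Option ι)) :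
    fill r s (b.map (Option.map lab)) = (fill r s b).map (Sum.map lab id) := by
  induction b generalizing s with
  | nil => rfl
  | cons c b ih => rcases c with _ | c <;> simp [ih]

/-- The multiplicities for `ρ⁻¹ ∘ f` are those for `f` with permuted degrees, and by `val_map`
corresponding words have the same value. Only the signs remain. -/
theorem theta_equivariant {k : ℕ} (ρ : Equiv.Perm (Fin k)) {f : NSeq k} (hf : complexity f.fn ≤ 2)
    (z : Fin k → HC R) (p : ℕ) (r : ℕ → R) :
    ev p r (theta R k (perm ρ (Finsupp.single f 1)) fun i => hom (z i)) =
      (∑ i : Fin k, ∑ i' : Fin k,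
        if i < i' ∧ ρ i' < ρ i then ((z i).1 : ℤ) * (z i').1 else 0).negOnePow •
          ev p r (theta R k (Finsupp.single f 1) fun i => hom (z (ρ⁻¹ i))) := by
  have hf' := complexity_le_two_iff.1 hf
  have hh : Noncrossing (List.ofFn (⇑ρ⁻¹ ∘ f.fn)) := by
    rw [← List.map_ofFn, noncrossing_map_iff ρ⁻¹.injective]
    exact hf'
  rw [perm, Finsupp.linearCombination_single, one_smul, ev_theta_units_smul, ev_theta_cls hh,
    ev_theta_single hf]
  have hdeg : deg (toG fun i => z (ρ⁻¹ i)) = deg (toG z) ∘ ⇑ρ⁻¹ := rfl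
  have hsum : ∑ i, (deg (toG z) ∘ ⇑ρ⁻¹) i = ∑ i, deg (toG z) i := Equiv.sum_comp ρ⁻¹ _
  have hmult : Mult f.fn (deg (toG z) ∘ ⇑ρ⁻¹) = Mult (⇑ρ⁻¹ ∘ f.fn) (deg (toG z)) := by
    ext n
    rw [mem_Mult, mem_Mult, ρ.surjective.forall]
    refine forall_congr' fun i => ?_
    have h1 : ∀ j, f.fn j = ρ i ↔ ρ⁻¹ (f.fn j) = i := fun j => ρ.symm_apply_eq.symm
    have h2 : ρ⁻¹ (ρ i) = i := ρ.symm_apply_apply i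
    simp only [Function.comp_apply, h1, h2]
  rw [hdeg, hsum]
  split_ifs
  · rw [hmult, Finset.smul_sum, Finset.smul_sum]
    refine Finset.sum_congr rfl fun n hn => ?_
    rw [smul_smul, smul_smul, ← Int.negOnePow_add, ← Int.negOnePow_add, sign_perm f.fn ρ hn,
      bexp_map, fill_map_letters, val_map ρ⁻¹.injective]
    rfl
  · simp

end Hochschild

namespace Hochschild

open SeqOperad

/-! ## Lattice paths with weights -/

section Path

variable {A B : Type*}

/-- `Path X Y Z` says that the pairs in `Z` form a lattice path from the first to the last corner of
the grid with rows `X` and columns `Y`, and that its weights determine the weights of the rows and of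
the columns: the weight of a row is the sum of the weights of its entries, and the weight of a
column is the sum of the weights of its entries plus the number of steps in the column. -/
inductive Path : List (A × ℕ) → List (B × ℕ) → List ((A × B) × ℕ) → Prop
  | empty (x : A) : Path [(x, 0)] [] []
  | last (x : A) (y : B) (n : ℕ) : Path [(x, n)] [(y, n)] [((x, y), n)]
  | left (x : A) (y : B) (n c : ℕ) {X Y Z} : Path X ((y, c) :: Y) Z →
      Path ((x, n) :: X) ((y, n + c + 1) :: Y) (((x, y), n) :: Z)
  | right (x : A) (y : B) (n p : ℕ) {y' : B} {c : ℕ} {X Y Z} :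
      Path ((x, p) :: X) ((y', c) :: Y) Z →
      Path ((x, p + n) :: X) ((y, n) :: (y', c) :: Y) (((x, y), n) :: Z)

/-- The first step is forced by the first weights: the path moves to the next row if the row weight
is smaller than the column weight, and otherwise to the next column, if there is one. -/
theorem Path.unique {X : List (A × ℕ)} {Y : List (B × ℕ)} {Z Z' : List ((A × B) × ℕ)}
    (h : Path X Y Z) (h' : Path X Y Z') : Z = Z' := by
  induction h generalizing Z' with
  | empty x =>
    generalize hX : [(x, 0)] = X at h'
    generalize hY : ([] : List (B × ℕ)) = Y at h'
    cases h' with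
    | empty => rfl
    | last => simp at hY
    | left => simp at hY
    | right => simp at hY
  | last x y n =>
    generalize hX : [(x, n)] = X at h'
    generalize hY : [(y, n)] = Y at h'
    cases h' with
    | empty => simp at hY
    | last => simp at hX hY; obtain ⟨rfl, rfl⟩ := hX; obtain ⟨rfl, -⟩ := hY; rfl
    | left x' y' n' c' h1 => simp at hX hY; omega
    | right => simp at hY
  | @left x y n c X Y Z h ih =>
    generalize hX : (x, n) :: X = X' at h'
    generalize hY : (y, n + c + 1) :: Y = Y' at h'
    cases h' with
    | empty => simp at hY
    | last => simp at hX hY; omega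
    | left x' y' n' c' h1 =>
      simp at hX hY
      obtain ⟨⟨rfl, rfl⟩, rfl⟩ := hX
      obtain ⟨⟨rfl, hc⟩, rfl⟩ := hY
      obtain rfl : c = c' := by omega
      rw [ih h1]
    | right => simp at hX hY; omega
  | @right x y n p y' c X Y Z h ih =>
    generalize hX : (x, p + n) :: X = X' at h'
    generalize hY : (y, n) :: (y', c) :: Y = Y' at h'
    cases h' with
    | empty => simp at hY
    | last => simp at hY
    | left => simp at hX hY; omega
    | right x' y'' n' p' h1 =>
      simp at hX hY
      obtain ⟨⟨rfl, hp⟩, rfl⟩ := hX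
      obtain ⟨⟨rfl, rfl⟩, ⟨rfl, rfl⟩, rfl⟩ := hY
      obtain rfl : p = p' := by omega
      rw [ih h1]

/-- The steps are chosen greedily. Splitting off the first corner preserves the relation between the
sums, and this relation guarantees that rows and columns are used up together. -/
theorem Path.exists_of_sum (X : List (A × ℕ)) (Y : List (B × ℕ))
    (h : (X.map fun x => x.2 + 1).sum = (Y.map Prod.snd).sum + 1) : ∃ Z, Path X Y Z := by
  induction hN : X.length + Y.length using Nat.strong_induction_on generalizing X Y with
  | _ N ih =>
    subst hN
    rcases X with _ | ⟨⟨x, p⟩, X⟩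
    · simp at h
    rcases Y with _ | ⟨⟨y, c⟩, Y⟩
    · rcases X with _ | ⟨⟨x', p'⟩, X⟩
      · simp at h
        subst h
        exact ⟨_, Path.empty x⟩
      · simp at h
        omega
    simp only [List.map_cons, List.sum_cons] at h
    by_cases hpc : p < c
    · obtain ⟨c', rfl⟩ : ∃ c', c = p + c' + 1 := ⟨c - p - 1, by omega⟩
      obtain ⟨Z, hZ⟩ := ih _ (by simp only [List.length_cons]; omega) X ((y, c') :: Y)
        (by simp only [List.map_cons, List.sum_cons]; omega) rfl
      exact ⟨_, Path.left x y p c' hZ⟩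
    · rcases Y with _ | ⟨⟨y', c'⟩, Y⟩
      · rcases X with _ | ⟨⟨x', p'⟩, X⟩
        · simp at h
          subst h
          exact ⟨_, Path.last x y p⟩
        · simp only [List.map_cons, List.sum_cons, List.map_nil, List.sum_nil] at h
          omega
      · obtain ⟨p', rfl⟩ : ∃ p', p = p' + c := ⟨p - c, by omega⟩
        obtain ⟨Z, hZ⟩ := ih _ (by simp only [List.length_cons]; omega) ((x, p') :: X)
          ((y', c') :: Y) (by simp only [List.map_cons, List.sum_cons] at h ⊢; omega) rfl
        exact ⟨_, Path.right x y c p' hZ⟩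

lemma Path.sum_eq {X : List (A × ℕ)} {Y : List (B × ℕ)} {Z : List ((A × B) × ℕ)}
    (h : Path X Y Z) : (X.map fun x => x.2 + 1).sum = (Y.map Prod.snd).sum + 1 := by
  induction h with
  | empty => simp
  | last => simp
  | left x y n c h ih => simp only [List.map_cons, List.sum_cons] at ih ⊢; omega
  | right x y n p h ih => simp only [List.map_cons, List.sum_cons] at ih ⊢; omega

lemma Path.length_eq {X : List (A × ℕ)} {Y : List (B × ℕ)} {Z : List ((A × B) × ℕ)}
    (h : Path X Y Z) : Z.length + 1 = X.length + Y.length := by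
  induction h with
  | empty => simp
  | last => simp
  | left x y n c h ih => simp only [List.length_cons] at ih ⊢; omega
  | right x y n p h ih => simp only [List.length_cons] at ih ⊢; omega

lemma Path.head {x : A} {y : B} {p c : ℕ} {X : List (A × ℕ)} {Y : List (B × ℕ)}
    {Z : List ((A × B) × ℕ)} (h : Path ((x, p) :: X) ((y, c) :: Y) Z) :
    ∃ n Z', Z = ((x, y), n) :: Z' := by
  cases h <;> exact ⟨_, _, rfl⟩

lemma Path.mem_left {X : List (A × ℕ)} {Y : List (B × ℕ)} {Z : List ((A × B) × ℕ)}
    (h : Path X Y Z) : ∀ t ∈ Z, t.1.1 ∈ X.map Prod.fst := by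
  induction h with
  | empty => simp
  | last => simp
  | left x y n c h ih =>
    intro t ht
    rcases List.mem_cons.1 ht with rfl | ht
    · simp
    · exact List.mem_cons_of_mem _ (ih t ht)
  | right x y n p h ih =>
    intro t ht
    rcases List.mem_cons.1 ht with rfl | ht
    · simp
    · exact ih t ht

lemma Path.mem_right {X : List (A × ℕ)} {Y : List (B × ℕ)} {Z : List ((A × B) × ℕ)}
    (h : Path X Y Z) : ∀ t ∈ Z, t.1.2 ∈ Y.map Prod.fst := by
  induction h with
  | empty => simp
  | last => simp
  | left x y n c h ih =>
    intro t ht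
    rcases List.mem_cons.1 ht with rfl | ht
    · simp
    · exact ih t ht
  | right x y n p h ih =>
    intro t ht
    rcases List.mem_cons.1 ht with rfl | ht
    · simp
    · exact List.mem_cons_of_mem _ (ih t ht)

lemma Path.cover_left {X : List (A × ℕ)} {Y : List (B × ℕ)} {Z : List ((A × B) × ℕ)}
    (h : Path X Y Z) (hY : Y ≠ []) : ∀ x ∈ X.map Prod.fst, ∃ t ∈ Z, t.1.1 = x := by
  induction h with
  | empty => simp at hY
  | last => simp
  | left x y n c h ih =>
    intro x' hx'
    rcases List.mem_cons.1 hx' with rfl | hx'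
    · exact ⟨_, List.mem_cons_self, rfl⟩
    · obtain ⟨t, ht, rfl⟩ := ih (by simp) x' hx'
      exact ⟨t, List.mem_cons_of_mem _ ht, rfl⟩
  | right x y n p h ih =>
    intro x' hx'
    obtain ⟨t, ht, rfl⟩ := ih (by simp) x' hx'
    exact ⟨t, List.mem_cons_of_mem _ ht, rfl⟩

lemma Path.cover_right {X : List (A × ℕ)} {Y : List (B × ℕ)} {Z : List ((A × B) × ℕ)}
    (h : Path X Y Z) : ∀ y ∈ Y.map Prod.fst, ∃ t ∈ Z, t.1.2 = y := by
  induction h with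
  | empty => simp
  | last => simp
  | left x y n c h ih =>
    intro y' hy'
    obtain ⟨t, ht, rfl⟩ := ih y' hy'
    exact ⟨t, List.mem_cons_of_mem _ ht, rfl⟩
  | right x y n p h ih =>
    intro y' hy'
    rcases List.mem_cons.1 hy' with rfl | hy'
    · exact ⟨_, List.mem_cons_self, rfl⟩
    · obtain ⟨t, ht, rfl⟩ := ih y' hy'
      exact ⟨t, List.mem_cons_of_mem _ ht, rfl⟩

lemma sum_ite_eq_zero {T : Type*} (Z : List T) (P : T → Prop) [DecidablePred P] (F : T → ℕ)
    (h : ∀ t ∈ Z, ¬ P t) : (Z.map fun t => if P t then F t else 0).sum = 0 := by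
  refine List.sum_eq_zero fun n hn => ?_
  obtain ⟨t, ht, rfl⟩ := List.mem_map.1 hn
  exact if_neg (h t ht)

lemma Path.sum_left [DecidableEq A] {X : List (A × ℕ)} {Y : List (B × ℕ)}
    {Z : List ((A × B) × ℕ)} (h : Path X Y Z) (hX : (X.map Prod.fst).Nodup) :
    ∀ x ∈ X, (Z.map fun t => if t.1.1 = x.1 then t.2 else 0).sum = x.2 := by
  induction h with
  | empty => simp
  | last => simp
  | @left x y n c X Y Z h ih =>
    simp only [List.map_cons, List.nodup_cons] at hX
    intro x' hx'
    rcases List.mem_cons.1 hx' with rfl | hx2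
    · simp only [List.map_cons, List.sum_cons, if_true]
      have h0 : (Z.map fun t => if t.1.1 = x then t.2 else 0).sum = 0 :=
        sum_ite_eq_zero Z (fun t => t.1.1 = x) Prod.snd fun t ht he =>
          hX.1 (he ▸ h.mem_left t ht)
      rw [h0, add_zero]
    · simp only [List.map_cons, List.sum_cons]
      rw [ih hX.2 x' hx2, if_neg, zero_add]
      rintro rfl
      exact hX.1 (List.mem_map_of_mem hx2)
  | right x y n p h ih =>
    intro x' hx'
    have hX' := hX
    simp only [List.map_cons, List.nodup_cons] at hX
    rcases List.mem_cons.1 hx' with rfl | hx2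
    · have := ih hX' (x, p) List.mem_cons_self
      simp only [List.map_cons, List.sum_cons, if_true]
      rw [this, add_comm]
    · simp only [List.map_cons, List.sum_cons]
      rw [ih hX' x' (List.mem_cons_of_mem _ hx2), if_neg, zero_add]
      rintro rfl
      exact hX.1 (List.mem_map_of_mem hx2)

lemma Path.sum_right [DecidableEq B] {X : List (A × ℕ)} {Y : List (B × ℕ)}
    {Z : List ((A × B) × ℕ)} (h : Path X Y Z) (hY : (Y.map Prod.fst).Nodup) :
    ∀ y ∈ Y, (Z.map fun t => if t.1.2 = y.1 then t.2 + 1 else 0).sum = y.2 + 1 := by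
  induction h with
  | empty => simp
  | last => simp
  | left x y n c h ih =>
    intro y' hy'
    have hY' := hY
    simp only [List.map_cons, List.nodup_cons] at hY
    rcases List.mem_cons.1 hy' with rfl | hy2
    · have := ih hY' (y, c) List.mem_cons_self
      simp only [List.map_cons, List.sum_cons, if_true]
      rw [this]
      omega
    · simp only [List.map_cons, List.sum_cons]
      rw [ih hY' y' (List.mem_cons_of_mem _ hy2), if_neg, zero_add]
      rintro rfl
      exact hY.1 (List.mem_map_of_mem hy2)
  | @right x y n p y₁ c X Y Z h ih =>
    intro y' hy'
    rw [List.map_cons, List.nodup_cons] at hY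
    rcases List.mem_cons.1 hy' with rfl | hy2
    · simp only [List.map_cons, List.sum_cons, if_true]
      have h0 : (Z.map fun t => if t.1.2 = y then t.2 + 1 else 0).sum = 0 :=
        sum_ite_eq_zero Z (fun t => t.1.2 = y) (fun t => t.2 + 1) fun t ht he =>
          hY.1 (he ▸ h.mem_right t ht)
      rw [h0, add_zero]
    · simp only [List.map_cons, List.sum_cons]
      rw [ih hY.2 y' hy2, if_neg, zero_add]
      rintro rfl
      exact hY.1 (List.mem_map.2 ⟨y', hy2, rfl⟩)

/-- The steps of a lattice path. -/
def Step [LT A] [LT B] (u v : A × B) : Prop := (u.1 < v.1 ∧ u.2 = v.2) ∨ (u.1 = v.1 ∧ u.2 < v.2)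

lemma Step.le [PartialOrder A] [PartialOrder B] {u v : A × B} (h : Step u v) : u ≤ v := by
  rcases h with ⟨h1, h2⟩ | ⟨h1, h2⟩
  · exact ⟨h1.le, h2.le⟩
  · exact ⟨h1.le, h2.le⟩

lemma Path.isChain [PartialOrder A] [PartialOrder B] {X : List (A × ℕ)} {Y : List (B × ℕ)}
    {Z : List ((A × B) × ℕ)} (h : Path X Y Z) (hX : (X.map Prod.fst).Pairwise (· < ·))
    (hY : (Y.map Prod.fst).Pairwise (· < ·)) : (Z.map Prod.fst).IsChain Step := by
  induction h with
  | empty => simp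
  | last => simp
  | @left x y n c X Y Z h ih =>
    rw [List.map_cons, List.pairwise_cons] at hX
    have h1 := ih hX.2 (by simpa using hY)
    rcases X with _ | ⟨⟨x', p'⟩, X⟩
    · cases h
    obtain ⟨n', Z', rfl⟩ := h.head
    rw [List.map_cons, List.map_cons, List.isChain_cons_cons]
    exact ⟨Or.inl ⟨hX.1 _ (by simp), rfl⟩, h1⟩
  | @right x y n p y' c X Y Z h ih =>
    rw [List.map_cons, List.pairwise_cons] at hY
    have h1 := ih (by simpa using hX) hY.2
    obtain ⟨n', Z', rfl⟩ := h.head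
    rw [List.map_cons, List.map_cons, List.isChain_cons_cons]
    exact ⟨Or.inr ⟨rfl, hY.1 _ (by simp)⟩, h1⟩

lemma IsChain_le_head {T : Type*} [PartialOrder T] {t : T} {l : List T}
    (h : (t :: l).IsChain (· ≤ ·)) : ∀ t' ∈ l, t ≤ t' := by
  rw [List.isChain_iff_pairwise, List.pairwise_cons] at h
  exact h.1

lemma exists_eq_cons_of_le {T : Type*} [PartialOrder T] {L : List T} {a : T}
    (hL : L.Pairwise (· < ·)) (ha : a ∈ L) (hb : ∀ b ∈ L, a ≤ b) : ∃ L', L = a :: L' := by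
  rcases L with _ | ⟨a', L⟩
  · simp at ha
  · rcases List.mem_cons.1 ha with rfl | ha
    · exact ⟨L, rfl⟩
    · exact absurd ((List.pairwise_cons.1 hL).1 a ha) (hb a' (by simp)).not_gt

/-- The first entry is the corner because the chain is increasing and meets all rows and columns.
The step to the second entry tells whether the first row or the first column is finished, and the
weights are read off from the chain. -/
theorem Path.of_isChain [PartialOrder A] [PartialOrder B] [DecidableEq A] [DecidableEq B]
    {X : List A} {Y : List B} {Z : List ((A × B) × ℕ)} (hX : X.Pairwise (· < ·))
    (hY : Y.Pairwise (· < ·)) (hZ : (Z.map Prod.fst).IsChain Step)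
    (hne : Z ≠ []) (hX1 : ∀ t ∈ Z, t.1.1 ∈ X) (hY1 : ∀ t ∈ Z, t.1.2 ∈ Y)
    (hX2 : ∀ x ∈ X, ∃ t ∈ Z, t.1.1 = x) (hY2 : ∀ y ∈ Y, ∃ t ∈ Z, t.1.2 = y) :
    Path (X.map fun x => (x, (Z.map fun t => if t.1.1 = x then t.2 else 0).sum))
      (Y.map fun y => (y, (Z.map fun t => if t.1.2 = y then t.2 + 1 else 0).sum - 1)) Z := by
  induction Z generalizing X Y with
  | nil => exact absurd rfl hne
  | cons t Z ih =>
    obtain ⟨⟨x, y⟩, n⟩ := t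
    have hle : ∀ t ∈ Z, x ≤ t.1.1 ∧ y ≤ t.1.2 := by
      rw [List.map_cons] at hZ
      have := IsChain_le_head (hZ.imp fun _ _ h => h.le)
      intro t ht
      exact this t.1 (List.mem_map_of_mem ht)
    obtain ⟨X, rfl⟩ := exists_eq_cons_of_le hX (hX1 _ List.mem_cons_self) (by
      intro x' hx'
      obtain ⟨t, ht, rfl⟩ := hX2 x' hx'
      rcases List.mem_cons.1 ht with rfl | ht
      · exact le_rfl
      · exact (hle t ht).1)
    obtain ⟨Y, rfl⟩ := exists_eq_cons_of_le hY (hY1 _ List.mem_cons_self) (by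
      intro y' hy'
      obtain ⟨t, ht, rfl⟩ := hY2 y' hy'
      rcases List.mem_cons.1 ht with rfl | ht
      · exact le_rfl
      · exact (hle t ht).2)
    have hXc := List.pairwise_cons.1 hX
    have hYc := List.pairwise_cons.1 hY
    rcases Z with _ | ⟨⟨⟨x', y'⟩, n'⟩, Z⟩
    · obtain rfl : X = [] := by
        refine List.eq_nil_iff_forall_not_mem.2 fun x' hx' => ?_
        obtain ⟨t, ht, rfl⟩ := hX2 x' (by simp [hx'])
        rw [List.mem_singleton] at ht
        subst ht
        exact lt_irrefl _ (hXc.1 _ hx')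
      obtain rfl : Y = [] := by
        refine List.eq_nil_iff_forall_not_mem.2 fun y' hy' => ?_
        obtain ⟨t, ht, rfl⟩ := hY2 y' (by simp [hy'])
        rw [List.mem_singleton] at ht
        subst ht
        exact lt_irrefl _ (hYc.1 _ hy')
      simpa using Path.last x y n
    · set Z' := ((x', y'), n') :: Z with hZ'
      have hchain : (Z'.map Prod.fst).IsChain Step := by
        rw [List.map_cons] at hZ
        exact hZ.tail
      have hstep : Step (x, y) (x', y') := by
        rw [List.map_cons, hZ', List.map_cons, List.isChain_cons_cons] at hZ
        exact hZ.1
      have hle' : ∀ t ∈ Z', x' ≤ t.1.1 ∧ y' ≤ t.1.2 := by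
        intro t ht
        rcases List.mem_cons.1 ht with rfl | ht
        · exact ⟨le_rfl, le_rfl⟩
        · rw [hZ', List.map_cons] at hchain
          exact IsChain_le_head (hchain.imp fun _ _ h => h.le) t.1 (List.mem_map_of_mem ht)
      rcases hstep with ⟨h1, h2⟩ | ⟨h1, h2⟩
      · dsimp only at h1 h2
        subst h2
        have hnot : ∀ t ∈ Z', t.1.1 ≠ x := fun t ht he => (h1.trans_le (he ▸ (hle' t ht).1)).false
        have hih := ih hXc.2 hY hchain (by simp [hZ'])
          (fun t ht => (List.mem_cons.1 (hX1 t (List.mem_cons_of_mem _ ht))).resolve_left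
            (hnot t ht))
          (fun t ht => hY1 t (List.mem_cons_of_mem _ ht))
          (fun x'' hx'' => by
            obtain ⟨t, ht, rfl⟩ := hX2 x'' (List.mem_cons_of_mem _ hx'')
            rcases List.mem_cons.1 ht with rfl | ht
            · exact absurd (hXc.1 _ hx'') (lt_irrefl _)
            · exact ⟨t, ht, rfl⟩)
          (fun y'' hy'' => by
            obtain ⟨t, ht, rfl⟩ := hY2 y'' hy''
            rcases List.mem_cons.1 ht with rfl | ht
            · exact ⟨((x', y), n'), by simp [hZ'], rfl⟩
            · exact ⟨t, ht, rfl⟩)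
        have hsum0 : (Z'.map fun t => if t.1.1 = x then t.2 else 0).sum = 0 :=
          sum_ite_eq_zero _ (fun t : (A × B) × ℕ => t.1.1 = x) Prod.snd hnot
        -- The next entry lies in the same column, so the truncated subtraction in the column weight
        -- is a genuine one.
        have hpos : 1 ≤ (Z'.map fun t => if t.1.2 = y then t.2 + 1 else 0).sum := by
          simp [hZ']
          omega
        have hXmap : (X.map fun x'' =>
            (x'', ((((x, y), n) :: Z').map fun t => if t.1.1 = x'' then t.2 else 0).sum)) =
            X.map fun x'' => (x'', (Z'.map fun t => if t.1.1 = x'' then t.2 else 0).sum) := by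
          refine List.map_congr_left fun x'' hx'' => ?_
          rw [List.map_cons, List.sum_cons, if_neg (hXc.1 _ hx'').ne, zero_add]
        have hYmap : (Y.map fun y'' =>
            (y'', ((((x, y), n) :: Z').map fun t => if t.1.2 = y'' then t.2 + 1 else 0).sum - 1)) =
            Y.map fun y'' =>
              (y'', (Z'.map fun t => if t.1.2 = y'' then t.2 + 1 else 0).sum - 1) := by
          refine List.map_congr_left fun y'' hy'' => ?_
          rw [List.map_cons, List.sum_cons, if_neg (hYc.1 _ hy'').ne, zero_add]
        rw [List.map_cons (l := X), List.map_cons (l := Y), hXmap, hYmap]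
        rw [List.map_cons] at hih
        have := Path.left x y n _ hih
        convert this using 3
        · simp [hsum0]
        · simp only [List.map_cons, List.sum_cons, if_true]
          omega
      · dsimp only at h1 h2
        subst h1
        have hnot : ∀ t ∈ Z', t.1.2 ≠ y := fun t ht he => (h2.trans_le (he ▸ (hle' t ht).2)).false
        have hih := ih hX hYc.2 hchain (by simp [hZ'])
          (fun t ht => hX1 t (List.mem_cons_of_mem _ ht))
          (fun t ht => (List.mem_cons.1 (hY1 t (List.mem_cons_of_mem _ ht))).resolve_left
            (hnot t ht))
          (fun x'' hx'' => by
            obtain ⟨t, ht, rfl⟩ := hX2 x'' hx''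
            rcases List.mem_cons.1 ht with rfl | ht
            · exact ⟨((x, y'), n'), by simp [hZ'], rfl⟩
            · exact ⟨t, ht, rfl⟩)
          (fun y'' hy'' => by
            obtain ⟨t, ht, rfl⟩ := hY2 y'' (List.mem_cons_of_mem _ hy'')
            rcases List.mem_cons.1 ht with rfl | ht
            · exact absurd (hYc.1 _ hy'') (lt_irrefl _)
            · exact ⟨t, ht, rfl⟩)
        have hsum0 : (Z'.map fun t => if t.1.2 = y then t.2 + 1 else 0).sum = 0 :=
          sum_ite_eq_zero _ (fun t : (A × B) × ℕ => t.1.2 = y) (fun t => t.2 + 1) hnot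
        have hXmap : (X.map fun x'' =>
            (x'', ((((x, y), n) :: Z').map fun t => if t.1.1 = x'' then t.2 else 0).sum)) =
            X.map fun x'' => (x'', (Z'.map fun t => if t.1.1 = x'' then t.2 else 0).sum) := by
          refine List.map_congr_left fun x'' hx'' => ?_
          rw [List.map_cons, List.sum_cons, if_neg (hXc.1 _ hx'').ne, zero_add]
        have hYmap : (Y.map fun y'' =>
            (y'', ((((x, y), n) :: Z').map fun t => if t.1.2 = y'' then t.2 + 1 else 0).sum - 1)) =
            Y.map fun y'' =>
              (y'', (Z'.map fun t => if t.1.2 = y'' then t.2 + 1 else 0).sum - 1) := by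
          refine List.map_congr_left fun y'' hy'' => ?_
          rw [List.map_cons, List.sum_cons, if_neg (hYc.1 _ hy'').ne, zero_add]
        rw [List.map_cons (l := X), List.map_cons (l := Y), hXmap, hYmap]
        obtain ⟨Y', rfl⟩ : ∃ Y', Y = y' :: Y' := by
          refine exists_eq_cons_of_le hYc.2 ?_ ?_
          · exact (List.mem_cons.1 (hY1 ((x, y'), n') (by simp [hZ']))).resolve_left h2.ne'
          · intro y'' hy''
            obtain ⟨t, ht, rfl⟩ := hY2 y'' (List.mem_cons_of_mem _ hy'')
            rcases List.mem_cons.1 ht with rfl | ht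
            · exact absurd (hYc.1 _ hy'') (lt_irrefl _)
            · exact (hle' t ht).2
        rw [List.map_cons (l := X), List.map_cons (l := Y')] at hih
        have := Path.right x y n _ hih
        rw [List.map_cons (l := Y')]
        convert this using 3
        · simp only [List.map_cons, List.sum_cons, if_true]
          omega
        · simp [hsum0]

variable {ι : Type*}

lemma blk_add (c : ι) (n n' : ℕ) : blk c (n + n' + 1) = blk c n ++ none :: blk c n' := by
  induction n with
  | zero => simp [blk]
  | succ n ih =>
    rw [show n + 1 + n' + 1 = (n + n' + 1) + 1 by omega, blk, ih]
    rfl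

/-- The word read off from a row of a path. -/
def rowWord [DecidableEq A] (L : B → ι) (Z : List ((A × B) × ℕ)) (x : A) : List (Option ι) :=
  (Z.filter fun t => t.1.1 = x).flatMap fun t => blk (L t.1.2) t.2

/-- A step to the next row within a column removes one bar from the block of this column. Putting a
bar in front of each row restores these bars, while a step within a row changes the column and needs
no bar. -/
theorem Path.word_eq [DecidableEq A] {X : List (A × ℕ)} {Y : List (B × ℕ)}
    {Z : List ((A × B) × ℕ)} (h : Path X Y Z) (hX : (X.map Prod.fst).Nodup) (L : B → ι) :
    (X.map Prod.fst).flatMap (fun x => none :: rowWord L Z x) =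
      none :: Y.flatMap fun y => blk (L y.1) y.2 := by
  induction h with
  | empty => simp [rowWord]
  | last => simp [rowWord]
  | @left x y n c X Y Z h ih =>
    rw [List.map_cons, List.nodup_cons] at hX
    have h1 : rowWord L (((x, y), n) :: Z) x = blk (L y) n := by
      have : Z.filter (fun t => t.1.1 = x) = [] := by
        rw [List.filter_eq_nil_iff]
        intro t ht
        simp only [decide_eq_true_eq]
        rintro rfl
        exact hX.1 (h.mem_left t ht)
      simp [rowWord, this]
    have h2 : (X.map Prod.fst).flatMap (fun x' => none :: rowWord L (((x, y), n) :: Z) x') =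
        (X.map Prod.fst).flatMap (fun x' => none :: rowWord L Z x') := by
      refine List.flatMap_congr fun x' hx' => ?_
      have : x ≠ x' := by rintro rfl; exact hX.1 hx'
      simp [rowWord, this]
    rw [List.map_cons, List.flatMap_cons, h1, h2, ih hX.2, List.flatMap_cons, List.flatMap_cons,
      blk_add]
    simp
  | @right x y n p y' c X Y Z h ih =>
    have hX' := hX
    rw [List.map_cons, List.nodup_cons] at hX
    have h1 : rowWord L (((x, y), n) :: Z) x = blk (L y) n ++ rowWord L Z x := by
      simp [rowWord]
    have h2 : (X.map Prod.fst).flatMap (fun x' => none :: rowWord L (((x, y), n) :: Z) x') =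
        (X.map Prod.fst).flatMap (fun x' => none :: rowWord L Z x') := by
      refine List.flatMap_congr fun x' hx' => ?_
      have : x ≠ x' := by rintro rfl; exact hX.1 hx'
      simp [rowWord, this]
    have h3 := ih hX'
    rw [List.map_cons, List.flatMap_cons] at h3 ⊢
    rw [h1, h2, List.flatMap_cons]
    simp only [List.cons_append, List.cons.injEq, true_and] at h3 ⊢
    rw [List.append_assoc, h3]

end Path

end Hochschild

namespace Hochschild

open SeqOperad

/-! ## Weighted diagrams -/

/-- This translates between neighbours in the list of positions of a summand and covering pairs, in
terms of which special diagrams are defined. -/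
lemma isChain_iff_of_sorted {T : Type*} [LinearOrder T] {L : List T} (hL : L.Pairwise (· < ·))
    (r : T → T → Prop) :
    L.IsChain r ↔ ∀ l ∈ L, ∀ l' ∈ L, l < l' → (∀ l'' ∈ L, ¬ (l < l'' ∧ l'' < l')) → r l l' := by
  induction L with
  | nil => simp
  | cons a L ih =>
    rcases L with _ | ⟨b, L⟩
    · simp
    rw [List.isChain_cons_cons, ih hL.tail]
    have hab : a < b := (List.pairwise_cons.1 hL).1 b (by simp)
    have hb : ∀ l ∈ L, b < l := (List.pairwise_cons.1 hL.tail).1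
    constructor
    · rintro ⟨h1, h2⟩ l hl l' hl' hlt hbet
      have ha : ∀ x ∈ b :: L, a < x := (List.pairwise_cons.1 hL).1
      have hm' : l' ∈ b :: L := by
        refine (List.mem_cons.1 hl').resolve_left ?_
        rintro rfl
        rcases List.mem_cons.1 hl with h | h
        · exact hlt.ne h
        · exact hlt.not_gt (ha l h)
      rcases List.mem_cons.1 hl with h3 | hm
      · rcases List.mem_cons.1 hm' with h4 | hm2
        · rwa [h3, h4]
        · exact absurd ⟨h3 ▸ hab, hb l' hm2⟩ (hbet b (by simp))
      · exact h2 l hm l' hm' hlt fun l'' hl'' => hbet l'' (List.mem_cons_of_mem _ hl'')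
    · intro h
      refine ⟨h a (by simp) b (by simp) hab ?_, fun l hl l' hl' hlt hbet =>
        h l (List.mem_cons_of_mem _ hl) l' (List.mem_cons_of_mem _ hl') hlt ?_⟩
      · rintro l'' hl'' ⟨h1, h2⟩
        rcases List.mem_cons.1 hl'' with rfl | hl''
        · exact lt_irrefl _ h1
        rcases List.mem_cons.1 hl'' with rfl | hl''
        · exact lt_irrefl _ h2
        · exact lt_asymm h2 (hb l'' hl'')
      · rintro l'' hl'' h3
        rcases List.mem_cons.1 hl'' with rfl | hl''
        · exact absurd h3.1 ((List.pairwise_cons.1 hL).1 l hl).not_gt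
        · exact hbet l'' hl'' h3

lemma sum_map_filter {T : Type*} (L : List T) (P : T → Prop) [DecidablePred P] (F : T → ℕ) :
    ((L.filter (fun t => P t)).map F).sum = (L.map fun t => if P t then F t else 0).sum := by
  induction L with
  | nil => rfl
  | cons t L ih => by_cases h : P t <;> simp [h, ih]

lemma pairwise_filter_finRange {n : ℕ} (P : Fin n → Bool) :
    ((List.finRange n).filter P).Pairwise (· < ·) := (List.pairwise_lt_finRange n).filter _

lemma flatMap_filter_eq {T V : Type*} [LinearOrder V] {L : List V} (hL : L.Pairwise (· < ·))
    (φ : T → V) {Z : List T} (hZ : (Z.map φ).Pairwise (· ≤ ·)) (hm : ∀ t ∈ Z, φ t ∈ L) :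
    L.flatMap (fun j => Z.filter fun t => φ t = j) = Z := by
  induction L generalizing Z with
  | nil =>
    rw [List.eq_nil_iff_forall_not_mem.2 fun t ht => List.not_mem_nil (hm t ht)]
    rfl
  | cons j L ih =>
    have hj : ∀ t ∈ Z, j ≤ φ t := fun t ht => by
      rcases List.mem_cons.1 (hm t ht) with h | h
      · exact h.ge
      · exact ((List.pairwise_cons.1 hL).1 _ h).le
    have hsplit : ∀ Z : List T, (Z.map φ).Pairwise (· ≤ ·) → (∀ t ∈ Z, j ≤ φ t) →
        Z.filter (fun t => φ t = j) ++ Z.filter (fun t => φ t ≠ j) = Z := by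
      intro Z hZ hj
      induction Z with
      | nil => rfl
      | cons t Z ih =>
        rw [List.map_cons, List.pairwise_cons] at hZ
        by_cases ht : φ t = j
        · have := ih hZ.2 fun t' ht' => hj t' (List.mem_cons_of_mem _ ht')
          simp only [ht, decide_true, List.filter_cons_of_pos, ne_eq, not_true, decide_false,
            Bool.false_eq_true, not_false_eq_true, List.filter_cons_of_neg, List.cons_append] at this ⊢
          rw [this]
        · have hgt : ∀ t' ∈ Z, j < φ t' := fun t' ht' =>
            (lt_of_le_of_ne (hj t (by simp)) (Ne.symm ht)).trans_le
              (hZ.1 _ (List.mem_map_of_mem ht'))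
          have h1 : (t :: Z).filter (fun t => φ t = j) = [] := by
            rw [List.filter_eq_nil_iff]
            intro t' ht'
            rcases List.mem_cons.1 ht' with rfl | ht'
            · simpa using ht
            · simpa using (hgt t' ht').ne'
          have h2 : (t :: Z).filter (fun t => φ t ≠ j) = t :: Z := by
            rw [List.filter_eq_self]
            intro t' ht'
            rcases List.mem_cons.1 ht' with rfl | ht'
            · simpa using ht
            · simpa using (hgt t' ht').ne'
          rw [h1, h2, List.nil_append]
    have h2 : L.flatMap (fun j' => Z.filter fun t => φ t = j') =
        L.flatMap fun j' => (Z.filter fun t => φ t ≠ j).filter fun t => φ t = j' := by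
      refine List.flatMap_congr fun j' hj' => ?_
      rw [List.filter_filter]
      refine List.filter_congr fun t _ => ?_
      have := ((List.pairwise_cons.1 hL).1 _ hj').ne'
      by_cases h : φ t = j'
      · simp [h, this]
      · simp [h]
    have hsub : (Z.filter fun t => φ t ≠ j).Sublist Z := List.filter_sublist
    rw [List.flatMap_cons, h2, ih (List.pairwise_cons.1 hL).2 (hZ.sublist (hsub.map φ)) ?_,
      hsplit Z hZ hj]
    intro t ht
    rw [List.mem_filter] at ht
    exact (List.mem_cons.1 (hm t ht.1)).resolve_left (by simpa using ht.2)

section Weighted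

variable {m k N : ℕ} {f : Fin m → Fin k} {ms : Fin k → ℕ}

/-- The rows of the `i`-th path of a diagram: the positions of `i` in `f`, with weights `ν`. -/
def rows (f : Fin m → Fin k) (ν : Fin m → ℕ) (i : Fin k) : List (Fin m × ℕ) :=
  ((List.finRange m).filter fun j => f j = i).map fun j => (j, ν j)

/-- The columns of the `i`-th path of a diagram: the positions of the `i`-th sequence. -/
def cols (c : ∀ i, Fin (ms i) → ℕ) (i : Fin k) : List ((Σ i : Fin k, Fin (ms i)) × ℕ) :=
  (List.finRange (ms i)).map fun r => (⟨i, r⟩, c i r)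

/-- The `i`-th path of the diagram `(a, b)`, with weights `n`. -/
def trail (a : Fin N → Fin m) (b : Fin N → Σ i : Fin k, Fin (ms i)) (n : Fin N → ℕ) (i : Fin k) :
    List ((Fin m × Σ i : Fin k, Fin (ms i)) × ℕ) :=
  ((List.finRange N).filter fun l => (b l).1 = i).map fun l => ((a l, b l), n l)

/-- `(a, b)` is a diagram whose paths, weighted by `n`, have row weights `ν` and column weights
`c`. -/
structure IsWeighted (f : Fin m → Fin k) (a : Fin N → Fin m)
    (b : Fin N → Σ i : Fin k, Fin (ms i)) (n : Fin N → ℕ) (c : ∀ i, Fin (ms i) → ℕ)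
    (ν : Fin m → ℕ) : Prop where
  mono : Monotone a
  comm : ∀ l, f (a l) = (b l).1
  path : ∀ i, Path (rows f ν i) (cols c i) (trail a b n i)

variable {a : Fin N → Fin m} {b : Fin N → Σ i : Fin k, Fin (ms i)} {n : Fin N → ℕ}
  {c : ∀ i, Fin (ms i) → ℕ} {ν : Fin m → ℕ}

lemma map_fst_rows (f : Fin m → Fin k) (ν : Fin m → ℕ) (i : Fin k) :
    (rows f ν i).map Prod.fst = (List.finRange m).filter fun j => f j = i := by
  rw [rows, List.map_map]
  exact List.map_id _

lemma map_fst_cols (c : ∀ i, Fin (ms i) → ℕ) (i : Fin k) :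
    (cols c i).map Prod.fst = (List.finRange (ms i)).map fun r => ⟨i, r⟩ := by
  rw [cols, List.map_map]
  rfl

lemma map_fst_trail (i : Fin k) : (trail a b n i).map Prod.fst =
    ((List.finRange N).filter fun l => (b l).1 = i).map fun l => (a l, b l) := by
  rw [trail, List.map_map]
  rfl

lemma rows_sorted (f : Fin m → Fin k) (ν : Fin m → ℕ) (i : Fin k) :
    ((rows f ν i).map Prod.fst).Pairwise (· < ·) := by
  rw [map_fst_rows]
  exact pairwise_filter_finRange _

lemma cols_sorted (c : ∀ i, Fin (ms i) → ℕ) (i : Fin k) :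
    ((cols c i).map Prod.fst).Pairwise (· < ·) := by
  rw [map_fst_cols, List.pairwise_map]
  refine (List.pairwise_lt_finRange (ms i)).imp ?_
  intro r r' hr
  exact Sigma.mk_lt_mk_iff.2 hr

lemma mem_trail {i : Fin k} {t : (Fin m × Σ i : Fin k, Fin (ms i)) × ℕ} :
    t ∈ trail a b n i ↔ ∃ l, (b l).1 = i ∧ ((a l, b l), n l) = t := by
  simp [trail]

lemma sum_trail (i : Fin k) (F : (Fin m × Σ i : Fin k, Fin (ms i)) × ℕ → ℕ) :
    ((trail a b n i).map F).sum =
      ∑ l, if (b l).1 = i then F ((a l, b l), n l) else 0 := by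
  rw [trail, List.map_map, sum_map_filter, sum_map_finRange]
  rfl

lemma nodup_of_sorted {T : Type*} [PartialOrder T] {L : List T} (hL : L.Pairwise (· < ·)) :
    L.Nodup := hL.imp fun h => h.ne

lemma IsWeighted.row_sum (h : IsWeighted f a b n c ν) (j : Fin m) :
    ∑ l, (if a l = j then n l else 0) = ν j := by
  have h1 := (h.path (f j)).sum_left (nodup_of_sorted (rows_sorted f ν _)) (j, ν j)
    (by simp [rows])
  rw [sum_trail] at h1
  refine Eq.trans ?_ h1
  refine Finset.sum_congr rfl fun l _ => ?_
  by_cases hl : a l = j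
  · subst hl
    simp [h.comm]
  · simp [hl]

lemma IsWeighted.col_sum (h : IsWeighted f a b n c ν) (i : Fin k) (r : Fin (ms i)) :
    ∑ l, (if b l = ⟨i, r⟩ then n l + 1 else 0) = c i r + 1 := by
  have h1 := (h.path i).sum_right (nodup_of_sorted (cols_sorted c _)) (⟨i, r⟩, c i r)
    (by simp [cols])
  rw [sum_trail] at h1
  refine Eq.trans ?_ h1
  refine Finset.sum_congr rfl fun l _ => ?_
  by_cases hl : b l = ⟨i, r⟩
  · simp [hl]
  · simp [hl]

lemma IsWeighted.sum_eq (h : IsWeighted f a b n c ν) (i : Fin k) :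
    ∑ j, (if f j = i then ν j + 1 else 0) = (∑ r, c i r) + 1 := by
  have h1 := (h.path i).sum_eq
  rw [rows, cols, List.map_map, List.map_map, sum_map_filter, sum_map_finRange,
    sum_map_finRange] at h1
  exact h1

/-- The row weights of a diagram. -/
def rowWeight (a : Fin N → Fin m) (n : Fin N → ℕ) (j : Fin m) : ℕ :=
  ∑ l, if a l = j then n l else 0

/-- The column weights of a diagram. -/
def colWeight (b : Fin N → Σ i : Fin k, Fin (ms i)) (n : Fin N → ℕ) (i : Fin k) (r : Fin (ms i)) :
    ℕ := ∑ l, (if b l = ⟨i, r⟩ then n l + 1 else 0) - 1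

/-- Neighbouring positions of a summand change exactly one of row and column, so they form a lattice
path. The weights `n` are arbitrary and determine those of the rows and columns. -/
theorem isWeighted_of_isDiagram (hf : Function.Surjective f) (h : IsDiagram f ms a b)
    (n : Fin N → ℕ) : IsWeighted f a b n (colWeight b n) (rowWeight a n) := by
  obtain ⟨hm, comm, hs⟩ := h
  refine ⟨hm, comm, fun i => ?_⟩
  obtain ⟨h1, h2, h3, h4, h5⟩ := hs i
  -- If there are no columns, the convention on `{pt} ← ∅ → ∅` applies: `i` occurs exactly once in
  -- `f`, existence coming from surjectivity, and the path is empty.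
  by_cases hms : ms i = 0
  · have hemp : ∀ l, (b l).1 ≠ i := by
      rintro l rfl
      have := (b l).2.isLt
      omega
    have hU : IsEmpty {r : Σ i' : Fin k, Fin (ms i') // r.1 = i} := by
      refine ⟨fun ⟨⟨i', r⟩, hr⟩ => ?_⟩
      subst hr
      exact absurd r.isLt (by simp [show ms i' = 0 from hms])
    have hT : IsEmpty {l : Fin N // (b l).1 = i} := ⟨fun l => hemp l.1 l.2⟩
    obtain ⟨j, hj⟩ := hf i
    have hcard : Nat.card {j : Fin m // f j = i} = 1 := by
      rcases h4 with h4 | h4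
      · obtain ⟨l, -⟩ := h4 ⟨j, hj⟩
        exact hT.elim l
      · exact h4.2
    obtain ⟨hsub, -⟩ := Nat.card_eq_one_iff_unique.1 hcard
    have hrows : (List.finRange m).filter (fun j => f j = i) = [j] := by
      refine (pairwise_filter_finRange _).eq_of_mem_iff (List.pairwise_singleton _ j) fun j' => ?_
      simp only [List.mem_filter, List.mem_finRange, true_and, decide_eq_true_eq,
        List.mem_singleton]
      exact ⟨fun hj' => congrArg Subtype.val (hsub.elim ⟨j', hj'⟩ ⟨j, hj⟩), fun h => h ▸ hj⟩
    have hν : rowWeight a n j = 0 := by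
      refine Finset.sum_eq_zero fun l _ => if_neg ?_
      rintro rfl
      exact hemp l ((comm l).symm.trans hj)
    have htrail : trail a b n i = [] := by
      rw [trail, List.map_eq_nil_iff, List.filter_eq_nil_iff]
      intro l _
      simpa using hemp l
    have hcols : cols (colWeight b n) i = [] := by
      rw [cols, List.map_eq_nil_iff]
      exact List.length_eq_zero_iff.1 (by simpa using hms)
    rw [rows, hrows, htrail, hcols, List.map_singleton, hν]
    exact Path.empty j
  · have hsα : Function.Surjective fun l : {l : Fin N // (b l).1 = i} =>
        (⟨a l.1, (comm l).trans l.2⟩ : {j : Fin m // f j = i}) :=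
      h4.resolve_right fun h => h.1.false ⟨⟨i, ⟨0, by omega⟩⟩, rfl⟩
    have hsort := pairwise_filter_finRange fun l => decide ((b l).1 = i)
    have hP := Path.of_isChain (X := (List.finRange m).filter fun j => f j = i)
      (Y := (List.finRange (ms i)).map fun r => (⟨i, r⟩ : Σ i : Fin k, Fin (ms i)))
      (Z := trail a b n i) (pairwise_filter_finRange _)
      (by rw [← map_fst_cols (colWeight b n)]; exact cols_sorted _ i)
      (by
        rw [map_fst_trail, List.isChain_map, isChain_iff_of_sorted hsort]
        intro l hl l' hl' hlt hbet
        simp only [List.mem_filter, List.mem_finRange, true_and, decide_eq_true_eq] at hl hl' hbet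
        have hcov : (⟨l, hl⟩ : {l : Fin N // (b l).1 = i}) ⋖ ⟨l', hl'⟩ :=
          ⟨hlt, fun c h1 h2 => hbet c.1 c.2 ⟨h1, h2⟩⟩
        have hma := h1 hcov.le
        have hmb := h2 hcov.le
        rcases h5 _ _ hcov with ⟨h6, h7⟩ | ⟨h6, h7⟩
        · exact Or.inl ⟨h6, congrArg Subtype.val (eq_of_le_of_not_lt hmb h7)⟩
        · exact Or.inr ⟨congrArg Subtype.val (eq_of_le_of_not_lt hma h7), h6⟩)
      (by
        obtain ⟨l, -⟩ := h3 ⟨⟨i, ⟨0, by omega⟩⟩, rfl⟩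
        exact List.ne_nil_of_mem (mem_trail.2 ⟨l.1, l.2, rfl⟩))
      (by
        intro t ht
        obtain ⟨l, hl, rfl⟩ := mem_trail.1 ht
        simp [comm, hl])
      (by
        intro t ht
        obtain ⟨l, hl, rfl⟩ := mem_trail.1 ht
        rw [List.mem_map]
        subst hl
        exact ⟨(b l).2, List.mem_finRange _, rfl⟩)
      (by
        intro j hj
        simp only [List.mem_filter, List.mem_finRange, true_and, decide_eq_true_eq] at hj
        obtain ⟨l, hl⟩ := hsα ⟨j, hj⟩
        exact ⟨_, mem_trail.2 ⟨l.1, l.2, rfl⟩, congrArg Subtype.val hl⟩)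
      (by
        intro r hr
        obtain ⟨r, -, rfl⟩ := List.mem_map.1 hr
        obtain ⟨l, hl⟩ := h3 ⟨⟨i, r⟩, rfl⟩
        exact ⟨_, mem_trail.2 ⟨l.1, l.2, rfl⟩, congrArg Subtype.val hl⟩)
    convert hP using 1
    · rw [rows]
      refine List.map_congr_left fun j hj => ?_
      simp only [List.mem_filter, List.mem_finRange, true_and, decide_eq_true_eq] at hj
      rw [sum_trail, rowWeight]
      congr 1
      refine Finset.sum_congr rfl fun l _ => ?_
      by_cases hl : a l = j
      · subst hl
        simp [← comm, hj]
      · simp [hl]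
    · rw [cols, List.map_map]
      refine List.map_congr_left fun r _ => ?_
      rw [Function.comp_apply, sum_trail, colWeight]
      congr 2
      refine Finset.sum_congr rfl fun l _ => ?_
      by_cases hl : b l = ⟨i, r⟩
      · simp [hl]
      · simp [hl]

theorem IsWeighted.isDiagram (h : IsWeighted f a b n c ν) : IsDiagram f ms a b := by
  refine ⟨h.mono, h.comm, fun i => ?_⟩
  have hsort := pairwise_filter_finRange fun l => decide ((b l).1 = i)
  have hchain := (h.path i).isChain (rows_sorted f ν i) (cols_sorted c i)
  rw [map_fst_trail, List.isChain_map] at hchain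
  have hle : ∀ l l', (b l).1 = i → (b l').1 = i → l ≤ l' → b l ≤ b l' := by
    intro l l' hl hl' hll
    rcases hll.eq_or_lt with rfl | hll
    · exact le_rfl
    have h1 : (((List.finRange N).filter fun l => (b l).1 = i).map b).IsChain (· ≤ ·) := by
      rw [List.isChain_map]
      exact hchain.imp fun _ _ h => h.le.2
    rw [List.isChain_iff_pairwise, List.pairwise_map] at h1
    have hLs := List.pairwise_iff_getElem.1 h1
    obtain ⟨p, hp, rfl⟩ := List.mem_iff_getElem.1
      (show l ∈ (List.finRange N).filter fun l => (b l).1 = i by simpa using hl)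
    obtain ⟨p', hp', rfl⟩ := List.mem_iff_getElem.1
      (show l' ∈ (List.finRange N).filter fun l => (b l).1 = i by simpa using hl')
    refine hLs p p' hp hp' ?_
    by_contra hpp
    rcases (not_lt.1 hpp).eq_or_lt with h2 | h2
    · subst h2
      exact lt_irrefl _ hll
    · exact lt_asymm hll (List.pairwise_iff_getElem.1 hsort p' p hp' hp h2)
  refine ⟨fun l l' hl => h.mono hl, fun l l' hl => hle _ _ l.2 l'.2 hl, ?_, ?_, ?_⟩
  · rintro ⟨⟨i', r⟩, hr⟩
    subst hr
    obtain ⟨t, ht, hr⟩ := (h.path i').cover_right ⟨i', r⟩ (by rw [map_fst_cols]; simp)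
    obtain ⟨l, hl, rfl⟩ := mem_trail.1 ht
    exact ⟨⟨l, hl⟩, Subtype.ext hr⟩
  · by_cases hms : ms i = 0
    · right
      refine ⟨⟨fun ⟨⟨i', r⟩, hr⟩ => ?_⟩, ?_⟩
      · subst hr
        exact absurd r.isLt (by simp [show ms i' = 0 from hms])
      · have h1 : (cols c i).length = 0 := by simp [cols, hms]
        have h2 : (trail a b n i).length = 0 := by
          rw [List.length_eq_zero_iff, trail, List.map_eq_nil_iff, List.filter_eq_nil_iff]
          intro l _ hl
          simp only [decide_eq_true_eq] at hl
          subst hl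
          have := (b l).2.isLt
          omega
        have h3 := (h.path i).length_eq
        have h4 : (rows f ν i).length = Nat.card {j : Fin m // f j = i} := by
          rw [Nat.card_eq_fintype_card, Fintype.card_subtype, rows, List.length_map,
            ← List.toFinset_card_of_nodup (nodup_of_sorted (pairwise_filter_finRange _))]
          congr 1
          ext
          simp
        omega
    · left
      rintro ⟨j, hj⟩
      obtain ⟨t, ht, hr⟩ := (h.path i).cover_left
        (List.ne_nil_of_length_pos (by simp [cols]; omega)) j (by rw [map_fst_rows]; simp [hj])
      obtain ⟨l, hl, rfl⟩ := mem_trail.1 ht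
      exact ⟨⟨l, hl⟩, Subtype.ext hr⟩
  · intro q q' hq
    rw [isChain_iff_of_sorted hsort] at hchain
    have := hchain q.1 (by simpa using q.2) q'.1 (by simpa using q'.2) hq.lt (by
      intro l hl hlt
      exact hq.2 (c := ⟨l, by simpa using hl⟩) hlt.1 hlt.2)
    rcases this with ⟨h1, h2⟩ | ⟨h1, h2⟩
    · exact Or.inl ⟨h1, fun h3 => (show b q.1 < b q'.1 from h3).ne h2⟩
    · exact Or.inr ⟨h2, fun h3 => (show a q.1 < a q'.1 from h3).ne h1⟩

lemma filter_trail (h : IsWeighted f a b n c ν) (j : Fin m) :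
    ((List.finRange N).map fun l => ((a l, b l), n l)).filter (fun t => t.1.1 = j) =
      (trail a b n (f j)).filter fun t => t.1.1 = j := by
  rw [trail, List.filter_map, List.filter_map, List.filter_filter]
  congr 1
  refine List.filter_congr fun l _ => ?_
  by_cases hl : a l = j
  · subst hl
    simp [h.comm]
  · simp [hl]

/-- `a` is nondecreasing, so the positions are grouped by rows, and each row belongs to a single
path. Hence the diagram and its weights are recovered from the paths. -/
lemma IsWeighted.list_eq (h : IsWeighted f a b n c ν) :
    ((List.finRange N).map fun l => ((a l, b l), n l)) =
      (List.finRange m).flatMap fun j => (trail a b n (f j)).filter fun t => t.1.1 = j := by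
  rw [← List.flatMap_congr fun j _ => filter_trail h j]
  refine (flatMap_filter_eq (List.pairwise_lt_finRange m) _ ?_ fun _ _ => List.mem_finRange _).symm
  rw [List.map_map, List.pairwise_map]
  exact (List.pairwise_lt_finRange N).imp fun h' => h.mono h'.le

theorem IsWeighted.unique {a' : Fin N → Fin m} {b' : Fin N → Σ i : Fin k, Fin (ms i)}
    {n' : Fin N → ℕ} (h : IsWeighted f a b n c ν) (h' : IsWeighted f a' b' n' c ν) :
    a = a' ∧ b = b' ∧ n = n' := by
  have h1 := h.list_eq
  have h2 : ∀ i, trail a b n i = trail a' b' n' i := fun i => (h.path i).unique (h'.path i)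
  simp only [h2] at h1
  rw [← h'.list_eq] at h1
  have h3 : ∀ l, ((a l, b l), n l) = ((a' l, b' l), n' l) := fun l =>
    List.map_inj_left.1 h1 l (List.mem_finRange l)
  simp only [Prod.mk.injEq] at h3
  exact ⟨funext fun l => (h3 l).1.1, funext fun l => (h3 l).1.2, funext fun l => (h3 l).2⟩

/-- The paths of the different `i` exist independently and are interleaved in the order of their
rows. Each has one entry fewer than it has rows and columns together, and `hN` says that the total
length is `N`. -/
theorem exists_isWeighted (hN : N + k = m + ∑ i, ms i)
    (h : ∀ i, ∑ j, (if f j = i then ν j + 1 else 0) = (∑ r, c i r) + 1) :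
    ∃ (a : Fin N → Fin m) (b : Fin N → Σ i : Fin k, Fin (ms i)) (n : Fin N → ℕ),
      IsWeighted f a b n c ν := by
  have hex : ∀ i, ∃ Z, Path (rows f ν i) (cols c i) Z := fun i => by
    refine Path.exists_of_sum _ _ ?_
    rw [rows, cols, List.map_map, List.map_map, sum_map_filter, sum_map_finRange,
      sum_map_finRange]
    exact h i
  choose Zi hZi using hex
  have hleft : ∀ i, ∀ t ∈ Zi i, f t.1.1 = i := by
    intro i t ht
    have := (hZi i).mem_left t ht
    rw [map_fst_rows] at this
    simpa using this
  have hright : ∀ i, ∀ t ∈ Zi i, t.1.2.1 = i := by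
    intro i t ht
    have := (hZi i).mem_right t ht
    rw [map_fst_cols, List.mem_map] at this
    obtain ⟨r, -, hr⟩ := this
    rw [← hr]
  have hmono : ∀ i, ((Zi i).map fun t => t.1.1).Pairwise (· ≤ ·) := by
    intro i
    rw [← List.isChain_iff_pairwise, List.isChain_map]
    have := (hZi i).isChain (rows_sorted f ν i) (cols_sorted c i)
    rw [List.isChain_map] at this
    exact this.imp fun _ _ h => h.le.1
  set Z := (List.finRange m).flatMap fun j => (Zi (f j)).filter fun t => t.1.1 = j with hZ
  have hZmono : (Z.map fun t => t.1.1).Pairwise (· ≤ ·) := by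
    rw [hZ, List.map_flatMap, List.pairwise_flatMap]
    constructor
    · intro j _
      exact (hmono _).sublist (List.filter_sublist.map _)
    · refine (List.pairwise_lt_finRange m).imp ?_
      intro j j' hj x hx y hy
      obtain ⟨t, ht, rfl⟩ := List.mem_map.1 hx
      obtain ⟨t', ht', rfl⟩ := List.mem_map.1 hy
      simp only [List.mem_filter, decide_eq_true_eq] at ht ht'
      rw [ht.2, ht'.2]
      exact hj.le
  have hZcomm : ∀ t ∈ Z, f t.1.1 = t.1.2.1 := by
    intro t ht
    obtain ⟨j, -, ht⟩ := List.mem_flatMap.1 ht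
    simp only [List.mem_filter, decide_eq_true_eq] at ht
    rw [hleft _ t ht.1, hright _ t ht.1]
  have hZfil : ∀ i, (Z.filter fun t => t.1.2.1 = i) = Zi i := by
    intro i
    refine Eq.trans ?_ (flatMap_filter_eq (List.pairwise_lt_finRange m) (fun t => t.1.1)
      (hmono i) fun _ _ => List.mem_finRange _)
    rw [hZ, List.filter_flatMap]
    refine List.flatMap_congr fun j _ => ?_
    by_cases hj : f j = i
    · subst hj
      rw [List.filter_eq_self]
      intro t ht
      rw [List.mem_filter] at ht
      simpa using hright _ t ht.1
    · have h1 : (Zi i).filter (fun t => t.1.1 = j) = [] := by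
        rw [List.filter_eq_nil_iff]
        intro t ht
        simp only [decide_eq_true_eq]
        rintro rfl
        exact hj (hleft i t ht)
      rw [h1, List.filter_eq_nil_iff]
      intro t ht
      rw [List.mem_filter] at ht
      simpa [hright _ t ht.1] using hj
  have hlen : Z.length = N := by
    have h1 : ∀ Z' : List ((Fin m × Σ i : Fin k, Fin (ms i)) × ℕ), Z'.length =
        ∑ i, (Z'.filter fun t => t.1.2.1 = i).length := by
      intro Z'
      induction Z' with
      | nil => simp
      | cons t Z' ih =>
        have : ∀ i, ((t :: Z').filter fun t => t.1.2.1 = i).length =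
            (Z'.filter fun t => t.1.2.1 = i).length + if t.1.2.1 = i then 1 else 0 := by
          intro i
          by_cases hi : t.1.2.1 = i <;> simp [hi]
        rw [Finset.sum_congr rfl fun i _ => this i, Finset.sum_add_distrib, ← ih]
        simp
    have h2 : ∀ i, (Zi i).length + 1 = (∑ j, if f j = i then 1 else 0) + ms i := by
      intro i
      rw [(hZi i).length_eq]
      congr 1
      · have := sum_map_filter (List.finRange m) (fun j => f j = i) fun _ => 1
        rw [sum_map_finRange] at this
        rw [← this]
        simp [rows]
      · simp [cols]
    have h3 : ∑ i, ((Zi i).length + 1) = ∑ i, ((∑ j, if f j = i then 1 else 0) + ms i) :=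
      Finset.sum_congr rfl fun i _ => h2 i
    rw [Finset.sum_add_distrib, Finset.sum_add_distrib, Finset.sum_comm (γ := Fin k)] at h3
    rw [h1 Z, Finset.sum_congr rfl fun i _ => congrArg List.length (hZfil i)]
    simp at h3
    omega
  subst hlen
  have hget : (List.finRange Z.length).map Z.get = Z := by
    rw [← List.ofFn_eq_map, List.ofFn_get]
  refine ⟨fun l => (Z.get l).1.1, fun l => (Z.get l).1.2, fun l => (Z.get l).2, ?_,
    fun l => hZcomm _ (List.get_mem _ _), fun i => ?_⟩
  · intro l l' hl
    rcases hl.eq_or_lt with rfl | hl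
    · exact le_rfl
    · rw [List.pairwise_map, List.pairwise_iff_get] at hZmono
      exact hZmono l l' hl
  · have : trail (fun l => (Z.get l).1.1) (fun l => (Z.get l).1.2) (fun l => (Z.get l).2) i =
        Zi i := by
      rw [← hZfil i, trail]
      conv_rhs => rw [← hget]
      rw [List.filter_map]
      rfl
    rw [this]
    exact hZi i

end Weighted

end Hochschild

namespace Hochschild

open SeqOperad

/-! ## The value of a word obtained from a weighted diagram -/

variable {R : Type*} [Ring R]

lemma weave_append {α : Type*} (r : ℕ → R) (s : ℕ) (P Q : List (List (α ⊕ R))) :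
    weave r s (P ++ Q) = weave r s P ++ weave r (s + P.length) Q := by
  induction P generalizing s with
  | nil => rfl
  | cons p P ih => simp [weave, ih, add_assoc, add_comm 1]

/-- Needed to discard the bar in front of the first row, which uses up the entry with index 0. -/
lemma weave_shift {α : Type*} (r : ℕ → R) (s : ℕ) (P : List (List (α ⊕ R))) :
    weave (fun t => r (t - 1)) (s + 1) P = weave r s P := by
  induction P generalizing s with
  | nil => rfl
  | cons p P ih => simp [weave, ih]

section Piece

variable {α : Type*} [DecidableEq α]

variable (R) in
/-- The piece of a word between the bars `s` and `s + 1`. -/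
def piece : ℕ → List (Option α) → List (α ⊕ R)
  | _, [] => []
  | 0, none :: _ => []
  | s + 1, none :: b => piece s b
  | 0, some c :: b => Sum.inl c :: piece 0 b
  | s + 1, some _ :: b => piece (s + 1) b

lemma mem_letters_piece {s : ℕ} {b : List (Option α)} {c : α} (h : c ∈ letters (piece R s b)) :
    some c ∈ b := by
  induction b generalizing s with
  | nil => cases s <;> simp [piece] at h
  | cons o b ih =>
    rcases o with _ | c' <;> rcases s with _ | s
    · simp [piece] at h
    · exact List.mem_cons_of_mem _ (ih h)
    · rw [piece, letters_inl] at h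
      rcases List.mem_cons.1 h with rfl | h
      · simp
      · exact List.mem_cons_of_mem _ (ih h)
    · exact List.mem_cons_of_mem _ (ih h)

lemma fill_eq_weave (r : ℕ → R) (t : ℕ) (b : List (Option α)) :
    fill r t b = piece R 0 b ++ weave r t ((List.range' 1 (bars b)).map fun s => piece R s b) := by
  induction b generalizing t with
  | nil => simp [piece, weave]
  | cons o b ih =>
    rcases o with _ | c
    · have h : (List.range' 2 (bars b)).map (fun s => piece R s (none :: b)) =
          (List.range' 1 (bars b)).map fun s => piece R s b := by
        rw [List.range'_eq_map_range, List.range'_eq_map_range, List.map_map, List.map_map]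
        refine List.map_congr_left fun s _ => ?_
        simp only [Function.comp_apply]
        rw [show 2 + s = (1 + s) + 1 by omega, piece]
      rw [fill_none, bars_none, ih, List.range'_succ, List.map_cons, h]
      simp [piece, weave]
    · have h : (List.range' 1 (bars b)).map (fun s => piece R s (some c :: b)) =
          (List.range' 1 (bars b)).map fun s => piece R s b := by
        rw [List.range'_eq_map_range, List.map_map, List.map_map]
        refine List.map_congr_left fun s _ => ?_
        simp only [Function.comp_apply]
        rw [show 1 + s = s + 1 by omega, piece]
      rw [fill_some, bars_some, ih, h, piece]
      rfl

/-- The word `(x, s) | (x, s + 1) | ⋯` with `n` bars. -/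
def numbered {A : Type*} (x : A) : ℕ → ℕ → List (Option (A × ℕ))
  | s, 0 => [some (x, s)]
  | s, n + 1 => some (x, s) :: none :: numbered x (s + 1) n

lemma numbered_map {A : Type*} [DecidableEq A] (f : A → α) (x : A) (s n : ℕ) :
    (numbered x s n).map (Option.map fun t => f t.1) = blk (f x) n := by
  induction n generalizing s with
  | zero => rfl
  | succ n ih => simp [numbered, blk, ih]

lemma bars_numbered {A : Type*} [DecidableEq A] (x : A) (s n : ℕ) : bars (numbered x s n) = n := by
  induction n generalizing s with
  | zero => rfl
  | succ n ih => simp [numbered, ih]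

lemma reduceOption_numbered {A : Type*} [DecidableEq A] (x : A) (s n : ℕ) :
    (numbered x s n).reduceOption = (List.range' s (n + 1)).map fun t => (x, t) := by
  induction n generalizing s with
  | zero => rfl
  | succ n ih =>
    rw [numbered, List.reduceOption_cons_of_some, List.reduceOption_cons_of_none, ih,
      List.range'_succ (n := n + 1), List.map_cons]

lemma subst_numbered {A : Type*} [DecidableEq A] (part : A × ℕ → List (α ⊕ R)) (r : ℕ → R) (t : ℕ) (x : A)
    (s n : ℕ) : subst part (fill r t (numbered x s n)) =
      part (x, s) ++ weave r t ((List.range' (s + 1) n).map fun s' => part (x, s')) := by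
  induction n generalizing s t with
  | zero => simp [numbered, subst, weave]
  | succ n ih =>
    rw [numbered, fill_some, fill_none, subst_inl, subst_inr, ih, List.range'_succ]
    rfl

/-- The occurrence number `s` of `x` in its block is replaced by the piece number `s` of `B x`; the
bars inside the block are the bars of `B x`. -/
lemma subst_flatMap_numbered {A : Type*} [DecidableEq A] (B : A → List (Option α)) (ν : A → ℕ)
    (hB : ∀ x, bars (B x) = ν x) (r : ℕ → R) (t : ℕ) (X : List A) :
    subst (fun x => piece R x.2 (B x.1)) (fill r t (X.flatMap fun x => numbered x 0 (ν x))) =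
      fill r t (X.flatMap B) := by
  induction X generalizing t with
  | nil => rfl
  | cons x X ih =>
    rw [List.flatMap_cons, List.flatMap_cons, fill_append, fill_append, subst_append, ih,
      subst_numbered, bars_numbered, fill_eq_weave r t (B x), hB]

/-- The same pieces with a bar in front of each of them: the bars inside the words `B x` are kept,
and one more appears in front of each word. -/
lemma weave_flatMap_piece {A : Type*} [DecidableEq A] (B : A → List (Option α)) (ν : A → ℕ)
    (hB : ∀ x, bars (B x) = ν x) (r : ℕ → R) (t : ℕ) (X : List A) :
    weave r t ((X.flatMap fun x => (List.range' 0 (ν x + 1)).map fun s => (x, s)).map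
      fun x => piece R x.2 (B x.1)) = fill r t (X.flatMap fun x => none :: B x) := by
  induction X generalizing t with
  | nil => rfl
  | cons x X ih =>
    rw [List.flatMap_cons, List.flatMap_cons, List.map_append, weave_append, ih, fill_append,
      List.map_map]
    congr 1
    · rw [List.range'_succ, List.map_cons, weave, fill_none, fill_eq_weave, hB]
      rfl
    · simp [hB]

end Piece

section Weighted

variable {m k N : ℕ} {f : Fin m → Fin k} {ms : Fin k → ℕ} {a : Fin N → Fin m}
  {b : Fin N → Σ i : Fin k, Fin (ms i)} {n : Fin N → ℕ} {c : ∀ i, Fin (ms i) → ℕ} {ν : Fin m → ℕ}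
  {α : Type*} [DecidableEq α]

/-- The word of the row `j` of a diagram. -/
def diagRow (L : (Σ i : Fin k, Fin (ms i)) → α) (a : Fin N → Fin m)
    (b : Fin N → Σ i : Fin k, Fin (ms i)) (n : Fin N → ℕ) (j : Fin m) : List (Option α) :=
  rowWord L ((List.finRange N).map fun l => ((a l, b l), n l)) j

lemma diagRow_eq (L : (Σ i : Fin k, Fin (ms i)) → α) (j : Fin m) : diagRow L a b n j =
    ((List.finRange N).filter fun l => a l = j).flatMap fun l => blk (L (b l)) (n l) := by
  rw [diagRow, rowWord, List.filter_map, List.flatMap_map]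
  rfl

lemma bars_diagRow (L : (Σ i : Fin k, Fin (ms i)) → α) (h : IsWeighted f a b n c ν) (j : Fin m) :
    bars (diagRow L a b n j) = ν j := by
  rw [diagRow_eq, bars_flatMap, ← h.row_sum j]
  simp only [bars_blk]
  rw [sum_map_filter, sum_map_finRange]

lemma flatMap_diagRow (L : (Σ i : Fin k, Fin (ms i)) → α) (h : IsWeighted f a b n c ν) :
    (List.finRange m).flatMap (diagRow L a b n) = bexp (L ∘ b) n := by
  have h1 := flatMap_filter_eq (List.pairwise_lt_finRange m) a (Z := List.finRange N)
    (by
      rw [List.pairwise_map]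
      exact (List.pairwise_lt_finRange N).imp fun h' => h.mono h'.le)
    fun _ _ => List.mem_finRange _
  rw [bexp]
  conv_rhs => rw [← h1]
  rw [List.flatMap_assoc]
  exact List.flatMap_congr fun j _ => diagRow_eq L j

lemma word_eq_of_isWeighted (L : (Σ i : Fin k, Fin (ms i)) → α) (h : IsWeighted f a b n c ν)
    (i : Fin k) :
    ((List.finRange m).filter fun j => f j = i).flatMap (fun j => none :: diagRow L a b n j) =
      none :: bexp (fun r => L ⟨i, r⟩) (c i) := by
  have h1 := (h.path i).word_eq (nodup_of_sorted (rows_sorted f ν i)) L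
  rw [map_fst_rows] at h1
  refine Eq.trans (List.flatMap_congr fun j hj => ?_) (h1.trans ?_)
  · simp only [List.mem_filter, List.mem_finRange, true_and, decide_eq_true_eq] at hj
    subst hj
    rw [diagRow, rowWord, rowWord, filter_trail h]
  · rw [cols, List.flatMap_map]
    rfl

/-- An instance of `val_subst`. The letters of the word of `f` are the numbered occurrences `(j, s)`
with label `f j`, and `(j, s)` is replaced by the piece number `s` of row `j`. Substitution gives
the word of the diagram with multiplicities `n`. The pieces with label `i`, read in order with bars
between them, give by `Path.word_eq` the word with multiplicities `c i`, which is the one that `y i`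
evaluates. -/
theorem val_isWeighted (L : (Σ i : Fin k, Fin (ms i)) → α) (own : α → Fin k)
    (hL : ∀ s, own (L s) = s.1) (h : IsWeighted f a b n c ν) (y : Fin k → GCoch R)
    (z : α → GCoch R) (hy : ∀ i r, app (y i) r = val z (fill r 0 (bexp (fun s => L ⟨i, s⟩) (c i))))
    (hb : Good (deg y) (expand f ν)) (hs : Good (deg z) (expand (L ∘ b) n)) (r : ℕ → R) :
    val y (fill r 0 (bexp f ν)) = val z (fill r 0 (bexp (L ∘ b) n)) := by
  have hB := bars_diagRow L h
  have hsub := subst_flatMap_numbered _ ν hB r 0 (List.finRange m)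
  rw [flatMap_diagRow L h] at hsub
  have hmap : (fill r 0 ((List.finRange m).flatMap fun j => numbered j 0 (ν j))).map
      (Sum.map (fun t => f t.1) id) = fill r 0 (bexp f ν) := by
    rw [← fill_map_letters, List.map_flatMap, bexp]
    congr 1
    exact List.flatMap_congr fun j _ => numbered_map f j 0 (ν j)
  rw [← hmap, ← hsub]
  refine val_subst (fun t : Fin m × ℕ => f t.1) (fun x => piece R x.2 (diagRow L a b n x.1)) own
    ?_ y z _ ?_ ?_ ?_
  · rintro ⟨j, s⟩ c' hc'
    have h1 := mem_letters_piece hc'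
    rw [diagRow_eq, List.mem_flatMap] at h1
    obtain ⟨l, hl, h1⟩ := h1
    simp only [List.mem_filter, List.mem_finRange, true_and, decide_eq_true_eq] at hl
    have h2 : c' = L (b l) := by
      have h3 := List.reduceOption_mem_iff.2 h1
      rw [reduceOption_blk] at h3
      exact List.eq_of_mem_replicate h3
    rw [h2, hL, ← h.comm, hl]
  · rw [hmap, letters_fill, reduceOption_bexp]
    exact hb
  · rw [hsub, letters_fill, reduceOption_bexp]
    exact hs
  · intro i x xs hx r'
    have hfil : (letters (fill r 0 ((List.finRange m).flatMap fun j => numbered j 0 (ν j)))).filter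
        (fun t => f t.1 = i) = ((List.finRange m).filter fun j => f j = i).flatMap
          fun j => (List.range' 0 (ν j + 1)).map fun s => (j, s) := by
      rw [letters_fill, reduceOption_flatMap]
      simp only [reduceOption_numbered]
      induction List.finRange m with
      | nil => rfl
      | cons j X ih =>
        rw [List.flatMap_cons, List.filter_append, ih, List.filter_map]
        by_cases hj : f j = i
        · simp [hj, Function.comp_def]
        · simp [hj, Function.comp_def]
    rw [hfil] at hx
    -- In `Path.word_eq` a bar also precedes the first row. The entries are shifted by one so that
    -- this bar takes a superfluous entry and can be cancelled.
    have h1 := weave_flatMap_piece _ ν hB (fun t => r' (t - 1)) 0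
      ((List.finRange m).filter fun j => f j = i)
    rw [hx, word_eq_of_isWeighted L h, List.map_cons, weave, fill_none, zero_add,
      List.cons_append, List.cons.injEq] at h1
    have h2 := weave_shift r' 0 (xs.map fun x => piece R x.2 (diagRow L a b n x.1))
    rw [zero_add] at h2
    rw [← h2, h1.2, hy]
    congr 1
    refine fill_congr fun t _ => ?_
    congr 1
    omega

end Weighted

end Hochschild

namespace Hochschild

open SeqOperad

/-! ## Counting in weighted diagrams -/

section Count

variable {m k N : ℕ} {f : Fin m → Fin k} {ms : Fin k → ℕ} {a : Fin N → Fin m}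
  {b : Fin N → Σ i : Fin k, Fin (ms i)} {n : Fin N → ℕ} {c : ∀ i, Fin (ms i) → ℕ} {ν : Fin m → ℕ}

lemma enc_val {j : Fin k → ℕ} (i : Fin k) (t : Fin (j i)) :
    ((finSigmaFinEquiv ⟨i, t⟩ : Fin (∑ i, j i)) : ℕ) = (∑ i', if i' < i then j i' else 0) + t := by
  rw [finSigmaFinEquiv_apply]
  congr 1
  rw [← Finset.sum_filter]
  refine Finset.sum_bij (fun x _ => Fin.castLE i.2.le x) (fun x _ => ?_) (fun x _ y _ h => ?_)
    (fun i' hi' => ?_) (fun x _ => rfl)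
  · simp only [Finset.mem_filter, Finset.mem_univ, true_and]
    exact x.2
  · exact Fin.castLE_injective _ h
  · simp only [Finset.mem_filter, Finset.mem_univ, true_and] at hi'
    exact ⟨⟨i', hi'⟩, Finset.mem_univ _, rfl⟩

lemma enc_lt_of_lt {j : Fin k → ℕ} {i i' : Fin k} (h : i < i') (t : Fin (j i)) (t' : Fin (j i')) :
    (finSigmaFinEquiv ⟨i, t⟩ : Fin (∑ i, j i)) < finSigmaFinEquiv ⟨i', t'⟩ := by
  rw [Fin.lt_def, enc_val, enc_val]
  have h1 : (∑ i'', if i'' < i then j i'' else 0) + (∑ i'', if i'' = i then j i'' else 0) ≤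
      ∑ i'', if i'' < i' then j i'' else 0 := by
    rw [← Finset.sum_add_distrib]
    refine Finset.sum_le_sum fun i'' _ => ?_
    by_cases h1 : i'' < i
    · simp [h1, h1.ne, h1.trans h]
    · by_cases h2 : i'' = i
      · subst h2
        simp [h]
      · simp [h1, h2]
  rw [Finset.sum_ite_eq' Finset.univ i, if_pos (Finset.mem_univ i)] at h1
  have := t.2
  omega

lemma enc_lt_iff {j : Fin k → ℕ} (i : Fin k) (t t' : Fin (j i)) :
    (finSigmaFinEquiv ⟨i, t⟩ : Fin (∑ i, j i)) < finSigmaFinEquiv ⟨i, t'⟩ ↔ t < t' := by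
  rw [Fin.lt_def, enc_val, enc_val, Fin.lt_def]
  omega

lemma IsWeighted.le (h : IsWeighted f a b n c ν) {l l' : Fin N} (hi : (b l).1 = (b l').1)
    (hl : l ≤ l') : b l ≤ b l' := by
  obtain ⟨-, comm, hs⟩ := h.isDiagram
  have h1 := (hs (b l').1).2.1
  have h2 : (⟨l, hi⟩ : {x : Fin N // (b x).1 = (b l').1}) ≤ ⟨l', rfl⟩ := hl
  exact h1 h2

lemma IsWeighted.lt (h : IsWeighted f a b n c ν) {l l' : Fin N} (hb : b l < b l') : l < l' := by
  by_contra hl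
  have hi : (b l).1 = (b l').1 := by
    obtain ⟨hi, -⟩ := Sigma.lt_def.1 hb
    exact hi
  exact hb.not_ge (h.le hi.symm (not_lt.1 hl))

/-- The elements of a disjoint union in a given summand, as an ordered set. -/
def fiberIso (ms : Fin k → ℕ) (i : Fin k) :
    {r : Σ i' : Fin k, Fin (ms i') // r.1 = i} ≃o Fin (ms i) where
  toFun r := r.2 ▸ r.1.2
  invFun r := ⟨⟨i, r⟩, rfl⟩
  left_inv := by rintro ⟨⟨i', r⟩, hr⟩; subst hr; rfl
  right_inv r := rfl
  map_rel_iff' := by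
    rintro ⟨⟨i', r⟩, hr⟩ ⟨⟨i'', r'⟩, hr'⟩
    subst hr
    obtain rfl : i'' = i' := hr'
    change r ≤ r' ↔ (⟨i'', r⟩ : Σ i' : Fin k, Fin (ms i')) ≤ ⟨i'', r'⟩
    rw [Sigma.mk_le_mk_iff]

lemma card_subtype_lt {T : Type*} [Fintype T] [LinearOrder T] (P : T → Prop) [DecidablePred P]
    (x : {t : T // P t}) : (Finset.univ.filter (· < x)).card =
      ∑ t, if P t ∧ t < x.1 then 1 else 0 := by
  have h1 := Finset.sum_subtype (Finset.univ.filter P) (p := P) (F := inferInstance) (by simp)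
    (fun t => if t < x.1 then 1 else 0)
  rw [Finset.sum_filter] at h1
  rw [Finset.card_filter]
  refine Eq.trans (Finset.sum_congr rfl fun t _ => if_congr Iff.rfl rfl rfl) (h1.symm.trans ?_)
  refine Finset.sum_congr rfl fun t _ => ?_
  by_cases h : P t <;> simp [h]

/-- `IsSpecial.card_lt` in the summand of `b l`: the number of earlier positions of the summand is
the number of earlier rows plus the number of earlier columns. -/
theorem IsWeighted.card_lt (h : IsWeighted f a b n c ν) (l : Fin N) :
    ∑ l', (if (b l').1 = (b l).1 ∧ l' < l then 1 else 0) =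
      (∑ j, if f j = (b l).1 ∧ j < a l then 1 else 0) + ((b l).2 : ℕ) := by
  obtain ⟨-, comm, hs⟩ := h.isDiagram
  have h1 := IsSpecial.card_lt (IsSpecial.comp_orderIso (hs (b l).1) (fiberIso ms (b l).1)) ⟨l, rfl⟩
  rw [card_subtype_lt, card_subtype_lt, card_filter_lt_fin] at h1
  exact h1

/-- If the row did not change either, `IsWeighted.card_lt` would give `l` and `l'` the same number
of predecessors. -/
lemma IsWeighted.lt_left (h : IsWeighted f a b n c ν) {l l' : Fin N} (hb : b l = b l')
    (hl : l < l') : a l < a l' := by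
  refine lt_of_le_of_ne (h.mono hl.le) fun ha => ?_
  have h1 := h.card_lt l
  have h2 := h.card_lt l'
  rw [← ha, ← hb] at h2
  have h3 : (∑ x, if (b x).1 = (b l).1 ∧ x < l then 1 else 0) +
      (∑ x, if x = l then 1 else 0) ≤ ∑ x, if (b x).1 = (b l).1 ∧ x < l' then 1 else 0 := by
    rw [← Finset.sum_add_distrib]
    refine Finset.sum_le_sum fun x _ => ?_
    by_cases hx : x = l
    · subst hx
      simp [hl]
    · by_cases hx' : (b x).1 = (b l).1 ∧ x < l
      · simp [hx, hx'.1, hx'.2, hx'.2.trans hl]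
      · rw [if_neg hx', if_neg hx]
        exact Nat.zero_le _
  simp only [Finset.sum_ite_eq', Finset.mem_univ, if_true] at h3
  omega

lemma IsWeighted.norm1_image (h : IsWeighted f a b n c ν) (s : Σ i : Fin k, Fin (ms i)) :
    norm1 (a '' (b ⁻¹' {s})) + 1 = ∑ l, if b l = s then 1 else 0 := by
  have hinj : Set.InjOn a (b ⁻¹' {s}) := by
    intro l hl l' hl' he
    have hb : b l = b l' := (show b l = s from hl).trans (show b l' = s from hl').symm
    rcases lt_trichotomy l l' with h1 | h1 | h1
    · exact absurd he (h.lt_left hb h1).ne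
    · exact h1
    · exact absurd he (h.lt_left hb.symm h1).ne'
  have hset : b ⁻¹' {s} = ((Finset.univ.filter fun l => b l = s : Finset (Fin N)) : Set (Fin N)) := by
    ext; simp
  rw [norm1, hinj.ncard_image, hset, Set.ncard_coe_finset, Finset.card_filter]
  push_cast
  ring

/-- The column norms of a diagram. -/
def colNorm (a : Fin N → Fin m) (b : Fin N → Σ i : Fin k, Fin (ms i)) (i : Fin k)
    (r : Fin (ms i)) : ℤ := norm1 (a '' (b ⁻¹' {⟨i, r⟩}))

/-- By `IsWeighted.lt_left` a column has `colNorm + 1` entries. So the multiplicity in a column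
splits into the norm that enters η(D) and the weights that enter the sign of the word of the
diagram. -/
lemma IsWeighted.colNorm_add (h : IsWeighted f a b n c ν) (i : Fin k) (r : Fin (ms i)) :
    colNorm a b i r + ∑ l, (if b l = ⟨i, r⟩ then (n l : ℤ) else 0) = c i r := by
  have h1 := h.norm1_image ⟨i, r⟩
  have h2 := congrArg (Nat.cast (R := ℤ)) (h.col_sum i r)
  push_cast at h2
  have h3 : ∑ l, (if b l = ⟨i, r⟩ then (n l : ℤ) + 1 else 0) =
      (∑ l, if b l = ⟨i, r⟩ then (n l : ℤ) else 0) + ∑ l, if b l = ⟨i, r⟩ then 1 else 0 := by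
    rw [← Finset.sum_add_distrib]
    refine Finset.sum_congr rfl fun l _ => ?_
    split_ifs <;> simp
  rw [colNorm]
  linarith

lemma sum_sigma_fiber (b : Fin N → Σ i : Fin k, Fin (ms i)) (x : Fin N → ℤ)
    (G : (Σ i : Fin k, Fin (ms i)) → ℤ) :
    ∑ i, ∑ r, (∑ l, if b l = ⟨i, r⟩ then x l else 0) * G ⟨i, r⟩ = ∑ l, x l * G (b l) := by
  simp only [Finset.sum_mul]
  rw [Finset.sum_congr rfl fun i _ => Finset.sum_comm, Finset.sum_comm]
  refine Finset.sum_congr rfl fun l _ => ?_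
  rw [← Fintype.sum_sigma' (fun i r => (if b l = ⟨i, r⟩ then x l else 0) * G ⟨i, r⟩)]
  simp

end Count

end Hochschild

namespace Hochschild

open SeqOperad

/-! ### The linear part of the sign of a weighted diagram. -/

section Linear

variable {m k N : ℕ} {f : Fin m → Fin k} {ms : Fin k → ℕ} {a : Fin N → Fin m}
  {b : Fin N → Σ i : Fin k, Fin (ms i)} {n : Fin N → ℕ} {c : ∀ i, Fin (ms i) → ℕ} {ν : Fin m → ℕ}
  {J : Fin k → ℕ}

/-- The sequence on the disjoint union determined by a family of sequences. -/
def enc (g : ∀ i, Fin (ms i) → Fin (J i)) (s : Σ i : Fin k, Fin (ms i)) : Fin (∑ i, J i) :=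
  finSigmaFinEquiv ⟨s.1, g s.1 s.2⟩

/-- Within the summand of `l`, the entries of an earlier column all precede `l` and those of a later
column all follow it; only the column of `l` itself is cut. -/
lemma IsWeighted.prefix_sum (h : IsWeighted f a b n c ν) (l : Fin N) (r : Fin (ms (b l).1)) :
    ∑ l', (if b l' = ⟨(b l).1, r⟩ then if l' < l then (1 : ℤ) else 0 else 0) =
      (if r < (b l).2 then colNorm a b _ r + 1 else 0) +
        if r = (b l).2 then ∑ l', (if b l' = b l then if l' < l then (1 : ℤ) else 0 else 0) else 0 := by
  rcases lt_trichotomy r (b l).2 with hr | hr | hr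
  · rw [if_pos hr, if_neg hr.ne, add_zero, colNorm, h.norm1_image]
    refine Finset.sum_congr rfl fun l' _ => ?_
    by_cases hl : b l' = ⟨(b l).1, r⟩
    · rw [if_pos hl, if_pos hl, if_pos]
      refine h.lt ?_
      rw [hl]
      exact Sigma.mk_lt_mk_iff.2 hr
    · rw [if_neg hl, if_neg hl]
  · rw [if_neg hr.not_lt, if_pos hr, zero_add, hr]
  · rw [if_neg hr.not_gt, if_neg hr.ne', zero_add]
    refine Finset.sum_eq_zero fun l' _ => ?_
    by_cases hl : b l' = ⟨(b l).1, r⟩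
    · rw [if_pos hl, if_neg]
      intro hll
      have h1 := h.le (l := l') (l' := l) (by rw [hl]) hll.le
      rw [hl] at h1
      have h2 : (⟨(b l).1, r⟩ : Σ i : Fin k, Fin (ms i)) ≤ ⟨(b l).1, (b l).2⟩ := h1
      rw [Sigma.mk_le_mk_iff] at h2
      exact hr.not_ge h2
    · rw [if_neg hl]

lemma sum_fiber_fst (b : Fin N → Σ i : Fin k, Fin (ms i)) (x : Fin N → ℤ) (i : Fin k) :
    ∑ l, (if (b l).1 = i then x l else 0) = ∑ r, ∑ l, if b l = ⟨i, r⟩ then x l else 0 := by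
  rw [Finset.sum_comm]
  refine Finset.sum_congr rfl fun l _ => ?_
  by_cases hl : (b l).1 = i
  · subst hl
    rw [if_pos rfl, Finset.sum_eq_single (b l).2, if_pos rfl]
    · intro r _ hr
      refine if_neg fun h => hr ?_
      have h' : (⟨(b l).1, (b l).2⟩ : Σ i : Fin k, Fin (ms i)) = ⟨(b l).1, r⟩ := h
      exact (eq_of_heq (Sigma.mk.inj h').2).symm
    · simp
  · rw [if_neg hl]
    refine (Finset.sum_eq_zero fun r _ => if_neg fun h => hl ?_).symm
    rw [h]

/-- Both sides count the entries of the path of `i`, the right side through `Path.length_eq`. -/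
lemma IsWeighted.sum_colNorm (h : IsWeighted f a b n c ν) (i : Fin k) :
    ∑ r, (colNorm a b i r + 1) = (∑ j, if f j = i then 1 else 0) + ms i - 1 := by
  simp only [colNorm, h.norm1_image]
  rw [← sum_fiber_fst b (fun _ => 1)]
  have h1 := (h.path i).length_eq
  have h2 : ∀ (T : Type) (L : List T) (P : T → Prop) [DecidablePred P],
      (L.filter fun t => P t).length = (L.map fun t => if P t then 1 else 0).sum := by
    intro T L P _
    rw [← sum_map_filter]
    simp
  rw [trail, rows, cols, List.length_map, List.length_map, List.length_map, List.length_finRange,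
    h2 _ _ fun l => (b l).1 = i, h2 _ _ fun j => f j = i, sum_map_finRange, sum_map_finRange] at h1
  have h3 := congrArg (Nat.cast (R := ℤ)) h1
  push_cast at h3
  linarith

lemma IsWeighted.card_prefix (h : IsWeighted f a b n c ν) (l : Fin N) :
    (∑ j, if f j = f (a l) ∧ j < a l then (1 : ℤ) else 0) =
      (∑ r, if r < (b l).2 then colNorm a b _ r else 0) +
        ∑ l', (if b l' = b l then if l' < l then (1 : ℤ) else 0 else 0) := by
  have h1 := congrArg (Nat.cast (R := ℤ)) (h.card_lt l)
  push_cast at h1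
  have h2 := sum_fiber_fst b (fun l' => if l' < l then 1 else 0) (b l).1
  rw [Finset.sum_congr rfl fun r _ => h.prefix_sum l r, Finset.sum_add_distrib] at h2
  have h3 : ∑ r, (if r < (b l).2 then colNorm a b _ r + 1 else 0) =
      (∑ r, if r < (b l).2 then colNorm a b _ r else 0) + ((b l).2 : ℕ) := by
    rw [← sum_lt_val (b l).2, ← Finset.sum_add_distrib]
    refine Finset.sum_congr rfl fun r _ => ?_
    split_ifs <;> simp
  have h4 : ∑ l', (if (b l').1 = (b l).1 ∧ l' < l then (1 : ℤ) else 0) =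
      ∑ l', if (b l').1 = (b l).1 then if l' < l then 1 else 0 else 0 :=
    Finset.sum_congr rfl fun l' _ => by rw [ite_and]
  rw [h3, Finset.sum_ite_eq' Finset.univ, if_pos (Finset.mem_univ _)] at h2
  rw [h.comm]
  linarith

/-- The positions that sort before `l` are counted column by column: all columns of smaller
summands, then in the summand of `l` the columns with a smaller letter, the earlier columns with the
same letter, and the earlier entries of the column of `l`. -/
lemma IsWeighted.tau_enc (h : IsWeighted f a b n c ν) (g : ∀ i, Fin (ms i) → Fin (J i))
    (l : Fin N) :
    tau (enc g ∘ b) l - entry (enc g ∘ b) l =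
      (∑ i, if i < (b l).1 then ∑ r, (colNorm a b i r + 1) - J i else 0) +
      (∑ r, if g _ r < g _ (b l).2 then colNorm a b _ r + 1 else 0) +
      (∑ r, if g _ r = g _ (b l).2 ∧ r < (b l).2 then colNorm a b _ r + 1 else 0) +
      (∑ l', (if b l' = b l then if l' < l then (1 : ℤ) else 0 else 0)) -
      (g _ (b l).2 : ℕ) := by
  have e1 : (∑ l', if (enc g ∘ b) l' < (enc g ∘ b) l then (1 : ℤ) else 0) =
      (∑ i, if i < (b l).1 then ∑ r, (colNorm a b i r + 1) else 0) +
      (∑ r, if g _ r < g _ (b l).2 then colNorm a b _ r + 1 else 0) := by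
    have h1 := sum_sigma_fiber b (fun _ => 1) fun s => if enc g s < enc g (b l) then 1 else 0
    simp only [one_mul] at h1
    refine h1.symm.trans ?_
    simp only [← h.norm1_image]
    have h2 : ∀ i, (∑ r, (norm1 (a '' (b ⁻¹' {⟨i, r⟩})) + 1) *
        if enc g ⟨i, r⟩ < enc g (b l) then (1 : ℤ) else 0) =
        (if i < (b l).1 then ∑ r, (colNorm a b i r + 1) else 0) + if i = (b l).1 then
          ∑ r, (colNorm a b i r + 1) * if enc g ⟨i, r⟩ < enc g (b l) then (1 : ℤ) else 0 else 0 := by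
      intro i
      rcases lt_trichotomy i (b l).1 with hi | hi | hi
      · rw [if_pos hi, if_neg hi.ne, add_zero]
        refine Finset.sum_congr rfl fun r _ => ?_
        rw [if_pos (show enc g ⟨i, r⟩ < enc g (b l) from enc_lt_of_lt hi _ _), mul_one]
        rfl
      · rw [if_neg hi.not_lt, if_pos hi, zero_add]
        rfl
      · rw [if_neg hi.not_gt, if_neg hi.ne', add_zero]
        refine Finset.sum_eq_zero fun r _ => ?_
        rw [if_neg (show enc g (b l) < enc g ⟨i, r⟩ from enc_lt_of_lt hi _ _).not_gt, mul_zero]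
    rw [Finset.sum_congr rfl fun i _ => h2 i, Finset.sum_add_distrib,
      Finset.sum_ite_eq' Finset.univ, if_pos (Finset.mem_univ _)]
    congr 1
    refine Finset.sum_congr rfl fun r _ => ?_
    rw [mul_ite, mul_one, mul_zero]
    exact if_congr (enc_lt_iff _ _ _) rfl rfl
  have e2 : (∑ l', if (enc g ∘ b) l' = (enc g ∘ b) l ∧ l' < l then (1 : ℤ) else 0) =
      (∑ r, if g _ r = g _ (b l).2 ∧ r < (b l).2 then colNorm a b _ r + 1 else 0) +
      (∑ l', (if b l' = b l then if l' < l then (1 : ℤ) else 0 else 0)) := by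
    have h1 := sum_sigma_fiber b (fun l' => if l' < l then (1 : ℤ) else 0)
      fun s => if enc g s = enc g (b l) then 1 else 0
    have h0 : (∑ l', if (enc g ∘ b) l' = (enc g ∘ b) l ∧ l' < l then (1 : ℤ) else 0) =
        ∑ l', (if l' < l then (1 : ℤ) else 0) * if enc g (b l') = enc g (b l) then 1 else 0 := by
      refine Finset.sum_congr rfl fun l' _ => ?_
      rw [Function.comp_apply, Function.comp_apply]
      split_ifs <;> simp_all
    rw [h0, ← h1, Finset.sum_eq_single (b l).1]
    · have h3 : ∀ r, (∑ l', if b l' = ⟨(b l).1, r⟩ then if l' < l then (1 : ℤ) else 0 else 0) *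
          (if enc g ⟨(b l).1, r⟩ = enc g (b l) then (1 : ℤ) else 0) =
          (if g _ r = g _ (b l).2 ∧ r < (b l).2 then colNorm a b _ r + 1 else 0) +
          if r = (b l).2 then ∑ l', (if b l' = b l then if l' < l then (1 : ℤ) else 0 else 0)
            else 0 := by
        intro r
        have h4 : enc g ⟨(b l).1, r⟩ = enc g (b l) ↔ g _ r = g _ (b l).2 := by
          rw [enc, enc, finSigmaFinEquiv.injective.eq_iff]
          simp
        rw [h.prefix_sum l r, if_congr h4 rfl rfl]
        by_cases h5 : g _ r = g _ (b l).2
        · simp [h5]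
        · have h6 : r ≠ (b l).2 := fun h6 => h5 (congrArg (g _) h6)
          simp [h5, h6]
      rw [Finset.sum_congr rfl fun r _ => h3 r, Finset.sum_add_distrib,
        Finset.sum_ite_eq' Finset.univ, if_pos (Finset.mem_univ _)]
    · intro i _ hi
      refine Finset.sum_eq_zero fun r _ => ?_
      rw [if_neg, mul_zero]
      intro h6
      exact hi (congrArg Sigma.fst (finSigmaFinEquiv.injective h6))
    · simp
  have e3 : (((enc g ∘ b) l : ℕ) : ℤ) =
      (∑ i, if i < (b l).1 then (J i : ℤ) else 0) + (g _ (b l).2 : ℕ) := by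
    rw [Function.comp_apply, enc, enc_val]
    push_cast
    rfl
  have e4 : (∑ l', if (enc g ∘ b) l' < (enc g ∘ b) l ∨
      ((enc g ∘ b) l' = (enc g ∘ b) l ∧ l' < l) then (1 : ℤ) else 0) =
      (∑ l', if (enc g ∘ b) l' < (enc g ∘ b) l then (1 : ℤ) else 0) +
      ∑ l', if (enc g ∘ b) l' = (enc g ∘ b) l ∧ l' < l then (1 : ℤ) else 0 := by
    rw [← Finset.sum_add_distrib]
    refine Finset.sum_congr rfl fun l' _ => ?_
    by_cases h1 : (enc g ∘ b) l' < (enc g ∘ b) l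
    · simp only [h1, true_or, if_true, h1.ne, false_and, if_false, add_zero]
    · simp only [h1, false_or, if_false, zero_add]
  have e5 : (∑ i, if i < (b l).1 then ∑ r, (colNorm a b i r + 1) - J i else 0) +
      (∑ i, if i < (b l).1 then (J i : ℤ) else 0) =
      ∑ i, if i < (b l).1 then ∑ r, (colNorm a b i r + 1) else 0 := by
    rw [← Finset.sum_add_distrib]
    refine Finset.sum_congr rfl fun i _ => ?_
    split_ifs <;> simp
  rw [tau_sub_entry, e4, e1, e2, e3]
  linarith

/-- Modulo 2 this compares the coefficient of `n l` in ε of the word of the diagram with its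
coefficients in ε of `f` and of the sequence `g` of its summand. The difference is the sum of the
degrees `ms i - J i` of the earlier sequences. -/
theorem IsWeighted.tau_sub_entry_eq (h : IsWeighted f a b n c ν)
    (g : ∀ i, Fin (ms i) → Fin (J i)) (l : Fin N) :
    (tau (enc g ∘ b) l - entry (enc g ∘ b) l) +
        (∑ i, if i < (b l).1 then ((ms i : ℤ) - J i) else 0) +
        2 * (∑ r, if r < (b l).2 ∧ g _ (b l).2 < g _ r then colNorm a b _ r else 0) =
      (tau f (a l) - entry f (a l)) + (tau (g _) (b l).2 - entry (g _) (b l).2) +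
        (∑ r, colNorm a b _ r * ((if r < (b l).2 ∧ g _ (b l).2 < g _ r then 1 else 0) +
          if (b l).2 < r ∧ g _ r < g _ (b l).2 then 1 else 0)) +
        2 * ∑ i, if i < (b l).1 then ((ms i : ℤ) - J i) else 0 := by
  have h1 := h.card_prefix l
  have h2 := h.tau_enc g l
  have h3 : (∑ i, if i < (b l).1 then ∑ r, (colNorm a b i r + 1) - J i else 0) +
      ((b l).1 : ℕ) = (∑ j, if f j < f (a l) then 1 else 0) +
        ∑ i, if i < (b l).1 then ((ms i : ℤ) - J i) else 0 := by
    rw [← sum_lt_val (b l).1, h.comm]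
    have h5 : (∑ j, if f j < (b l).1 then (1 : ℤ) else 0) =
        ∑ i, if i < (b l).1 then ∑ j, if f j = i then 1 else 0 else 0 := by
      have := sum_fiber f (fun _ => 1) fun i => if i < (b l).1 then 1 else 0
      simp only [mul_ite, mul_one, mul_zero] at this
      exact this.symm
    rw [h5, ← Finset.sum_add_distrib, ← Finset.sum_add_distrib]
    refine Finset.sum_congr rfl fun i _ => ?_
    rw [h.sum_colNorm]
    split_ifs <;> ring
  have h4 : (∑ j, if f j < f (a l) ∨ (f j = f (a l) ∧ j < a l) then (1 : ℤ) else 0) =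
      (∑ j, if f j < f (a l) then 1 else 0) +
        ∑ j, if f j = f (a l) ∧ j < a l then 1 else 0 := by
    rw [← Finset.sum_add_distrib]
    refine Finset.sum_congr rfl fun j _ => ?_
    by_cases h1 : f j < f (a l)
    · simp only [h1, true_or, if_true, h1.ne, false_and, if_false, add_zero]
    · simp only [h1, false_or, if_false, zero_add]
  have h5 : (∑ r, if g _ r < g _ (b l).2 then colNorm a b _ r + 1 else 0) +
      (∑ r, if g _ r = g _ (b l).2 ∧ r < (b l).2 then colNorm a b _ r + 1 else 0) +
      2 * (∑ r, if r < (b l).2 ∧ g _ (b l).2 < g _ r then colNorm a b _ r else 0) =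
      (∑ r, if g _ r < g _ (b l).2 ∨ (g _ r = g _ (b l).2 ∧ r < (b l).2) then 1 else 0) +
        (∑ r, colNorm a b _ r * ((if r < (b l).2 ∧ g _ (b l).2 < g _ r then 1 else 0) +
          if (b l).2 < r ∧ g _ r < g _ (b l).2 then 1 else 0)) +
        ∑ r, if r < (b l).2 then colNorm a b _ r else 0 := by
    rw [Finset.mul_sum, ← Finset.sum_add_distrib, ← Finset.sum_add_distrib,
      ← Finset.sum_add_distrib, ← Finset.sum_add_distrib]
    refine Finset.sum_congr rfl fun r _ => ?_
    rcases lt_trichotomy r (b l).2 with hr | hr | hr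
    · rcases lt_trichotomy (g _ r) (g _ (b l).2) with hg | hg | hg
      · simp [hr, hg, hr.not_gt, hg.not_gt, hg.ne]; ring
      · simp [hr, hg, hr.not_gt]; ring
      · simp [hr, hg, hr.not_gt, hg.not_gt, hg.ne']; ring
    · simp [hr]
    · rcases lt_trichotomy (g _ r) (g _ (b l).2) with hg | hg | hg
      · simp [hr, hg, hr.not_gt, hg.not_gt]; ring
      · simp [hr, hg, hr.not_gt]
      · simp [hr, hg, hr.not_gt, hg.not_gt, hg.ne']
  rw [tau_sub_entry f, tau_sub_entry (g _), h2, h4, h1]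
  have h6 : ((f (a l) : ℕ) : ℤ) = ((b l).1 : ℕ) := by rw [h.comm]
  rw [h6]
  linarith

end Linear

end Hochschild

namespace Hochschild

open SeqOperad

/-! ## The sign of a weighted diagram -/

section Sign

/-- ε is a quadratic polynomial in the numbers; the mixed terms are collected as a coefficient of
`y`. -/
lemma eps_add {m k : ℕ} (f : Fin m → Fin k) (x y : Fin m → ℤ) :
    eps f (fun j => x j + y j) = eps f x +
      (∑ j, ∑ j', if j < j' ∧ f j' < f j then y j * y j' else 0) +
      ∑ j, y j * ((tau f j - entry f j) +
        ∑ j', x j' * ((if j' < j ∧ f j < f j' then 1 else 0) +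
          if j < j' ∧ f j' < f j then 1 else 0)) := by
  have h1 : (∑ j, ∑ j', if j < j' ∧ f j' < f j then (x j + y j) * (x j' + y j') else 0) =
      (∑ j, ∑ j', if j < j' ∧ f j' < f j then x j * x j' else 0) +
      (∑ j, ∑ j', if j < j' ∧ f j' < f j then y j * y j' else 0) +
      ((∑ j, ∑ j', if j < j' ∧ f j' < f j then x j * y j' else 0) +
      ∑ j, ∑ j', if j < j' ∧ f j' < f j then y j * x j' else 0) := by
    simp only [← Finset.sum_add_distrib]
    refine Finset.sum_congr rfl fun j _ => Finset.sum_congr rfl fun j' _ => ?_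
    split_ifs <;> ring
  have h2 : (∑ j, ∑ j', if j < j' ∧ f j' < f j then x j * y j' else 0) =
      ∑ j, y j * ∑ j', x j' * if j' < j ∧ f j < f j' then 1 else 0 := by
    rw [Finset.sum_comm]
    refine Finset.sum_congr rfl fun j _ => ?_
    rw [Finset.mul_sum]
    refine Finset.sum_congr rfl fun j' _ => ?_
    split_ifs <;> ring
  have h3 : (∑ j, ∑ j', if j < j' ∧ f j' < f j then y j * x j' else 0) =
      ∑ j, y j * ∑ j', x j' * if j < j' ∧ f j' < f j then 1 else 0 := by
    refine Finset.sum_congr rfl fun j _ => ?_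
    rw [Finset.mul_sum]
    refine Finset.sum_congr rfl fun j' _ => ?_
    split_ifs <;> ring
  rw [eps, eps, h1, h2, h3]
  simp only [add_mul, mul_add, Finset.sum_add_distrib]
  ring

variable {k : ℕ}

/-- The sum of the products `x i * y i'` over all `i < i'`. -/
def pairSum (x y : Fin k → ℤ) : ℤ := ∑ i, ∑ i', if i < i' then x i * y i' else 0

lemma pairSum_add (x y z : Fin k → ℤ) :
    pairSum x (fun i => y i + z i) = pairSum x y + pairSum x z := by
  simp only [pairSum, ← Finset.sum_add_distrib]
  refine Finset.sum_congr rfl fun i _ => Finset.sum_congr rfl fun i' _ => ?_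
  split_ifs <;> ring

lemma sum_mul_sum_eq (x y : Fin k → ℤ) :
    (∑ i, x i) * ∑ i, y i = (∑ i, x i * y i) + pairSum x y + pairSum y x := by
  have h2 : pairSum y x = ∑ i, ∑ i', if i' < i then x i * y i' else 0 := by
    rw [pairSum, Finset.sum_comm]
    refine Finset.sum_congr rfl fun i _ => Finset.sum_congr rfl fun i' _ => ?_
    split_ifs <;> ring
  have h3 : ∑ i, x i * y i = ∑ i, ∑ i', if i = i' then x i * y i' else 0 := by simp
  rw [h2, h3, pairSum, Finset.sum_mul_sum, ← Finset.sum_add_distrib, ← Finset.sum_add_distrib]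
  refine Finset.sum_congr rfl fun i _ => ?_
  rw [← Finset.sum_add_distrib, ← Finset.sum_add_distrib]
  refine Finset.sum_congr rfl fun i' _ => ?_
  rcases lt_trichotomy i i' with h | h | h
  · simp [h, h.ne, h.not_gt]
  · simp [h]
  · simp [h, h.ne', h.not_gt]

lemma two_mul_triangle (x : ℤ) : 2 * (x * (x + 1) / 2) = x * (x + 1) :=
  Int.mul_ediv_cancel' (Int.even_mul_succ_self x).two_dvd

/-- The polarization of `x (x + 1) / 2`, applied to `δ` and all the `d i`. -/
lemma triangle_add (δ : ℤ) (d : Fin k → ℤ) :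
    (δ + ∑ i, d i) * (δ + ∑ i, d i + 1) / 2 =
      δ * (δ + 1) / 2 + (∑ i, d i * (d i + 1) / 2) + δ * (∑ i, d i) + pairSum d d := by
  have h1 := two_mul_triangle (δ + ∑ i, d i)
  have h2 := two_mul_triangle δ
  have h3 : 2 * ∑ i, d i * (d i + 1) / 2 = (∑ i, d i * d i) + ∑ i, d i := by
    rw [Finset.mul_sum, ← Finset.sum_add_distrib]
    refine Finset.sum_congr rfl fun i _ => ?_
    rw [two_mul_triangle]
    ring
  have h4 := sum_mul_sum_eq d d
  have h5 : (δ + ∑ i, d i) * (δ + ∑ i, d i + 1) =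
      δ * (δ + 1) + ((∑ i, d i) * ∑ i, d i) + (∑ i, d i) + 2 * (δ * ∑ i, d i) := by ring
  linarith

/-- In the application `δ` is the degree of `f` and `d i` that of the `i`-th sequence. `N i` is the
total multiplicity and `φ i` the norm of the fibre of `f` over `i`, `e i` the degree of the `i`-th
inner value, and `Q i` the total degree of its arguments. -/
lemma even_const (δ : ℤ) (d N φ e Q : Fin k → ℤ) (he : ∀ i, e i = N i + φ i)
    (hQ : ∀ i, Q i = e i + d i) :
    Even ((pairSum d φ + ((δ + ∑ i, d i) * (∑ i, Q i) + (δ + ∑ i, d i) * (δ + ∑ i, d i + 1) / 2)) -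
      (pairSum Q d + (∑ i, (d i * Q i + d i * (d i + 1) / 2)) +
        (δ * (∑ i, e i) + δ * (δ + 1) / 2) + pairSum d N)) := by
  have h1 := triangle_add δ d
  have h2 := sum_mul_sum_eq d Q
  have h3 : pairSum d Q = pairSum d N + pairSum d φ + pairSum d d := by
    rw [← pairSum_add, ← pairSum_add]
    congr 1
    funext i
    rw [hQ, he]
  have h4 : ∑ i, Q i = (∑ i, e i) + ∑ i, d i := by
    rw [← Finset.sum_add_distrib]
    exact Finset.sum_congr rfl fun i _ => hQ i
  have h5 : δ * ∑ i, Q i = δ * (∑ i, e i) + δ * ∑ i, d i := by rw [h4, mul_add]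
  rw [Finset.sum_add_distrib, add_mul]
  exact ⟨δ * (∑ i, d i) + pairSum d d + pairSum d φ, by linarith⟩

variable {m N : ℕ} {f : Fin m → Fin k} {ms : Fin k → ℕ} {a : Fin N → Fin m}
  {b : Fin N → Σ i : Fin k, Fin (ms i)} {n : Fin N → ℕ} {c : ∀ i, Fin (ms i) → ℕ} {ν : Fin m → ℕ}
  {J : Fin k → ℕ}

lemma IsWeighted.sum_row (h : IsWeighted f a b n c ν) (G : Fin m → ℤ) :
    ∑ j, (ν j : ℤ) * G j = ∑ l, (n l : ℤ) * G (a l) := by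
  rw [← sum_fiber a (fun l => (n l : ℤ)) G]
  refine Finset.sum_congr rfl fun j _ => ?_
  rw [← h.row_sum j]
  push_cast
  rfl

-- An inversion of the word of the diagram within a summand is an inversion between two columns of
-- one sequence; an inversion across summands is an inversion of `f` between two rows.
open Classical in
lemma IsWeighted.quad_eq (h : IsWeighted f a b n c ν) (g : ∀ i, Fin (ms i) → Fin (J i))
    (l l' : Fin N) :
    (if l < l' ∧ enc g (b l') < enc g (b l) then (n l : ℤ) * n l' else 0) =
      (if b l < b l' ∧ enc g (b l') < enc g (b l) then (n l : ℤ) * n l' else 0) +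
        if a l < a l' ∧ f (a l') < f (a l) then (n l : ℤ) * n l' else 0 := by
  rw [h.comm, h.comm]
  rcases lt_trichotomy (b l').1 (b l).1 with hi | hi | hi
  · have h1 : enc g (b l') < enc g (b l) := enc_lt_of_lt hi _ _
    have h2 : ¬ b l < b l' := fun h2 => by
      obtain ⟨h3, -⟩ := Sigma.lt_def.1 h2
      exact hi.ne' h3
    have h4 : l < l' ↔ a l < a l' := by
      constructor
      · intro h5
        refine lt_of_le_of_ne (h.mono h5.le) fun h6 => ?_
        have := h.comm l
        rw [h6, h.comm] at this
        exact hi.ne this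
      · intro h5
        by_contra h6
        exact h5.not_ge (h.mono (not_lt.1 h6))
    simp [h1, h2, hi, h4]
  · have h1 : l < l' ∧ enc g (b l') < enc g (b l) ↔ b l < b l' ∧ enc g (b l') < enc g (b l) := by
      refine and_congr_left fun h2 => ⟨fun h3 => ?_, fun h3 => h.lt h3⟩
      refine lt_of_le_of_ne (h.le hi.symm h3.le) fun h4 => ?_
      rw [h4] at h2
      exact lt_irrefl _ h2
    rw [if_congr h1 rfl rfl, if_neg (c := a l < a l' ∧ _) (fun h2 => h2.2.ne hi), add_zero]
  · have h1 : ¬ enc g (b l') < enc g (b l) :=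
      (show enc g (b l) < enc g (b l') from enc_lt_of_lt hi _ _).not_gt
    simp [h1, hi.not_gt]

open Classical in
lemma sum_quad (b : Fin N → Σ i : Fin k, Fin (ms i)) (n : Fin N → ℕ)
    (g : ∀ i, Fin (ms i) → Fin (J i)) :
    ∑ i, ∑ r, ∑ r', (if r < r' ∧ g i r' < g i r then
      (∑ l, if b l = ⟨i, r⟩ then (n l : ℤ) else 0) *
        ∑ l, if b l = ⟨i, r'⟩ then (n l : ℤ) else 0 else 0) =
      ∑ l, ∑ l', if b l < b l' ∧ enc g (b l') < enc g (b l) then (n l : ℤ) * n l' else 0 := by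
  have h1 := fun l => sum_sigma_fiber b (fun l' => (n l' : ℤ))
    fun s => if b l < s ∧ enc g s < enc g (b l) then 1 else 0
  have h2 := sum_sigma_fiber b (fun l => (n l : ℤ))
    fun s => ∑ l', (n l' : ℤ) * if s < b l' ∧ enc g (b l') < enc g s then 1 else 0
  have h3 : (∑ l, ∑ l', if b l < b l' ∧ enc g (b l') < enc g (b l) then (n l : ℤ) * n l' else 0) =
      ∑ l, (n l : ℤ) * ∑ l', (n l' : ℤ) *
        if b l < b l' ∧ enc g (b l') < enc g (b l) then 1 else 0 := by
    refine Finset.sum_congr rfl fun l _ => ?_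
    rw [Finset.mul_sum]
    refine Finset.sum_congr rfl fun l' _ => ?_
    split_ifs <;> ring
  rw [h3, ← h2]
  refine Finset.sum_congr rfl fun i _ => Finset.sum_congr rfl fun r _ => ?_
  rw [← sum_sigma_fiber b (fun l' => (n l' : ℤ))
    fun s => if (⟨i, r⟩ : Σ i : Fin k, Fin (ms i)) < s ∧ enc g s < enc g ⟨i, r⟩ then 1 else 0,
    Finset.sum_eq_single i, Finset.mul_sum]
  · refine Finset.sum_congr rfl fun r' _ => ?_
    have h4 : ((⟨i, r⟩ : Σ i : Fin k, Fin (ms i)) < ⟨i, r'⟩ ∧ enc g ⟨i, r'⟩ < enc g ⟨i, r⟩) ↔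
        (r < r' ∧ g i r' < g i r) := and_congr Sigma.mk_lt_mk_iff (enc_lt_iff _ _ _)
    rw [if_congr h4 rfl rfl]
    split_ifs <;> ring
  · intro i' _ hi
    refine Finset.sum_eq_zero fun r' _ => ?_
    rw [if_neg, mul_zero]
    rintro ⟨h4, -⟩
    obtain ⟨h5, -⟩ := Sigma.lt_def.1 h4
    exact hi h5.symm
  · simp

/-- The `ν` are row sums of `n`, and the `c` are `colNorm` plus column sums of `n`. Expanded in `n`,
the constant terms are those in η(D), the quadratic terms agree by `IsWeighted.quad_eq`, and the
linear ones agree modulo 2 by `IsWeighted.tau_sub_entry_eq` up to the last sum. -/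
theorem IsWeighted.eps_eq (h : IsWeighted f a b n c ν) (g : ∀ i, Fin (ms i) → Fin (J i)) :
    ∃ W : ℤ, eps (enc g ∘ b) (fun l => (n l : ℤ)) + (∑ i, eps (g i) (colNorm a b i)) + 2 * W =
      (∑ i, eps (g i) fun r => (c i r : ℤ)) + eps f (fun j => (ν j : ℤ)) +
        pairSum (fun i => (ms i : ℤ) - J i) fun i => ∑ j, if f j = i then (ν j : ℤ) else 0 := by
  classical
  have e1 : (∑ i, eps (g i) fun r => (c i r : ℤ)) = (∑ i, eps (g i) (colNorm a b i)) +
      (∑ l, ∑ l', if b l < b l' ∧ enc g (b l') < enc g (b l) then (n l : ℤ) * n l' else 0) +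
      ∑ l, (n l : ℤ) * ((tau (g _) (b l).2 - entry (g _) (b l).2) +
        ∑ r, colNorm a b _ r * ((if r < (b l).2 ∧ g _ (b l).2 < g _ r then 1 else 0) +
          if (b l).2 < r ∧ g _ r < g _ (b l).2 then 1 else 0)) := by
    rw [← sum_quad, ← sum_sigma_fiber b (fun l => (n l : ℤ)) fun s =>
      (tau (g _) s.2 - entry (g _) s.2) +
        ∑ r, colNorm a b _ r * ((if r < s.2 ∧ g _ s.2 < g _ r then 1 else 0) +
          if s.2 < r ∧ g _ r < g _ s.2 then 1 else 0), ← Finset.sum_add_distrib,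
      ← Finset.sum_add_distrib]
    refine Finset.sum_congr rfl fun i _ => ?_
    rw [← eps_add]
    congr 1
    funext r
    exact (h.colNorm_add i r).symm
  have e2 : eps f (fun j => (ν j : ℤ)) =
      (∑ l, ∑ l', if a l < a l' ∧ f (a l') < f (a l) then (n l : ℤ) * n l' else 0) +
        ∑ l, (n l : ℤ) * (tau f (a l) - entry f (a l)) := by
    rw [eps, h.sum_row]
    congr 1
    have h1 : ∀ j, (∑ j', if j < j' ∧ f j' < f j then (ν j : ℤ) * ν j' else 0) =
        (ν j : ℤ) * ∑ l', (n l' : ℤ) * if j < a l' ∧ f (a l') < f j then 1 else 0 := by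
      intro j
      rw [← h.sum_row fun j' => if j < j' ∧ f j' < f j then 1 else 0, Finset.mul_sum]
      refine Finset.sum_congr rfl fun j' _ => ?_
      split_ifs <;> ring
    rw [Finset.sum_congr rfl fun j _ => h1 j, h.sum_row]
    refine Finset.sum_congr rfl fun l _ => ?_
    rw [Finset.mul_sum]
    refine Finset.sum_congr rfl fun l' _ => ?_
    split_ifs <;> ring
  have e3 : pairSum (fun i => (ms i : ℤ) - J i) (fun i => ∑ j, if f j = i then (ν j : ℤ) else 0) =
      ∑ l, (n l : ℤ) * ∑ i, if i < (b l).1 then ((ms i : ℤ) - J i) else 0 := by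
    have h1 := sum_fiber f (fun j => (ν j : ℤ)) fun i' =>
      ∑ i, if i < i' then ((ms i : ℤ) - J i) else 0
    rw [h.sum_row] at h1
    simp only [h.comm] at h1
    rw [← h1, pairSum, Finset.sum_comm]
    refine Finset.sum_congr rfl fun i' _ => ?_
    rw [Finset.mul_sum]
    refine Finset.sum_congr rfl fun i _ => ?_
    split_ifs <;> ring
  have e4 : eps (enc g ∘ b) (fun l => (n l : ℤ)) =
      (∑ l, ∑ l', if b l < b l' ∧ enc g (b l') < enc g (b l) then (n l : ℤ) * n l' else 0) +
      (∑ l, ∑ l', if a l < a l' ∧ f (a l') < f (a l) then (n l : ℤ) * n l' else 0) +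
        ∑ l, (n l : ℤ) * (tau (enc g ∘ b) l - entry (enc g ∘ b) l) := by
    rw [eps]
    congr 1
    rw [← Finset.sum_add_distrib]
    refine Finset.sum_congr rfl fun l _ => ?_
    rw [← Finset.sum_add_distrib]
    exact Finset.sum_congr rfl fun l' _ => h.quad_eq g l l'
  refine ⟨∑ l, (n l : ℤ) * ((∑ r, if r < (b l).2 ∧ g _ (b l).2 < g _ r then colNorm a b _ r
    else 0)), ?_⟩
  have e5 : (∑ l, (n l : ℤ) * (tau (enc g ∘ b) l - entry (enc g ∘ b) l)) +
      2 * (∑ l, (n l : ℤ) * ((∑ r, if r < (b l).2 ∧ g _ (b l).2 < g _ r then colNorm a b _ r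
        else 0))) =
      (∑ l, (n l : ℤ) * (tau f (a l) - entry f (a l))) +
      (∑ l, (n l : ℤ) * ((tau (g _) (b l).2 - entry (g _) (b l).2) +
        ∑ r, colNorm a b _ r * ((if r < (b l).2 ∧ g _ (b l).2 < g _ r then 1 else 0) +
          if (b l).2 < r ∧ g _ r < g _ (b l).2 then 1 else 0))) +
      ∑ l, (n l : ℤ) * ∑ i, if i < (b l).1 then ((ms i : ℤ) - J i) else 0 := by
    rw [Finset.mul_sum, ← Finset.sum_add_distrib, ← Finset.sum_add_distrib,
      ← Finset.sum_add_distrib]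
    refine Finset.sum_congr rfl fun l _ => ?_
    have := h.tau_sub_entry_eq g l
    linear_combination (n l : ℤ) * this
  rw [e1, e2, e3, e4]
  linarith

/-- `IsWeighted.eps_eq` compares the ε-terms and `even_const` all others. The sum pairing the
degrees of the sequences with the total multiplicities occurs in both and so contributes an even
number. -/
theorem sign_composition {f : NSeq k} {g : ∀ i, NSeq (J i)} {a : Fin N → Fin f.len}
    {b : Fin N → Σ i : Fin k, Fin (g i).len} {n : Fin N → ℕ} {c : ∀ i, Fin (g i).len → ℕ}
    {ν : Fin f.len → ℕ} (h : IsWeighted f.fn a b n c ν) (q : Fin (∑ i, J i) → ℕ)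
    (hN : N + k = f.len + ∑ i, (g i).len)
    (hc : ∀ i, c i ∈ Mult (g i).fn fun t => q (finSigmaFinEquiv ⟨i, t⟩)) :
    (eta f g a b + thetaExp (hD g b) q n).negOnePow =
      ((∑ i : Fin k, ∑ i' : Fin k, if i < i' then
          (g i').degree * ∑ t : Fin (J i), (q (finSigmaFinEquiv ⟨i, t⟩) : ℤ) else 0) +
        (∑ i, thetaExp (g i).fn (fun t => q (finSigmaFinEquiv ⟨i, t⟩)) (c i)) +
        thetaExp f.fn (fun i => ∑ r, c i r) ν).negOnePow := by
  obtain ⟨W, hW⟩ := h.eps_eq fun i => (g i).fn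
  have hQ : ∀ i, ((∑ t, q (finSigmaFinEquiv ⟨i, t⟩) : ℕ) : ℤ) =
      ((∑ r, c i r : ℕ) : ℤ) + (((g i).len : ℤ) - J i) := by
    intro i
    have := congrArg (Nat.cast (R := ℤ)) (sum_of_mem_Mult (hc i))
    push_cast at this ⊢
    linarith
  have he : ∀ i, ((∑ r, c i r : ℕ) : ℤ) =
      (∑ j, if f.fn j = i then (ν j : ℤ) else 0) + norm1 (f.fn ⁻¹' {i}) := by
    intro i
    have h1 := congrArg (Nat.cast (R := ℤ)) (h.sum_eq i)
    have h2 : (∑ j, if f.fn j = i then (ν j : ℤ) + 1 else 0) =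
        (∑ j, if f.fn j = i then (ν j : ℤ) else 0) + ∑ j, if f.fn j = i then 1 else 0 := by
      rw [← Finset.sum_add_distrib]
      refine Finset.sum_congr rfl fun j _ => ?_
      split_ifs <;> ring
    push_cast at h1 ⊢
    rw [norm1_fiber]
    linarith
  have hconst := even_const ((f.len : ℤ) - k) (fun i => ((g i).len : ℤ) - J i) _ _ _ _ he hQ
  have hlen : (N : ℤ) - ((∑ i, J i : ℕ) : ℤ) =
      (f.len : ℤ) - k + ∑ i, (((g i).len : ℤ) - J i) := by
    have := congrArg (Nat.cast (R := ℤ)) hN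
    rw [Finset.sum_sub_distrib]
    push_cast at this ⊢
    linarith
  have hsum : ∑ l, (q l : ℤ) = ∑ i, ((∑ t, q (finSigmaFinEquiv ⟨i, t⟩) : ℕ) : ℤ) := by
    rw [← finSigmaFinEquiv.sum_comp, Fintype.sum_sigma]
    push_cast
    rfl
  have hK : (∑ i : Fin k, ∑ i' : Fin k, if i < i' then
      (g i').degree * ∑ t : Fin (J i), (q (finSigmaFinEquiv ⟨i, t⟩) : ℤ) else 0) =
      pairSum (fun i => ((∑ t, q (finSigmaFinEquiv ⟨i, t⟩) : ℕ) : ℤ))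
        fun i => ((g i).len : ℤ) - J i := by
    refine Finset.sum_congr rfl fun i _ => Finset.sum_congr rfl fun i' _ => ?_
    rw [mul_comm, NSeq.degree]
    push_cast
    rfl
  have heta : eta f g a b = pairSum (fun i => ((g i).len : ℤ) - J i)
      (fun i => norm1 (f.fn ⁻¹' {i})) + ∑ i, eps (g i).fn (colNorm a b i) := rfl
  have hh : thetaExp (hD g b) q n = eps (enc (fun i => (g i).fn) ∘ b) (fun l => (n l : ℤ)) +
      (((N : ℤ) - ((∑ i, J i : ℕ) : ℤ)) * ∑ l, (q l : ℤ) +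
      ((N : ℤ) - ((∑ i, J i : ℕ) : ℤ)) * ((N : ℤ) - ((∑ i, J i : ℕ) : ℤ) + 1) / 2) := add_assoc _ _ _
  have hg : (∑ i, thetaExp (g i).fn (fun t => q (finSigmaFinEquiv ⟨i, t⟩)) (c i)) =
      (∑ i, eps (g i).fn fun r => (c i r : ℤ)) +
      ∑ i, ((((g i).len : ℤ) - J i) * ((∑ t, q (finSigmaFinEquiv ⟨i, t⟩) : ℕ) : ℤ) +
        (((g i).len : ℤ) - J i) * ((((g i).len : ℤ) - J i) + 1) / 2) := by
    rw [← Finset.sum_add_distrib]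
    refine Finset.sum_congr rfl fun i _ => ?_
    rw [thetaExp, add_assoc]
    push_cast
    rfl
  rw [Int.negOnePow_eq_iff, hK, heta, hh, hg, hlen, hsum, thetaExp]
  obtain ⟨V, hV⟩ := hconst
  exact ⟨V - W + pairSum (fun i => ((g i).len : ℤ) - J i)
    (fun i => ∑ j, if f.fn j = i then (ν j : ℤ) else 0), by linear_combination hW + hV⟩

end Sign

end Hochschild

namespace Hochschild

open SeqOperad

/-! ## Compatibility with the composition -/

section Composition

variable {k : ℕ} {J : Fin k → ℕ}

/-- By `IsWeighted.col_sum` the column `r` of summand `i` accounts for `c i r + 1` letters of the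
word of the diagram, so both conditions count the same letters. -/
lemma IsWeighted.mem_Mult_iff {m N : ℕ} {f : Fin m → Fin k} {ms : Fin k → ℕ} {a : Fin N → Fin m}
    {b : Fin N → Σ i : Fin k, Fin (ms i)} {n : Fin N → ℕ} {c : ∀ i, Fin (ms i) → ℕ} {ν : Fin m → ℕ}
    (h : IsWeighted f a b n c ν) (g : ∀ i, Fin (ms i) → Fin (J i)) (q : Fin (∑ i, J i) → ℕ) :
    n ∈ Mult (enc g ∘ b) q ↔ ∀ i, c i ∈ Mult (g i) fun t => q (finSigmaFinEquiv ⟨i, t⟩) := by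
  have key : ∀ i t, ∑ l, (if (enc g ∘ b) l = finSigmaFinEquiv ⟨i, t⟩ then n l + 1 else 0) =
      ∑ r, if g i r = t then c i r + 1 else 0 := by
    intro i t
    have h1 := sum_sigma_fiber b (fun l => (n l : ℤ) + 1)
      fun s => if enc g s = finSigmaFinEquiv ⟨i, t⟩ then 1 else 0
    rw [Finset.sum_eq_single i] at h1
    · have h2 : ∀ r, (∑ l, if b l = ⟨i, r⟩ then (n l : ℤ) + 1 else 0) *
          (if enc g ⟨i, r⟩ = finSigmaFinEquiv ⟨i, t⟩ then (1 : ℤ) else 0) =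
          ((if g i r = t then c i r + 1 else 0 : ℕ) : ℤ) := by
        intro r
        have h3 := congrArg (Nat.cast (R := ℤ)) (h.col_sum i r)
        push_cast at h3
        have h4 : enc g ⟨i, r⟩ = finSigmaFinEquiv ⟨i, t⟩ ↔ g i r = t := by
          rw [enc, finSigmaFinEquiv.injective.eq_iff]
          simp
        rw [h3, if_congr h4 rfl rfl]
        by_cases h5 : g i r = t <;> simp [h5]
      rw [Finset.sum_congr rfl fun r _ => h2 r] at h1
      rw [← Nat.cast_inj (R := ℤ)]
      push_cast at h1 ⊢
      rw [h1]
      refine Finset.sum_congr rfl fun l _ => ?_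
      rw [mul_ite, mul_one, mul_zero]
      rfl
    · intro i' _ hi
      refine Finset.sum_eq_zero fun r _ => ?_
      rw [if_neg, mul_zero]
      intro h2
      exact hi (congrArg Sigma.fst (finSigmaFinEquiv.injective h2))
    · simp
  simp only [mem_Mult]
  rw [finSigmaFinEquiv.surjective.forall, Sigma.forall]
  exact forall_congr' fun i => forall_congr' fun t => by rw [key]

lemma IsWeighted.mem_Mult_row {m N : ℕ} {f : Fin m → Fin k} {ms : Fin k → ℕ} {a : Fin N → Fin m}
    {b : Fin N → Σ i : Fin k, Fin (ms i)} {n : Fin N → ℕ} {c : ∀ i, Fin (ms i) → ℕ} {ν : Fin m → ℕ}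
    (h : IsWeighted f a b n c ν) : ν ∈ Mult f fun i => ∑ r, c i r :=
  mem_Mult.2 h.sum_eq

lemma IsWeighted.weights_eq {m N : ℕ} {f : Fin m → Fin k} {ms : Fin k → ℕ} {a : Fin N → Fin m}
    {b : Fin N → Σ i : Fin k, Fin (ms i)} {n : Fin N → ℕ} {c : ∀ i, Fin (ms i) → ℕ} {ν : Fin m → ℕ}
    (h : IsWeighted f a b n c ν) : colWeight b n = c ∧ rowWeight a n = ν := by
  refine ⟨funext fun i => funext fun r => ?_, funext fun j => h.row_sum j⟩
  rw [colWeight, h.col_sum, Nat.add_sub_cancel]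

variable {R : Type*} [Ring R]

/-- The value of the word `g` with multiplicities `c`, as a homogeneous cochain. -/
def term {m j : ℕ} (g : Fin m → Fin j) (z : Fin j → HC R) (c : Fin m → ℕ) : HC R :=
  ⟨(eval (fun t => (z t).2.1) (expand g c)).1, (eval (fun t => (z t).2.1) (expand g c)).2,
    eval_mem (fun t => (z t).2) (expand g c)⟩

lemma theta_single_hom {j : ℕ} {g : NSeq j} (hg : complexity g.fn ≤ 2) (z : Fin j → HC R) :
    theta R j (Finsupp.single g 1) (fun t => hom (z t)) = ∑ c ∈ Mult g.fn (deg (toG z)),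
      (((thetaExp g.fn (deg (toG z)) c).negOnePow : ℤˣ) : ℤ) • hom (term g.fn z c) := by
  rw [theta_single, thetaGen_eq _ (complexity_le_two_iff.1 hg), thetaMulti_hom, thetaHom_eq]
  rfl

lemma term_spec {j : ℕ} {g : NSeq j} (hg : complexity g.fn ≤ 2) (z : Fin j → HC R)
    {c : Fin g.len → ℕ} (hc : c ∈ Mult g.fn (deg (toG z))) :
    (term g.fn z c).1 = ∑ r, c r ∧
      ∀ r, app ⟨_, (term g.fn z c).2.1⟩ r = val (toG z) (fill r 0 (bexp g.fn c)) := by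
  have h := eval_eq_val (toG z) (expand g.fn c) (good_expand (complexity_le_two_iff.1 hg) hc)
  rw [bar_expand c g.nondeg.2, bars_bexp] at h
  exact h

theorem theta_single_sum {f : NSeq k} (hf : complexity f.fn ≤ 2) {g : ∀ i, NSeq (J i)}
    (hg : ∀ i, complexity (g i).fn ≤ 2) (z : ∀ i, Fin (J i) → HC R) (p : ℕ) (r : ℕ → R) :
    ev p r (theta R k (Finsupp.single f 1) fun i =>
      theta R (J i) (Finsupp.single (g i) 1) fun t => hom (z i t)) =
    ∑ c ∈ Fintype.piFinset fun i => Mult (g i).fn (deg (toG (z i))),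
      (∑ i, thetaExp (g i).fn (deg (toG (z i))) (c i)).negOnePow •
        ev p r (theta R k (Finsupp.single f 1) fun i => hom (term (g i).fn (z i) (c i))) := by
  classical
  simp only [theta_single_hom (hg _)]
  rw [theta_single, thetaGen_eq _ (complexity_le_two_iff.1 hf)]
  refine (congrArg (ev p r) (MultilinearMap.map_sum_finset _ _ _)).trans ?_
  rw [map_sum]
  refine Finset.sum_congr rfl fun c _ => ?_
  rw [theta_single, thetaGen_eq _ (complexity_le_two_iff.1 hf)]
  refine (congrArg (ev p r) (MultilinearMap.map_smul_univ _ _ _)).trans ?_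
  rw [ev_zsmul, Units.smul_def]
  congr 1
  have : ∀ s : Finset (Fin k), (∑ i ∈ s, thetaExp (g i).fn (deg (toG (z i))) (c i)).negOnePow =
      ∏ i ∈ s, (thetaExp (g i).fn (deg (toG (z i))) (c i)).negOnePow := by
    intro s
    induction s using Finset.induction_on with
    | empty => simp
    | insert i s hi ih => rw [Finset.sum_insert hi, Finset.prod_insert hi, Int.negOnePow_add, ih]
  rw [this]
  push_cast
  rfl

-- The column and row weights of a diagram with multiplicities are multiplicities for the inner
-- sequences and for `f`. This is a bijection by `IsWeighted.unique` and `exists_isWeighted`.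
open Classical in
theorem sum_diagrams {M : Type*} [AddCommMonoid M] {f : NSeq k} {g : ∀ i, NSeq (J i)} {N : ℕ}
    (hN : N + k = f.len + ∑ i, (g i).len) (q : Fin (∑ i, J i) → ℕ)
    (F : (Fin N → Fin f.len) × (Fin N → Σ i : Fin k, Fin (g i).len) → (Fin N → ℕ) → M)
    (G : (∀ i, Fin (g i).len → ℕ) → (Fin f.len → ℕ) → M)
    (h : ∀ a b n c ν, IsWeighted f.fn a b n c ν →
      (∀ i, c i ∈ Mult (g i).fn fun t => q (finSigmaFinEquiv ⟨i, t⟩)) → n ∈ Mult (hD g b) q →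
      F (a, b) n = G c ν) :
    ∑ D ∈ Finset.univ.filter (fun D : (Fin N → Fin f.len) × (Fin N → Σ i : Fin k, Fin (g i).len) =>
        IsDiagram f.fn (fun i => (g i).len) D.1 D.2), ∑ n ∈ Mult (hD g D.2) q, F D n =
      ∑ c ∈ Fintype.piFinset fun i => Mult (g i).fn fun t => q (finSigmaFinEquiv ⟨i, t⟩),
        ∑ ν ∈ Mult f.fn fun i => ∑ r, c i r, G c ν := by
  rw [Finset.sum_sigma', Finset.sum_sigma']
  refine Finset.sum_bij
    (fun x _ => ⟨colWeight x.1.2 x.2, rowWeight x.1.1 x.2⟩) ?_ ?_ ?_ ?_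
  · rintro ⟨⟨a, b⟩, n⟩ hx
    rw [Finset.mem_sigma, Finset.mem_filter] at hx
    have h := isWeighted_of_isDiagram f.nondeg.1 hx.1.2 n
    rw [Finset.mem_sigma, Fintype.mem_piFinset]
    exact ⟨(h.mem_Mult_iff (fun i => (g i).fn) _).1 hx.2, h.mem_Mult_row⟩
  · rintro ⟨⟨a, b⟩, n⟩ hx ⟨⟨a', b'⟩, n'⟩ hx' he
    rw [Finset.mem_sigma, Finset.mem_filter] at hx hx'
    have h := isWeighted_of_isDiagram f.nondeg.1 hx.1.2 n
    have h' := isWeighted_of_isDiagram f.nondeg.1 hx'.1.2 n'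
    simp only [Sigma.mk.injEq, heq_eq_eq] at he
    rw [← he.1, ← he.2] at h'
    obtain ⟨rfl, rfl, rfl⟩ := h.unique h'
    rfl
  · rintro ⟨c, ν⟩ hx
    rw [Finset.mem_sigma, Fintype.mem_piFinset] at hx
    obtain ⟨a, b, n, h⟩ := exists_isWeighted (f := f.fn) hN (mem_Mult.1 hx.2)
    refine ⟨⟨(a, b), n⟩, ?_, ?_⟩
    · rw [Finset.mem_sigma, Finset.mem_filter]
      exact ⟨⟨Finset.mem_univ _, h.isDiagram⟩, (h.mem_Mult_iff (fun i => (g i).fn) _).2 hx.1⟩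
    · rw [h.weights_eq.1, h.weights_eq.2]
  · rintro ⟨⟨a, b⟩, n⟩ hx
    rw [Finset.mem_sigma, Finset.mem_filter] at hx
    have hw := isWeighted_of_isDiagram f.nondeg.1 hx.1.2 n
    exact h a b n _ _ hw ((hw.mem_Mult_iff (fun i => (g i).fn) _).1 hx.2) hx.2

/-- `sum_diagrams` matches the terms of both sides, and they agree by `sign_composition` and
`val_isWeighted`. Diagrams with degenerate sequence need no separate treatment, since `ev_theta_cls`
covers them. -/
theorem theta_composition {f : NSeq k} (hf : complexity f.fn ≤ 2) {g : ∀ i, NSeq (J i)}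
    (hg : ∀ i, complexity (g i).fn ≤ 2) (z : Fin (∑ i, J i) → HC R) (p : ℕ) (r : ℕ → R) :
    ev p r (theta R (∑ i, J i) (gamma f g) fun l => hom (z l)) =
      (∑ i : Fin k, ∑ i' : Fin k, if i < i' then
          (g i').degree * ∑ t : Fin (J i), ((z (finSigmaFinEquiv ⟨i, t⟩)).1 : ℤ)
        else 0).negOnePow •
      ev p r (theta R k (Finsupp.single f 1) fun i =>
        theta R (J i) (Finsupp.single (g i) 1) fun t => hom (z (finSigmaFinEquiv ⟨i, t⟩))) := by
  classical
  -- `f` is surjective, so the truncated subtraction in the length of the diagrams is a genuine one.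
  have hkf : k ≤ f.len := by
    simpa using Fintype.card_le_of_surjective _ f.nondeg.1
  have hN : (f.len + ∑ i, (g i).len - k) + k = f.len + ∑ i, (g i).len := by omega
  have hf' := complexity_le_two_iff.1 hf
  have hg' := fun i => complexity_le_two_iff.1 (hg i)
  rw [theta_single_sum hf hg fun i t => z (finSigmaFinEquiv ⟨i, t⟩)]
  have hR : ∀ c ∈ Fintype.piFinset fun i => Mult (g i).fn
      (deg (toG fun t => z (finSigmaFinEquiv ⟨i, t⟩))),
      ev p r (theta R k (Finsupp.single f 1) fun i =>
        hom (term (g i).fn (fun t => z (finSigmaFinEquiv ⟨i, t⟩)) (c i))) =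
      if p + (f.len + ∑ i, (g i).len - k) = ∑ l, deg (toG z) l + ∑ i, J i then
        ∑ ν ∈ Mult f.fn (fun i => ∑ r, c i r),
          (thetaExp f.fn (fun i => ∑ r, c i r) ν).negOnePow •
            val (toG fun i => term (g i).fn (fun t => z (finSigmaFinEquiv ⟨i, t⟩)) (c i))
              (fill r 0 (bexp f.fn ν)) else 0 := by
    intro c hc
    rw [Fintype.mem_piFinset] at hc
    have hdeg : deg (toG fun i => term (g i).fn (fun t => z (finSigmaFinEquiv ⟨i, t⟩)) (c i)) =
        fun i => ∑ r, c i r := funext fun i => (term_spec (hg i) _ (hc i)).1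
    rw [ev_theta_single hf, hdeg]
    refine if_congr ?_ rfl rfl
    change p + f.len = (∑ i, ∑ r, c i r) + k ↔ _
    -- Summing the degree relations of the inner values turns the degree condition for `f` into the
    -- one for the composite.
    have h1 : ∑ i, ((∑ r, c i r) + (g i).len) =
        ∑ i, ((∑ t, deg (toG z) (finSigmaFinEquiv ⟨i, t⟩)) + J i) :=
      Finset.sum_congr rfl fun i _ => sum_of_mem_Mult (hc i)
    have h2 : ∑ l, deg (toG z) l = ∑ i, ∑ t, deg (toG z) (finSigmaFinEquiv ⟨i, t⟩) := by
      rw [← finSigmaFinEquiv.sum_comp, Fintype.sum_sigma]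
    rw [Finset.sum_add_distrib, Finset.sum_add_distrib] at h1
    omega
  rw [Finset.sum_congr rfl fun c hc => congrArg (_ • ·) (hR c hc), gamma, ev_theta_sum]
  simp only [ev_theta_units_smul]
  rw [Finset.sum_congr rfl fun D hD => congrArg (_ • ·)
    (ev_theta_cls (hD_noncrossing (Finset.mem_filter.1 hD).2 hf' hg') z p r)]
  split_ifs with hp
  swap
  · simp
  simp only [Finset.smul_sum, smul_smul, ← Int.negOnePow_add]
  refine sum_diagrams hN (deg (toG z)) _ _ fun a b n c ν h hc hn => ?_
  have hsign := sign_composition h (deg (toG z)) hN hc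
  have hdeg : deg (toG fun i => term (g i).fn (fun t => z (finSigmaFinEquiv ⟨i, t⟩)) (c i)) =
      fun i => ∑ r, c i r := funext fun i => (term_spec (hg i) _ (hc i)).1
  have hval := val_isWeighted (R := R) (enc fun i => (g i).fn)
    (fun x => (finSigmaFinEquiv.symm x).1) (fun s => by rw [enc, Equiv.symm_apply_apply]) h
    (toG fun i => term (g i).fn (fun t => z (finSigmaFinEquiv ⟨i, t⟩)) (c i)) (toG z)
    (fun i r' => by
      refine ((term_spec (hg i) _ (hc i)).2 r').trans ?_
      have h1 : (fun s => enc (fun i => (g i).fn) ⟨i, s⟩) =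
          (fun t => (finSigmaFinEquiv ⟨i, t⟩ : Fin (∑ i, J i))) ∘ (g i).fn := rfl
      rw [h1, bexp_map, fill_map_letters, val_map]
      · rfl
      · intro t t' htt
        simpa using htt)
    (good_expand hf' (by rw [hdeg]; exact h.mem_Mult_row))
    (good_expand (hD_noncrossing h.isDiagram hf' hg') hn) r
  exact congrArg₂ (fun (u : ℤˣ) (v : R) => u • v)
    (hsign.trans (by rw [add_assoc]; rfl)) hval.symm

end Composition

end Hochschild

namespace Hochschild

/-- An additive map on a direct sum is compatible with differences and signed sums. -/
lemma map_sub_units_smul_sum {M : ℕ → Type*} [∀ p, AddCommGroup (M p)] {B : Type*} [AddCommGroup B]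
    (φ : (⨁ p, M p) →+ B) (x : ⨁ p, M p) (u : ℤˣ) {k : ℕ} (v : Fin k → ℤˣ)
    (y : Fin k → ⨁ p, M p) :
    φ (x - u • ∑ i, v i • y i) = φ x - u • ∑ i, v i • φ (y i) := by
  have h : ∀ (w : ℤˣ) (c : ⨁ p, M p), φ (w • c) = w • φ c := fun w c => by
    rw [Units.smul_def, Units.smul_def, map_zsmul]
  rw [map_sub, h, map_sum]
  simp only [h]

end Hochschild

end

/-! ### Assembly of the compatibilities. -/

theorem mainTheorem6 (R : Type*) [Ring R] :
    SeqOperad.IsSuboperad 2 ∧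
    SeqOperad.IsAlgebraOver 2 (M := fun p => Hochschild.normalized R p) (Hochschild.d R) (Hochschild.theta R) ∧
    ∀ (R' : Type*) [Ring R'] (e : R ≃+* R') (k : ℕ), ∀ s ∈ SeqOperad.Sub 2 k,
      ∀ x : Fin k → Hochschild.C R,
        Hochschild.transport e (Hochschild.theta R k s x) =
          Hochschild.theta R' k s fun i => Hochschild.transport e (x i) := by
  classical
  refine ⟨SeqOperad.isSuboperad_two, ⟨fun k s hs => Hochschild.theta_multilinear hs, ?_, ?_,
    Hochschild.theta_unit, ?_, ?_⟩,
    fun R' _ e k s hs x => Hochschild.transport_theta e hs x⟩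
  · intro k f hf q x p hp
    exact Hochschild.theta_degree hf (fun i => (⟨q i, x i⟩ : Hochschild.HC R)) hp
  · intro k f hf q x
    refine Hochschild.ev_ext fun p r => ?_
    refine (Hochschild.theta_chain_map hf (fun i => (⟨q i, x i⟩ : Hochschild.HC R)) p r).trans ?_
    exact (Hochschild.map_sub_units_smul_sum (M := fun p => Hochschild.normalized R p)
      (Hochschild.ev p r) _ _ _ _).symm
  · intro k ρ f hf q x
    refine Hochschild.ev_ext fun p r => ?_
    refine (Hochschild.theta_equivariant ρ hf (fun i => (⟨q i, x i⟩ : Hochschild.HC R)) p r).trans ?_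
    rw [Hochschild.ev_units_smul]
    rfl
  · intro k f j g hf hg q x
    refine Hochschild.ev_ext fun p r => ?_
    refine (Hochschild.theta_composition hf hg (fun l => (⟨q l, x l⟩ : Hochschild.HC R)) p r).trans ?_
    rw [Hochschild.ev_units_smul]
    rfl
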